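/- Let $d\in\{2,3\}$, let $k\ge 1$ be an integer, and let $\Omega\subset\mathbb R^d$ be a bounded connected open set with Lipschitz boundary $\Gamma$. Let $0<\mu_1\le\mu_2<\infty$ and let $\gamma>0$. Then there is a constant $C>0$, depending only on $d,k,\Omega,\mu_1,\mu_2,\gamma$ (in particular not on $\lambda$, $h$, $\mathbf f$, $\widehat{\mathbf g}$ or $\mathbf u$), such that the following holds for all $\mu\in[\mu_1,\mu_2]$ and $\lambda\in(0,\infty)$. Let $\mathbf u\in[H^{k+1}(\Omega)]^d$ be a solution of $$-\mu\Delta\mathbf u-(\lambda+\mu)\nabla(\nabla\cdot\mathbf u)=\mathbf f\ \text{ a.e. in }\Omega,\qquad \mathbf u=\widehat{\mathbf g}\ \text{ on }\Gamma\ \text{(in the sense of traces)}.$$ Let $\mathcal T_h$ be a conforming finite simplicial partition of $\Omega$ such that every $T\in\mathcal T_h$, of diameter $h_T$, contains a ball of radius $h_T/\gamma$; let $h=\max_T h_T$ and let $\mathcal E_h$ be the set of its edges ($d=2$) or faces ($d=3$). Let $V_h$ be the space of pairs $\mathbf v=\{\mathbf v_0,\mathbf v_b\}$ with $\mathbf v_0|_T\in[P_k(T)]^d$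 for $T\in\mathcal T_h$ and $\mathbf v_b|_e\in[P_k(e)]^d$ for $e\in\mathcal E_h$, and $V_h^0=\{\mathbf v\in V_h:\mathbf v_b=\mathbf 0\text{ on }\Gamma\}$. For $\mathbf v\in V_h$ and $T\in\mathcal T_h$ with outward unit normal $\mathbf n$ on $\partial T$, let $\nabla_w\mathbf v\in[P_{k-1}(T)]^{d\times d}$ and $\nabla_w\cdot\mathbf v\in P_k(T)$ be given by $$(\nabla_w\mathbf v,\varphi)_T=-(\mathbf v_0,\nabla\cdot\varphi)_T+\langle\mathbf v_b,\varphi\mathbf n\rangle_{\partial T}\quad\forall\varphi\in[P_{k-1}(T)]^{d\times d},$$ $$(\nabla_w\cdot\mathbf v,\phi)_T=-(\mathbf v_0,\nabla\phi)_T+\langle\mathbf v_b\cdot\mathbf n,\phi\rangle_{\partial T}\quad\forall\phi\in P_k(T),$$ and let $\mathbf R_T(\mathbf v)\in[P_k(T)]^d+\mathbf x P_k(T)$ be given by $\int_T\mathbf R_T(\mathbf v)\cdot\mathbf w=\int_T\mathbf v_0\cdot\mathbf w$ for all $\mathbf w\in[P_{k-1}(T)]^d$ and $\int_e\mathbf R_T(\mathbf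 v)\cdot\mathbf n\,\phi=\int_e\mathbf v_b\cdot\mathbf n\,\phi$ for all edges/faces $e\subset\partial T$ and $\phi\in P_k(e)$. Let $Q_0$ and $Q_b$ be the $L^2$-projections onto $[P_k(T)]^d$ and $[P_k(e)]^d$, and $Q_h\mathbf u=\{Q_0\mathbf u,Q_b\mathbf u\}$. Let $\mathbf u_h=\{\mathbf u_0,\mathbf u_b\}\in V_h$ be the solution of the weak Galerkin scheme: $\mathbf u_b=Q_b\widehat{\mathbf g}$ on $\Gamma$ and, for all $\mathbf v\in V_h^0$, $$\mu\sum_{T}(\nabla_w\mathbf u_h,\nabla_w\mathbf v)_T+(\lambda+\mu)\sum_T(\nabla_w\cdot\mathbf u_h,\nabla_w\cdot\mathbf v)_T+\sum_T h_T^{-1}\langle\mathbf u_0-\mathbf u_b,\mathbf v_0-\mathbf v_b\rangle_{\partial T}=\sum_T(\mathbf f,\mathbf R_T(\mathbf v))_T.$$ Then $$|||Q_h\mathbf u-\mathbf u_h|||\le C\,h^k\,\|\mathbf u\|_{k+1},\qquad\text{where}\quad |||\mathbf v|||^2=\sum_{T\in\mathcal T_h}\Big(\|\nabla_w\mathbf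 v\|_T^2+h_T^{-1}\|\mathbf v_0-\mathbf v_b\|_{\partial T}^2\Big).$$ No bound on $\lambda\|\nabla\cdot\mathbf u\|_k$ is assumed. -/

import Mathlib

open MeasureTheory Filter Topology
open scoped ContDiff NNReal

noncomputable section

namespace WG

/-- The Euclidean space `ℝ^d`. -/
abbrev E (d : ℕ) : Type := EuclideanSpace ℝ (Fin d)

variable {d : ℕ}

/-- `(d-1)`-dimensional surface measure on `ℝ^d`, normalised to agree with Lebesgue measure on
hyperplanes. -/
def surf (d : ℕ) : Measure (E d) := MeasureTheory.Measure.euclideanHausdorffMeasure (d - 1)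

/-! ### Lipschitz domains -/

/-- The boundary of `Ω` is locally the graph of a Lipschitz function: near every boundary point
there are a unit vector `ν` and a Lipschitz function `g` not depending on the coordinate in
direction `ν` such that `Ω` is locally the set of points whose `ν`-coordinate is less than `g`. -/
def HasLipschitzBoundary (Ω : Set (E d)) : Prop :=
  ∀ x ∈ frontier Ω, ∃ (ν : E d) (r : ℝ) (K : ℝ≥0) (g : E d → ℝ),
    ‖ν‖ = 1 ∧ 0 < r ∧ LipschitzWith K g ∧ (∀ (y : E d) (t : ℝ), g (y + t • ν) = g y) ∧
    ∀ y ∈ Metric.ball x r, (y ∈ Ω ↔ inner ℝ y ν < g y)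

/-- Bounded connected open (nonempty) set with Lipschitz boundary. -/
structure IsLipschitzDomain (Ω : Set (E d)) : Prop where
  isOpen : IsOpen Ω
  bounded : Bornology.IsBounded Ω
  connected : IsConnected Ω
  lipschitz : HasLipschitzBoundary Ω

/-! ### Weak derivatives and Sobolev spaces -/

/-- Classical partial derivative `∂ᵢ φ`. -/
def pd (i : Fin d) (φ : E d → ℝ) : E d → ℝ :=
  fun x => fderiv ℝ φ x (EuclideanSpace.single i 1)

/-- Classical partial derivative `∂^α φ` for a multi-index `α`. -/
def pdMulti (α : Fin d → ℕ) (φ : E d → ℝ) : E d → ℝ :=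
  (List.finRange d).foldr (fun i ψ => (pd i)^[α i] ψ) φ

/-- `g` is a weak derivative `∂^α w` on `Ω`. -/
def HasWeakDeriv (Ω : Set (E d)) (α : Fin d → ℕ) (w g : E d → ℝ) : Prop :=
  ∀ φ : E d → ℝ, ContDiff ℝ ∞ φ → HasCompactSupport φ → tsupport φ ⊆ Ω →
    ∫ x in Ω, w x * pdMulti α φ x = (-1 : ℝ) ^ (∑ i, α i) * ∫ x in Ω, g x * φ x

/-- `w ∈ H^m(Ω)`. -/
def MemSobolev (Ω : Set (E d)) (m : ℕ) (w : E d → ℝ) : Prop :=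
  MemLp w 2 (volume.restrict Ω) ∧
    ∀ α : Fin d → ℕ, ∑ i, α i ≤ m →
      ∃ g : E d → ℝ, MemLp g 2 (volume.restrict Ω) ∧ HasWeakDeriv Ω α w g

open scoped Classical in
/-- The weak derivative `∂^α w ∈ L²(Ω)` (unique up to a null set of `Ω`); `0` if there is none. -/
def weakDeriv (Ω : Set (E d)) (α : Fin d → ℕ) (w : E d → ℝ) : E d → ℝ :=
  if h : ∃ g : E d → ℝ, MemLp g 2 (volume.restrict Ω) ∧ HasWeakDeriv Ω α w g
  then h.choose else 0

/-- The norm `‖u‖_m` of `[H^m(Ω)]^d`. -/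
def sobolevNorm (Ω : Set (E d)) (m : ℕ) (u : E d → E d) : ℝ :=
  √(∑ i : Fin d, ∑ l ∈ Finset.range (m + 1), ∑ α ∈ Finset.piAntidiag Finset.univ l,
    ∫ x in Ω, (weakDeriv Ω α (fun y => u y i) x) ^ 2)

/-- `g ∈ L²(S)` is the trace on `S ⊆ closure Ω` of `w ∈ H¹(Ω)`: some sequence of functions smooth
up to the boundary converges to `w` in `H¹(Ω)`, and its restrictions to `S` converge to `g` in
`L²(S)`. -/
def HasTrace (Ω S : Set (E d)) (w g : E d → ℝ) : Prop :=
  MemLp g 2 ((surf d).restrict S) ∧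
  ∃ φ : ℕ → E d → ℝ, (∀ n, ContDiff ℝ ∞ (φ n)) ∧
    Tendsto (fun n => eLpNorm (φ n - w) 2 (volume.restrict Ω)) atTop (𝓝 0) ∧
    (∀ i, Tendsto (fun n => eLpNorm (pd i (φ n) - weakDeriv Ω (Pi.single i 1) w) 2
      (volume.restrict Ω)) atTop (𝓝 0)) ∧
    Tendsto (fun n => eLpNorm (φ n - g) 2 ((surf d).restrict S)) atTop (𝓝 0)

open scoped Classical in
/-- The trace of `w` on `S`; `0` if there is none. -/
def trace (Ω S : Set (E d)) (w : E d → ℝ) : E d → ℝ :=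
  if h : ∃ g, HasTrace Ω S w g then h.choose else 0

/-! ### The linear elasticity problem -/

/-- `u` satisfies `-μ Δu - (lam+μ) ∇(∇·u) = f` a.e. in `Ω` (with weak derivatives), and `u = g` on
`∂Ω` in the sense of traces. -/
structure IsExactSolution (Ω : Set (E d)) (μ lam : ℝ) (f g u : E d → E d) : Prop where
  pde : ∀ᵐ x ∂(volume.restrict Ω), ∀ i : Fin d,
    -μ * (∑ j, weakDeriv Ω (Pi.single j 1 + Pi.single j 1) (fun y => u y i) x)
      - (lam + μ) * (∑ j, weakDeriv Ω (Pi.single i 1 + Pi.single j 1) (fun y => u y j) x)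
      = f x i
  bc : ∀ i, HasTrace Ω (frontier Ω) (fun x => u x i) (fun x => g x i)

/-! ### Simplicial partitions -/

/-- A (conforming, finite) simplicial partition of `Ω`: a finite simplicial complex whose
underlying space is the closure of `Ω`. A simplex is given by the finite set of its vertices. -/
structure Triangulation (Ω : Set (E d)) where
  complex : Geometry.SimplicialComplex ℝ (E d)
  finite : complex.faces.Finite
  space_eq : complex.space = closure Ω

/-- The closed simplex with the given vertices. -/
def hull (s : Finset (E d)) : Set (E d) := convexHull ℝ (s : Set (E d))

/-- The diameter `h_T`. -/
def diam (T : Finset (E d)) : ℝ := Metric.diam (hull T)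

/-- The elements `T ∈ 𝒯_h`: the `d`-simplices. -/
def Triangulation.elems {Ω : Set (E d)} (𝒯 : Triangulation Ω) : Finset (Finset (E d)) :=
  𝒯.finite.toFinset.filter (fun T => T.card = d + 1)

/-- The set `ℰ_h` of edges (`d = 2`) or faces (`d = 3`): the `(d-1)`-simplices. -/
def Triangulation.facets {Ω : Set (E d)} (𝒯 : Triangulation Ω) : Finset (Finset (E d)) :=
  𝒯.finite.toFinset.filter (fun e => e.card = d)

/-- The mesh size `h = max_T h_T`. -/
def Triangulation.meshSize {Ω : Set (E d)} (𝒯 : Triangulation Ω) : ℝ :=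
  sSup (diam '' (𝒯.elems : Set (Finset (E d))))

/-- Shape regularity with parameter `γ`: every element contains a ball of radius at least
`h_T / γ`. -/
def Triangulation.ShapeRegular {Ω : Set (E d)} (𝒯 : Triangulation Ω) (γ : ℝ) : Prop :=
  ∀ T ∈ 𝒯.elems, ∃ c : E d, Metric.closedBall c (diam T / γ) ⊆ hull T

open scoped Classical in
/-- The facet of the simplex `T` opposite to its vertex `a`; `∂T` is the union of the facets
`opp T a`, `a ∈ T`. -/
def opp (T : Finset (E d)) (a : E d) : Finset (E d) := T.erase a

/-- The unit normal on the facet `opp T a` pointing out of `T`: the normalised component,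
orthogonal to the facet, of a vector leading from `a` to the facet. -/
def normal (T : Finset (E d)) (a : E d) : E d :=
  let w := (vectorSpan ℝ (opp T a : Set (E d)))ᗮ.starProjection
    ((opp T a).centroid ℝ id - a)
  ‖w‖⁻¹ • w

/-! ### Polynomials and weak finite element functions -/

/-- Real polynomials in `d` variables. -/
abbrev Poly (d : ℕ) : Type := MvPolynomial (Fin d) ℝ

/-- Value of a polynomial at a point of `ℝ^d`. -/
def ev (p : Poly d) (x : E d) : ℝ := MvPolynomial.eval (fun i => x i) p

/-- Polynomials of degree at most `k`. -/
def P (d k : ℕ) : Submodule ℝ (Poly d) := MvPolynomial.restrictTotalDegree (Fin d) ℝ k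

open scoped Classical in
/-- The polynomial `p` of degree at most `m` with `∫_S p φ dν = ℓ φ` for all `φ` of degree at most
`m` (as a function on `S` it is unique); `0` if there is none. -/
def represent (m : ℕ) (S : Set (E d)) (ν : Measure (E d)) (ℓ : Poly d → ℝ) : Poly d :=
  if h : ∃ p ∈ P d m, ∀ φ ∈ P d m, ∫ x in S, ev p x * ev φ x ∂ν = ℓ φ then h.choose else 0

/-- Pairs `v = {v₀, v_b}`: `v.1 T i` is the `i`-th component of `v₀` on the element `T`, and
`v.2 e i` the `i`-th component of `v_b` on the facet `e`. The function `v_b` on `e` is the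
restriction to `e` of the polynomial `v.2 e i`, which enters everything below only through its
values on `e`. -/
abbrev WeakFun (d : ℕ) : Type :=
  (Finset (E d) → Fin d → Poly d) × (Finset (E d) → Fin d → Poly d)

/-- `v ∈ V_h`. -/
def InVh {Ω : Set (E d)} (𝒯 : Triangulation Ω) (k : ℕ) (v : WeakFun d) : Prop :=
  (∀ T ∈ 𝒯.elems, ∀ i, v.1 T i ∈ P d k) ∧ (∀ e ∈ 𝒯.facets, ∀ i, v.2 e i ∈ P d k)

/-- `v ∈ V_h^0`: moreover `v_b = 0` on `∂Ω`. -/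
def InVh0 {Ω : Set (E d)} (𝒯 : Triangulation Ω) (k : ℕ) (v : WeakFun d) : Prop :=
  InVh 𝒯 k v ∧
    ∀ e ∈ 𝒯.facets, hull e ⊆ frontier Ω → ∀ i, ∀ x ∈ hull e, ev (v.2 e i) x = 0

/-- The `(i,j)` entry of the weak gradient `∇_w v ∈ [P_{k-1}(T)]^{d×d}` on `T`:
`(∇_w v, Φ)_T = -(v₀, ∇·Φ)_T + ⟨v_b, Φ n⟩_{∂T}`, tested with the matrices `Φ` whose only nonzero
entry is `Φ_{ij} = φ`. -/
def weakGrad (k : ℕ) (v : WeakFun d) (T : Finset (E d)) (i j : Fin d) : Poly d :=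
  represent (k - 1) (hull T) volume fun φ =>
    -(∫ x in hull T, ev (v.1 T i) x * ev (MvPolynomial.pderiv j φ) x)
      + ∑ a ∈ T, ∫ x in hull (opp T a), ev (v.2 (opp T a) i) x * ev φ x * normal T a j ∂(surf d)

/-- The weak divergence `∇_w · v ∈ P_k(T)` on `T`:
`(∇_w·v, φ)_T = -(v₀, ∇φ)_T + ⟨v_b · n, φ⟩_{∂T}`. -/
def weakDiv (k : ℕ) (v : WeakFun d) (T : Finset (E d)) : Poly d :=
  represent k (hull T) volume fun φ =>
    -(∫ x in hull T, ∑ i, ev (v.1 T i) x * ev (MvPolynomial.pderiv i φ) x)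
      + ∑ a ∈ T, ∫ x in hull (opp T a),
          (∑ i, ev (v.2 (opp T a) i) x * normal T a i) * ev φ x ∂(surf d)

/-- `r ∈ RT_k = [P_k]^d + x P_k`. -/
def InRT (k : ℕ) (r : Fin d → Poly d) : Prop :=
  ∃ (p : Fin d → Poly d) (q : Poly d), (∀ i, p i ∈ P d k) ∧ q ∈ P d k ∧
    ∀ i, r i = p i + MvPolynomial.X i * q

/-- `r` is the displacement reconstruction of `v` on `T`. -/
structure IsReconstruction (k : ℕ) (v : WeakFun d) (T : Finset (E d)) (r : Fin d → Poly d) :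
    Prop where
  mem : InRT k r
  interior : ∀ w : Fin d → Poly d, (∀ i, w i ∈ P d (k - 1)) →
    ∫ x in hull T, ∑ i, ev (r i) x * ev (w i) x = ∫ x in hull T, ∑ i, ev (v.1 T i) x * ev (w i) x
  facet : ∀ a ∈ T, ∀ φ ∈ P d k,
    ∫ x in hull (opp T a), (∑ i, ev (r i) x * normal T a i) * ev φ x ∂(surf d)
      = ∫ x in hull (opp T a), (∑ i, ev (v.2 (opp T a) i) x * normal T a i) * ev φ x ∂(surf d)

open scoped Classical in
/-- The displacement reconstruction operator `R_T(v)` on the element `T`. -/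
def reconstruct (k : ℕ) (v : WeakFun d) (T : Finset (E d)) : Fin d → Poly d :=
  if h : ∃ r, IsReconstruction k v T r then h.choose else 0

/-! ### Bilinear forms, the scheme, projections and the energy norm -/

variable {Ω : Set (E d)}

/-- The stabilizer `S_h(w, v) = ∑_T h_T⁻¹ ⟨w₀ - w_b, v₀ - v_b⟩_{∂T}`. -/
def stab (𝒯 : Triangulation Ω) (w v : WeakFun d) : ℝ :=
  ∑ T ∈ 𝒯.elems, (diam T)⁻¹ * ∑ a ∈ T, ∫ x in hull (opp T a),
    ∑ i, (ev (w.1 T i) x - ev (w.2 (opp T a) i) x) * (ev (v.1 T i) x - ev (v.2 (opp T a) i) x)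
      ∂(surf d)

/-- `A_h(w, v) = μ ∑_T (∇_w w, ∇_w v)_T + (lam + μ) ∑_T (∇_w·w, ∇_w·v)_T`. -/
def formA (𝒯 : Triangulation Ω) (k : ℕ) (μ lam : ℝ) (w v : WeakFun d) : ℝ :=
  μ * (∑ T ∈ 𝒯.elems, ∫ x in hull T,
      ∑ i, ∑ j, ev (weakGrad k w T i j) x * ev (weakGrad k v T i j) x)
    + (lam + μ) * (∑ T ∈ 𝒯.elems, ∫ x in hull T, ev (weakDiv k w T) x * ev (weakDiv k v T) x)

/-- `A_h^s = A_h + S_h`. -/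
def formAs (𝒯 : Triangulation Ω) (k : ℕ) (μ lam : ℝ) (w v : WeakFun d) : ℝ :=
  formA 𝒯 k μ lam w v + stab 𝒯 w v

/-- `L²` projection onto `P_k(T)` of a function on the element `T`. -/
def elemProj (k : ℕ) (T : Finset (E d)) (w : E d → ℝ) : Poly d :=
  represent k (hull T) volume fun φ => ∫ x in hull T, w x * ev φ x

/-- `L²` projection onto `P_k(e)` of a function on the facet `e`. -/
def facetProj (k : ℕ) (e : Finset (E d)) (g : E d → ℝ) : Poly d :=
  represent k (hull e) (surf d) fun φ => ∫ x in hull e, g x * ev φ x ∂(surf d)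

/-- `Q_h u = {Q₀ u, Q_b u}`, where `Q_b` acts on the traces of `u` on the facets. -/
def Qh (Ω : Set (E d)) (k : ℕ) (u : E d → E d) : WeakFun d :=
  (fun T i => elemProj k T fun x => u x i,
   fun e i => facetProj k e (trace Ω (hull e) fun x => u x i))

/-- `uh ∈ V_h` solves the weak Galerkin scheme: `u_b = Q_b g` on `∂Ω`, and
`A_h^s(uh, v) = (f, R_T(v))` for all `v ∈ V_h^0`. -/
structure IsWGSolution (𝒯 : Triangulation Ω) (k : ℕ) (μ lam : ℝ) (f g : E d → E d)
    (uh : WeakFun d) : Prop where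
  mem : InVh 𝒯 k uh
  bc : ∀ e ∈ 𝒯.facets, hull e ⊆ frontier Ω → ∀ i, ∀ x ∈ hull e,
    ev (uh.2 e i) x = ev (facetProj k e fun y => g y i) x
  eqn : ∀ v : WeakFun d, InVh0 𝒯 k v →
    formAs 𝒯 k μ lam uh v
      = ∑ T ∈ 𝒯.elems, ∫ x in hull T, ∑ i, f x i * ev (reconstruct k v T i) x

/-- The energy norm
`|||v||| = (∑_T ‖∇_w v‖²_T + h_T⁻¹ ‖v₀ - v_b‖²_{∂T})^{1/2}`. -/
def energyNorm (𝒯 : Triangulation Ω) (k : ℕ) (v : WeakFun d) : ℝ :=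
  √(∑ T ∈ 𝒯.elems,
    ((∫ x in hull T, ∑ i, ∑ j, (ev (weakGrad k v T i j) x) ^ 2)
      + (diam T)⁻¹ * ∑ a ∈ T, ∫ x in hull (opp T a),
          ∑ i, (ev (v.1 T i) x - ev (v.2 (opp T a) i) x) ^ 2 ∂(surf d)))

end WG

end

/-!
The error `v = Q_h u - u_h` is tested with itself. The bilinear form is coercive with constant
`min μ₁ 1`, since the divergence terms are nonnegative (`mul_energyNorm_sq_le`), so that the energy
norm of `v` is bounded by the consistency error of `Q_h u`. The point is that this consistency
error does not contain `λ`.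

*Cancellation.* `∇_w (Q_h u)` and `∇_w · (Q_h u)` are the `L²`-projections of `∇u` and `∇ · u` on
each element. The reconstruction `R_T(v)` satisfies `∇ · R_T(v) = ∇_w · v` (`pdiv_reconstruct`) and
has the normal components of `v_b` on the facets (`ncomp_reconstruct_ae`). Hence the divergence term
equals `(∇ · u, ∇ · R_T(v))`, and integration by parts turns it into the term with `∇(∇ · u)` of
the right-hand side, up to facet integrals of the trace of `∇ · u` times `v_b · n`
(`integral_weakDiv_mul_weakDiv`). These sum to zero over the mesh, as do those of the trace of `∇u`
times `v_b`, because the traces of functions in `H¹(Ω)` are single-valued on the facets inside `Ω`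
and `v_b` vanishes on the boundary (`sum_facet_integral_eq_zero`). There remains a sum of
contributions `elemError` of the elements (`formAs_Qh_sub_eq`): `Δu` tested with `R_T(v) - v₀`, the
projection error of `∇u` tested with `v₀ - v_b`, and the stabilizer.

*Approximation.* Each of these is a product of an approximation error of `u`, of order `h^k`, and
the jump `v₀ - v_b` in the scaling of the energy norm (`exists_abs_elemError_le`). The polynomial
with the mean values of the derivatives of `u` approximates `u` on a convex element, by repeated use
of the Poincaré inequality (`IsJet.exists_approx`); the errors on the facets follow from a trace
inequality and an inverse inequality. The bound of `R_T(v) - v₀` by the jumps is an inequality for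
Raviart–Thomas fields without interior moments (`exists_nm_rt_le`); it also gives uniqueness, and
by counting dimensions existence, of the reconstruction. It is proved without a reference element:
the constants come from the ball contained in the element.

*Simplices and traces.* A facet integral is expressed by volume integrals through slicing along
the edges (`height_mul_integral`), which yields the divergence theorem on a simplex
(`integral_fderiv`) and the trace inequality. On an element, functions with weak derivatives are
limits of smooth functions (`exists_h1Approx`: contract towards an interior point, then mollify), so
both extend to them, with traces defined as limits (`HasFacetTraces`). That a facet lies either on the boundary or, up to its ridges, inside the
domain uses that a Lipschitz domain is locally on one side of its boundary (`facet_dichotomy`).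
-/

noncomputable section

namespace WG

variable {d : ℕ}

/-! ### The `L²` seminorm -/

/-- The `L²(μ)` seminorm `(∫ f² dμ)^{1/2}` of a real function. -/
def nm {α : Type*} [MeasurableSpace α] (μ : Measure α) (f : α → ℝ) : ℝ := √(∫ x, f x ^ 2 ∂μ)

section L2

variable {α : Type*} [MeasurableSpace α] {μ : Measure α} {f g : α → ℝ}

lemma nm_nonneg : 0 ≤ nm μ f := Real.sqrt_nonneg _

lemma nm_sq : nm μ f ^ 2 = ∫ x, f x ^ 2 ∂μ := Real.sq_sqrt (integral_nonneg fun _ => sq_nonneg _)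

lemma nm_congr_ae (h : f =ᵐ[μ] g) : nm μ f = nm μ g := by
  unfold nm
  rw [integral_congr_ae]
  filter_upwards [h] with x hx
  rw [hx]

lemma integrable_mul_of_memLp (hf : MemLp f 2 μ) (hg : MemLp g 2 μ) :
    Integrable (fun x => f x * g x) μ := hf.integrable_mul hg

lemma integrable_sq_of_memLp (hf : MemLp f 2 μ) : Integrable (fun x => f x ^ 2) μ :=
  hf.integrable_sq

lemma nm_eq (hf : MemLp f 2 μ) : nm μ f = (eLpNorm f 2 μ).toReal := by
  rw [hf.eLpNorm_eq_integral_rpow_norm (by simp) (by simp), ENNReal.toReal_ofReal (by positivity),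
    nm, Real.sqrt_eq_rpow]
  simp

lemma nm_eq_norm (hf : MemLp f 2 μ) : nm μ f = ‖hf.toLp f‖ := by
  rw [Lp.norm_toLp, nm_eq hf]

lemma nm_add_le (hf : MemLp f 2 μ) (hg : MemLp g 2 μ) :
    nm μ (fun x => f x + g x) ≤ nm μ f + nm μ g := by
  have h : nm μ (fun x => f x + g x) = ‖(hf.add hg).toLp (f + g)‖ := nm_eq_norm (hf.add hg)
  rw [h, MemLp.toLp_add, nm_eq_norm hf, nm_eq_norm hg]
  exact norm_add_le _ _

lemma nm_const_mul (c : ℝ) : nm μ (fun x => c * f x) = |c| * nm μ f := by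
  simp only [nm, mul_pow, integral_const_mul]
  rw [Real.sqrt_mul (sq_nonneg c), Real.sqrt_sq_eq_abs]

lemma nm_neg : nm μ (fun x => - f x) = nm μ f := by
  simp [nm]

lemma nm_sub_comm : nm μ (fun x => f x - g x) = nm μ (fun x => g x - f x) := by
  unfold nm
  congr 2
  ext x
  ring

lemma nm_sub_le (hf : MemLp f 2 μ) (hg : MemLp g 2 μ) :
    nm μ (fun x => f x - g x) ≤ nm μ f + nm μ g := by
  have h := nm_add_le hf hg.neg
  have h2 : nm μ (-g) = nm μ g := nm_neg
  rw [h2] at h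
  exact h

/-- The triangle inequality through an intermediate function. -/
lemma nm_sub_le_add {k : α → ℝ} (hf : MemLp f 2 μ) (hg : MemLp g 2 μ) (hk : MemLp k 2 μ) :
    nm μ (fun x => f x - k x) ≤ nm μ (fun x => f x - g x) + nm μ (fun x => g x - k x) := by
  have h := nm_add_le (hf.sub hg) (hg.sub hk)
  simp only [Pi.sub_apply, sub_add_sub_cancel] at h
  exact h

lemma nm_sum_le {ι : Type*} (s : Finset ι) (F : ι → α → ℝ) (hF : ∀ i ∈ s, MemLp (F i) 2 μ) :
    nm μ (fun x => ∑ i ∈ s, F i x) ≤ ∑ i ∈ s, nm μ (F i) := by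
  classical
  induction s using Finset.induction_on with
  | empty => simp [nm]
  | insert a s ha ih =>
    simp only [Finset.sum_insert ha]
    have h1 := ih fun i hi => hF i (Finset.mem_insert_of_mem hi)
    have h2 : MemLp (fun x => ∑ i ∈ s, F i x) 2 μ :=
      memLp_finsetSum s fun i hi => hF i (Finset.mem_insert_of_mem hi)
    linarith [nm_add_le (hF a (Finset.mem_insert_self a s)) h2]

/-- The Cauchy–Schwarz inequality. -/
lemma abs_integral_mul_le (hf : MemLp f 2 μ) (hg : MemLp g 2 μ) :
    |∫ x, f x * g x ∂μ| ≤ nm μ f * nm μ g := by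
  have h : ∫ x, f x * g x ∂μ = inner ℝ (hf.toLp f) (hg.toLp g) := by
    rw [L2.inner_def]
    refine integral_congr_ae ?_
    filter_upwards [hf.coeFn_toLp, hg.coeFn_toLp] with x h1 h2
    simp [h1, h2, mul_comm]
  rw [h, nm_eq_norm hf, nm_eq_norm hg]
  exact abs_real_inner_le_norm _ _

lemma nm_le_of_abs_le {c : ℝ} (hc : 0 ≤ c) (hg : MemLp g 2 μ)
    (h : ∀ᵐ x ∂μ, |f x| ≤ c * |g x|) : nm μ f ≤ c * nm μ g := by
  rw [← abs_of_nonneg hc, ← nm_const_mul]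
  refine Real.sqrt_le_sqrt (integral_mono_of_nonneg (.of_forall fun _ => sq_nonneg _)
    (integrable_sq_of_memLp (hg.const_mul c)) ?_)
  filter_upwards [h] with x hx
  have := abs_nonneg (f x)
  rw [← sq_abs (f x), mul_pow, ← sq_abs (g x), ← mul_pow]
  exact pow_le_pow_left₀ this hx 2

lemma nm_mono_set {s t : Set α} (hst : s ⊆ t) (hf : MemLp f 2 (μ.restrict t)) :
    nm (μ.restrict s) f ≤ nm (μ.restrict t) f :=
  Real.sqrt_le_sqrt (setIntegral_mono_set (integrable_sq_of_memLp hf)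
    (.of_forall fun _ => sq_nonneg _) (Filter.Eventually.of_forall hst))

lemma ae_eq_zero_of_nm_eq_zero (hf : MemLp f 2 μ) (h : nm μ f = 0) : f =ᵐ[μ] 0 := by
  have h1 : ∫ x, f x ^ 2 ∂μ = 0 := by rw [← nm_sq, h]; norm_num
  have h2 := (integral_eq_zero_iff_of_nonneg (fun x => sq_nonneg (f x))
    (integrable_sq_of_memLp hf)).1 h1
  filter_upwards [h2] with x hx
  simpa using hx

lemma tendsto_nm_of_eLpNorm {F : ℕ → α → ℝ} (hF : ∀ n, MemLp (F n) 2 μ)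
    (h : Tendsto (fun n => eLpNorm (F n) 2 μ) atTop (𝓝 0)) :
    Tendsto (fun n => nm μ (F n)) atTop (𝓝 0) := by
  have h2 := (ENNReal.tendsto_toReal (by simp : (0 : ENNReal) ≠ ⊤)).comp h
  refine h2.congr fun n => ?_
  rw [nm_eq (hF n)]
  rfl

lemma tendsto_eLpNorm_of_nm {F : ℕ → α → ℝ} (hF : ∀ n, MemLp (F n) 2 μ)
    (h : Tendsto (fun n => nm μ (F n)) atTop (𝓝 0)) :
    Tendsto (fun n => eLpNorm (F n) 2 μ) atTop (𝓝 0) := by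
  have h2 := ENNReal.tendsto_ofReal h
  rw [ENNReal.ofReal_zero] at h2
  refine h2.congr fun n => ?_
  rw [nm_eq (hF n), ENNReal.ofReal_toReal (hF n).eLpNorm_ne_top]

/-- Completeness of `L²`. -/
lemma exists_nm_limit {F : ℕ → α → ℝ} (hF : ∀ n, MemLp (F n) 2 μ) {b : ℕ → ℝ}
    (hb : Tendsto b atTop (𝓝 0)) (h : ∀ n m, nm μ (fun x => F n x - F m x) ≤ b n + b m) :
    ∃ g, MemLp g 2 μ ∧ Tendsto (fun n => nm μ (fun x => F n x - g x)) atTop (𝓝 0) := by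
  have hd : ∀ n m, dist ((hF n).toLp (F n)) ((hF m).toLp (F m)) ≤ b n + b m := by
    intro n m
    rw [dist_eq_norm, ← MemLp.toLp_sub, ← nm_eq_norm]
    exact h n m
  have hc : CauchySeq fun n => (hF n).toLp (F n) := by
    rw [Metric.cauchySeq_iff']
    intro ε hε
    obtain ⟨N, hN⟩ := (hb.eventually (gt_mem_nhds (half_pos hε))).exists_forall_of_atTop
    exact ⟨N, fun n hn => (hd n N).trans_lt (by linarith [hN n hn, hN N le_rfl])⟩
  obtain ⟨g, hg⟩ := cauchySeq_tendsto_of_complete hc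
  refine ⟨g, Lp.memLp g, ?_⟩
  rw [tendsto_iff_norm_sub_tendsto_zero] at hg
  refine hg.congr fun n => ?_
  have h1 := nm_eq_norm ((hF n).sub (Lp.memLp g))
  rw [MemLp.toLp_sub _ (Lp.memLp g), Lp.toLp_coeFn g (Lp.memLp g)] at h1
  exact h1.symm

lemma tendsto_integral_mul {F : ℕ → α → ℝ} (hF : ∀ n, MemLp (F n) 2 μ) (hf : MemLp f 2 μ)
    (hg : MemLp g 2 μ) (h : Tendsto (fun n => nm μ (fun x => F n x - f x)) atTop (𝓝 0)) :
    Tendsto (fun n => ∫ x, F n x * g x ∂μ) atTop (𝓝 (∫ x, f x * g x ∂μ)) := by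
  rw [tendsto_iff_norm_sub_tendsto_zero]
  refine squeeze_zero (fun _ => norm_nonneg _) (fun n => ?_) (by simpa using h.mul_const (nm μ g))
  rw [← integral_sub (integrable_mul_of_memLp (hF n) hg) (integrable_mul_of_memLp hf hg)]
  simp only [← sub_mul]
  exact abs_integral_mul_le ((hF n).sub hf) hg

lemma tendsto_nm {F : ℕ → α → ℝ} (hF : ∀ n, MemLp (F n) 2 μ) (hf : MemLp f 2 μ)
    (h : Tendsto (fun n => nm μ (fun x => F n x - f x)) atTop (𝓝 0)) :
    Tendsto (fun n => nm μ (F n)) atTop (𝓝 (nm μ f)) := by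
  rw [tendsto_iff_norm_sub_tendsto_zero]
  refine squeeze_zero (fun _ => norm_nonneg _) (fun n => ?_) h
  have h1 := nm_add_le ((hF n).sub hf) hf
  have h2 := nm_add_le (hf.sub (hF n)) (hF n)
  simp only [Pi.sub_apply, sub_add_cancel] at h1 h2
  have h3 : nm μ (f - F n) = nm μ (fun x => F n x - f x) := nm_sub_comm
  have h4 : nm μ (F n - f) = nm μ (fun x => F n x - f x) := rfl
  rw [Real.norm_eq_abs, abs_le]
  constructor <;> linarith

end L2

/-! ### Finite dimensional linear algebra -/

/-- On a finite dimensional space, a linear map is bounded by any injective linear map. -/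
lemma exists_norm_le_of_injective {V X Y : Type*} [AddCommGroup V] [Module ℝ V]
    [FiniteDimensional ℝ V] [NormedAddCommGroup X] [NormedSpace ℝ X] [NormedAddCommGroup Y]
    [NormedSpace ℝ Y] (A : V →ₗ[ℝ] X) (B : V →ₗ[ℝ] Y) (hB : Function.Injective B) :
    ∃ C : ℝ, 0 < C ∧ ∀ v, ‖A v‖ ≤ C * ‖B v‖ := by
  -- `V` has no norm; work in coordinates, where an injective linear map is antilipschitz.
  let e := (Module.finBasis ℝ V).equivFun
  let A' := A ∘ₗ e.symm.toLinearMap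
  let B' := B ∘ₗ e.symm.toLinearMap
  obtain ⟨K, hK, hK'⟩ := B'.injective_iff_antilipschitz.1 (hB.comp e.symm.injective)
  let A'' := A'.toContinuousLinearMap
  refine ⟨(‖A''‖ + 1) * K, by positivity, fun v => ?_⟩
  have h1 : ‖A v‖ ≤ ‖A''‖ * ‖e v‖ := by
    have := A''.le_opNorm (e v)
    simpa [A'', A'] using this
  have h2 : ‖e v‖ ≤ K * ‖B v‖ := by
    have := hK'.le_mul_norm (map_zero B') (e v)
    simpa [B'] using this
  calc ‖A v‖ ≤ ‖A''‖ * ‖e v‖ := h1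
    _ ≤ (‖A''‖ + 1) * (K * ‖B v‖) := by gcongr; linarith
    _ = _ := by ring

/-- In finite dimension a symmetric form represents each functional that vanishes on its
kernel. -/
lemma exists_represent_of_ker {V : Type*} [AddCommGroup V] [Module ℝ V] [FiniteDimensional ℝ V]
    (B : V →ₗ[ℝ] Module.Dual ℝ V) (ℓ : Module.Dual ℝ V)
    (hker : ∀ v, B v = 0 → ℓ v = 0) : ∃ p, ∀ φ, B φ p = ℓ φ := by
  have h : ℓ ∈ B.dualMap.range := by
    rw [LinearMap.range_dualMap_eq_dualAnnihilator_ker, Submodule.mem_dualAnnihilator]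
    exact fun w hw => hker w (LinearMap.mem_ker.1 hw)
  obtain ⟨ξ, hξ⟩ := h
  obtain ⟨p, rfl⟩ := (Module.evalEquiv ℝ V).surjective ξ
  exact ⟨p, fun φ => by rw [← hξ]; rfl⟩

/-! ### Polynomials and their evaluation -/

@[simp] lemma ev_add (p q : Poly d) (x : E d) : ev (p + q) x = ev p x + ev q x := by simp [ev]
@[simp] lemma ev_sub (p q : Poly d) (x : E d) : ev (p - q) x = ev p x - ev q x := by simp [ev]
@[simp] lemma ev_mul (p q : Poly d) (x : E d) : ev (p * q) x = ev p x * ev q x := by simp [ev]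
@[simp] lemma ev_zero (x : E d) : ev (0 : Poly d) x = 0 := by simp [ev]
@[simp] lemma ev_one (x : E d) : ev (1 : Poly d) x = 1 := by simp [ev]
@[simp] lemma ev_smul (c : ℝ) (p : Poly d) (x : E d) : ev (c • p) x = c * ev p x := by
  simp [ev, MvPolynomial.smul_eval]
@[simp] lemma ev_C (c : ℝ) (x : E d) : ev (MvPolynomial.C c : Poly d) x = c := by simp [ev]
@[simp] lemma ev_X (i : Fin d) (x : E d) : ev (MvPolynomial.X i : Poly d) x = x i := by simp [ev]
@[simp] lemma ev_sum {ι : Type*} (s : Finset ι) (p : ι → Poly d) (x : E d) :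
    ev (∑ i ∈ s, p i) x = ∑ i ∈ s, ev (p i) x := by simp [ev, map_sum]

lemma contDiff_ev (p : Poly d) : ContDiff ℝ ∞ (ev p) := by
  induction p using MvPolynomial.induction_on with
  | C a => simpa [funext fun x => ev_C a x] using (contDiff_const : ContDiff ℝ ∞ fun _ : E d => a)
  | add p q hp hq => rw [funext fun x => ev_add p q x]; exact hp.add hq
  | mul_X p i hp =>
    have h : ev (p * MvPolynomial.X i) = fun x => ev p x * x i := by
      ext x
      simp
    rw [h]
    exact hp.mul (by fun_prop)

@[fun_prop]
lemma continuous_ev (p : Poly d) : Continuous (ev p) := (contDiff_ev p).continuous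

section pd

variable {f g : E d → ℝ}

lemma differentiable_of_smooth (hf : ContDiff ℝ ∞ f) : Differentiable ℝ f :=
  hf.differentiable (by simp)

lemma contDiff_pd (hf : ContDiff ℝ ∞ f) (i : Fin d) : ContDiff ℝ ∞ (pd i f) := by
  have : ContDiff ℝ ∞ (fderiv ℝ f) := hf.fderiv_right (by simp)
  exact this.clm_apply contDiff_const

lemma pd_add (hf : ContDiff ℝ ∞ f) (hg : ContDiff ℝ ∞ g) (i : Fin d) (x : E d) :
    pd i (fun y => f y + g y) x = pd i f x + pd i g x := by
  unfold pd
  rw [fderiv_fun_add (differentiable_of_smooth hf x) (differentiable_of_smooth hg x)]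
  rfl

lemma pd_sub (hf : ContDiff ℝ ∞ f) (hg : ContDiff ℝ ∞ g) (i : Fin d) (x : E d) :
    pd i (fun y => f y - g y) x = pd i f x - pd i g x := by
  unfold pd
  rw [fderiv_fun_sub (differentiable_of_smooth hf x) (differentiable_of_smooth hg x)]
  rfl

lemma pd_mul (hf : ContDiff ℝ ∞ f) (hg : ContDiff ℝ ∞ g) (i : Fin d) (x : E d) :
    pd i (fun y => f y * g y) x = pd i f x * g x + f x * pd i g x := by
  unfold pd
  rw [fderiv_fun_mul (differentiable_of_smooth hf x) (differentiable_of_smooth hg x)]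
  simp
  ring

lemma pd_comm (hf : ContDiff ℝ ∞ f) (i j : Fin d) : pd i (pd j f) = pd j (pd i f) := by
  ext x
  have h2 : ContDiff ℝ ∞ (fderiv ℝ f) := hf.fderiv_right (by simp)
  have h3 : DifferentiableAt ℝ (fderiv ℝ f) x := h2.differentiable (by simp) x
  have key : ∀ i j : Fin d, pd i (pd j f) x
      = fderiv ℝ (fderiv ℝ f) x (EuclideanSpace.single i 1) (EuclideanSpace.single j 1) := by
    intro i j
    unfold pd
    rw [fderiv_clm_apply h3 (differentiableAt_const _)]
    simp
  rw [key, key]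
  exact (hf.contDiffAt.isSymmSndFDerivAt (by simpa using ENat.LEInfty.out)) _ _

/-- The derivative in direction `v` in terms of partial derivatives. -/
lemma fderiv_eq_sum_pd (x v : E d) : fderiv ℝ f x v = ∑ i, v i * pd i f x := by
  have hv : v = ∑ i, v i • EuclideanSpace.single i (1 : ℝ) := by
    ext j
    simp [Finset.sum_apply, Pi.single_apply]
  conv_lhs => rw [hv]
  simp [map_sum, pd]

end pd

lemma pd_ev (p : Poly d) (i : Fin d) : pd i (ev p) = ev (MvPolynomial.pderiv i p) := by
  ext x
  induction p using MvPolynomial.induction_on generalizing x with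
  | C a => simp [pd, funext fun x => ev_C a x]
  | add p q hp hq =>
    rw [funext fun x => ev_add p q x, pd_add (contDiff_ev p) (contDiff_ev q), hp, hq]
    simp
  | mul_X p j hp =>
    have hX : pd i (ev (MvPolynomial.X j : Poly d)) x = ev (MvPolynomial.pderiv i (.X j)) x := by
      have h : ev (MvPolynomial.X j : Poly d) = EuclideanSpace.proj (𝕜 := ℝ) j := by
        ext y
        simp
      unfold pd
      rw [h, ContinuousLinearMap.fderiv, MvPolynomial.pderiv_X]
      by_cases hij : i = j
      · subst hij; simp
      · simp [Ne.symm hij]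
    have h : ev (p * MvPolynomial.X j) = fun x => ev p x * ev (MvPolynomial.X j) x := by
      ext x
      simp
    rw [h, pd_mul (contDiff_ev p) (contDiff_ev _), hp, hX]
    simp
    ring

lemma mem_P {p : Poly d} {k : ℕ} : p ∈ P d k ↔ p.totalDegree ≤ k :=
  MvPolynomial.mem_restrictTotalDegree _ _ _

instance (k : ℕ) : FiniteDimensional ℝ (P d k) :=
  inferInstanceAs (Module.Finite ℝ (MvPolynomial.restrictTotalDegree (Fin d) ℝ k))

lemma P_mono {k l : ℕ} (h : k ≤ l) {p : Poly d} (hp : p ∈ P d k) : p ∈ P d l :=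
  mem_P.2 ((mem_P.1 hp).trans h)

lemma mul_mem_P {k l : ℕ} {p q : Poly d} (hp : p ∈ P d k) (hq : q ∈ P d l) :
    p * q ∈ P d (k + l) :=
  mem_P.2 ((MvPolynomial.totalDegree_mul p q).trans (add_le_add (mem_P.1 hp) (mem_P.1 hq)))

lemma C_mem_P (k : ℕ) (c : ℝ) : (MvPolynomial.C c : Poly d) ∈ P d k := mem_P.2 (by simp)

lemma X_mem_P (i : Fin d) : (MvPolynomial.X i : Poly d) ∈ P d 1 := mem_P.2 (by simp)

/-- Induction over the monomials of degree at most `k`. -/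
lemma P_induction {k : ℕ} {motive : Poly d → Prop} (zero : motive 0)
    (add : ∀ p q, motive p → motive q → motive (p + q))
    (mon : ∀ (m : Fin d →₀ ℕ) (a : ℝ), m.degree ≤ k → motive (MvPolynomial.monomial m a))
    {p : Poly d} (hp : p ∈ P d k) : motive p := by
  rw [MvPolynomial.as_sum p]
  refine Finset.sum_induction _ motive add zero fun m hm => mon m _ ?_
  exact (MvPolynomial.le_totalDegree hm).trans (mem_P.1 hp)

lemma pderiv_mem_P {k : ℕ} {p : Poly d} (hp : p ∈ P d k) (i : Fin d) :
    MvPolynomial.pderiv i p ∈ P d (k - 1) := by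
  refine P_induction (motive := fun p => MvPolynomial.pderiv i p ∈ P d (k - 1)) (by simp)
    (fun p q hp hq => by rw [map_add]; exact add_mem hp hq) (fun m a hm => ?_) hp
  · rw [MvPolynomial.pderiv_monomial]
    by_cases hi : m i = 0
    · simp [hi]
    · refine mem_P.2 ((MvPolynomial.totalDegree_monomial_le _ _).trans ?_)
      have h1 : Finsupp.single i 1 ≤ m := by
        rw [Finsupp.single_le_iff]; omega
      have h2 : (m - Finsupp.single i 1 + Finsupp.single i 1).degree = m.degree := by
        rw [tsub_add_cancel_of_le h1]
      rw [map_add, Finsupp.degree_single] at h2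
      change (m - Finsupp.single i 1).degree ≤ _
      omega

lemma pderiv_eq_zero_of_mem_P_zero {p : Poly d} (hp : p ∈ P d 0) (i : Fin d) :
    MvPolynomial.pderiv i p = 0 := by
  have h := mem_P.1 hp
  rw [Nat.le_zero, MvPolynomial.totalDegree_eq_zero_iff_eq_C] at h
  rw [h]
  simp

/-- Substitution of an affine map, given by polynomials of degree one, preserves the degree. -/
lemma bind_mem_P {k : ℕ} {f : Fin d → Poly d} (hf : ∀ i, f i ∈ P d 1) {p : Poly d}
    (hp : p ∈ P d k) : MvPolynomial.bind₁ f p ∈ P d k := by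
  refine P_induction (motive := fun p => MvPolynomial.bind₁ f p ∈ P d k) (by simp)
    (fun p q hp hq => by rw [map_add]; exact add_mem hp hq) (fun m a hm => ?_) hp
  · rw [MvPolynomial.bind₁_monomial]
    refine mem_P.2 ((MvPolynomial.totalDegree_mul _ _).trans ?_)
    rw [MvPolynomial.totalDegree_C, zero_add]
    refine (MvPolynomial.totalDegree_finsetProd _ _).trans ?_
    refine le_trans (Finset.sum_le_sum fun i _ => (MvPolynomial.totalDegree_pow _ _).trans
      (Nat.mul_le_mul_left _ (mem_P.1 (hf i)))) ?_
    simp only [mul_one]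
    exact hm

lemma ev_bind (f : Fin d → Poly d) (p : Poly d) (x : E d) :
    ev (MvPolynomial.bind₁ f p) x = ev p (WithLp.toLp 2 fun i => ev (f i) x) := by
  induction p using MvPolynomial.induction_on with
  | C a => simp
  | add p q hp hq => simp [hp, hq]
  | mul_X p i hp => simp [hp]

/-- A polynomial vanishing on a nonempty open set is zero. -/
lemma eq_zero_of_ev_eq_zero {U : Set (E d)} (hU : IsOpen U) (hne : U.Nonempty) {p : Poly d}
    (h : ∀ x ∈ U, ev p x = 0) : p = 0 := by
  obtain ⟨c, hc⟩ := hne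
  have hV : IsOpen ((WithLp.toLp 2 : (Fin d → ℝ) → E d) ⁻¹' U) :=
    hU.preimage (PiLp.continuous_toLp 2 _)
  obtain ⟨ε, hε, hball⟩ := Metric.isOpen_iff.1 hV (WithLp.ofLp c) (by simpa using hc)
  refine MvPolynomial.funext_set (fun i => Metric.ball (c i) ε) (fun i => ?_) fun x hx => ?_
  · rw [Real.ball_eq_Ioo]
    exact Set.Ioo_infinite (by linarith)
  · have hx' : x ∈ Metric.ball (WithLp.ofLp c) ε := by
      rw [ball_pi _ hε]
      exact hx
    simpa [ev] using h _ (hball hx')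

lemma memLp_of_continuous {ν : Measure (E d)} {S : Set (E d)} (hS : IsCompact S)
    (hν : ν S < ⊤) {f : E d → ℝ} (hf : Continuous f) : MemLp f 2 (ν.restrict S) := by
  obtain ⟨C, hC⟩ := hS.exists_bound_of_continuousOn hf.continuousOn
  have : IsFiniteMeasure (ν.restrict S) := ⟨by simpa using hν⟩
  refine MemLp.of_bound hf.aestronglyMeasurable C ?_
  exact (ae_restrict_iff' hS.measurableSet).2 (.of_forall hC)

/-- A linear functional on polynomials of degree at most `m` that vanishes on the polynomials which
are zero on `S` is represented by integration over `S` against such a polynomial. -/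
lemma represent_spec {m : ℕ} {S : Set (E d)} {ν : Measure (E d)} (hS : IsCompact S)
    (hν : ν S < ⊤) {ℓ : Poly d → ℝ} (hadd : ∀ φ ψ, ℓ (φ + ψ) = ℓ φ + ℓ ψ)
    (hsmul : ∀ (c : ℝ) φ, ℓ (c • φ) = c * ℓ φ)
    (hker : ∀ φ, ev φ =ᵐ[ν.restrict S] 0 → ℓ φ = 0) :
    represent m S ν ℓ ∈ P d m ∧
      ∀ φ ∈ P d m, ∫ x in S, ev (represent m S ν ℓ) x * ev φ x ∂ν = ℓ φ := by
  have hL : ∀ p : Poly d, MemLp (ev p) 2 (ν.restrict S) := fun p =>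
    memLp_of_continuous hS hν (continuous_ev p)
  have hi : ∀ p q : Poly d, Integrable (fun x => ev p x * ev q x) (ν.restrict S) := fun p q =>
    integrable_mul_of_memLp (hL p) (hL q)
  have hex : ∃ p ∈ P d m, ∀ φ ∈ P d m, ∫ x in S, ev p x * ev φ x ∂ν = ℓ φ := by
    let B : P d m →ₗ[ℝ] Module.Dual ℝ (P d m) := LinearMap.mk₂ ℝ
      (fun φ p => ∫ x in S, ev p.1 x * ev φ.1 x ∂ν)
      (fun φ ψ p => by simp [mul_add, integral_add (hi _ _) (hi _ _)])
      (fun c φ p => by simp [mul_left_comm, integral_const_mul])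
      (fun φ p q => by simp [add_mul, integral_add (hi _ _) (hi _ _)])
      (fun c φ p => by simp [mul_assoc, integral_const_mul])
    let ℓ' : Module.Dual ℝ (P d m) :=
      { toFun := fun φ => ℓ φ.1
        map_add' := fun φ ψ => hadd _ _
        map_smul' := fun c φ => hsmul _ _ }
    obtain ⟨p, hp⟩ := exists_represent_of_ker B ℓ' (by
      intro φ hφ
      refine hker φ.1 (ae_eq_zero_of_nm_eq_zero (hL _) ?_)
      have h1 : ∫ x in S, ev φ.1 x * ev φ.1 x ∂ν = 0 := by
        have := LinearMap.congr_fun hφ φ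
        exact this
      rw [nm, Real.sqrt_eq_zero']
      simp only [pow_two, h1, le_refl])
    exact ⟨p.1, p.2, fun φ hφ => hp ⟨φ, hφ⟩⟩
  unfold represent
  rw [dif_pos hex]
  exact hex.choose_spec

/-! ### Polynomial inequalities on balls -/

lemma memLp_volume {K : Set (E d)} (hK : IsCompact K) {f : E d → ℝ} (hf : Continuous f) :
    MemLp f 2 (volume.restrict K) := memLp_of_continuous hK hK.measure_lt_top hf

lemma eq_zero_of_ae_eq_zero {K : Set (E d)} (hK : (interior K).Nonempty) {p : Poly d}
    (h : ev p =ᵐ[volume.restrict K] 0) : p = 0 := by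
  refine eq_zero_of_ev_eq_zero isOpen_interior hK fun x hx => ?_
  have h1 : ev p =ᵐ[volume.restrict (interior K)] 0 :=
    ae_restrict_of_ae_restrict_of_subset interior_subset h
  exact Measure.eqOn_open_of_ae_eq h1 isOpen_interior (continuous_ev p).continuousOn
    continuousOn_const hx

lemma eq_zero_of_nm_eq_zero {K : Set (E d)} (hK : IsCompact K) (hK' : (interior K).Nonempty)
    {p : Poly d} (h : nm (volume.restrict K) (ev p) = 0) : p = 0 :=
  eq_zero_of_ae_eq_zero hK' (ae_eq_zero_of_nm_eq_zero (memLp_volume hK (continuous_ev p)) h)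

/-- The class in `L²(K)` of a polynomial, composed with a linear map into polynomials. -/
def toL2 {K : Set (E d)} (hK : IsCompact K) {V : Type*} [AddCommGroup V] [Module ℝ V]
    (A : V →ₗ[ℝ] Poly d) : V →ₗ[ℝ] Lp ℝ 2 ((volume : Measure (E d)).restrict K) where
  toFun v := (memLp_volume hK (continuous_ev (A v))).toLp _
  map_add' v w := by
    rw [← MemLp.toLp_add]
    congr 1
    ext x
    simp
  map_smul' c v := by
    rw [RingHom.id_apply, ← MemLp.toLp_const_smul]
    congr 1
    ext x
    simp

lemma norm_toL2 {K : Set (E d)} (hK : IsCompact K) {V : Type*} [AddCommGroup V] [Module ℝ V]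
    (A : V →ₗ[ℝ] Poly d) (v : V) : ‖toL2 hK A v‖ = nm (volume.restrict K) (ev (A v)) :=
  (nm_eq_norm (memLp_volume hK (continuous_ev (A v)))).symm

/-- All seminorms of a polynomial of bounded degree are controlled by its `L²` norm on a set with
nonempty interior, since the latter is a norm on a finite dimensional space. -/
lemma exists_nm_le {K L : Set (E d)} (hK : IsCompact K) (hL : IsCompact L)
    (hL' : (interior L).Nonempty) (k : ℕ) (A : Poly d →ₗ[ℝ] Poly d) :
    ∃ C : ℝ, 0 < C ∧ ∀ p ∈ P d k,
      nm (volume.restrict K) (ev (A p)) ≤ C * nm (volume.restrict L) (ev p) := by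
  obtain ⟨C, hC, h⟩ := exists_norm_le_of_injective (toL2 hK (A ∘ₗ (P d k).subtype))
    (toL2 hL (P d k).subtype) (by
      rw [← LinearMap.ker_eq_bot, LinearMap.ker_eq_bot']
      intro p hp
      have h1 : nm (volume.restrict L) (ev p.1) = 0 := by
        rw [← Submodule.subtype_apply, ← norm_toL2 hL, hp, norm_zero]
      exact Subtype.ext (eq_zero_of_nm_eq_zero hL hL' h1))
  refine ⟨C, hC, fun p hp => ?_⟩
  have := h ⟨p, hp⟩
  rwa [norm_toL2, norm_toL2] at this

/-- Change of variables under `x ↦ c + h x`. -/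
lemma setIntegral_comp_homothety (f : E d → ℝ) (S : Set (E d)) (hS : MeasurableSet S)
    (c : E d) {h : ℝ} (hh : 0 < h) :
    ∫ x in S, f x = h ^ d * ∫ x in (fun x => c + h • x) ⁻¹' S, f (c + h • x) := by
  have hm : Measurable fun x : E d => c + h • x := by fun_prop
  rw [← integral_indicator hS, ← integral_indicator (hm hS)]
  have h1 := Measure.integral_comp_smul volume (fun x => S.indicator f (c + x)) h
  rw [integral_add_left_eq_self (S.indicator f) c, finrank_euclideanSpace_fin, smul_eq_mul] at h1
  have h2 : (fun x => S.indicator f (c + h • x))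
      = ((fun x => c + h • x) ⁻¹' S).indicator fun x => f (c + h • x) := by
    ext x
    rfl
  rw [← h2, h1, abs_of_pos (by positivity), ← mul_assoc, mul_inv_cancel₀ (by positivity), one_mul]

lemma nm_homothety (f : E d → ℝ) (S : Set (E d)) (hS : MeasurableSet S)
    (c : E d) {h : ℝ} (hh : 0 < h) :
    nm (volume.restrict S) f = √(h ^ d) *
      nm (volume.restrict ((fun x => c + h • x) ⁻¹' S)) (fun x => f (c + h • x)) := by
  rw [nm, setIntegral_comp_homothety _ S hS c hh, Real.sqrt_mul (by positivity), nm]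

lemma preimage_homothety_closedBall (c : E d) {h : ℝ} (hh : 0 < h) (r : ℝ) :
    (fun x : E d => c + h • x) ⁻¹' Metric.closedBall c (h * r) = Metric.closedBall 0 r := by
  ext x
  simp [dist_eq_norm, norm_smul, abs_of_pos hh, hh]

/-- The polynomial `x ↦ p (c + h x)`. -/
def homothety (c : E d) (h : ℝ) (p : Poly d) : Poly d :=
  MvPolynomial.bind₁ (fun i => MvPolynomial.C (c i) + h • MvPolynomial.X i) p

lemma ev_homothety (c : E d) (h : ℝ) (p : Poly d) (x : E d) :
    ev (homothety c h p) x = ev p (c + h • x) := by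
  rw [homothety, ev_bind]
  congr 1
  ext i
  simp

lemma homothety_mem_P {k : ℕ} (c : E d) (h : ℝ) {p : Poly d} (hp : p ∈ P d k) :
    homothety c h p ∈ P d k :=
  bind_mem_P (fun i => add_mem (C_mem_P 1 _) (Submodule.smul_mem _ _ (X_mem_P i))) hp

lemma pd_comp_homothety {f : E d → ℝ} (hf : ContDiff ℝ ∞ f) (c : E d) (h : ℝ) (i : Fin d)
    (x : E d) : pd i (fun y => f (c + h • y)) x = h * pd i f (c + h • x) := by
  have h1 : HasFDerivAt (fun y : E d => c + h • y) (h • ContinuousLinearMap.id ℝ (E d)) x :=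
    ((hasFDerivAt_id x).const_smul h).const_add c
  have h2 := ((differentiable_of_smooth hf (c + h • x)).hasFDerivAt.comp x h1).fderiv
  unfold pd
  change fderiv ℝ (f ∘ fun y => c + h • y) x _ = _
  rw [h2]
  simp

lemma ev_pderiv_homothety (c : E d) (h : ℝ) (p : Poly d) (i : Fin d) (x : E d) :
    ev (MvPolynomial.pderiv i (homothety c h p)) x
      = h * ev (MvPolynomial.pderiv i p) (c + h • x) := by
  rw [← pd_ev, ← pd_ev, ← pd_comp_homothety (contDiff_ev p)]
  congr 1
  ext y
  exact ev_homothety c h p y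

/-- Norm equivalence and inverse inequality for polynomials on concentric balls. -/
lemma exists_ball_inverse (k : ℕ) {γ : ℝ} (hγ : 0 < γ) :
    ∃ C : ℝ, 0 < C ∧ ∀ p ∈ P d k, ∀ (c : E d) (h : ℝ), 0 < h →
      nm (volume.restrict (Metric.closedBall c h)) (ev p)
        ≤ C * nm (volume.restrict (Metric.closedBall c (h / γ))) (ev p) ∧
      ∀ i, nm (volume.restrict (Metric.closedBall c h)) (ev (MvPolynomial.pderiv i p))
        ≤ C * h⁻¹ * nm (volume.restrict (Metric.closedBall c (h / γ))) (ev p) := by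
  have hK : IsCompact (Metric.closedBall (0 : E d) 1) := isCompact_closedBall _ _
  have hL : IsCompact (Metric.closedBall (0 : E d) (1 / γ)) := isCompact_closedBall _ _
  have hL' : (interior (Metric.closedBall (0 : E d) (1 / γ))).Nonempty :=
    ⟨0, Metric.ball_subset_interior_closedBall (Metric.mem_ball_self (by positivity))⟩
  obtain ⟨C₀, hC₀, h₀⟩ := exists_nm_le hK hL hL' k LinearMap.id
  choose C₁ hC₁ h₁ using fun i =>
    exists_nm_le hK hL hL' k (MvPolynomial.pderiv i : Derivation ℝ (Poly d) (Poly d)).toLinearMap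
  have hsum : ∀ i, C₁ i ≤ ∑ j, C₁ j := fun i =>
    Finset.single_le_sum (fun j _ => (hC₁ j).le) (Finset.mem_univ i)
  have hs0 : 0 ≤ ∑ j, C₁ j := Finset.sum_nonneg fun j _ => (hC₁ j).le
  refine ⟨C₀ + ∑ j, C₁ j, by positivity, fun p hp c h hh => ?_⟩
  -- Rescaling both balls to balls centred at the origin makes the constants independent of `c`,
  -- `h`.
  have e1 : ∀ f : E d → ℝ, nm (volume.restrict (Metric.closedBall c h)) f
      = √(h ^ d) * nm (volume.restrict (Metric.closedBall 0 1)) (fun x => f (c + h • x)) := by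
    intro f
    have := nm_homothety f (Metric.closedBall c (h * 1)) measurableSet_closedBall c hh
    rwa [preimage_homothety_closedBall c hh, mul_one] at this
  have e2 : ∀ f : E d → ℝ, nm (volume.restrict (Metric.closedBall c (h / γ))) f
      = √(h ^ d) * nm (volume.restrict (Metric.closedBall 0 (1 / γ))) (fun x => f (c + h • x)) := by
    intro f
    have := nm_homothety f (Metric.closedBall c (h * (1 / γ))) measurableSet_closedBall c hh
    rwa [preimage_homothety_closedBall c hh, mul_one_div] at this
  have e3 : (fun x => ev p (c + h • x)) = ev (homothety c h p) := by
    ext x; rw [ev_homothety]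
  refine ⟨?_, fun i => ?_⟩
  · rw [e1, e2, e3, mul_left_comm]
    gcongr
    refine (h₀ _ (homothety_mem_P c h hp)).trans ?_
    have := nm_nonneg (μ := volume.restrict (Metric.closedBall 0 (1 / γ)))
      (f := ev (homothety c h p))
    gcongr
    linarith
  · have e4 : (fun x => ev (MvPolynomial.pderiv i p) (c + h • x))
        = fun x => h⁻¹ * ev (MvPolynomial.pderiv i (homothety c h p)) x := by
      ext x
      rw [ev_pderiv_homothety, ← mul_assoc, inv_mul_cancel₀ hh.ne', one_mul]
    have h5 := nm_nonneg (μ := volume.restrict (Metric.closedBall 0 (1 / γ)))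
      (f := ev (homothety c h p))
    have h6 : nm (volume.restrict (Metric.closedBall 0 1))
        (ev (MvPolynomial.pderiv i (homothety c h p))) ≤ (C₀ + ∑ j, C₁ j) *
          nm (volume.restrict (Metric.closedBall 0 (1 / γ))) (ev (homothety c h p)) := by
      refine (h₁ i _ (homothety_mem_P c h hp)).trans ?_
      gcongr
      linarith [hsum i]
    rw [e1, e2, e3, e4, nm_const_mul, abs_of_pos (by positivity)]
    calc _ ≤ √(h ^ d) * (h⁻¹ * ((C₀ + ∑ j, C₁ j) *
          nm (volume.restrict (Metric.closedBall 0 (1 / γ))) (ev (homothety c h p)))) := by gcongr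
      _ = _ := by ring

/-! ### Slicing Lebesgue measure by parallel hyperplanes -/

/-- The hyperplane `⟪n, y⟫ = c`. -/
def hyper (n : E d) (c : ℝ) : Set (E d) := {y | inner ℝ n y = c}

lemma isClosed_hyper (n : E d) (c : ℝ) : IsClosed (hyper n c) :=
  isClosed_eq (by fun_prop) continuous_const

lemma measurableSet_hyper (n : E d) (c : ℝ) : MeasurableSet (hyper n c) :=
  (isClosed_hyper n c).measurableSet

/-- The surface measure on a hyperplane is an isometric image of a Lebesgue measure. -/
lemma exists_isometry_hyper {n : E d} (hn : ‖n‖ = 1) (c : ℝ) :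
    ∃ f : (ℝ ∙ n)ᗮ → E d, Isometry f ∧
      (surf d).restrict (hyper n c) = Measure.map f (volume : Measure (ℝ ∙ n)ᗮ) := by
  have hn0 : n ≠ 0 := by rintro rfl; simp at hn
  have hfr : Module.finrank ℝ (ℝ ∙ n)ᗮ = d - 1 := by
    have h1 := (ℝ ∙ n).finrank_add_finrank_orthogonal
    rw [finrank_span_singleton hn0, finrank_euclideanSpace_fin] at h1
    omega
  have hf : Isometry fun w : (ℝ ∙ n)ᗮ => (w : E d) + c • n :=
    Isometry.of_dist_eq fun x y => by rw [dist_add_right]; rfl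
  refine ⟨_, hf, ?_⟩
  have hr : Set.range (fun w : (ℝ ∙ n)ᗮ => (w : E d) + c • n) = hyper n c := by
    ext y
    simp only [Set.mem_range, hyper, Set.mem_ofPred_eq]
    constructor
    · rintro ⟨w, rfl⟩
      rw [inner_add_right, inner_smul_right, real_inner_self_eq_norm_sq, hn,
        Submodule.mem_orthogonal_singleton_iff_inner_right.1 w.2]
      simp
    · intro hy
      refine ⟨⟨y - c • n, ?_⟩, by simp⟩
      rw [Submodule.mem_orthogonal_singleton_iff_inner_right, inner_sub_right, inner_smul_right,
        real_inner_self_eq_norm_sq, hn, hy]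
      simp
  rw [← hr, surf, ← hf.map_euclideanHausdorffMeasure, ← hfr,
    InnerProductSpace.euclideanHausdorffMeasure_eq_volume]

lemma sFinite_hyper {n : E d} (hn : ‖n‖ = 1) (c : ℝ) :
    SFinite ((surf d).restrict (hyper n c)) := by
  obtain ⟨f, hf, h⟩ := exists_isometry_hyper hn c
  rw [h]
  infer_instance

/-- Compact subsets of a hyperplane have finite area. -/
lemma surf_lt_top {n : E d} (hn : ‖n‖ = 1) {c : ℝ} {K : Set (E d)} (hK : IsCompact K)
    (hKc : K ⊆ hyper n c) : surf d K < ⊤ := by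
  obtain ⟨f, hf, h⟩ := exists_isometry_hyper hn c
  rw [← Measure.restrict_eq_self (surf d) hKc, h,
    Measure.map_apply hf.continuous.measurable hK.measurableSet]
  exact (hf.isClosedEmbedding.isCompact_preimage hK).measure_lt_top

/-- The volume of a set is the integral of the areas of its slices by the translates `hyper n c + s
v`: Hausdorff measure is translation invariant, and the translate by `s v` is the hyperplane at the
level `c + s ⟪n, v⟫`. -/
lemma volume_slice {n v : E d} (hn : ‖n‖ = 1) (c : ℝ) (hv : inner ℝ n v ≠ 0)
    {t : Set (E d)} (ht : MeasurableSet t) :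
    volume t = ENNReal.ofReal |inner ℝ n v| *
      ∫⁻ s : ℝ, (surf d).restrict (hyper n c) {y | y + s • v ∈ t} := by
  have hn0 : n ≠ 0 := by rintro rfl; simp at hn
  have hsl : ∀ x : ℝ, ((AffineSubspace.mk' (x • n +ᵥ c • n) (ℝ ∙ n)ᗮ : AffineSubspace ℝ (E d)) :
      Set (E d)) = hyper n (c + x) := by
    intro x
    ext y
    simp only [SetLike.mem_coe, AffineSubspace.mem_mk', hyper, Set.mem_ofPred_eq, vsub_eq_sub,
      Submodule.mem_orthogonal_singleton_iff_inner_right, vadd_eq_add, inner_sub_right,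
      inner_add_right, inner_smul_right, real_inner_self_eq_norm_sq, hn]
    constructor <;> intro h <;> linarith
  have h1 := EuclideanGeometry.euclideanHausdorffMeasure_eq_lintegral (V := E d) (c • n) hn0 ht
  rw [finrank_euclideanSpace_fin, EuclideanSpace.euclideanHausdorffMeasure_eq_volume] at h1
  have hne : ‖n‖ₑ = 1 := by rw [← ofReal_norm, hn, ENNReal.ofReal_one]
  simp only [hsl, hne, one_mul] at h1
  have h2 : ∀ s : ℝ, (surf d).restrict (hyper n c) {y | y + s • v ∈ t}
      = surf d (t ∩ hyper n (c + inner ℝ n v * s)) := by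
    intro s
    have hm : MeasurableSet {y | y + s • v ∈ t} :=
      (by fun_prop : Measurable fun y : E d => y + s • v) ht
    have hinv : (surf d).IsAddLeftInvariant := by unfold surf; infer_instance
    rw [Measure.restrict_apply hm, ← measure_preimage_add (surf d) (s • v) (t ∩ hyper n _)]
    congr 1
    ext y
    simp only [Set.mem_inter_iff, Set.mem_ofPred_eq, hyper, Set.mem_preimage, inner_add_right,
      inner_smul_right, add_comm (s • v) y]
    refine and_congr_right fun _ => ?_
    constructor <;> intro h <;> linarith
  simp only [h2]
  rw [h1]
  have h3 := Real.smul_map_volume_mul_left hv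
  have h4 : ∀ G : ℝ → ENNReal, ∫⁻ x, G x
      = ENNReal.ofReal |inner ℝ n v| * ∫⁻ s, G (inner ℝ n v * s) := by
    intro G
    conv_lhs => rw [← h3]
    rw [lintegral_smul_measure, smul_eq_mul]
    congr 1
    exact lintegral_map_equiv G (Homeomorph.mulLeft₀ _ hv).toMeasurableEquiv
  exact h4 fun x => surf d (t ∩ hyper n (c + x))

/-- Fubini's theorem for slices by translates of a hyperplane in a transversal direction. -/
lemma integral_slice {n v : E d} (hn : ‖n‖ = 1) (c : ℝ) (hv : inner ℝ n v ≠ 0)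
    {F : E d → ℝ} (hF : Integrable F) :
    ∫ x, F x = |inner ℝ n v| * ∫ y in hyper n c, (∫ s : ℝ, F (y + s • v)) ∂(surf d) := by
  have := sFinite_hyper hn c
  have hm : Measurable fun q : E d × ℝ => q.1 + q.2 • v := by fun_prop
  have hμ : (volume : Measure (E d)) = ENNReal.ofReal |inner ℝ n v| •
      Measure.map (fun q : E d × ℝ => q.1 + q.2 • v)
        (((surf d).restrict (hyper n c)).prod volume) := by
    ext t ht
    rw [Measure.smul_apply, Measure.map_apply hm ht, Measure.prod_apply_symm (hm ht), smul_eq_mul,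
      volume_slice hn c hv ht]
    rfl
  have hpos : ENNReal.ofReal |inner ℝ n v| ≠ 0 := by simpa using hv
  rw [hμ] at hF
  have hF2 := (integrable_smul_measure hpos ENNReal.ofReal_ne_top).1 hF
  conv_lhs => rw [hμ]
  rw [integral_smul_measure, ENNReal.toReal_ofReal (abs_nonneg _), smul_eq_mul,
    integral_map hm.aemeasurable hF2.1]
  congr 1
  exact integral_prod _ (hF2.comp_measurable hm)

/-! ### Simplices -/

/-- The finite set `T` is the set of vertices of a nondegenerate `d`-simplex in `ℝ^d`. -/
structure IsSimplex (T : Finset (E d)) : Prop where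
  indep : AffineIndependent ℝ ((↑) : T → E d)
  card : T.card = d + 1

/-- The vertices of a nondegenerate simplex as an affine basis. -/
def IsSimplex.basis {T : Finset (E d)} (hT : IsSimplex T) : AffineBasis T ℝ (E d) :=
  ⟨(↑), hT.indep, by
    rw [hT.indep.affineSpan_eq_top_iff_card_eq_finrank_add_one]
    simp [hT.card]⟩

open scoped Classical in
/-- The barycentric coordinate of `ℝ^d` belonging to the vertex `a` of the simplex `T`. -/
def bary (T : Finset (E d)) (a : E d) : E d →ᵃ[ℝ] ℝ :=
  if h : ∃ _ : IsSimplex T, a ∈ T then h.1.basis.coord ⟨a, h.2⟩ else 0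

lemma affineMap_sum (f : E d →ᵃ[ℝ] ℝ) {ι : Type*} (s : Finset ι) (w : ι → ℝ) (p : ι → E d)
    (hw : ∑ i ∈ s, w i = 1) : f (∑ i ∈ s, w i • p i) = ∑ i ∈ s, w i * f (p i) := by
  have h : ∀ x, f x = f.linear x + f 0 := fun x => congrFun f.decomp x
  rw [h]
  simp only [h (p _), mul_add, Finset.sum_add_distrib, ← Finset.sum_mul, hw, map_sum, map_smul,
    smul_eq_mul, one_mul]

lemma affineMap_add (f : E d →ᵃ[ℝ] ℝ) (x v : E d) : f (x + v) = f x + f.linear v := by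
  rw [add_comm, ← vadd_eq_add, f.map_vadd, vadd_eq_add, add_comm]

lemma affineMap_sub (f : E d →ᵃ[ℝ] ℝ) (x y : E d) : f x - f y = f.linear (x - y) := by
  have := affineMap_add f y (x - y)
  rw [add_sub_cancel] at this
  rw [this]
  ring

lemma continuous_affineMap (f : E d →ᵃ[ℝ] ℝ) : Continuous f :=
  AffineMap.continuous_of_finiteDimensional f

lemma isCompact_hull (T : Finset (E d)) : IsCompact (hull T) :=
  T.finite_toSet.isCompact_convexHull ℝ

lemma convex_hull' (T : Finset (E d)) : Convex ℝ (hull T) := convex_convexHull ℝ _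

lemma measurableSet_hull (T : Finset (E d)) : MeasurableSet (hull T) :=
  (isCompact_hull T).measurableSet

lemma mem_hull_of_mem {T : Finset (E d)} {a : E d} (ha : a ∈ T) : a ∈ hull T :=
  subset_convexHull ℝ _ ha

lemma mem_opp {T : Finset (E d)} {a b : E d} : b ∈ opp T a ↔ b ≠ a ∧ b ∈ T := by
  classical
  simp [opp]

lemma opp_subset (T : Finset (E d)) (a : E d) : opp T a ⊆ T := fun _ hb => (mem_opp.1 hb).2

section simplex

variable {T : Finset (E d)} (hT : IsSimplex T) {a : E d}

include hT

lemma bary_eq (ha : a ∈ T) (x : E d) : bary T a x = hT.basis.coord ⟨a, ha⟩ x := by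
  rw [bary, dif_pos ⟨hT, ha⟩]

lemma bary_self (ha : a ∈ T) : bary T a a = 1 := by
  rw [bary_eq hT ha]
  exact hT.basis.coord_apply_eq ⟨a, ha⟩

lemma bary_ne (ha : a ∈ T) {b : E d} (hb : b ∈ T) (hab : a ≠ b) : bary T a b = 0 := by
  rw [bary_eq hT ha]
  exact hT.basis.coord_apply_ne (i := ⟨a, ha⟩) (j := ⟨b, hb⟩) (by simpa using hab)

lemma sum_bary (x : E d) : ∑ a ∈ T, bary T a x = 1 := by
  rw [← hT.basis.sum_coord_apply_eq_one x, ← Finset.sum_coe_sort]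
  exact Finset.sum_congr rfl fun a _ => bary_eq hT a.2 x

lemma sum_bary_smul (x : E d) : ∑ a ∈ T, bary T a x • a = x := by
  conv_rhs => rw [← hT.basis.linear_combination_coord_eq_self x]
  rw [← Finset.sum_coe_sort]
  exact Finset.sum_congr rfl fun a _ => by rw [bary_eq hT a.2 x]; rfl

lemma sum_bary_linear (v : E d) : ∑ a ∈ T, (bary T a).linear v = 0 := by
  have h : ∑ a ∈ T, (bary T a v - bary T a 0) = 0 := by
    rw [Finset.sum_sub_distrib, sum_bary hT, sum_bary hT, sub_self]
  simpa only [affineMap_sub, sub_zero] using h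

lemma sum_bary_linear_smul (v : E d) : ∑ a ∈ T, (bary T a).linear v • a = v := by
  have h := sum_bary_smul hT v
  have h0 := sum_bary_smul hT 0
  have : ∑ a ∈ T, (bary T a v • a - bary T a 0 • a) = v := by
    rw [Finset.sum_sub_distrib, h, h0, sub_zero]
  simpa only [← sub_smul, affineMap_sub, sub_zero] using this

/-- The hull of a set `S` of vertices is the face on which the other coordinates vanish. -/
lemma mem_hull_subset {S : Finset (E d)} (hS : S ⊆ T) (x : E d) :
    x ∈ hull S ↔ (∀ a ∈ T, 0 ≤ bary T a x) ∧ ∀ a ∈ T, a ∉ S → bary T a x = 0 := by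
  constructor
  · intro hx
    obtain ⟨w, hw0, hw1, rfl⟩ := Finset.mem_convexHull'.1 hx
    refine ⟨fun a ha => ?_, fun a ha haS => ?_⟩ <;> rw [affineMap_sum _ _ _ _ hw1]
    · refine Finset.sum_nonneg fun b hb => mul_nonneg (hw0 b hb) ?_
      by_cases hab : a = b
      · rw [← hab, bary_self hT ha]; exact zero_le_one
      · rw [bary_ne hT ha (hS hb) hab]
    · refine Finset.sum_eq_zero fun b hb => ?_
      rw [bary_ne hT ha (hS hb) (by rintro rfl; exact haS hb), mul_zero]
  · rintro ⟨h0, h1⟩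
    refine Finset.mem_convexHull'.2 ⟨fun a => bary T a x, fun a ha => h0 a (hS ha), ?_, ?_⟩
    · rw [Finset.sum_subset hS h1, sum_bary hT]
    · rw [Finset.sum_subset hS fun a ha haS => by simp only [h1 a ha haS, zero_smul],
        sum_bary_smul hT]

lemma mem_hull {x : E d} : x ∈ hull T ↔ ∀ a ∈ T, 0 ≤ bary T a x := by
  rw [mem_hull_subset hT subset_rfl]
  exact ⟨fun h => h.1, fun h => ⟨h, fun a ha h' => (h' ha).elim⟩⟩

lemma mem_hull_opp (ha : a ∈ T) {x : E d} :
    x ∈ hull (opp T a) ↔ bary T a x = 0 ∧ ∀ b ∈ T, 0 ≤ bary T b x := by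
  rw [mem_hull_subset hT (opp_subset T a)]
  constructor
  · rintro ⟨h1, h2⟩
    exact ⟨h2 a ha (by simp [mem_opp]), h1⟩
  · rintro ⟨h1, h2⟩
    refine ⟨h2, fun b hb hb' => ?_⟩
    have : b = a := by
      by_contra hne
      exact hb' (mem_opp.2 ⟨hne, hb⟩)
    rw [this, h1]

lemma bary_le_one {x : E d} (hx : x ∈ hull T) (ha : a ∈ T) : bary T a x ≤ 1 := by
  rw [← sum_bary hT x]
  exact Finset.single_le_sum (f := fun a => bary T a x) (fun b hb => (mem_hull hT).1 hx b hb) ha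

end simplex

/-! ### Normals, heights and the divergence theorem on a simplex -/

/-- The distance from the vertex `a` of the simplex `T` to the opposite facet. -/
def height (T : Finset (E d)) (a : E d) : ℝ :=
  ‖(vectorSpan ℝ (opp T a : Set (E d)))ᗮ.starProjection ((opp T a).centroid ℝ id - a)‖

lemma contDiff_bary (T : Finset (E d)) (a : E d) : ContDiff ℝ ∞ (bary T a) :=
  (⟨bary T a, continuous_affineMap _⟩ : E d →ᴬ[ℝ] ℝ).contDiff

lemma fderiv_bary (T : Finset (E d)) (a x v : E d) :
    fderiv ℝ (bary T a) x v = (bary T a).linear v := by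
  have h : (bary T a : E d → ℝ) = fun x => (bary T a).linear.toContinuousLinearMap x + bary T a 0 :=
    (bary T a).decomp
  rw [h, fderiv_add_const, ContinuousLinearMap.fderiv]
  rfl

section simplex

variable {T : Finset (E d)} (hT : IsSimplex T) {a : E d}

include hT

lemma opp_nonempty (hd : 1 ≤ d) (ha : a ∈ T) : (opp T a).Nonempty := by
  classical
  rw [← Finset.card_pos]
  have : (opp T a).card = T.card - 1 := by rw [opp]; convert Finset.card_erase_of_mem ha
  rw [this, hT.card]
  omega

/-- The vector `w` from the vertex `a` perpendicular to the opposite facet represents, up to a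
factor, the linear part of the barycentric coordinate of `a`. -/
lemma inner_heightVector (hd : 1 ≤ d) (ha : a ∈ T) :
    0 < height T a ∧ ∀ v, inner ℝ ((vectorSpan ℝ (opp T a : Set (E d)))ᗮ.starProjection
      ((opp T a).centroid ℝ id - a)) v = -(height T a) ^ 2 * (bary T a).linear v := by
  set V := vectorSpan ℝ (opp T a : Set (E d)) with hV
  set c := (opp T a).centroid ℝ id with hc
  set w := Vᗮ.starProjection (c - a) with hw
  have hh : height T a = ‖w‖ := rfl
  have hcm : c ∈ hull (opp T a) := Finset.centroid_mem_convexHull _ (opp_nonempty hT hd ha)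
  have hwV : ∀ v ∈ V, inner ℝ w v = 0 := fun v hv =>
    Submodule.inner_left_of_mem_orthogonal hv (Submodule.starProjection_apply_mem _ _)
  -- `⟪w, ·⟫` is constant on the facet, so it is determined by two values: the one there and the
  -- one at `a`.
  have hconst : ∀ b ∈ opp T a, ∀ b' ∈ opp T a, inner ℝ w b = inner ℝ w b' := by
    intro b hb b' hb'
    have := hwV _ (vsub_mem_vectorSpan ℝ (s := (opp T a : Set (E d))) hb hb')
    rw [vsub_eq_sub, inner_sub_right] at this
    linarith
  obtain ⟨b₀, hb₀⟩ := opp_nonempty hT hd ha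
  have hform : ∀ x, inner ℝ w x
      = inner ℝ w b₀ + bary T a x * (inner ℝ w a - inner ℝ w b₀) := by
    intro x
    conv_lhs => rw [← sum_bary_smul hT x]
    rw [inner_sum]
    have : ∀ b ∈ T, inner ℝ w (bary T b x • b) = bary T b x * inner ℝ w b₀
        + if b = a then bary T a x * (inner ℝ w a - inner ℝ w b₀) else 0 := by
      intro b hb
      rw [inner_smul_right]
      split_ifs with hba
      · rw [hba]; ring
      · rw [hconst b (mem_opp.2 ⟨hba, hb⟩) b₀ hb₀, add_zero]
    rw [Finset.sum_congr rfl this, Finset.sum_add_distrib, ← Finset.sum_mul, sum_bary hT,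
      Finset.sum_ite_eq' T a, if_pos ha, one_mul]
  have hww : inner ℝ w (c - a) = ‖w‖ ^ 2 := by
    have h1 : c - a - w ∈ V := by
      have := Submodule.sub_starProjection_mem_orthogonal (K := Vᗮ) (c - a)
      rwa [Submodule.orthogonal_orthogonal] at this
    have h2 : c - a = w + (c - a - w) := by abel
    rw [h2, inner_add_right, hwV _ h1, real_inner_self_eq_norm_sq, add_zero]
  have hca : bary T a c = 0 := ((mem_hull_opp hT ha).1 hcm).1
  have hval : inner ℝ w a - inner ℝ w b₀ = -‖w‖ ^ 2 := by
    rw [← hww, inner_sub_right, hform c, hca]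
    ring
  refine ⟨?_, fun v => ?_⟩
  · rw [hh, norm_pos_iff]
    intro h0
    -- If `w = 0` then `a` would lie in the affine hull of the opposite facet, where its
    -- barycentric coordinate vanishes.
    have h1 : c - a ∈ V := by
      have := Submodule.sub_starProjection_mem_orthogonal (K := Vᗮ) (c - a)
      rw [Submodule.orthogonal_orthogonal, ← hw, h0, sub_zero] at this
      exact this
    have hle : V ≤ LinearMap.ker (bary T a).linear := by
      rw [hV, vectorSpan_def, Submodule.span_le]
      rintro _ ⟨b, hb, b', hb', rfl⟩
      have hbb : ∀ e ∈ opp T a, bary T a e = 0 := fun e he =>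
        bary_ne hT ha (mem_opp.1 he).2 (mem_opp.1 he).1.symm
      simp only [SetLike.mem_coe, LinearMap.mem_ker, vsub_eq_sub]
      rw [← affineMap_sub, hbb b hb, hbb b' hb', sub_zero]
    have h2 := LinearMap.mem_ker.1 (hle h1)
    rw [← affineMap_sub, hca, bary_self hT ha] at h2
    norm_num at h2
  · have h1 := hform v
    have h2 := hform 0
    rw [inner_zero_right] at h2
    have h3 : (bary T a).linear v = bary T a v - bary T a 0 := by rw [affineMap_sub, sub_zero]
    rw [hh, h3, h1]
    rw [hval] at h2 ⊢
    linarith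

lemma height_pos (hd : 1 ≤ d) (ha : a ∈ T) : 0 < height T a := (inner_heightVector hT hd ha).1

lemma norm_normal (hd : 1 ≤ d) (ha : a ∈ T) : ‖normal T a‖ = 1 := by
  have h := height_pos hT hd ha
  change ‖(height T a)⁻¹ • _‖ = 1
  rw [norm_smul, norm_inv, Real.norm_of_nonneg h.le]
  exact inv_mul_cancel₀ h.ne'

lemma inner_normal (hd : 1 ≤ d) (ha : a ∈ T) (v : E d) :
    inner ℝ (normal T a) v = -(height T a) * (bary T a).linear v := by
  have h := height_pos hT hd ha
  change inner ℝ ((height T a)⁻¹ • _) v = _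
  rw [real_inner_smul_left, (inner_heightVector hT hd ha).2]
  field_simp

/-- The hyperplane of a facet. -/
lemma exists_hyper_eq (hd : 1 ≤ d) (ha : a ∈ T) :
    ∃ c, hyper (normal T a) c = {y | bary T a y = 0} := by
  have h := height_pos hT hd ha
  refine ⟨height T a * bary T a 0, ?_⟩
  ext y
  simp only [hyper, Set.mem_ofPred_eq]
  have h3 : (bary T a).linear y = bary T a y - bary T a 0 := by rw [affineMap_sub, sub_zero]
  rw [inner_normal hT hd ha, h3]
  constructor
  · intro h'
    have : height T a * bary T a y = 0 := by linarith
    simpa [h.ne'] using this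
  · intro h'
    rw [h']
    ring

lemma surf_hull_opp_lt_top (hd : 1 ≤ d) (ha : a ∈ T) : surf d (hull (opp T a)) < ⊤ := by
  obtain ⟨c, hc⟩ := exists_hyper_eq hT hd ha
  refine surf_lt_top (norm_normal hT hd ha) (c := c) (isCompact_hull _) ?_
  rw [hc]
  exact fun x hx => ((mem_hull_opp hT ha).1 hx).1

lemma memLp_facet (hd : 1 ≤ d) (ha : a ∈ T) {f : E d → ℝ} (hf : Continuous f) :
    MemLp f 2 ((surf d).restrict (hull (opp T a))) :=
  memLp_of_continuous (isCompact_hull _) (surf_hull_opp_lt_top hT hd ha) hf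

lemma integrable_facet (hd : 1 ≤ d) (ha : a ∈ T) {f : E d → ℝ} (hf : Continuous f) :
    IntegrableOn f (hull (opp T a)) (surf d) :=
  have : IsFiniteMeasure ((surf d).restrict (hull (opp T a))) :=
    ⟨by simpa using surf_hull_opp_lt_top hT hd ha⟩
  (memLp_facet hT hd ha hf).integrable (by norm_num)

lemma bary_linear_sub {b : E d} (ha : a ∈ T) (hb : b ∈ T) {e : E d} (he : e ∈ T) :
    (bary T e).linear (a - b) = (if e = a then 1 else 0) - if e = b then 1 else 0 := by
  rw [← affineMap_sub]
  congr 1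
  · split_ifs with h
    · rw [h, bary_self hT ha]
    · exact bary_ne hT he ha h
  · split_ifs with h
    · rw [h, bary_self hT hb]
    · exact bary_ne hT he hb h

/-- Integration by parts in the direction of an edge `a - b`, for a function vanishing on the
facet opposite to `a`. The slices of `T` in this direction are segments joining that facet to the
facet opposite to `b`. -/
lemma integral_fderiv_edge (hd : 1 ≤ d) {b : E d} (ha : a ∈ T) (hb : b ∈ T) (hab : a ≠ b)
    {f : E d → ℝ} (hf : ContDiff ℝ ∞ f) (h0 : ∀ x ∈ hull (opp T a), f x = 0) :
    ∫ x in hull T, fderiv ℝ f x (a - b) = height T b * ∫ y in hull (opp T b), f y ∂(surf d) := by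
  obtain ⟨c, hc⟩ := exists_hyper_eq hT hd hb
  have hn := norm_normal hT hd hb
  have hh := height_pos hT hd hb
  have hin : inner ℝ (normal T b) (a - b) = height T b := by
    rw [inner_normal hT hd hb, bary_linear_sub hT ha hb hb, if_neg hab.symm, if_pos rfl]
    ring
  have hfd : Continuous fun x => fderiv ℝ f x (a - b) :=
    (hf.continuous_fderiv (by simp)).clm_apply continuous_const
  have hint : Integrable ((hull T).indicator fun x => fderiv ℝ f x (a - b)) := by
    rw [integrable_indicator_iff (measurableSet_hull T)]
    exact hfd.continuousOn.integrableOn_compact (isCompact_hull T)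
  rw [← integral_indicator (measurableSet_hull T),
    integral_slice hn c (by rw [hin]; exact hh.ne') hint, hin, abs_of_pos hh]
  congr 1
  have hsub : hull (opp T b) ⊆ hyper (normal T b) c := by
    rw [hc]
    exact fun x hx => ((mem_hull_opp hT hb).1 hx).1
  -- The line through a point `y` of the hyperplane of the facet opposite to `b` meets `T` exactly
  -- for `-λ_a(y) ≤ s ≤ 0` if `y` lies in this facet, and not at all otherwise.
  have key : ∀ y ∈ hyper (normal T b) c,
      ∫ s : ℝ, (hull T).indicator (fun x => fderiv ℝ f x (a - b)) (y + s • (a - b))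
        = (hull (opp T b)).indicator f y := by
    intro y hy
    have hyb : bary T b y = 0 := by rw [hc] at hy; exact hy
    have hcoord : ∀ e ∈ T, ∀ s : ℝ, bary T e (y + s • (a - b)) = bary T e y
        + s * ((if e = a then 1 else 0) - if e = b then 1 else 0) := by
      intro e he s
      rw [affineMap_add, map_smul, bary_linear_sub hT ha hb he, smul_eq_mul]
    have ca : ∀ s : ℝ, bary T a (y + s • (a - b)) = bary T a y + s := fun s => by
      rw [hcoord a ha, if_pos rfl, if_neg hab]; ring
    have cb : ∀ s : ℝ, bary T b (y + s • (a - b)) = -s := fun s => by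
      rw [hcoord b hb, if_pos rfl, if_neg hab.symm, hyb]; ring
    have ce : ∀ e ∈ T, e ≠ a → e ≠ b → ∀ s : ℝ, bary T e (y + s • (a - b)) = bary T e y :=
      fun e he h1 h2 s => by rw [hcoord e he, if_neg h1, if_neg h2]; ring
    by_cases hyo : y ∈ hull (opp T b)
    · rw [Set.indicator_of_mem hyo]
      have hy0 := ((mem_hull_opp hT hb).1 hyo).2
      have hmem : ∀ s : ℝ, y + s • (a - b) ∈ hull T ↔ s ∈ Set.Icc (-bary T a y) 0 := by
        intro s
        rw [mem_hull hT]
        constructor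
        · intro h
          have h1 := h a ha
          have h2 := h b hb
          rw [ca] at h1
          rw [cb] at h2
          constructor <;> linarith
        · rintro ⟨h1, h2⟩ e he
          by_cases hea : e = a
          · rw [hea, ca]; linarith
          by_cases heb : e = b
          · rw [heb, cb]; linarith
          rw [ce e he hea heb]
          exact hy0 e he
      have e1 : (fun s : ℝ => (hull T).indicator (fun x => fderiv ℝ f x (a - b)) (y + s • (a - b)))
          = (Set.Icc (-bary T a y) 0).indicator
            fun s => fderiv ℝ f (y + s • (a - b)) (a - b) := by
        ext s
        by_cases hs : y + s • (a - b) ∈ hull T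
        · rw [Set.indicator_of_mem hs, Set.indicator_of_mem ((hmem s).1 hs)]
        · rw [Set.indicator_of_notMem hs, Set.indicator_of_notMem fun h => hs ((hmem s).2 h)]
      have hle : -bary T a y ≤ 0 := by linarith [hy0 a ha]
      have hder : ∀ s ∈ Set.uIcc (-bary T a y) 0, HasDerivAt (fun s : ℝ => f (y + s • (a - b)))
          (fderiv ℝ f (y + s • (a - b)) (a - b)) s := by
        intro s _
        have h1 : HasDerivAt (fun s : ℝ => y + s • (a - b)) (a - b) s := by
          simpa using ((hasDerivAt_id s).smul_const (a - b)).const_add y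
        exact (differentiable_of_smooth hf _).hasFDerivAt.comp_hasDerivAt s h1
      -- The fundamental theorem of calculus; the value at the end point on the facet opposite to
      -- `a` is zero.
      rw [e1, integral_indicator measurableSet_Icc, integral_Icc_eq_integral_Ioc,
        ← intervalIntegral.integral_of_le hle,
        intervalIntegral.integral_eq_sub_of_hasDerivAt hder
          (Continuous.intervalIntegrable (hfd.comp (by fun_prop)) _ _)]
      have hz : f (y + (-bary T a y) • (a - b)) = 0 := by
        refine h0 _ ((mem_hull_opp hT ha).2 ⟨by rw [ca]; ring, ?_⟩)
        exact (mem_hull hT).1 ((hmem _).2 ⟨le_rfl, hle⟩)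
      rw [hz]
      simp
    · rw [Set.indicator_of_notMem hyo]
      have hnm : ∀ s : ℝ, y + s • (a - b) ∉ hull T := by
        intro s hs
        rw [mem_hull hT] at hs
        refine hyo ((mem_hull_opp hT hb).2 ⟨hyb, fun e he => ?_⟩)
        have h1 := hs a ha
        have h2 := hs b hb
        rw [ca] at h1
        rw [cb] at h2
        by_cases hea : e = a
        · rw [hea]; linarith
        by_cases heb : e = b
        · rw [heb, hyb]
        · rw [← ce e he hea heb s]
          exact hs e he
      simp [Set.indicator_of_notMem (hnm _)]
  rw [setIntegral_congr_fun (measurableSet_hyper _ _) key,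
    setIntegral_indicator (measurableSet_hull _), Set.inter_eq_right.2 hsub]

/-- The cone formula: a facet integral in terms of a volume integral. -/
lemma height_mul_integral (hd : 1 ≤ d) (ha : a ∈ T) {g : E d → ℝ} (hg : ContDiff ℝ ∞ g) :
    height T a * ∫ y in hull (opp T a), g y ∂(surf d)
      = ∫ x in hull T, (d * g x + fderiv ℝ g x (x - a)) := by
  have hfd : ∀ v : E d, Continuous fun x => fderiv ℝ g x v := fun v =>
    (hg.continuous_fderiv (by simp)).clm_apply continuous_const
  -- Apply the edge formula to `λ_b g`, which vanishes on the facet opposite to `b`; the sum over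
  -- `b` gives the claim because `∑ λ_b = 1` on the facet opposite to `a`.
  have h1 : ∀ b ∈ opp T a, height T a * ∫ y in hull (opp T a), bary T b y * g y ∂(surf d)
      = ∫ x in hull T, (g x + bary T b x * fderiv ℝ g x (b - a)) := by
    intro b hb
    obtain ⟨hba, hb⟩ := mem_opp.1 hb
    rw [← integral_fderiv_edge hT hd hb ha hba ((contDiff_bary T b).mul hg)
      fun x hx => by rw [((mem_hull_opp hT hb).1 hx).1, zero_mul]]
    congr 1
    ext x
    rw [fderiv_fun_mul (differentiable_of_smooth (contDiff_bary T b) x)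
      (differentiable_of_smooth hg x)]
    simp only [add_apply, smul_apply, smul_eq_mul]
    rw [fderiv_bary, bary_linear_sub hT hb ha hb, if_pos rfl, if_neg hba]
    ring
  have hs1 : ∀ x, bary T a x = 0 → ∑ b ∈ opp T a, bary T b x = 1 := by
    intro x hx
    rw [← sum_bary hT x]
    refine Finset.sum_subset (opp_subset T a) fun b hb hb' => ?_
    have : b = a := by by_contra hne; exact hb' (mem_opp.2 ⟨hne, hb⟩)
    rw [this, hx]
  have e1 : ∫ y in hull (opp T a), g y ∂(surf d)
      = ∑ b ∈ opp T a, ∫ y in hull (opp T a), bary T b y * g y ∂(surf d) := by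
    rw [← integral_finsetSum]
    swap
    · exact fun b _ => integrable_facet hT hd ha ((continuous_affineMap _).mul hg.continuous)
    refine setIntegral_congr_fun (measurableSet_hull _) fun y hy => ?_
    simp only [← Finset.sum_mul]
    rw [hs1 y ((mem_hull_opp hT ha).1 hy).1, one_mul]
  rw [e1, Finset.mul_sum, Finset.sum_congr rfl h1, ← integral_finsetSum]
  swap
  · exact fun b _ => (hg.continuous.add
      ((continuous_affineMap _).mul (hfd _))).continuousOn.integrableOn_compact (isCompact_hull T)
  congr 1
  ext x
  have hcard : (opp T a).card = d := by
    classical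
    have : (opp T a).card = T.card - 1 := by rw [opp]; convert Finset.card_erase_of_mem ha
    rw [this, hT.card, Nat.add_sub_cancel]
  rw [Finset.sum_add_distrib, Finset.sum_const, hcard, nsmul_eq_mul]
  congr 1
  have hx : x - a = ∑ b ∈ opp T a, bary T b x • (b - a) := by
    have h2 : ∑ b ∈ opp T a, bary T b x • (b - a) = ∑ b ∈ T, bary T b x • (b - a) := by
      refine Finset.sum_subset (opp_subset T a) fun b hb hb' => ?_
      have : b = a := by by_contra hne; exact hb' (mem_opp.2 ⟨hne, hb⟩)
      rw [this, sub_self, smul_zero]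
    rw [h2]
    simp only [smul_sub, Finset.sum_sub_distrib, ← Finset.sum_smul]
    rw [sum_bary_smul hT, sum_bary hT, one_smul]
  rw [hx, map_sum]
  exact Finset.sum_congr rfl fun b _ => by rw [map_smul, smul_eq_mul]

/-- The divergence theorem on a simplex: the cone formulas combined with the weights `∂_v λ_a`,
using `∑ ∂_v λ_a = 0` and `∑ (∂_v λ_a) a = v`. -/
lemma integral_fderiv (hd : 1 ≤ d) {g : E d → ℝ} (hg : ContDiff ℝ ∞ g) (v : E d) :
    ∫ x in hull T, fderiv ℝ g x v
      = ∑ a ∈ T, inner ℝ (normal T a) v * ∫ y in hull (opp T a), g y ∂(surf d) := by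
  have hfd : ∀ w : E d → E d, Continuous w → Continuous fun x => fderiv ℝ g x (w x) := fun w hw =>
    (hg.continuous_fderiv (by simp)).clm_apply hw
  have h1 : ∀ a ∈ T, inner ℝ (normal T a) v * ∫ y in hull (opp T a), g y ∂(surf d)
      = ∫ x in hull T, -(bary T a).linear v * (d * g x + fderiv ℝ g x (x - a)) := by
    intro a ha
    rw [inner_normal hT hd ha, integral_const_mul, ← height_mul_integral hT hd ha hg]
    ring
  rw [Finset.sum_congr rfl h1, ← integral_finsetSum]
  swap
  · exact fun a _ => (continuous_const.mul ((continuous_const.mul hg.continuous).add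
      (hfd _ (by fun_prop)))).continuousOn.integrableOn_compact (isCompact_hull T)
  congr 1
  ext x
  simp only [map_sub]
  have h2 : ∀ a ∈ T, -(bary T a).linear v * (d * g x + (fderiv ℝ g x x - fderiv ℝ g x a))
      = -((bary T a).linear v * (d * g x + fderiv ℝ g x x))
        + fderiv ℝ g x ((bary T a).linear v • a) := by
    intro a _
    rw [map_smul, smul_eq_mul]
    ring
  rw [Finset.sum_congr rfl h2, Finset.sum_add_distrib, Finset.sum_neg_distrib, ← Finset.sum_mul,
    sum_bary_linear hT, ← map_sum, sum_bary_linear_smul hT]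
  ring

end simplex

/-! ### Shape regular simplices: integration by parts, trace and inverse inequalities -/

/-- The simplex `T` is nondegenerate and contains a ball of radius `h_T / γ`. -/
structure IsRegular (γ : ℝ) (T : Finset (E d)) : Prop where
  simplex : IsSimplex T
  ball : ∃ c : E d, Metric.closedBall c (diam T / γ) ⊆ hull T

lemma subset_closedBall {T : Finset (E d)} {x : E d} (hx : x ∈ hull T) :
    hull T ⊆ Metric.closedBall x (diam T) := fun _ hy =>
  Metric.dist_le_diam_of_mem (isCompact_hull T).isBounded hy hx

lemma memLp_hull (T : Finset (E d)) {f : E d → ℝ} (hf : Continuous f) :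
    MemLp f 2 (volume.restrict (hull T)) := memLp_volume (isCompact_hull T) hf

lemma integrable_hull (T : Finset (E d)) {f : E d → ℝ} (hf : Continuous f) :
    IntegrableOn f (hull T) := hf.continuousOn.integrableOn_compact (isCompact_hull T)

lemma continuous_pd {f : E d → ℝ} (hf : ContDiff ℝ ∞ f) (i : Fin d) : Continuous (pd i f) :=
  (contDiff_pd hf i).continuous

/-- Integration by parts on a simplex. -/
lemma integral_pd_mul_add {T : Finset (E d)} (hT : IsSimplex T) (hd : 1 ≤ d) {f g : E d → ℝ}
    (hf : ContDiff ℝ ∞ f) (hg : ContDiff ℝ ∞ g) (j : Fin d) :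
    ∫ x in hull T, pd j f x * g x = -(∫ x in hull T, f x * pd j g x)
      + ∑ a ∈ T, ∫ y in hull (opp T a), f y * g y * normal T a j ∂(surf d) := by
  have h1 : ∫ x in hull T, pd j (fun y => f y * g y) x
      = ∑ a ∈ T, ∫ y in hull (opp T a), f y * g y * normal T a j ∂(surf d) := by
    have := integral_fderiv hT hd (hf.mul hg) (EuclideanSpace.single j 1)
    unfold pd
    rw [this]
    refine Finset.sum_congr rfl fun a _ => ?_
    rw [integral_mul_const, EuclideanSpace.inner_single_right]
    simp [mul_comm]
  simp only [pd_mul hf hg] at h1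
  have hi1 : IntegrableOn (fun x => pd j f x * g x) (hull T) :=
    integrable_hull T ((continuous_pd hf j).mul hg.continuous)
  have hi2 : IntegrableOn (fun x => f x * pd j g x) (hull T) :=
    integrable_hull T (hf.continuous.mul (continuous_pd hg j))
  rw [integral_add hi1 hi2] at h1
  rw [← h1]
  ring

section regular

variable {γ : ℝ} {T : Finset (E d)}

lemma diam_pos (hT : IsSimplex T) (hd : 1 ≤ d) : 0 < diam T := by
  obtain ⟨a, ha, b, hb, hab⟩ := Finset.one_lt_card.1 (by rw [hT.card]; omega : 1 < T.card)
  exact (dist_pos.2 hab).trans_le (Metric.dist_le_diam_of_mem (isCompact_hull T).isBounded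
    (mem_hull_of_mem ha) (mem_hull_of_mem hb))

lemma abs_normal_le (hT : IsSimplex T) (hd : 1 ≤ d) {a : E d} (ha : a ∈ T) (j : Fin d) :
    |normal T a j| ≤ 1 := by
  rw [← norm_normal hT hd ha]
  exact PiLp.norm_apply_le (normal T a) j

lemma bary_linear_normal (hT : IsSimplex T) (hd : 1 ≤ d) {a : E d} (ha : a ∈ T) :
    (bary T a).linear (normal T a) = -(height T a)⁻¹ := by
  have h := inner_normal hT hd ha (normal T a)
  rw [real_inner_self_eq_norm_sq, norm_normal hT hd ha] at h
  have := height_pos hT hd ha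
  field_simp
  linarith

/-- The centre of a ball contained in a simplex is at least one radius away from each facet. -/
lemma radius_le_height_mul (hT : IsSimplex T) (hd : 1 ≤ d) {a : E d} (ha : a ∈ T) {c : E d} {ρ : ℝ}
    (hρ : 0 ≤ ρ) (hc : Metric.closedBall c ρ ⊆ hull T) : ρ ≤ height T a * bary T a c := by
  have h1 : c + ρ • normal T a ∈ hull T := hc (by
    simp [norm_smul, norm_normal hT hd ha, abs_of_nonneg hρ])
  have h2 := (mem_hull hT).1 h1 a ha
  rw [affineMap_add, map_smul, bary_linear_normal hT hd ha, smul_eq_mul] at h2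
  have := height_pos hT hd ha
  have h3 := mul_nonneg this.le h2
  have h4 : height T a * (bary T a c + ρ * -(height T a)⁻¹) = height T a * bary T a c - ρ := by
    field_simp
    ring
  linarith

lemma interior_hull_nonempty (hγ : 0 < γ) (hd : 1 ≤ d) (hT : IsRegular γ T) :
    (interior (hull T)).Nonempty := by
  obtain ⟨c, hc⟩ := hT.ball
  have := diam_pos hT.simplex hd
  exact ⟨c, interior_mono hc (Metric.ball_subset_interior_closedBall
    (Metric.mem_ball_self (by positivity)))⟩

lemma diam_div_le_height (hγ : 0 < γ) (hd : 1 ≤ d) (hT : IsRegular γ T) {a : E d} (ha : a ∈ T) :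
    diam T / γ ≤ height T a := by
  obtain ⟨c, hc⟩ := hT.ball
  have hp := diam_pos hT.simplex hd
  have h1 := radius_le_height_mul hT.simplex hd ha (by positivity) hc
  have h2 := height_pos hT.simplex hd ha
  have h3 := bary_le_one hT.simplex (hc (Metric.mem_closedBall_self (by positivity))) ha
  nlinarith

/-- The trace inequality on a shape regular simplex, obtained from the cone formula applied to
`g²`. -/
lemma nm_facet_sq_le (hγ : 0 < γ) (hd : 1 ≤ d) (hT : IsRegular γ T) {a : E d} (ha : a ∈ T)
    {g : E d → ℝ} (hg : ContDiff ℝ ∞ g) :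
    nm ((surf d).restrict (hull (opp T a))) g ^ 2 ≤ γ * (2 * d * (diam T)⁻¹ *
      nm (volume.restrict (hull T)) g ^ 2 +
        diam T * ∑ j, nm (volume.restrict (hull T)) (pd j g) ^ 2) := by
  have hp := diam_pos hT.simplex hd
  have hh := diam_div_le_height hγ hd hT ha
  have h1 := height_mul_integral hT.simplex hd ha (hg.pow 2)
  have hpt : ∀ x ∈ hull T, d * g x ^ 2 + fderiv ℝ (fun y => g y ^ 2) x (x - a)
      ≤ 2 * d * g x ^ 2 + diam T ^ 2 * ∑ j, pd j g x ^ 2 := by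
    intro x hx
    have e1 : fderiv ℝ (fun y => g y ^ 2) x (x - a) = ∑ j, 2 * g x * ((x - a) j * pd j g x) := by
      rw [fderiv_fun_pow 2 (differentiable_of_smooth hg x), ← Finset.mul_sum, ← fderiv_eq_sum_pd]
      simp
    -- By Young's inequality, as `|x - a| ≤ h_T`.
    have e2 : ∀ j, 2 * g x * ((x - a) j * pd j g x) ≤ g x ^ 2 + diam T ^ 2 * pd j g x ^ 2 := by
      intro j
      have h3 : |(x - a) j| ≤ diam T := (PiLp.norm_apply_le (x - a) j).trans (by
        rw [← dist_eq_norm]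
        exact subset_closedBall (mem_hull_of_mem ha) hx)
      have h4 : ((x - a) j) ^ 2 ≤ diam T ^ 2 := sq_le_sq.2 (by rwa [abs_of_pos hp])
      nlinarith [sq_nonneg (g x - (x - a) j * pd j g x),
        mul_le_mul_of_nonneg_right h4 (sq_nonneg (pd j g x))]
    have e3 := Finset.sum_le_sum fun j (_ : j ∈ Finset.univ) => e2 j
    rw [Finset.sum_add_distrib, Finset.sum_const, Finset.card_univ, Fintype.card_fin, nsmul_eq_mul,
      ← Finset.mul_sum (s := Finset.univ) (f := fun j => pd j g x ^ 2)] at e3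
    rw [e1]
    linarith
  have hcg := hg.continuous
  have hcp := fun j => continuous_pd hg j
  have hc2 : Continuous fun x => fderiv ℝ (fun y => g y ^ 2) x (x - a) :=
    ((hg.pow 2).continuous_fderiv (by simp)).clm_apply (by fun_prop)
  have h2 := setIntegral_mono_on (integrable_hull T (by fun_prop)) (integrable_hull T (by fun_prop))
    (measurableSet_hull T) hpt
  rw [← h1, integral_add (integrable_hull T (by fun_prop)) (integrable_hull T (by fun_prop)),
    integral_const_mul, integral_const_mul,
    integral_finsetSum _ fun j _ => integrable_hull T (by fun_prop)] at h2
  simp only [nm_sq]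
  set I := ∫ y in hull (opp T a), g y ^ 2 ∂(surf d)
  have hI : 0 ≤ I := integral_nonneg fun _ => sq_nonneg _
  have h3 : diam T / γ * I ≤ 2 * d * (∫ x in hull T, g x ^ 2) +
      diam T ^ 2 * ∑ j, ∫ x in hull T, pd j g x ^ 2 := by
    have := mul_le_mul_of_nonneg_right hh hI
    linarith
  have h4 := mul_le_mul_of_nonneg_left h3 (by positivity : 0 ≤ γ * (diam T)⁻¹)
  have e5 : γ * (diam T)⁻¹ * (diam T / γ * I) = I := by field_simp
  rw [e5] at h4
  refine h4.trans (le_of_eq ?_)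
  field_simp

/-- Inverse and discrete trace inequalities for polynomials on shape regular simplices. -/
lemma exists_inverse (hd : 1 ≤ d) (k : ℕ) (hγ : 0 < γ) :
    ∃ C : ℝ, 0 < C ∧ ∀ T : Finset (E d), IsRegular γ T → ∀ p ∈ P d k,
      (∀ i, nm (volume.restrict (hull T)) (ev (MvPolynomial.pderiv i p))
        ≤ C * (diam T)⁻¹ * nm (volume.restrict (hull T)) (ev p)) ∧
      ∀ a ∈ T, nm ((surf d).restrict (hull (opp T a))) (ev p) ^ 2
        ≤ C * (diam T)⁻¹ * nm (volume.restrict (hull T)) (ev p) ^ 2 := by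
  obtain ⟨C, hC, h⟩ := exists_ball_inverse (d := d) k hγ
  refine ⟨C + γ * (2 * d + d * C ^ 2), by positivity, fun T hT p hp => ?_⟩
  have hh := diam_pos hT.simplex hd
  obtain ⟨c, hc⟩ := hT.ball
  have hcT : c ∈ hull T := hc (Metric.mem_closedBall_self (by positivity))
  have hn := nm_nonneg (μ := volume.restrict (hull T)) (f := ev p)
  have h1 : ∀ i, nm (volume.restrict (hull T)) (ev (MvPolynomial.pderiv i p))
      ≤ C * (diam T)⁻¹ * nm (volume.restrict (hull T)) (ev p) := by
    intro i
    -- Compare `T` with the concentric balls of radius `h_T`, which contains it, and `h_T / γ`,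
    -- which it contains.
    refine (nm_mono_set (subset_closedBall hcT)
      (memLp_volume (isCompact_closedBall _ _) (continuous_ev _))).trans ?_
    refine ((h p hp c _ hh).2 i).trans ?_
    gcongr
    exact nm_mono_set hc (memLp_hull T (continuous_ev p))
  refine ⟨fun i => (h1 i).trans ?_, fun a ha => ?_⟩
  · gcongr
    have : 0 ≤ γ * (2 * d + d * C ^ 2) := by positivity
    linarith
  · refine (nm_facet_sq_le hγ hd hT ha (contDiff_ev p)).trans ?_
    have h2 : ∑ j, nm (volume.restrict (hull T)) (pd j (ev p)) ^ 2
        ≤ ∑ _j : Fin d, (C * (diam T)⁻¹ * nm (volume.restrict (hull T)) (ev p)) ^ 2 := by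
      refine Finset.sum_le_sum fun j _ => ?_
      rw [pd_ev]
      exact pow_le_pow_left₀ nm_nonneg (h1 j) 2
    rw [Finset.sum_const, Finset.card_univ, Fintype.card_fin, nsmul_eq_mul] at h2
    set N := nm (volume.restrict (hull T)) (ev p)
    calc _ ≤ γ * (2 * d * (diam T)⁻¹ * N ^ 2 + diam T * (d * (C * (diam T)⁻¹ * N) ^ 2)) := by
          gcongr
      _ = γ * (2 * d + d * C ^ 2) * (diam T)⁻¹ * N ^ 2 := by
          field_simp
      _ ≤ _ := by
          gcongr
          linarith

end regular

/-! ### Raviart–Thomas polynomials on shape regular simplices -/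

open MvPolynomial in
/-- The divergence of a polynomial vector field. -/
def pdiv (r : Fin d → Poly d) : Poly d := ∑ i, pderiv i (r i)

section algebra

open MvPolynomial

/-- By Euler's identity, `x · ∇q - k q` loses the top degree part of `q`. -/
lemma euler_sub_mem_P {k : ℕ} (hk : 1 ≤ k) {q : Poly d} (hq : q ∈ P d k) :
    ∑ i, X i * pderiv i q - (k : ℝ) • q ∈ P d (k - 1) := by
  refine P_induction (motive := fun q => ∑ i, X i * pderiv i q - (k : ℝ) • q ∈ P d (k - 1))
    (by simp) (fun p q hp hq => ?_) (fun m a hm => ?_) hq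
  · have : ∑ i, X i * pderiv i (p + q) - (k : ℝ) • (p + q)
        = (∑ i, X i * pderiv i p - (k : ℝ) • p) + (∑ i, X i * pderiv i q - (k : ℝ) • q) := by
      simp only [map_add, mul_add, Finset.sum_add_distrib, smul_add]
      abel
    rw [this]
    exact add_mem hp hq
  · have h := (isHomogeneous_monomial (σ := Fin d) a (rfl : m.degree = m.degree)).sum_X_mul_pderiv
    rw [h, ← Nat.cast_smul_eq_nsmul ℝ, ← sub_smul]
    rcases eq_or_lt_of_le hm with h1 | h1
    · rw [h1, sub_self, zero_smul]
      exact zero_mem _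
    · refine Submodule.smul_mem _ _ (mem_P.2 ((totalDegree_monomial_le _ _).trans ?_))
      change m.degree ≤ k - 1
      omega

lemma X_mul_pderiv_mem {k : ℕ} (hk : 1 ≤ k) {q : Poly d} (hq : q ∈ P d k) (i : Fin d) :
    X i * pderiv i q ∈ P d k := by
  have := mul_mem_P (X_mem_P i) (pderiv_mem_P hq i)
  rwa [Nat.add_sub_cancel' hk] at this

lemma pdiv_rt (p : Fin d → Poly d) (q : Poly d) :
    pdiv (fun i => p i + X i * q) = pdiv p + ((d : ℝ) • q + ∑ i, X i * pderiv i q) := by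
  have h : ∀ i : Fin d, pderiv i (p i + X i * q) = pderiv i (p i) + (q + X i * pderiv i q) := by
    intro i
    rw [map_add, Derivation.leibniz, pderiv_X_self]
    simp only [smul_eq_mul, mul_one]
    ring
  simp only [pdiv, h, Finset.sum_add_distrib, Finset.sum_const, Finset.card_univ, Fintype.card_fin]
  rw [← Nat.cast_smul_eq_nsmul ℝ]

lemma pdiv_mem_P {k : ℕ} {p : Fin d → Poly d} (hp : ∀ i, p i ∈ P d k) : pdiv p ∈ P d (k - 1) :=
  sum_mem fun i _ => pderiv_mem_P (hp i) i

lemma pdiv_mem_of_inRT {k : ℕ} (hk : 1 ≤ k) {r : Fin d → Poly d} (hr : InRT k r) :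
    pdiv r ∈ P d k := by
  obtain ⟨p, q, hp, hq, hr⟩ := hr
  rw [funext hr, pdiv_rt]
  exact add_mem (P_mono (Nat.sub_le _ _) (pdiv_mem_P hp)) (add_mem (Submodule.smul_mem _ _ hq)
    (sum_mem fun i _ => X_mul_pderiv_mem hk hq i))

/-- Removing `(x - c) (∇·r) / (d + k)` from a Raviart–Thomas field leaves a field of degree `k`. -/
lemma sub_mul_pdiv_mem_P {k : ℕ} (hk : 1 ≤ k) {r : Fin d → Poly d} (hr : InRT k r) (c : E d)
    (i : Fin d) : r i - (X i - C (c i)) * ((d + k : ℝ)⁻¹ • pdiv r) ∈ P d k := by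
  have ht := pdiv_mem_of_inRT hk hr
  obtain ⟨p, q, hp, hq, hr⟩ := hr
  set t := pdiv r with htd
  -- The divergence of `p + x q` is `(d + k) q` up to terms of degree `k - 1`, by Euler's identity.
  have h1 : t - (d + k : ℝ) • q ∈ P d (k - 1) := by
    have : t - (d + k : ℝ) • q = pdiv p + (∑ i, X i * pderiv i q - (k : ℝ) • q) := by
      rw [htd, funext hr, pdiv_rt, add_smul]
      abel
    rw [this]
    exact add_mem (pdiv_mem_P hp) (euler_sub_mem_P hk hq)
  have hdk : (d + k : ℝ) ≠ 0 := by positivity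
  have h2 : r i - (X i - C (c i)) * ((d + k : ℝ)⁻¹ • t)
      = p i - X i * ((d + k : ℝ)⁻¹ • (t - (d + k : ℝ) • q))
        + (c i) • ((d + k : ℝ)⁻¹ • t) := by
    rw [hr i, smul_sub, smul_smul _ _ q, inv_mul_cancel₀ hdk, one_smul, ← C_mul' (a := c i)]
    ring
  rw [h2]
  refine add_mem (sub_mem (hp i) ?_) (Submodule.smul_mem _ _ (Submodule.smul_mem _ _ ht))
  have := mul_mem_P (X_mem_P i) (Submodule.smul_mem _ (d + k : ℝ)⁻¹ h1)
  rwa [Nat.add_sub_cancel' hk] at this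

/-- An affine function as a polynomial. -/
def affPoly (f : E d →ᵃ[ℝ] ℝ) : Poly d :=
  C (f 0) + ∑ i, f.linear (EuclideanSpace.single i 1) • X i

lemma affPoly_mem (f : E d →ᵃ[ℝ] ℝ) : affPoly f ∈ P d 1 :=
  add_mem (C_mem_P 1 _) (sum_mem fun i _ => Submodule.smul_mem _ _ (X_mem_P i))

lemma ev_affPoly (f : E d →ᵃ[ℝ] ℝ) (x : E d) : ev (affPoly f) x = f x := by
  have hx : x = ∑ i, x i • EuclideanSpace.single i (1 : ℝ) := by
    ext j
    simp [Finset.sum_apply, Pi.single_apply]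
  have h : f x = f.linear x + f 0 := congrFun f.decomp x
  rw [h]
  conv_rhs => rw [hx]
  simp [affPoly, map_sum, mul_comm, add_comm]

/-- The polynomial `x ↦ q (x + ℓ(x) n)`. If `ℓ` is the distance to a hyperplane with normal `n`,
this is the composition of `q` with the orthogonal projection to the hyperplane. -/
def slide (ℓ : Poly d) (n : E d) (q : Poly d) : Poly d := bind₁ (fun i => X i + n i • ℓ) q

lemma slide_mem_P {k : ℕ} {ℓ : Poly d} (hℓ : ℓ ∈ P d 1) (n : E d) {q : Poly d} (hq : q ∈ P d k) :
    slide ℓ n q ∈ P d k :=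
  bind_mem_P (fun i => add_mem (X_mem_P i) (Submodule.smul_mem _ _ hℓ)) hq

lemma ev_slide (ℓ : Poly d) (n : E d) (q : Poly d) (x : E d) :
    ev (slide ℓ n q) x = ev q (x + ev ℓ x • n) := by
  rw [slide, ev_bind]
  congr 1
  ext i
  simp [mul_comm]

/-- A polynomial differs from its value on a hyperplane by a multiple of the equation of the
hyperplane. -/
lemma exists_sub_slide {k : ℕ} {ℓ : Poly d} (hℓ : ℓ ∈ P d 1) (n : E d) {q : Poly d}
    (hq : q ∈ P d k) : ∃ z ∈ P d (k - 1), q - slide ℓ n q = ℓ * z := by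
  have key : ∀ (N : ℕ) (m : Fin d →₀ ℕ), m.degree = N → ∃ z ∈ P d (N - 1), (N = 0 → z = 0) ∧
      monomial m 1 - slide ℓ n (monomial m 1) = ℓ * z := by
    intro N
    induction N with
    | zero =>
      intro m hm
      rw [Finsupp.degree_eq_zero_iff] at hm
      refine ⟨0, zero_mem _, fun _ => rfl, ?_⟩
      rw [hm]
      simp [slide]
    | succ N ih =>
      intro m hm
      obtain ⟨i, hi⟩ : ∃ i, m i ≠ 0 := by
        by_contra! h
        have : m = 0 := by ext i; simp [h i]
        simp [this] at hm
      have hle : Finsupp.single i 1 ≤ m := by rw [Finsupp.single_le_iff]; omega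
      set m' := m - Finsupp.single i 1 with hm'
      have hmm : m = m' + Finsupp.single i 1 := (tsub_add_cancel_of_le hle).symm
      have hdeg : m'.degree = N := by
        rw [hmm, map_add, Finsupp.degree_single] at hm
        omega
      obtain ⟨z, hz, hz0, hzeq⟩ := ih m' hdeg
      have hmon : (monomial m (1 : ℝ) : Poly d) = monomial m' 1 * X i := by
        rw [hmm, X, monomial_mul, one_mul]
      have hsl : slide ℓ n (monomial m 1 : Poly d)
          = slide ℓ n (monomial m' 1) * (X i + n i • ℓ) := by
        rw [hmon, slide, map_mul, bind₁_X_right]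
        rfl
      have hm'P : (monomial m' (1 : ℝ) : Poly d) ∈ P d N :=
        mem_P.2 ((totalDegree_monomial_le _ _).trans hdeg.le)
      refine ⟨z * X i - n i • slide ℓ n (monomial m' 1), sub_mem ?_ (Submodule.smul_mem _ _
        (slide_mem_P hℓ n hm'P)), by omega, ?_⟩
      · rcases Nat.eq_zero_or_pos N with h0 | h0
        · rw [hz0 h0, zero_mul]
          exact zero_mem _
        · have := mul_mem_P hz (X_mem_P i)
          rwa [Nat.sub_add_cancel h0] at this
      · rw [hsl, hmon, mul_sub, ← mul_assoc, ← hzeq, ← C_mul', ← C_mul']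
        ring
  refine P_induction (motive := fun q => ∃ z ∈ P d (k - 1), q - slide ℓ n q = ℓ * z)
    ⟨0, zero_mem _, by simp [slide]⟩ ?_ (fun m a hm => ?_) hq
  · rintro p q ⟨z, hz, h⟩ ⟨z', hz', h'⟩
    refine ⟨z + z', add_mem hz hz', ?_⟩
    rw [mul_add, ← h, ← h', slide, map_add]
    unfold slide
    ring
  · obtain ⟨z, hz, -, h⟩ := key _ m rfl
    refine ⟨a • z, Submodule.smul_mem _ _ (P_mono (by omega) hz), ?_⟩
    have h2 : (monomial m a : Poly d) = a • monomial m 1 := by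
      rw [smul_monomial, smul_eq_mul, mul_one]
    rw [mul_smul_comm, ← h, h2, slide, map_smul, smul_sub]
    rfl

end algebra

section facet

variable {γ : ℝ} {T : Finset (E d)}

lemma height_le_diam (hT : IsSimplex T) (hd : 1 ≤ d) {a : E d} (ha : a ∈ T) :
    height T a ≤ diam T := by
  obtain ⟨b, hb⟩ := opp_nonempty hT hd ha
  obtain ⟨hba, hb⟩ := mem_opp.1 hb
  have h := inner_normal hT hd ha (b - a)
  rw [bary_linear_sub hT hb ha ha, if_neg hba.symm, if_pos rfl] at h
  have h2 := real_inner_le_norm (normal T a) (b - a)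
  rw [norm_normal hT hd ha, one_mul, ← dist_eq_norm] at h2
  have h3 := subset_closedBall (mem_hull_of_mem ha) (mem_hull_of_mem hb)
  rw [Metric.mem_closedBall] at h3
  linarith

lemma bary_normal_slide (hT : IsSimplex T) (hd : 1 ≤ d) {a : E d} (ha : a ∈ T) (x : E d) (s : ℝ) :
    bary T a (x + s • normal T a) = bary T a x - s * (height T a)⁻¹ := by
  rw [affineMap_add, map_smul, bary_linear_normal hT hd ha, smul_eq_mul]
  ring

/-- Projecting a ball inside `T` from the vertex `a` gives a ball of the same radius in the
opposite facet. -/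
lemma exists_facet_ball (hT : IsSimplex T) (hd : 1 ≤ d) {a : E d} (ha : a ∈ T) {c : E d} {ρ : ℝ}
    (hρ : 0 < ρ) (hc : Metric.closedBall c ρ ⊆ hull T) :
    ∃ c' ∈ hull (opp T a), ∀ y ∈ Metric.closedBall c' ρ, bary T a y = 0 → y ∈ hull (opp T a) := by
  have hh := height_pos hT hd ha
  have h1 : c - ρ • normal T a ∈ hull T := hc (by
    simp [norm_smul, norm_normal hT hd ha, abs_of_nonneg hρ.le])
  have h2 := bary_le_one hT h1 ha
  rw [sub_eq_add_neg, ← neg_smul, bary_normal_slide hT hd ha] at h2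
  set s := 1 - bary T a c with hs
  have hs0 : 0 < s := by
    have : 0 < ρ * (height T a)⁻¹ := by positivity
    linarith
  have hs1 : s ≤ 1 := by
    have := (mem_hull hT).1 (hc (Metric.mem_closedBall_self hρ.le)) a ha
    linarith
  -- The homothety with centre `a` and ratio `s = 1 - λ_a(c)` maps the facet onto the slice of `T`
  -- through `c`; its inverse enlarges the ball.
  have key : ∀ y z : E d, bary T a y = 0 → z = a + s • (y - a) → z ∈ hull T →
      y ∈ hull (opp T a) := by
    intro y z hy hz hzT
    refine (mem_hull_opp hT ha).2 ⟨hy, fun b hb => ?_⟩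
    by_cases hba : b = a
    · rw [hba, hy]
    have h3 := (mem_hull hT).1 hzT b hb
    rw [hz, affineMap_add, map_smul, ← affineMap_sub, bary_ne hT hb ha hba, sub_zero, zero_add,
      smul_eq_mul] at h3
    exact nonneg_of_mul_nonneg_right h3 hs0
  set c' := a + s⁻¹ • (c - a) with hc'
  have hcc : c = a + s • (c' - a) := by
    rw [hc', add_sub_cancel_left, smul_smul, mul_inv_cancel₀ hs0.ne', one_smul, add_sub_cancel]
  have hc0 : bary T a c' = 0 := by
    rw [hc', affineMap_add, map_smul, ← affineMap_sub, bary_self hT ha, smul_eq_mul]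
    have : bary T a c - 1 = -s := by rw [hs]; ring
    rw [this]
    field_simp
    ring
  refine ⟨c', key c' c hc0 hcc (hc (Metric.mem_closedBall_self hρ.le)), fun y hy hy0 => ?_⟩
  refine key y _ hy0 rfl (hc ?_)
  rw [Metric.mem_closedBall, dist_eq_norm] at hy ⊢
  have : a + s • (y - a) - c = s • (y - c') := by
    conv_lhs => rw [hcc]
    module
  rw [this, norm_smul, Real.norm_of_nonneg hs0.le]
  nlinarith [norm_nonneg (y - c')]

/-- The polynomial obtained by composing `q` with the orthogonal projection onto the hyperplane of
the facet opposite to `a`. -/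
def facetExt (T : Finset (E d)) (a : E d) (q : Poly d) : Poly d :=
  slide (height T a • affPoly (bary T a)) (normal T a) q

lemma height_smul_affPoly_mem (T : Finset (E d)) (a : E d) :
    height T a • affPoly (bary T a) ∈ P d 1 := Submodule.smul_mem _ _ (affPoly_mem _)

/-- The extension is constant in the direction normal to the facet. -/
lemma ev_facetExt_add (hT : IsSimplex T) (hd : 1 ≤ d) {a : E d} (ha : a ∈ T) (q : Poly d) {y : E d}
    (hy : bary T a y = 0) (s : ℝ) : ev (facetExt T a q) (y + s • normal T a) = ev q y := by
  have hh := height_pos hT hd ha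
  rw [facetExt, ev_slide]
  congr 1
  rw [ev_smul, ev_affPoly, bary_normal_slide hT hd ha, hy]
  have : height T a * (0 - s * (height T a)⁻¹) = -s := by field_simp; ring
  rw [this]
  module

/-- Extending a polynomial constantly in the normal direction of a facet is stable. -/
lemma exists_nm_facetExt_le (hd : 1 ≤ d) (k : ℕ) (hγ : 0 < γ) :
    ∃ C : ℝ, 0 < C ∧ ∀ T : Finset (E d), IsRegular γ T → ∀ a ∈ T, ∀ q ∈ P d k,
      nm (volume.restrict (hull T)) (ev (facetExt T a q))
        ≤ C * (√(diam T) * nm ((surf d).restrict (hull (opp T a))) (ev q)) := by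
  obtain ⟨C, hC, h⟩ := exists_ball_inverse (d := d) k hγ
  refine ⟨C * √(2 / γ), by positivity, fun T hT a ha q hq => ?_⟩
  have hh := diam_pos hT.simplex hd
  obtain ⟨c₀, hc₀⟩ := hT.ball
  set ρ := diam T / γ with hρ
  have hρ0 : 0 < ρ := by positivity
  obtain ⟨c, hc, hcf⟩ := exists_facet_ball hT.simplex hd ha hρ0 hc₀
  set p := facetExt T a q with hp
  have hpP : p ∈ P d k := slide_mem_P (height_smul_affPoly_mem T a) _ hq
  have h1 : nm (volume.restrict (hull T)) (ev p)
      ≤ C * nm (volume.restrict (Metric.closedBall c ρ)) (ev p) := by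
    refine (nm_mono_set (subset_closedBall ?_)
      (memLp_volume (isCompact_closedBall _ _) (continuous_ev _))).trans (h p hpP c _ hh).1
    exact (mem_hull_subset hT.simplex subset_rfl c).2 ⟨((mem_hull_opp hT.simplex ha).1 hc).2,
      fun b hb hb' => (hb' hb).elim⟩
  -- Integrate over lines normal to the facet. A line meeting the ball around `c`, which is a point
  -- of the facet, does so in a segment of length at most `2 ρ` and passes through the facet.
  have h2 : nm (volume.restrict (Metric.closedBall c ρ)) (ev p) ^ 2
      ≤ 2 * ρ * nm ((surf d).restrict (hull (opp T a))) (ev q) ^ 2 := by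
    rw [nm_sq, nm_sq]
    obtain ⟨e, he⟩ := exists_hyper_eq hT.simplex hd ha
    have hn := norm_normal hT.simplex hd ha
    have hnn : inner ℝ (normal T a) (normal T a) = (1 : ℝ) := by
      rw [real_inner_self_eq_norm_sq, hn, one_pow]
    have hsub : hull (opp T a) ⊆ hyper (normal T a) e := by
      rw [he]
      exact fun x hx => ((mem_hull_opp hT.simplex ha).1 hx).1
    have hint : Integrable ((Metric.closedBall c ρ).indicator fun x => ev p x ^ 2) := by
      rw [integrable_indicator_iff measurableSet_closedBall]
      exact (by fun_prop : Continuous fun x => ev p x ^ 2).continuousOn.integrableOn_compact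
        (isCompact_closedBall _ _)
    rw [← integral_indicator measurableSet_closedBall,
      integral_slice hn e (by rw [hnn]; exact one_ne_zero) hint, hnn, abs_one, one_mul,
      ← integral_const_mul, ← Set.inter_eq_right.2 hsub, ← setIntegral_indicator
      (measurableSet_hull _)]
    refine integral_mono_of_nonneg (.of_forall fun y => integral_nonneg fun s =>
      Set.indicator_nonneg (fun _ _ => sq_nonneg _) _) ?_ ?_
    · refine Integrable.integrableOn ?_
      rw [integrable_indicator_iff (measurableSet_hull _)]
      exact integrable_facet hT.simplex hd ha (by fun_prop)
    refine (ae_restrict_iff' (measurableSet_hyper _ _)).2 (.of_forall fun y hy => ?_)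
    have hy0 : bary T a y = 0 := by rw [he] at hy; exact hy
    have hc0 : bary T a c = 0 := ((mem_hull_opp hT.simplex ha).1 hc).1
    have hmem : ∀ s : ℝ, y + s • normal T a ∈ Metric.closedBall c ρ →
        y ∈ Metric.closedBall c ρ ∧ s ∈ Set.Icc (-ρ) ρ := by
      intro s hs
      have horth : inner ℝ (y - c) (s • normal T a) = (0 : ℝ) := by
        rw [inner_smul_right, real_inner_comm, inner_normal hT.simplex hd ha, ← affineMap_sub, hy0,
          hc0]
        ring
      rw [Metric.mem_closedBall, dist_eq_norm] at hs ⊢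
      have h3 := norm_add_sq_eq_norm_sq_add_norm_sq_of_inner_eq_zero _ _ horth
      have h4 : y - c + s • normal T a = y + s • normal T a - c := by abel
      rw [h4, norm_smul, hn, mul_one, Real.norm_eq_abs] at h3
      have h5 : ‖y + s • normal T a - c‖ * ‖y + s • normal T a - c‖ ≤ ρ * ρ :=
        mul_self_le_mul_self (norm_nonneg _) hs
      refine ⟨abs_le_of_sq_le_sq' (by nlinarith [abs_nonneg s]) hρ0.le |>.2, ?_⟩
      rw [Set.mem_Icc, ← abs_le]
      exact abs_le_of_sq_le_sq' (by nlinarith [norm_nonneg (y - c)]) hρ0.le |>.2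
    by_cases hyo : y ∈ hull (opp T a)
    · rw [Set.indicator_of_mem hyo]
      calc ∫ s : ℝ, (Metric.closedBall c ρ).indicator (fun x => ev p x ^ 2) (y + s • normal T a)
          ≤ ∫ s : ℝ, (Set.Icc (-ρ) ρ).indicator (fun _ => ev q y ^ 2) s := by
            refine integral_mono_of_nonneg (.of_forall fun s =>
              Set.indicator_nonneg (fun _ _ => sq_nonneg _) _) ?_ (.of_forall fun s => ?_)
            · rw [integrable_indicator_iff measurableSet_Icc]
              exact continuousOn_const.integrableOn_compact isCompact_Icc
            · by_cases hs : y + s • normal T a ∈ Metric.closedBall c ρ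
              · simp only [Set.indicator_of_mem hs, Set.indicator_of_mem (hmem s hs).2]
                rw [hp, ev_facetExt_add hT.simplex hd ha q hy0]
              · simp only [Set.indicator_of_notMem hs]
                exact Set.indicator_nonneg (fun _ _ => sq_nonneg _) _
        _ = 2 * ρ * ev q y ^ 2 := by
            rw [integral_indicator measurableSet_Icc, setIntegral_const, smul_eq_mul,
              Real.volume_real_Icc_of_le (by linarith)]
            ring
    · have hnm : ∀ s : ℝ, y + s • normal T a ∉ Metric.closedBall c ρ := fun s hs =>
        hyo (hcf y (hmem s hs).1 hy0)
      simp [Set.indicator_of_notMem (hnm _), Set.indicator_of_notMem hyo]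
  have h3 : nm (volume.restrict (Metric.closedBall c ρ)) (ev p)
      ≤ √(2 * ρ) * nm ((surf d).restrict (hull (opp T a))) (ev q) := by
    refine abs_le_of_sq_le_sq' ?_ (mul_nonneg (Real.sqrt_nonneg _) nm_nonneg) |>.2
    rwa [mul_pow, Real.sq_sqrt (by positivity)]
  have h4 : √(2 * ρ) = √(2 / γ) * √(diam T) := by
    rw [← Real.sqrt_mul (by positivity), hρ]
    congr 1
    ring
  rw [h4] at h3
  calc _ ≤ C * (√(2 / γ) * √(diam T) * nm ((surf d).restrict (hull (opp T a))) (ev q)) :=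
        h1.trans (by gcongr)
    _ = _ := by ring

/-- A polynomial of degree `k` is controlled by its values on one facet and its moments against
polynomials of degree `k - 1`. -/
lemma exists_nm_le_facet (hd : 1 ≤ d) {k : ℕ} (hγ : 0 < γ) :
    ∃ C : ℝ, 0 < C ∧ ∀ T : Finset (E d), IsRegular γ T → ∀ a ∈ T, ∀ q ∈ P d k, ∀ M : ℝ,
      (∀ z ∈ P d (k - 1), |∫ x in hull T, ev q x * ev z x|
        ≤ M * nm (volume.restrict (hull T)) (ev z)) →
      nm (volume.restrict (hull T)) (ev q)
        ≤ C * (M + √(diam T) * nm ((surf d).restrict (hull (opp T a))) (ev q)) := by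
  obtain ⟨C₁, hC₁, h₁⟩ := exists_nm_facetExt_le (d := d) hd k hγ
  obtain ⟨C₂, hC₂, h₂⟩ := exists_ball_inverse (d := d) (k - 1) (γ := 2 * γ) (by positivity)
  refine ⟨C₁ + C₂ ^ 2 * (2 * γ) * (1 + C₁), by positivity, fun T hT a ha q hq M hM => ?_⟩
  have hh := diam_pos hT.simplex hd
  obtain ⟨c, hc⟩ := hT.ball
  set N : (E d → ℝ) → ℝ := nm (volume.restrict (hull T)) with hN
  set S := √(diam T) * nm ((surf d).restrict (hull (opp T a))) (ev q) with hS
  have hS0 : 0 ≤ S := mul_nonneg (Real.sqrt_nonneg _) nm_nonneg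
  have hL : ∀ p : Poly d, MemLp (ev p) 2 (volume.restrict (hull T)) := fun p =>
    memLp_hull T (continuous_ev p)
  obtain ⟨z', hz', hzeq'⟩ := exists_sub_slide (height_smul_affPoly_mem T a) (normal T a) hq
  -- `z` is the quotient by the barycentric coordinate
  set z := height T a • z' with hzd
  have hz : z ∈ P d (k - 1) := Submodule.smul_mem _ _ hz'
  have hzeq : q - facetExt T a q = affPoly (bary T a) * z := by
    rw [facetExt, hzeq', hzd, smul_mul_assoc, mul_smul_comm]
  have hzx : ∀ x, ev q x = ev (facetExt T a q) x + bary T a x * ev z x := by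
    intro x
    have := congrArg (fun p => ev p x) hzeq
    simp only [ev_sub, ev_mul, ev_affPoly] at this
    linarith
  have hht := height_pos hT.simplex hd ha
  have hext := h₁ T hT a ha q hq
  -- On the concentric ball of half the radius `λ_a ≥ 1 / (2γ)`, so the weight `λ_a` is harmless.
  have hz1 : N (ev z) ^ 2 ≤ C₂ ^ 2 * (2 * γ) * ∫ x in hull T, bary T a x * ev z x ^ 2 := by
    set B := Metric.closedBall c (diam T / (2 * γ)) with hB
    have hρ : diam T / (2 * γ) + diam T / (2 * γ) = diam T / γ := by field_simp; ring
    have hBT : B ⊆ hull T := (Metric.closedBall_subset_closedBall (by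
      have : 0 < diam T / (2 * γ) := by positivity
      linarith)).trans hc
    have e1 : N (ev z) ≤ C₂ * nm (volume.restrict B) (ev z) :=
      (nm_mono_set (subset_closedBall (hc (Metric.mem_closedBall_self (by positivity))))
        (memLp_volume (isCompact_closedBall _ _) (continuous_ev _))).trans (h₂ z hz c _ hh).1
    have e2 : ∀ x ∈ B, ev z x ^ 2 ≤ 2 * γ * (bary T a x * ev z x ^ 2) := by
      intro x hx
      have hxb : Metric.closedBall x (diam T / (2 * γ)) ⊆ hull T :=
        (Metric.closedBall_subset_closedBall' (by
          rw [Metric.mem_closedBall] at hx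
          linarith)).trans hc
      have e3 := radius_le_height_mul hT.simplex hd ha (by positivity) hxb
      have e4 := height_le_diam hT.simplex hd ha
      have e5 := (mem_hull hT.simplex).1 (hBT hx) a ha
      have e6 : diam T / (2 * γ) ≤ diam T * bary T a x :=
        e3.trans (mul_le_mul_of_nonneg_right e4 e5)
      have e7 : 1 ≤ 2 * γ * bary T a x := by
        rw [div_le_iff₀ (by positivity)] at e6
        have : diam T * 1 ≤ diam T * (2 * γ * bary T a x) := by linarith
        exact le_of_mul_le_mul_left this hh
      nlinarith [sq_nonneg (ev z x)]
    have hcb : Continuous (bary T a) := continuous_affineMap _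
    have e3 : nm (volume.restrict B) (ev z) ^ 2
        ≤ 2 * γ * ∫ x in hull T, bary T a x * ev z x ^ 2 := by
      rw [nm_sq, ← integral_const_mul]
      refine (setIntegral_mono_on ?_ ?_ measurableSet_closedBall e2).trans
        (setIntegral_mono_set ?_ ?_ (Filter.Eventually.of_forall hBT))
      · exact (by fun_prop : Continuous fun x => ev z x ^ 2).continuousOn.integrableOn_compact
          (isCompact_closedBall _ _)
      · exact (by fun_prop : Continuous fun x =>
          2 * γ * (bary T a x * ev z x ^ 2)).continuousOn.integrableOn_compact
          (isCompact_closedBall _ _)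
      · exact integrable_hull T (by fun_prop)
      · refine (ae_restrict_iff' (measurableSet_hull T)).2 (.of_forall fun x hx => ?_)
        have := (mem_hull hT.simplex).1 hx a ha
        simp only [Pi.zero_apply]
        positivity
    calc N (ev z) ^ 2 ≤ (C₂ * nm (volume.restrict B) (ev z)) ^ 2 := pow_le_pow_left₀ nm_nonneg e1 2
      _ = C₂ ^ 2 * nm (volume.restrict B) (ev z) ^ 2 := by ring
      _ ≤ C₂ ^ 2 * (2 * γ * ∫ x in hull T, bary T a x * ev z x ^ 2) := by gcongr
      _ = _ := by ring
  -- Test `q = ext q + λ_a z` with `z`.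
  have hz2 : ∫ x in hull T, bary T a x * ev z x ^ 2 ≤ (M + C₁ * S) * N (ev z) := by
    have e1 : ∫ x in hull T, bary T a x * ev z x ^ 2
        = (∫ x in hull T, ev q x * ev z x) - ∫ x in hull T, ev (facetExt T a q) x * ev z x := by
      rw [← integral_sub (integrable_mul_of_memLp (hL _) (hL _))
        (integrable_mul_of_memLp (hL _) (hL _))]
      congr 1
      ext x
      rw [hzx x]
      ring
    have e2 := (abs_le.1 (abs_integral_mul_le (hL (facetExt T a q)) (hL z))).1
    have e3 := (abs_le.1 (hM z hz)).2
    have e4 : N (ev (facetExt T a q)) * N (ev z) ≤ C₁ * S * N (ev z) := by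
      gcongr
      exact nm_nonneg
    rw [e1, add_mul]
    linarith
  have hM1 : 0 ≤ M := by
    have h1P : (1 : Poly d) ∈ P d (k - 1) := by simpa using C_mem_P (d := d) (k - 1) 1
    have h1N : 0 < N (ev (1 : Poly d)) := by
      refine lt_of_le_of_ne nm_nonneg fun h => one_ne_zero (α := Poly d) ?_
      exact eq_zero_of_nm_eq_zero (isCompact_hull T) (interior_hull_nonempty hγ hd hT) h.symm
    exact nonneg_of_mul_nonneg_left ((abs_nonneg _).trans (hM 1 h1P)) h1N
  have hM0 : 0 ≤ N (ev z) := nm_nonneg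
  have hz3 : N (ev z) ≤ C₂ ^ 2 * (2 * γ) * (M + C₁ * S) := by
    rcases hM0.eq_or_lt with h0 | h0
    · rw [← h0]
      positivity
    · have h5 : N (ev z) * N (ev z) ≤ C₂ ^ 2 * (2 * γ) * (M + C₁ * S) * N (ev z) := by
        calc _ = N (ev z) ^ 2 := by ring
          _ ≤ C₂ ^ 2 * (2 * γ) * ((M + C₁ * S) * N (ev z)) := hz1.trans (by gcongr)
          _ = _ := by ring
      exact le_of_mul_le_mul_right h5 h0
  have hq1 : N (ev q) ≤ N (ev (facetExt T a q)) + N (ev z) := by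
    have e1 : N (ev q) = N fun x => ev (facetExt T a q) x + ev (affPoly (bary T a) * z) x := by
      congr 1
      ext x
      rw [hzx x, ev_mul, ev_affPoly]
    rw [e1]
    refine (nm_add_le (hL _) (hL _)).trans (add_le_add le_rfl ?_)
    rw [← one_mul (N (ev z))]
    refine nm_le_of_abs_le zero_le_one (hL z) ((ae_restrict_iff' (measurableSet_hull T)).2
      (.of_forall fun x hx => ?_))
    rw [ev_mul, ev_affPoly, abs_mul, abs_of_nonneg ((mem_hull hT.simplex).1 hx a ha)]
    exact mul_le_mul_of_nonneg_right (bary_le_one hT.simplex hx ha) (abs_nonneg _)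
  have hfin : C₁ * S + C₂ ^ 2 * (2 * γ) * (M + C₁ * S)
      ≤ (C₁ + C₂ ^ 2 * (2 * γ) * (1 + C₁)) * (M + S) := by
    have h7 : 0 ≤ C₂ ^ 2 * (2 * γ) := by positivity
    nlinarith [mul_nonneg hC₁.le hM1, mul_nonneg h7 (mul_nonneg hC₁.le hM1), mul_nonneg h7 hS0]
  linarith
end facet

/-! ### The displacement reconstruction: stability -/

section reconstruction

variable {γ : ℝ} {T : Finset (E d)}

/-- The normal component of a polynomial vector field on the facet opposite to `a`. -/
def ncomp (T : Finset (E d)) (a : E d) (r : Fin d → Poly d) : Poly d := ∑ i, normal T a i • r i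

lemma ev_ncomp (a : E d) (r : Fin d → Poly d) (x : E d) :
    ev (ncomp T a r) x = ∑ i, ev (r i) x * normal T a i := by
  simp [ncomp, mul_comm]

lemma abs_sum_mul_normal_le (hT : IsSimplex T) (hd : 1 ≤ d) {a : E d} (ha : a ∈ T) (v : E d) :
    |∑ i, v i * normal T a i| ≤ ‖v‖ := by
  have h := abs_real_inner_le_norm (normal T a) v
  rw [norm_normal hT hd ha, one_mul] at h
  simpa [PiLp.inner_apply] using h

/-- A vector is controlled by its components in the directions of the facet normals. -/
lemma vector_eq_sum_normal (hT : IsSimplex T) (hd : 1 ≤ d) (c v : E d) :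
    v = ∑ a ∈ T, (-(height T a)⁻¹ * ∑ i, v i * normal T a i) • (a - c) := by
  have h1 : ∀ a ∈ T, (-(height T a)⁻¹ * ∑ i, v i * normal T a i) • (a - c)
      = (bary T a).linear v • a - (bary T a).linear v • c := by
    intro a ha
    have hh := height_pos hT hd ha
    have h2 := inner_normal hT hd ha v
    have h3 : inner ℝ (normal T a) v = ∑ i, v i * normal T a i := by simp [PiLp.inner_apply]
    rw [← h3, h2, ← smul_sub]
    congr 1
    field_simp
  rw [Finset.sum_congr rfl h1, Finset.sum_sub_distrib, ← Finset.sum_smul, sum_bary_linear hT,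
    sum_bary_linear_smul hT, zero_smul, sub_zero]

/-- Integration by parts for polynomials on a simplex, with the sum over the components. -/
lemma integral_pdiv_mul (hT : IsSimplex T) (hd : 1 ≤ d) (r : Fin d → Poly d) (t : Poly d) :
    ∫ x in hull T, ev (pdiv r) x * ev t x
      = -(∫ x in hull T, ∑ i, ev (r i) x * ev (MvPolynomial.pderiv i t) x)
        + ∑ a ∈ T, ∫ y in hull (opp T a), ev (ncomp T a r) y * ev t y ∂(surf d) := by
  have h1 : ∀ i, ∫ x in hull T, ev (MvPolynomial.pderiv i (r i)) x * ev t x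
      = -(∫ x in hull T, ev (r i) x * ev (MvPolynomial.pderiv i t) x)
        + ∑ a ∈ T, ∫ y in hull (opp T a), ev (r i) y * ev t y * normal T a i ∂(surf d) := by
    intro i
    have := integral_pd_mul_add hT hd (contDiff_ev (r i)) (contDiff_ev t) i
    rwa [pd_ev, pd_ev] at this
  have h2 : (fun x => ev (pdiv r) x * ev t x)
      = fun x => ∑ i, ev (MvPolynomial.pderiv i (r i)) x * ev t x := by
    ext x
    rw [pdiv, ev_sum, Finset.sum_mul]
  rw [h2, integral_finsetSum _ fun i _ => integrable_hull T (by fun_prop), Finset.sum_congr rfl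
    fun i _ => h1 i, Finset.sum_add_distrib, Finset.sum_neg_distrib,
    integral_finsetSum _ fun i _ => integrable_hull T (by fun_prop), Finset.sum_comm]
  congr 1
  refine Finset.sum_congr rfl fun a ha => ?_
  rw [← integral_finsetSum _ fun i _ => integrable_facet hT hd ha (by fun_prop)]
  congr 1
  ext y
  rw [ev_ncomp, Finset.sum_mul]
  exact Finset.sum_congr rfl fun i _ => by ring

/-- A Raviart–Thomas field whose moments of degree `k - 1` vanish is controlled by its normal
components. The divergence is bounded by testing with itself; after subtracting
`(x - c) (∇·r) / (d + k)` each normal component is a polynomial of degree `k` controlled by its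
values on the facet. -/
lemma exists_nm_rt_le (hd : 1 ≤ d) {k : ℕ} (hk : 1 ≤ k) (hγ : 0 < γ) :
    ∃ C : ℝ, 0 < C ∧ ∀ T : Finset (E d), IsRegular γ T → ∀ r : Fin d → Poly d, InRT k r →
      (∀ w : Fin d → Poly d, (∀ i, w i ∈ P d (k - 1)) →
        ∫ x in hull T, ∑ i, ev (r i) x * ev (w i) x = 0) →
      ∀ i, nm (volume.restrict (hull T)) (ev (r i)) ≤ C * (√(diam T) *
        ∑ a ∈ T, nm ((surf d).restrict (hull (opp T a))) (ev (ncomp T a r))) := by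
  obtain ⟨C₁, hC₁, h₁⟩ := exists_inverse (d := d) hd k hγ
  obtain ⟨C₂, hC₂, h₂⟩ := exists_nm_le_facet (d := d) hd (k := k) hγ
  set A := √C₁ * √C₁ with hA
  have hA0 : 0 ≤ A := by positivity
  refine ⟨(d + 1) * γ * (C₂ * (√C₁ + (1 + A))) + √C₁, by positivity,
    fun T hT r hr hw => ?_⟩
  have hh := diam_pos hT.simplex hd
  obtain ⟨c, hc⟩ := hT.ball
  have hcT : c ∈ hull T := hc (Metric.mem_closedBall_self (by positivity))
  set N : (E d → ℝ) → ℝ := nm (volume.restrict (hull T)) with hN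
  set F : E d → (E d → ℝ) → ℝ := fun a => nm ((surf d).restrict (hull (opp T a))) with hF
  set η := ∑ a ∈ T, F a (ev (ncomp T a r)) with hη
  have hη0 : 0 ≤ η := Finset.sum_nonneg fun a _ => nm_nonneg
  have hFη : ∀ a ∈ T, F a (ev (ncomp T a r)) ≤ η := fun a ha =>
    Finset.single_le_sum (f := fun a => F a (ev (ncomp T a r))) (fun _ _ => nm_nonneg) ha
  have hL : ∀ p : Poly d, MemLp (ev p) 2 (volume.restrict (hull T)) := fun p =>
    memLp_hull T (continuous_ev p)
  set H := √(diam T) with hH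
  have hH0 : 0 < H := Real.sqrt_pos.2 hh
  have hHH : H * H = diam T := Real.mul_self_sqrt hh.le
  set t := pdiv r with ht
  have htP : t ∈ P d k := pdiv_mem_of_inRT hk hr
  -- the discrete trace inequality without squares
  have hdt : ∀ a ∈ T, ∀ p ∈ P d k, H * F a (ev p) ≤ √C₁ * N (ev p) := by
    intro a ha p hp
    refine abs_le_of_sq_le_sq' ?_ (mul_nonneg (Real.sqrt_nonneg _) nm_nonneg) |>.2
    rw [mul_pow, mul_pow, Real.sq_sqrt hC₁.le, Real.sq_sqrt hh.le]
    calc diam T * F a (ev p) ^ 2 ≤ diam T * (C₁ * (diam T)⁻¹ * N (ev p) ^ 2) := by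
          gcongr
          exact (h₁ T hT p hp).2 a ha
      _ = _ := by field_simp; rfl
  -- the divergence
  have hdiv : H * N (ev t) ≤ √C₁ * η := by
    have e1 : N (ev t) ^ 2 ≤ ∑ a ∈ T, F a (ev (ncomp T a r)) * F a (ev t) := by
      have e2 := integral_pdiv_mul hT.simplex hd r t
      rw [hw (fun i => MvPolynomial.pderiv i t) fun i => pderiv_mem_P htP i, neg_zero,
        zero_add] at e2
      rw [hN, nm_sq]
      simp only [pow_two]
      rw [e2]
      refine Finset.sum_le_sum fun a ha => (le_abs_self _).trans (abs_integral_mul_le ?_ ?_) <;>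
      exact memLp_facet hT.simplex hd ha (continuous_ev _)
    have e3 : H * N (ev t) ^ 2 ≤ √C₁ * η * N (ev t) := by
      calc H * N (ev t) ^ 2 ≤ ∑ a ∈ T, F a (ev (ncomp T a r)) * (H * F a (ev t)) := by
            rw [show ∑ a ∈ T, F a (ev (ncomp T a r)) * (H * F a (ev t))
              = H * ∑ a ∈ T, F a (ev (ncomp T a r)) * F a (ev t) by
                rw [Finset.mul_sum]; exact Finset.sum_congr rfl fun _ _ => by ring]
            gcongr
        _ ≤ ∑ a ∈ T, F a (ev (ncomp T a r)) * (√C₁ * N (ev t)) :=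
            Finset.sum_le_sum fun a ha => mul_le_mul_of_nonneg_left (hdt a ha t htP) nm_nonneg
        _ = _ := by rw [← Finset.sum_mul]; ring
    rcases (nm_nonneg : 0 ≤ N (ev t)).eq_or_lt with h0 | h0
    · have h0' : N (ev t) = 0 := h0.symm
      rw [h0', mul_zero]
      positivity
    · refine le_of_mul_le_mul_right ?_ h0
      calc _ = H * N (ev t) ^ 2 := by ring
        _ ≤ _ := e3
  set s := (d + k : ℝ)⁻¹ • t with hs
  have hsP : s ∈ P d k := Submodule.smul_mem _ _ htP
  have hinv : |(d + k : ℝ)⁻¹| ≤ 1 := by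
    rw [abs_of_nonneg (by positivity)]
    refine inv_le_one_of_one_le₀ ?_
    have : (1 : ℝ) ≤ k := by exact_mod_cast hk
    have : (0 : ℝ) ≤ d := by positivity
    linarith
  have hsN : N (ev s) ≤ N (ev t) := by
    have : ev s = fun x => (d + k : ℝ)⁻¹ * ev t x := by ext x; simp [hs]
    rw [this, hN, nm_const_mul]
    exact mul_le_of_le_one_left nm_nonneg hinv
  set δ : Fin d → Poly d := fun i => r i - (MvPolynomial.X i - MvPolynomial.C (c i)) * s with hδ
  have hδP : ∀ i, δ i ∈ P d k := fun i => sub_mul_pdiv_mem_P hk hr c i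
  have hqP : ∀ a, ncomp T a δ ∈ P d k := fun a =>
    sum_mem fun i _ => Submodule.smul_mem _ _ (hδP i)
  have hqx : ∀ a x, ev (ncomp T a δ) x
      = ev (ncomp T a r) x - (∑ i, (x - c) i * normal T a i) * ev s x := by
    intro a x
    rw [ev_ncomp, ev_ncomp, Finset.sum_mul, ← Finset.sum_sub_distrib]
    refine Finset.sum_congr rfl fun i _ => ?_
    simp [hδ]
    ring
  have hxc : ∀ x ∈ hull T, ‖x - c‖ ≤ diam T := fun x hx => by
    rw [← dist_eq_norm]
    exact subset_closedBall hcT hx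
  -- the normal components of `δ`
  have hqN : ∀ a ∈ T, N (ev (ncomp T a δ)) ≤ C₂ * (√C₁ + (1 + A)) * (H * η) := by
    intro a ha
    have hsub : hull (opp T a) ⊆ hull T := convexHull_mono (by exact_mod_cast opp_subset T a)
    have e1 := h₂ T hT a ha (ncomp T a δ) (hqP a) (diam T * N (ev s)) (by
      intro z hz
      have e2 : ∫ x in hull T, ev (ncomp T a r) x * ev z x = 0 := by
        rw [← hw (fun i => normal T a i • z) fun i => Submodule.smul_mem _ _ hz]
        congr 1
        ext x
        rw [ev_ncomp, Finset.sum_mul]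
        exact Finset.sum_congr rfl fun i _ => by rw [ev_smul]; ring
      have e3 : ∫ x in hull T, ev (ncomp T a δ) x * ev z x
          = -∫ x in hull T, ((∑ i, (x - c) i * normal T a i) * ev s x) * ev z x := by
        have e4 : (fun x => ev (ncomp T a δ) x * ev z x) = fun x => ev (ncomp T a r) x * ev z x
            - ((∑ i, (x - c) i * normal T a i) * ev s x) * ev z x := by
          ext x
          rw [hqx]
          ring
        rw [e4, integral_sub (integrable_hull T (by fun_prop)) (integrable_hull T (by fun_prop)),
          e2, zero_sub]
      rw [e3, abs_neg]
      refine (abs_integral_mul_le (memLp_hull T (by fun_prop)) (hL z)).trans ?_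
      refine mul_le_mul_of_nonneg_right ?_ nm_nonneg
      refine nm_le_of_abs_le hh.le (hL s) ((ae_restrict_iff' (measurableSet_hull T)).2
        (.of_forall fun x hx => ?_))
      rw [abs_mul]
      exact mul_le_mul_of_nonneg_right ((abs_sum_mul_normal_le hT.simplex hd ha _).trans (hxc x hx))
        (abs_nonneg _))
    have e5 : F a (ev (ncomp T a δ)) ≤ F a (ev (ncomp T a r)) + diam T * F a (ev s) := by
      rw [funext (hqx a)]
      refine (nm_sub_le (memLp_facet hT.simplex hd ha (continuous_ev _))
        (memLp_facet hT.simplex hd ha (by fun_prop))).trans (add_le_add le_rfl ?_)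
      refine nm_le_of_abs_le hh.le (memLp_facet hT.simplex hd ha (continuous_ev s))
        ((ae_restrict_iff' (measurableSet_hull _)).2 (.of_forall fun x hx => ?_))
      rw [abs_mul]
      exact mul_le_mul_of_nonneg_right ((abs_sum_mul_normal_le hT.simplex hd ha _).trans
        (hxc x (hsub hx))) (abs_nonneg _)
    have e6 : diam T * F a (ev s) ≤ A * η := by
      calc diam T * F a (ev s) = H * (H * F a (ev s)) := by rw [← hHH]; ring
        _ ≤ H * (√C₁ * N (ev s)) := mul_le_mul_of_nonneg_left (hdt a ha s hsP) hH0.le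
        _ ≤ √C₁ * (H * N (ev t)) := by
            rw [mul_left_comm]
            gcongr
        _ ≤ √C₁ * (√C₁ * η) := by gcongr
        _ = A * η := by rw [hA]; ring
    have e7 : diam T * N (ev s) ≤ √C₁ * (H * η) := by
      calc diam T * N (ev s) = H * (H * N (ev s)) := by rw [← hHH]; ring
        _ ≤ H * (H * N (ev t)) := by gcongr
        _ ≤ H * (√C₁ * η) := by gcongr
        _ = _ := by ring
    calc N (ev (ncomp T a δ)) ≤ C₂ * (diam T * N (ev s) + H * F a (ev (ncomp T a δ))) := e1
      _ ≤ C₂ * (√C₁ * (H * η) + H * (η + A * η)) := by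
          gcongr
          linarith [hFη a ha]
      _ = _ := by ring
  intro i
  have hδN : N (ev (δ i)) ≤ (d + 1) * γ * (C₂ * (√C₁ + (1 + A)) * (H * η)) := by
    have e1 : ev (δ i) = fun x => ∑ a ∈ T, (-(height T a)⁻¹ * (a - c) i) * ev (ncomp T a δ) x := by
      ext x
      have := congrArg (fun v : E d => v i) (vector_eq_sum_normal hT.simplex hd c
        (WithLp.toLp 2 fun j => ev (δ j) x))
      simp only [PiLp.sub_apply] at this ⊢
      rw [this]
      simp only [WithLp.ofLp_sum, Finset.sum_apply, PiLp.smul_apply, smul_eq_mul, ev_ncomp,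
        PiLp.sub_apply]
      exact Finset.sum_congr rfl fun a _ => by ring
    rw [e1]
    refine (nm_sum_le T _ fun a _ => (hL _).const_mul _).trans ?_
    have e2 : ∀ a ∈ T, nm (volume.restrict (hull T))
        (fun x => (-(height T a)⁻¹ * (a - c) i) * ev (ncomp T a δ) x)
        ≤ γ * (C₂ * (√C₁ + (1 + A)) * (H * η)) := by
      intro a ha
      have hha := height_pos hT.simplex hd ha
      have hdh := diam_div_le_height hγ hd hT ha
      rw [nm_const_mul]
      refine mul_le_mul ?_ (hqN a ha) nm_nonneg hγ.le
      rw [abs_mul, abs_neg, abs_of_pos (inv_pos.2 hha)]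
      have e3 : |(a - c) i| ≤ diam T :=
        (PiLp.norm_apply_le (a - c) i).trans (hxc a (mem_hull_of_mem ha))
      rw [inv_mul_le_iff₀ hha]
      rw [div_le_iff₀ hγ] at hdh
      linarith
    refine (Finset.sum_le_sum e2).trans (le_of_eq ?_)
    rw [Finset.sum_const, hT.simplex.card, nsmul_eq_mul]
    push_cast
    ring
  have hr1 : N (ev (r i)) ≤ N (ev (δ i)) + diam T * N (ev s) := by
    have e1 : ev (r i) = fun x => ev (δ i) x + (x - c) i * ev s x := by
      ext x
      simp [hδ]
    rw [e1]
    refine (nm_add_le (hL _) (memLp_hull T (by fun_prop))).trans (add_le_add le_rfl ?_)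
    refine nm_le_of_abs_le hh.le (hL s) ((ae_restrict_iff' (measurableSet_hull T)).2
      (.of_forall fun x hx => ?_))
    rw [abs_mul]
    exact mul_le_mul_of_nonneg_right ((PiLp.norm_apply_le (x - c) i).trans (hxc x hx))
      (abs_nonneg _)
  have hr2 : diam T * N (ev s) ≤ √C₁ * (H * η) := by
    calc diam T * N (ev s) = H * (H * N (ev s)) := by rw [← hHH]; ring
      _ ≤ H * (H * N (ev t)) := by gcongr
      _ ≤ H * (√C₁ * η) := by gcongr
      _ = _ := by ring
  calc N (ev (r i)) ≤ (d + 1) * γ * (C₂ * (√C₁ + (1 + A)) * (H * η)) + √C₁ * (H * η) := by linarith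
    _ = _ := by ring

end reconstruction

/-! ### The displacement reconstruction: existence -/

section existence

open Module

variable {γ : ℝ} {T : Finset (E d)}

/-- On a facet the normal component of a Raviart–Thomas field is a polynomial of degree `k`, because
`x · n` is constant there. -/
lemma exists_ncomp_eq (hT : IsSimplex T) (hd : 1 ≤ d) {a : E d} (ha : a ∈ T) {k : ℕ}
    {r : Fin d → Poly d} (hr : InRT k r) :
    ∃ D ∈ P d k, ∀ x ∈ hull (opp T a), ev (ncomp T a r) x = ev D x := by
  obtain ⟨p, q, hp, hq, hpq⟩ := hr
  obtain ⟨c, hc⟩ := exists_hyper_eq hT hd ha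
  refine ⟨ncomp T a p + c • q, add_mem (sum_mem fun i _ => Submodule.smul_mem _ _ (hp i))
    (Submodule.smul_mem _ _ hq), fun x hx => ?_⟩
  have h1 : x ∈ hyper (normal T a) c := by
    rw [hc]
    exact ((mem_hull_opp hT ha).1 hx).1
  have h2 : ∑ i, x i * normal T a i = c := by
    have : inner ℝ (normal T a) x = c := h1
    simpa [PiLp.inner_apply] using this
  rw [ev_add, ev_smul, ev_ncomp, ev_ncomp, ← h2, Finset.sum_mul, ← Finset.sum_add_distrib]
  refine Finset.sum_congr rfl fun i _ => ?_
  rw [hpq, ev_add, ev_mul, ev_X]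
  ring

/-- The moments of a vector field in `T` and of its normal components on the facets of `T`. -/
def rtForm (hT : IsSimplex T) (hd : 1 ≤ d) (k : ℕ) :
    ((Fin d → P d k) × P d k) →ₗ[ℝ] Dual ℝ ((Fin d → P d (k - 1)) × (T → P d k)) :=
  LinearMap.mk₂ ℝ
    (fun s w => (∑ i, ∫ x in hull T, ev ((s.1 i).1 + MvPolynomial.X i * s.2.1) x * ev (w.1 i).1 x)
      + ∑ a : T, ∫ x in hull (opp T a.1),
        ev (ncomp T a.1 fun i => (s.1 i).1 + MvPolynomial.X i * s.2.1) x * ev (w.2 a).1 x ∂(surf d))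
    (fun s s' w => by
      have h1 : ∀ i, ∫ x in hull T, ev (((s + s').1 i).1 + MvPolynomial.X i * (s + s').2.1) x
            * ev (w.1 i).1 x
          = (∫ x in hull T, ev ((s.1 i).1 + MvPolynomial.X i * s.2.1) x * ev (w.1 i).1 x)
          + ∫ x in hull T, ev ((s'.1 i).1 + MvPolynomial.X i * s'.2.1) x * ev (w.1 i).1 x := by
        intro i
        rw [← integral_add (integrable_hull T (by fun_prop)) (integrable_hull T (by fun_prop))]
        congr 1; ext x; simp; ring
      have h2 : ∀ a : T, ∫ x in hull (opp T a.1), ev (ncomp T a.1 fun i => ((s + s').1 i).1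
            + MvPolynomial.X i * (s + s').2.1) x * ev (w.2 a).1 x ∂(surf d)
          = (∫ x in hull (opp T a.1), ev (ncomp T a.1 fun i => (s.1 i).1
            + MvPolynomial.X i * s.2.1) x * ev (w.2 a).1 x ∂(surf d))
          + ∫ x in hull (opp T a.1), ev (ncomp T a.1 fun i => (s'.1 i).1
            + MvPolynomial.X i * s'.2.1) x * ev (w.2 a).1 x ∂(surf d) := by
        intro a
        rw [← integral_add (integrable_facet hT hd a.2 (by fun_prop))
          (integrable_facet hT hd a.2 (by fun_prop))]
        congr 1; ext x
        rw [← add_mul, ev_ncomp, ev_ncomp, ev_ncomp, ← Finset.sum_add_distrib]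
        congr 1
        exact Finset.sum_congr rfl fun i _ => by simp; ring
      simp only [h1, h2, Finset.sum_add_distrib]
      ring)
    (fun c s w => by
      have h1 : ∀ i, ∫ x in hull T, ev (((c • s).1 i).1 + MvPolynomial.X i * (c • s).2.1) x
            * ev (w.1 i).1 x
          = c * (∫ x in hull T, ev ((s.1 i).1 + MvPolynomial.X i * s.2.1) x * ev (w.1 i).1 x) := by
        intro i
        rw [← integral_const_mul]
        congr 1; ext x; simp; ring
      have h2 : ∀ a : T, ∫ x in hull (opp T a.1), ev (ncomp T a.1 fun i => ((c • s).1 i).1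
            + MvPolynomial.X i * (c • s).2.1) x * ev (w.2 a).1 x ∂(surf d)
          = c * ∫ x in hull (opp T a.1), ev (ncomp T a.1 fun i => (s.1 i).1
            + MvPolynomial.X i * s.2.1) x * ev (w.2 a).1 x ∂(surf d) := by
        intro a
        rw [← integral_const_mul]
        congr 1; ext x
        rw [← mul_assoc, ev_ncomp, ev_ncomp, Finset.mul_sum]
        congr 1
        exact Finset.sum_congr rfl fun i _ => by simp; ring
      simp only [h1, h2, ← Finset.mul_sum, ← mul_add, smul_eq_mul])
    (fun s w w' => by
      have h1 : ∀ i, ∫ x in hull T, ev ((s.1 i).1 + MvPolynomial.X i * s.2.1) x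
            * ev ((w + w').1 i).1 x
          = (∫ x in hull T, ev ((s.1 i).1 + MvPolynomial.X i * s.2.1) x * ev (w.1 i).1 x)
          + ∫ x in hull T, ev ((s.1 i).1 + MvPolynomial.X i * s.2.1) x * ev (w'.1 i).1 x := by
        intro i
        rw [← integral_add (integrable_hull T (by fun_prop)) (integrable_hull T (by fun_prop))]
        congr 1; ext x; simp; ring
      have h2 : ∀ a : T, ∫ x in hull (opp T a.1), ev (ncomp T a.1 fun i => (s.1 i).1
            + MvPolynomial.X i * s.2.1) x * ev ((w + w').2 a).1 x ∂(surf d)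
          = (∫ x in hull (opp T a.1), ev (ncomp T a.1 fun i => (s.1 i).1
            + MvPolynomial.X i * s.2.1) x * ev (w.2 a).1 x ∂(surf d))
          + ∫ x in hull (opp T a.1), ev (ncomp T a.1 fun i => (s.1 i).1
            + MvPolynomial.X i * s.2.1) x * ev (w'.2 a).1 x ∂(surf d) := by
        intro a
        rw [← integral_add (integrable_facet hT hd a.2 (by fun_prop))
          (integrable_facet hT hd a.2 (by fun_prop))]
        congr 1; ext x
        rw [← mul_add]
        simp
      simp only [h1, h2, Finset.sum_add_distrib]
      ring)
    (fun c s w => by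
      have h1 : ∀ i, ∫ x in hull T, ev ((s.1 i).1 + MvPolynomial.X i * s.2.1) x
            * ev ((c • w).1 i).1 x
          = c * (∫ x in hull T, ev ((s.1 i).1 + MvPolynomial.X i * s.2.1) x * ev (w.1 i).1 x) := by
        intro i
        rw [← integral_const_mul]
        congr 1; ext x; simp; ring
      have h2 : ∀ a : T, ∫ x in hull (opp T a.1), ev (ncomp T a.1 fun i => (s.1 i).1
            + MvPolynomial.X i * s.2.1) x * ev ((c • w).2 a).1 x ∂(surf d)
          = c * ∫ x in hull (opp T a.1), ev (ncomp T a.1 fun i => (s.1 i).1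
            + MvPolynomial.X i * s.2.1) x * ev (w.2 a).1 x ∂(surf d) := by
        intro a
        rw [← integral_const_mul]
        congr 1; ext x; simp; ring
      simp only [h1, h2, ← Finset.mul_sum, ← mul_add, smul_eq_mul])

lemma rtForm_apply (hT : IsSimplex T) (hd : 1 ≤ d) (k : ℕ) (s : (Fin d → P d k) × P d k)
    (w : (Fin d → P d (k - 1)) × (T → P d k)) :
    rtForm hT hd k s w
      = (∑ i, ∫ x in hull T, ev ((s.1 i).1 + MvPolynomial.X i * s.2.1) x * ev (w.1 i).1 x)
      + ∑ a : T, ∫ x in hull (opp T a.1),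
        ev (ncomp T a.1 fun i => (s.1 i).1 + MvPolynomial.X i * s.2.1) x * ev (w.2 a).1 x
          ∂(surf d) := rfl

/-- A Raviart–Thomas field `p + x q` whose moments all vanish is zero. -/
lemma eq_of_rtForm_eq_zero (hd : 1 ≤ d) (hγ : 0 < γ) (hT : IsRegular γ T) {k : ℕ} (hk : 1 ≤ k)
    {s : (Fin d → P d k) × P d k} (hs : rtForm hT.simplex hd k s = 0) (i : Fin d) :
    (s.1 i).1 + MvPolynomial.X i * s.2.1 = 0 := by
  set r : Fin d → Poly d := fun i => (s.1 i).1 + MvPolynomial.X i * s.2.1 with hr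
  have hR : InRT k r := ⟨fun i => (s.1 i).1, s.2.1, fun i => (s.1 i).2, s.2.2, fun i => rfl⟩
  obtain ⟨C, -, h⟩ := exists_nm_rt_le hd hk hγ
  have h1 : ∀ w : Fin d → Poly d, (∀ i, w i ∈ P d (k - 1)) →
      ∫ x in hull T, ∑ i, ev (r i) x * ev (w i) x = 0 := by
    intro w hw
    have := LinearMap.congr_fun hs (fun i => ⟨w i, hw i⟩, 0)
    rw [rtForm_apply] at this
    simp only [Pi.zero_apply, ZeroMemClass.coe_zero, ev_zero, mul_zero,
      integral_zero, Finset.sum_const_zero, add_zero, LinearMap.zero_apply] at this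
    rw [integral_finsetSum _ fun i _ => integrable_hull T (by fun_prop)]
    exact this
  have h2 : ∀ a ∈ T, nm ((surf d).restrict (hull (opp T a))) (ev (ncomp T a r)) = 0 := by
    intro a ha
    obtain ⟨D, hD, hDe⟩ := exists_ncomp_eq hT.simplex hd ha hR
    have := LinearMap.congr_fun hs (0, Pi.single ⟨a, ha⟩ ⟨D, hD⟩)
    rw [rtForm_apply, Finset.sum_eq_single (⟨a, ha⟩ : T)] at this
    · simp only [Pi.zero_apply, ZeroMemClass.coe_zero, ev_zero, mul_zero,
        integral_zero, Finset.sum_const_zero, zero_add, LinearMap.zero_apply,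
        Pi.single_eq_same] at this
      rw [nm, Real.sqrt_eq_zero', ← this]
      refine le_of_eq (setIntegral_congr_fun (measurableSet_hull _) fun x hx => ?_)
      simp only [← hDe x hx, pow_two]
      rfl
    · intro b _ hb
      simp [Pi.single_eq_of_ne hb]
    · simp
  refine eq_zero_of_nm_eq_zero (isCompact_hull T) (interior_hull_nonempty hγ hd hT) (p := r i) ?_
  refine le_antisymm ((h T hT r hR h1 i).trans ?_) nm_nonneg
  rw [Finset.sum_eq_zero h2, mul_zero, mul_zero]

lemma mem_P_pred_of_X_mul (k : ℕ) (hk : 1 ≤ k) (i : Fin d) {q : Poly d}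
    (h : MvPolynomial.X i * q ∈ P d k) : q ∈ P d (k - 1) := by
  by_cases hq : q = 0
  · rw [hq]; exact zero_mem _
  rw [mem_P, MvPolynomial.totalDegree_mul_of_isDomain (MvPolynomial.X_ne_zero i) hq,
    MvPolynomial.totalDegree_X] at h
  rw [mem_P]
  omega

/-- The functionals arising from the moments of Raviart–Thomas fields are all those that vanish on
the facet polynomials which are zero on their facets. The proof counts dimensions. -/
lemma exists_rtForm_eq (hd : 1 ≤ d) (hγ : 0 < γ) (hT : IsRegular γ T) {k : ℕ} (hk : 1 ≤ k)
    (ℓ : Dual ℝ ((Fin d → P d (k - 1)) × (T → P d k)))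
    (hℓ : ∀ φ : T → P d k, (∀ a : T, ∀ x ∈ hull (opp T a.1), ev (φ a).1 x = 0) → ℓ (0, φ) = 0) :
    ∃ s, rtForm hT.simplex hd k s = ℓ := by
  have hLm : ∀ (a : T) (z : P d (k - 1)), affPoly (bary T a.1) * z.1 ∈ P d k := fun a z => by
    have := mul_mem_P (affPoly_mem (bary T a.1)) z.2
    rwa [show 1 + (k - 1) = k by omega] at this
  -- By `exists_sub_slide` these are the facet polynomials `λ_a z` which vanish on their facets.
  let M : (T → P d (k - 1)) →ₗ[ℝ] ((Fin d → P d (k - 1)) × (T → P d k)) :=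
    { toFun := fun z => (0, fun a => ⟨affPoly (bary T a.1) * (z a).1, hLm a (z a)⟩)
      map_add' := fun z z' => by
        ext <;> simp [mul_add]
      map_smul' := fun c z => by
        ext <;> simp }
  have hMvan : ∀ z (a : T), ∀ x ∈ hull (opp T a.1), ev ((M z).2 a).1 x = 0 := by
    intro z a x hx
    change ev (affPoly (bary T a.1) * (z a).1) x = 0
    rw [ev_mul, ev_affPoly, ((mem_hull_opp hT.simplex a.2).1 hx).1, zero_mul]
  have hMinj : Function.Injective M := by
    rw [← LinearMap.ker_eq_bot, LinearMap.ker_eq_bot']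
    intro z hz
    ext a : 1
    have h1 : affPoly (bary T a.1) * (z a).1 = 0 := by
      have := congrArg (fun w => (w.2 a).1) hz
      simpa [M] using this
    rcases mul_eq_zero.1 h1 with h2 | h2
    · exfalso
      have h3 := ev_affPoly (bary T a.1) a.1
      rw [h2, bary_self hT.simplex a.2, ev_zero] at h3
      exact zero_ne_one h3
    · exact Subtype.ext h2
  set B := rtForm hT.simplex hd k with hB
  have hle : LinearMap.range B ≤ (LinearMap.range M).dualAnnihilator := by
    rintro _ ⟨s, rfl⟩
    rw [Submodule.mem_dualAnnihilator]
    rintro _ ⟨z, rfl⟩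
    rw [hB, rtForm_apply]
    have h1 : ∀ a : T, ∫ x in hull (opp T a.1),
        ev (ncomp T a.1 fun i => (s.1 i).1 + MvPolynomial.X i * s.2.1) x * ev ((M z).2 a).1 x
          ∂(surf d) = 0 := by
      intro a
      refine setIntegral_eq_zero_of_forall_eq_zero fun x hx => ?_
      rw [hMvan z a x hx, mul_zero]
    rw [Finset.sum_eq_zero fun a _ => h1 a]
    simp [M]
  -- The kernel of `B` consists of the pairs `(-x q, q)` with `q` of degree at most `k - 1`.
  have hker : finrank ℝ (LinearMap.ker B) ≤ finrank ℝ (P d (k - 1)) := by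
    have hs : ∀ s : LinearMap.ker B, ∀ i, (s.1.1 i).1 + MvPolynomial.X i * s.1.2.1 = 0 := fun s i =>
      eq_of_rtForm_eq_zero hd hγ hT hk (LinearMap.mem_ker.1 s.2) i
    have hq : ∀ s : LinearMap.ker B, s.1.2.1 ∈ P d (k - 1) := fun s => by
      refine mem_P_pred_of_X_mul k hk ⟨0, hd⟩ ?_
      rw [eq_neg_of_add_eq_zero_right (hs s ⟨0, hd⟩)]
      exact neg_mem (s.1.1 _).2
    let J : LinearMap.ker B →ₗ[ℝ] P d (k - 1) :=
      { toFun := fun s => ⟨s.1.2.1, hq s⟩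
        map_add' := fun s s' => rfl
        map_smul' := fun c s => rfl }
    refine LinearMap.finrank_le_finrank_of_injective (f := J) ?_
    intro s s' h0
    have h1 : s.1.2.1 = s'.1.2.1 := congrArg (fun z : P d (k - 1) => z.1) h0
    have h2 : ∀ i, (s.1.1 i).1 = (s'.1.1 i).1 := fun i => by
      rw [eq_neg_of_add_eq_zero_left (hs s i), eq_neg_of_add_eq_zero_left (hs s' i), h1]
    refine Subtype.ext (Prod.ext (funext fun i => Subtype.ext (h2 i)) (Subtype.ext h1))
  have hcard : Fintype.card T = d + 1 := by rw [Fintype.card_coe, hT.simplex.card]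
  -- Both sides have dimension `(d + 1) dim P_k - dim P_{k - 1}`.
  have heq : LinearMap.range B = (LinearMap.range M).dualAnnihilator := by
    refine Submodule.eq_of_le_of_finrank_le hle ?_
    have h1 := Subspace.finrank_add_finrank_dualAnnihilator_eq (LinearMap.range M)
    rw [LinearMap.finrank_range_of_inj hMinj] at h1
    have h2 := LinearMap.finrank_range_add_finrank_ker B
    simp only [Module.finrank_prod, Module.finrank_pi_fintype, Finset.sum_const, Finset.card_univ,
      hcard, Fintype.card_fin, smul_eq_mul] at h1 h2
    nlinarith
  have hmem : ℓ ∈ LinearMap.range B := by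
    rw [heq, Submodule.mem_dualAnnihilator]
    rintro _ ⟨z, rfl⟩
    exact hℓ _ (hMvan z)
  exact hmem

/-- The displacement reconstruction exists. -/
lemma exists_isReconstruction (hd : 1 ≤ d) (hγ : 0 < γ) (hT : IsRegular γ T) {k : ℕ} (hk : 1 ≤ k)
    (v : WeakFun d) : ∃ r, IsReconstruction k v T r := by
  have hi1 : ∀ p q : Poly d, IntegrableOn (fun x => ev p x * ev q x) (hull T) := fun p q =>
    integrable_hull T (by fun_prop)
  have hi2 : ∀ (a : T) (p q : Poly d),
      IntegrableOn (fun x => ev p x * ev q x) (hull (opp T a.1)) (surf d) := fun a p q =>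
    integrable_facet hT.simplex hd a.2 (by fun_prop)
  let ℓ : Dual ℝ ((Fin d → P d (k - 1)) × (T → P d k)) :=
    { toFun := fun w => (∑ i, ∫ x in hull T, ev (v.1 T i) x * ev (w.1 i).1 x)
        + ∑ a : T, ∫ x in hull (opp T a.1), ev (ncomp T a.1 (v.2 (opp T a.1))) x * ev (w.2 a).1 x
          ∂(surf d)
      map_add' := fun w w' => by
        have h1 : ∀ i, ∫ x in hull T, ev (v.1 T i) x * ev ((w + w').1 i).1 x
            = (∫ x in hull T, ev (v.1 T i) x * ev (w.1 i).1 x)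
              + ∫ x in hull T, ev (v.1 T i) x * ev (w'.1 i).1 x := by
          intro i
          rw [← integral_add (hi1 _ _) (hi1 _ _)]
          congr 1; ext x; simp; ring
        have h2 : ∀ a : T, ∫ x in hull (opp T a.1), ev (ncomp T a.1 (v.2 (opp T a.1))) x
              * ev ((w + w').2 a).1 x ∂(surf d)
            = (∫ x in hull (opp T a.1), ev (ncomp T a.1 (v.2 (opp T a.1))) x * ev (w.2 a).1 x
              ∂(surf d)) + ∫ x in hull (opp T a.1), ev (ncomp T a.1 (v.2 (opp T a.1))) x
                * ev (w'.2 a).1 x ∂(surf d) := by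
          intro a
          rw [← integral_add (hi2 a _ _) (hi2 a _ _)]
          congr 1; ext x; simp; ring
        simp only [h1, h2, Finset.sum_add_distrib]
        ring
      map_smul' := fun c w => by
        have h1 : ∀ i, ∫ x in hull T, ev (v.1 T i) x * ev ((c • w).1 i).1 x
            = c * (∫ x in hull T, ev (v.1 T i) x * ev (w.1 i).1 x) := by
          intro i
          rw [← integral_const_mul]
          congr 1; ext x; simp; ring
        have h2 : ∀ a : T, ∫ x in hull (opp T a.1), ev (ncomp T a.1 (v.2 (opp T a.1))) x
              * ev ((c • w).2 a).1 x ∂(surf d)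
            = c * (∫ x in hull (opp T a.1), ev (ncomp T a.1 (v.2 (opp T a.1))) x * ev (w.2 a).1 x
              ∂(surf d)) := by
          intro a
          rw [← integral_const_mul]
          congr 1; ext x; simp; ring
        simp only [h1, h2, ← Finset.mul_sum, ← mul_add, smul_eq_mul, RingHom.id_apply] }
  obtain ⟨s, hs⟩ := exists_rtForm_eq hd hγ hT hk ℓ (by
    intro φ hφ
    have h1 : ∀ a : T, ∫ x in hull (opp T a.1), ev (ncomp T a.1 (v.2 (opp T a.1))) x
        * ev (φ a).1 x ∂(surf d) = 0 := fun a =>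
      setIntegral_eq_zero_of_forall_eq_zero fun x hx => by rw [hφ a x hx, mul_zero]
    change (∑ i, ∫ x in hull T, ev (v.1 T i) x * ev (0 : P d (k - 1)).1 x) + _ = 0
    rw [Finset.sum_eq_zero fun a _ => h1 a]
    simp)
  refine ⟨fun i => (s.1 i).1 + MvPolynomial.X i * s.2.1, ⟨fun i => (s.1 i).1, s.2.1,
    fun i => (s.1 i).2, s.2.2, fun i => rfl⟩, fun w hw => ?_, fun a ha φ hφ => ?_⟩
  · have := LinearMap.congr_fun hs (fun i => ⟨w i, hw i⟩, 0)
    rw [rtForm_apply] at this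
    rw [integral_finsetSum _ fun i _ => hi1 _ _, integral_finsetSum _ fun i _ => hi1 _ _]
    simpa [ℓ] using this
  · have := LinearMap.congr_fun hs (0, Pi.single ⟨a, ha⟩ ⟨φ, hφ⟩)
    rw [rtForm_apply, Finset.sum_eq_single (⟨a, ha⟩ : T) _ (by simp)] at this
    · have h2 : ℓ (0, Pi.single ⟨a, ha⟩ ⟨φ, hφ⟩) = ∫ x in hull (opp T a),
          ev (ncomp T a (v.2 (opp T a))) x * ev φ x ∂(surf d) := by
        change (∑ i, ∫ x in hull T, ev (v.1 T i) x * ev (0 : P d (k - 1)).1 x) + _ = _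
        rw [Finset.sum_eq_single (⟨a, ha⟩ : T) _ (by simp)]
        · simp
        · intro b _ hb
          simp [Pi.single_eq_of_ne hb]
      rw [h2] at this
      simp only [← ev_ncomp]
      simpa using this
    · intro b _ hb
      simp [Pi.single_eq_of_ne hb]

end existence

/-! ### The weak operators and the reconstruction -/

section weak_operators

variable {γ : ℝ} {T : Finset (E d)}

/-- On an element every linear functional on polynomials is represented, since a polynomial
vanishing almost everywhere there is zero. -/
lemma represent_hull_spec (hd : 1 ≤ d) (hγ : 0 < γ) (hT : IsRegular γ T) {m : ℕ}
    {ℓ : Poly d → ℝ} (hadd : ∀ φ ψ, ℓ (φ + ψ) = ℓ φ + ℓ ψ)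
    (hsmul : ∀ (c : ℝ) φ, ℓ (c • φ) = c * ℓ φ) :
    represent m (hull T) volume ℓ ∈ P d m ∧
      ∀ φ ∈ P d m, ∫ x in hull T, ev (represent m (hull T) volume ℓ) x * ev φ x = ℓ φ := by
  refine represent_spec (isCompact_hull T) (isCompact_hull T).measure_lt_top hadd hsmul
    fun φ hφ => ?_
  rw [eq_zero_of_ae_eq_zero (interior_hull_nonempty hγ hd hT) hφ]
  simpa using hsmul 0 0

/-- Polynomials of degree at most `m` with the same moments of degree `m` on an element agree. -/
lemma eq_of_forall_integral_eq (hd : 1 ≤ d) (hγ : 0 < γ) (hT : IsRegular γ T) {m : ℕ}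
    {p q : Poly d} (hp : p ∈ P d m) (hq : q ∈ P d m)
    (h : ∀ φ ∈ P d m, ∫ x in hull T, ev p x * ev φ x = ∫ x in hull T, ev q x * ev φ x) : p = q := by
  rw [← sub_eq_zero]
  refine eq_zero_of_nm_eq_zero (isCompact_hull T) (interior_hull_nonempty hγ hd hT) ?_
  have h1 := h (p - q) (sub_mem hp hq)
  rw [nm, Real.sqrt_eq_zero']
  have h2 : (fun x => ev (p - q) x ^ 2)
      = fun x => ev p x * ev (p - q) x - ev q x * ev (p - q) x := by
    ext x
    rw [ev_sub]
    ring
  rw [h2, integral_sub (integrable_hull T (by fun_prop)) (integrable_hull T (by fun_prop)), h1,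
    sub_self]

lemma weakGrad_spec (hd : 1 ≤ d) (hγ : 0 < γ) (hT : IsRegular γ T) (k : ℕ) (v : WeakFun d)
    (i j : Fin d) : weakGrad k v T i j ∈ P d (k - 1) ∧ ∀ φ ∈ P d (k - 1),
      ∫ x in hull T, ev (weakGrad k v T i j) x * ev φ x
        = -(∫ x in hull T, ev (v.1 T i) x * ev (MvPolynomial.pderiv j φ) x)
      + ∑ a ∈ T, ∫ x in hull (opp T a), ev (v.2 (opp T a) i) x * ev φ x * normal T a j
        ∂(surf d) := by
  refine represent_hull_spec hd hγ hT (fun φ ψ => ?_) fun c φ => ?_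
  · have h1 : ∫ x in hull T, ev (v.1 T i) x * ev (MvPolynomial.pderiv j (φ + ψ)) x
        = (∫ x in hull T, ev (v.1 T i) x * ev (MvPolynomial.pderiv j φ) x)
          + ∫ x in hull T, ev (v.1 T i) x * ev (MvPolynomial.pderiv j ψ) x := by
      rw [← integral_add (integrable_hull T (by fun_prop)) (integrable_hull T (by fun_prop))]
      congr 1; ext x; simp; ring
    have h2 : ∀ a ∈ T, ∫ x in hull (opp T a), ev (v.2 (opp T a) i) x * ev (φ + ψ) x * normal T a j
          ∂(surf d)
        = (∫ x in hull (opp T a), ev (v.2 (opp T a) i) x * ev φ x * normal T a j ∂(surf d))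
          + ∫ x in hull (opp T a), ev (v.2 (opp T a) i) x * ev ψ x * normal T a j ∂(surf d) := by
      intro a ha
      rw [← integral_add (integrable_facet hT.simplex hd ha (by fun_prop))
        (integrable_facet hT.simplex hd ha (by fun_prop))]
      congr 1; ext x; simp; ring
    rw [h1, Finset.sum_congr rfl h2, Finset.sum_add_distrib]
    ring
  · rw [mul_add, Finset.mul_sum, mul_neg, ← integral_const_mul]
    congr 1
    · congr 2; ext x; simp; ring
    · refine Finset.sum_congr rfl fun a _ => ?_
      rw [← integral_const_mul]
      congr 1; ext x; simp; ring

lemma weakDiv_spec (hd : 1 ≤ d) (hγ : 0 < γ) (hT : IsRegular γ T) (k : ℕ) (v : WeakFun d) :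
    weakDiv k v T ∈ P d k ∧ ∀ φ ∈ P d k, ∫ x in hull T, ev (weakDiv k v T) x * ev φ x
      = -(∫ x in hull T, ∑ i, ev (v.1 T i) x * ev (MvPolynomial.pderiv i φ) x)
      + ∑ a ∈ T, ∫ x in hull (opp T a), (∑ i, ev (v.2 (opp T a) i) x * normal T a i) * ev φ x
        ∂(surf d) := by
  refine represent_hull_spec hd hγ hT (fun φ ψ => ?_) fun c φ => ?_
  · have h1 : ∫ x in hull T, ∑ i, ev (v.1 T i) x * ev (MvPolynomial.pderiv i (φ + ψ)) x
        = (∫ x in hull T, ∑ i, ev (v.1 T i) x * ev (MvPolynomial.pderiv i φ) x)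
          + ∫ x in hull T, ∑ i, ev (v.1 T i) x * ev (MvPolynomial.pderiv i ψ) x := by
      rw [← integral_add (integrable_hull T (by fun_prop)) (integrable_hull T (by fun_prop))]
      congr 1; ext x; simp [mul_add, Finset.sum_add_distrib]
    have h2 : ∀ a ∈ T, ∫ x in hull (opp T a), (∑ i, ev (v.2 (opp T a) i) x * normal T a i)
          * ev (φ + ψ) x ∂(surf d)
        = (∫ x in hull (opp T a), (∑ i, ev (v.2 (opp T a) i) x * normal T a i) * ev φ x ∂(surf d))
          + ∫ x in hull (opp T a), (∑ i, ev (v.2 (opp T a) i) x * normal T a i) * ev ψ x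
            ∂(surf d) := by
      intro a ha
      rw [← integral_add (integrable_facet hT.simplex hd ha (by fun_prop))
        (integrable_facet hT.simplex hd ha (by fun_prop))]
      congr 1; ext x; rw [ev_add, mul_add]
    rw [h1, Finset.sum_congr rfl h2, Finset.sum_add_distrib]
    ring
  · rw [mul_add, Finset.mul_sum, mul_neg, ← integral_const_mul]
    congr 1
    · congr 2; ext x; rw [Finset.mul_sum]
      exact Finset.sum_congr rfl fun i _ => by simp; ring
    · refine Finset.sum_congr rfl fun a _ => ?_
      rw [← integral_const_mul]
      congr 1; ext x; rw [ev_smul]; ring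

/-- The weak gradient is the gradient plus the contribution of the jumps `v_b - v₀`. -/
lemma integral_weakGrad_mul (hd : 1 ≤ d) (hγ : 0 < γ) (hT : IsRegular γ T) (k : ℕ) (v : WeakFun d)
    (i j : Fin d) {φ : Poly d} (hφ : φ ∈ P d (k - 1)) :
    ∫ x in hull T, ev (weakGrad k v T i j) x * ev φ x
      = (∫ x in hull T, ev (MvPolynomial.pderiv j (v.1 T i)) x * ev φ x)
      - ∑ a ∈ T, ∫ x in hull (opp T a), (ev (v.1 T i) x - ev (v.2 (opp T a) i) x) * ev φ x
        * normal T a j ∂(surf d) := by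
  rw [(weakGrad_spec hd hγ hT k v i j).2 φ hφ]
  have h1 := integral_pd_mul_add hT.simplex hd (contDiff_ev (v.1 T i)) (contDiff_ev φ) j
  rw [pd_ev, pd_ev] at h1
  have h2 : ∀ a ∈ T, ∫ x in hull (opp T a), (ev (v.1 T i) x - ev (v.2 (opp T a) i) x) * ev φ x
        * normal T a j ∂(surf d)
      = (∫ x in hull (opp T a), ev (v.1 T i) x * ev φ x * normal T a j ∂(surf d))
        - ∫ x in hull (opp T a), ev (v.2 (opp T a) i) x * ev φ x * normal T a j ∂(surf d) := by
    intro a ha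
    rw [← integral_sub (integrable_facet hT.simplex hd ha (by fun_prop))
      (integrable_facet hT.simplex hd ha (by fun_prop))]
    congr 1; ext x; ring
  rw [h1, Finset.sum_congr rfl h2, Finset.sum_sub_distrib]
  ring

lemma weakGrad_sub (hd : 1 ≤ d) (hγ : 0 < γ) (hT : IsRegular γ T) (k : ℕ) (v w : WeakFun d)
    (i j : Fin d) : weakGrad k (v - w) T i j = weakGrad k v T i j - weakGrad k w T i j := by
  obtain ⟨h1, h1'⟩ := weakGrad_spec hd hγ hT k (v - w) i j
  obtain ⟨h2, h2'⟩ := weakGrad_spec hd hγ hT k v i j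
  obtain ⟨h3, h3'⟩ := weakGrad_spec hd hγ hT k w i j
  refine eq_of_forall_integral_eq hd hγ hT h1 (sub_mem h2 h3) fun φ hφ => ?_
  have e1 : (fun x => ev (weakGrad k v T i j - weakGrad k w T i j) x * ev φ x)
      = fun x => ev (weakGrad k v T i j) x * ev φ x - ev (weakGrad k w T i j) x * ev φ x := by
    ext x; rw [ev_sub]; ring
  have e2 : ∫ x in hull T, ev ((v - w).1 T i) x * ev (MvPolynomial.pderiv j φ) x
      = (∫ x in hull T, ev (v.1 T i) x * ev (MvPolynomial.pderiv j φ) x)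
        - ∫ x in hull T, ev (w.1 T i) x * ev (MvPolynomial.pderiv j φ) x := by
    rw [← integral_sub (integrable_hull T (by fun_prop)) (integrable_hull T (by fun_prop))]
    congr 1; ext x; simp; ring
  have e3 : ∀ a ∈ T, ∫ x in hull (opp T a), ev ((v - w).2 (opp T a) i) x * ev φ x * normal T a j
        ∂(surf d)
      = (∫ x in hull (opp T a), ev (v.2 (opp T a) i) x * ev φ x * normal T a j ∂(surf d))
        - ∫ x in hull (opp T a), ev (w.2 (opp T a) i) x * ev φ x * normal T a j ∂(surf d) := by
    intro a ha
    rw [← integral_sub (integrable_facet hT.simplex hd ha (by fun_prop))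
      (integrable_facet hT.simplex hd ha (by fun_prop))]
    congr 1; ext x; simp; ring
  rw [e1, integral_sub (integrable_hull T (by fun_prop)) (integrable_hull T (by fun_prop)),
    h1' φ hφ, h2' φ hφ, h3' φ hφ, e2, Finset.sum_congr rfl e3, Finset.sum_sub_distrib]
  ring

lemma weakDiv_sub (hd : 1 ≤ d) (hγ : 0 < γ) (hT : IsRegular γ T) (k : ℕ) (v w : WeakFun d) :
    weakDiv k (v - w) T = weakDiv k v T - weakDiv k w T := by
  obtain ⟨h1, h1'⟩ := weakDiv_spec hd hγ hT k (v - w)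
  obtain ⟨h2, h2'⟩ := weakDiv_spec hd hγ hT k v
  obtain ⟨h3, h3'⟩ := weakDiv_spec hd hγ hT k w
  refine eq_of_forall_integral_eq hd hγ hT h1 (sub_mem h2 h3) fun φ hφ => ?_
  have e1 : (fun x => ev (weakDiv k v T - weakDiv k w T) x * ev φ x)
      = fun x => ev (weakDiv k v T) x * ev φ x - ev (weakDiv k w T) x * ev φ x := by
    ext x; rw [ev_sub]; ring
  have e2 : ∫ x in hull T, ∑ i, ev ((v - w).1 T i) x * ev (MvPolynomial.pderiv i φ) x
      = (∫ x in hull T, ∑ i, ev (v.1 T i) x * ev (MvPolynomial.pderiv i φ) x)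
        - ∫ x in hull T, ∑ i, ev (w.1 T i) x * ev (MvPolynomial.pderiv i φ) x := by
    rw [← integral_sub (integrable_hull T (by fun_prop)) (integrable_hull T (by fun_prop))]
    congr 1; ext x; rw [← Finset.sum_sub_distrib]
    exact Finset.sum_congr rfl fun i _ => by simp; ring
  have e3 : ∀ a ∈ T, ∫ x in hull (opp T a), (∑ i, ev ((v - w).2 (opp T a) i) x * normal T a i)
        * ev φ x ∂(surf d)
      = (∫ x in hull (opp T a), (∑ i, ev (v.2 (opp T a) i) x * normal T a i) * ev φ x ∂(surf d))
        - ∫ x in hull (opp T a), (∑ i, ev (w.2 (opp T a) i) x * normal T a i) * ev φ x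
          ∂(surf d) := by
    intro a ha
    rw [← integral_sub (integrable_facet hT.simplex hd ha (by fun_prop))
      (integrable_facet hT.simplex hd ha (by fun_prop))]
    congr 1; ext x; rw [← sub_mul, ← Finset.sum_sub_distrib]
    congr 1
    exact Finset.sum_congr rfl fun i _ => by simp; ring
  rw [e1, integral_sub (integrable_hull T (by fun_prop)) (integrable_hull T (by fun_prop)),
    h1' φ hφ, h2' φ hφ, h3' φ hφ, e2, Finset.sum_congr rfl e3, Finset.sum_sub_distrib]
  ring

lemma reconstruct_spec (hd : 1 ≤ d) (hγ : 0 < γ) (hT : IsRegular γ T) {k : ℕ} (hk : 1 ≤ k)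
    (v : WeakFun d) : IsReconstruction k v T (reconstruct k v T) := by
  have h := exists_isReconstruction hd hγ hT hk v
  unfold reconstruct
  rw [dif_pos h]
  exact h.choose_spec

variable {k : ℕ} {v : WeakFun d}

lemma integral_reconstruct_mul (hd : 1 ≤ d) (hγ : 0 < γ) (hT : IsRegular γ T) (hk : 1 ≤ k)
    (v : WeakFun d) (i : Fin d) {w : Poly d} (hw : w ∈ P d (k - 1)) :
    ∫ x in hull T, ev (reconstruct k v T i) x * ev w x
      = ∫ x in hull T, ev (v.1 T i) x * ev w x := by
  have h := (reconstruct_spec hd hγ hT hk v).interior (Pi.single i w) fun l => by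
    by_cases hl : l = i
    · subst hl; simpa using hw
    · rw [Pi.single_eq_of_ne hl]; exact zero_mem _
  have h1 : ∀ (f : Fin d → Poly d) (x : E d),
      ∑ l, ev (f l) x * ev ((Pi.single i w : Fin d → Poly d) l) x
      = ev (f i) x * ev w x := by
    intro f x
    rw [Finset.sum_eq_single i, Pi.single_eq_same]
    · intro l _ hl
      rw [Pi.single_eq_of_ne hl, ev_zero, mul_zero]
    · simp
  simpa only [h1] using h

/-- The normal components of the reconstruction are those of `v_b`. -/
lemma ncomp_reconstruct_ae (hd : 1 ≤ d) (hγ : 0 < γ) (hT : IsRegular γ T) (hk : 1 ≤ k)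
    {a : E d} (ha : a ∈ T) (hv : ∀ i, v.2 (opp T a) i ∈ P d k) :
    ev (ncomp T a (reconstruct k v T)) =ᵐ[(surf d).restrict (hull (opp T a))]
      ev (ncomp T a (v.2 (opp T a))) := by
  have hr := reconstruct_spec hd hγ hT hk v
  obtain ⟨D, hD, hDe⟩ := exists_ncomp_eq hT.simplex hd ha hr.mem
  set q := D - ncomp T a (v.2 (opp T a)) with hq
  have hqP : q ∈ P d k := sub_mem hD (sum_mem fun i _ => Submodule.smul_mem _ _ (hv i))
  have hqe : ∀ x ∈ hull (opp T a), ev q x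
      = ev (ncomp T a (reconstruct k v T)) x - ev (ncomp T a (v.2 (opp T a))) x := by
    intro x hx
    rw [hq, ev_sub, hDe x hx]
  have h1 : nm ((surf d).restrict (hull (opp T a))) (ev q) = 0 := by
    have h2 := hr.facet a ha q hqP
    simp only [← ev_ncomp] at h2
    rw [nm, Real.sqrt_eq_zero', ← sub_self (∫ x in hull (opp T a),
      ev (ncomp T a (v.2 (opp T a))) x * ev q x ∂(surf d))]
    nth_rewrite 1 [← h2]
    rw [← integral_sub (integrable_facet hT.simplex hd ha (by fun_prop))
      (integrable_facet hT.simplex hd ha (by fun_prop))]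
    refine le_of_eq (setIntegral_congr_fun (measurableSet_hull _) fun x hx => ?_)
    simp only [hqe x hx]
    ring
  have h2 := ae_eq_zero_of_nm_eq_zero (memLp_facet hT.simplex hd ha (continuous_ev q)) h1
  filter_upwards [h2, ae_restrict_mem (measurableSet_hull _)] with x hx hxm
  rw [hqe x hxm] at hx
  exact sub_eq_zero.1 hx

/-- The divergence of the reconstruction is the weak divergence. -/
lemma pdiv_reconstruct (hd : 1 ≤ d) (hγ : 0 < γ) (hT : IsRegular γ T) (hk : 1 ≤ k)
    (v : WeakFun d) : pdiv (reconstruct k v T) = weakDiv k v T := by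
  have hr := reconstruct_spec hd hγ hT hk v
  obtain ⟨h1, h1'⟩ := weakDiv_spec hd hγ hT k v
  refine eq_of_forall_integral_eq hd hγ hT (pdiv_mem_of_inRT hk hr.mem) h1 fun φ hφ => ?_
  rw [h1' φ hφ, integral_pdiv_mul hT.simplex hd,
    hr.interior (fun i => MvPolynomial.pderiv i φ) fun i => pderiv_mem_P hφ i]
  congr 1
  refine Finset.sum_congr rfl fun a ha => ?_
  rw [← hr.facet a ha φ hφ]
  simp only [ev_ncomp]

/-- The reconstruction differs from `v₀` by the jumps of the normal components. -/
lemma exists_nm_reconstruct_sub_le (hd : 1 ≤ d) {k : ℕ} (hk : 1 ≤ k) (hγ : 0 < γ) :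
    ∃ C : ℝ, 0 < C ∧ ∀ T : Finset (E d), IsRegular γ T → ∀ v : WeakFun d,
      (∀ i, v.1 T i ∈ P d k) → (∀ a ∈ T, ∀ i, v.2 (opp T a) i ∈ P d k) →
      ∀ i, nm (volume.restrict (hull T)) (fun x => ev (reconstruct k v T i) x - ev (v.1 T i) x)
        ≤ C * (√(diam T) * ∑ a ∈ T, ∑ i, nm ((surf d).restrict (hull (opp T a)))
          fun x => ev (v.1 T i) x - ev (v.2 (opp T a) i) x) := by
  obtain ⟨C, hC, h⟩ := exists_nm_rt_le (d := d) hd hk hγ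
  refine ⟨C, hC, fun T hT v hv0 hvb i => ?_⟩
  have hr := reconstruct_spec hd hγ hT hk v
  set r : Fin d → Poly d := fun i => reconstruct k v T i - v.1 T i with hrdef
  have hR : InRT k r := by
    obtain ⟨p, q, hp, hq, hpq⟩ := hr.mem
    refine ⟨fun i => p i - v.1 T i, q, fun i => sub_mem (hp i) (hv0 i), hq, fun i => ?_⟩
    rw [hrdef]
    simp only [hpq]
    ring
  have h1 := h T hT r hR (fun w hw => by
    rw [integral_finsetSum _ fun i _ => integrable_hull T (by fun_prop)]
    refine Finset.sum_eq_zero fun i _ => ?_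
    have h2 : (fun x => ev (r i) x * ev (w i) x) = fun x =>
        ev (reconstruct k v T i) x * ev (w i) x - ev (v.1 T i) x * ev (w i) x := by
      ext x; rw [hrdef]; simp only [ev_sub]; ring
    rw [h2, integral_sub (integrable_hull T (by fun_prop)) (integrable_hull T (by fun_prop)),
      integral_reconstruct_mul hd hγ hT hk v i (hw i), sub_self]) i
  have h2 : (fun x => ev (reconstruct k v T i) x - ev (v.1 T i) x) = ev (r i) := by
    ext x; simp [hrdef]
  rw [h2]
  refine h1.trans ?_
  gcongr with a ha
  have h3 : ev (ncomp T a r) =ᵐ[(surf d).restrict (hull (opp T a))]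
      fun x => ∑ i, -normal T a i * (ev (v.1 T i) x - ev (v.2 (opp T a) i) x) := by
    filter_upwards [ncomp_reconstruct_ae hd hγ hT hk ha (hvb a ha)] with x hx
    have h4 : ev (ncomp T a r) x
        = ev (ncomp T a (reconstruct k v T)) x - ev (ncomp T a (v.1 T)) x := by
      rw [ev_ncomp, ev_ncomp, ev_ncomp, ← Finset.sum_sub_distrib]
      exact Finset.sum_congr rfl fun i _ => by rw [hrdef]; simp only [ev_sub]; ring
    rw [h4, hx, ev_ncomp, ev_ncomp, ← Finset.sum_sub_distrib]
    exact Finset.sum_congr rfl fun i _ => by ring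
  have hm : ∀ i, MemLp (fun x => ev (v.1 T i) x - ev (v.2 (opp T a) i) x) 2
      ((surf d).restrict (hull (opp T a))) := fun i =>
    memLp_facet hT.simplex hd ha (by fun_prop)
  rw [nm_congr_ae h3]
  refine (nm_sum_le _ _ fun i _ => (hm i).const_mul _).trans (Finset.sum_le_sum fun i _ => ?_)
  rw [nm_const_mul, abs_neg]
  exact mul_le_of_le_one_left nm_nonneg (abs_normal_le hT.simplex hd ha i)

end weak_operators

/-! ### The Poincaré inequality on convex sets -/

section poincare

variable {K : Set (E d)} {φ : E d → ℝ}

lemma integrable_prod_of_continuous {X Y : Type*} [TopologicalSpace X] [TopologicalSpace Y]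
    [MeasurableSpace X] [MeasurableSpace Y] [OpensMeasurableSpace X] [OpensMeasurableSpace Y]
    [BorelSpace (X × Y)] [SecondCountableTopologyEither X Y] [T2Space X] [T2Space Y]
    {μ : Measure X} {ν : Measure Y} [SFinite μ] [SFinite ν] [IsFiniteMeasureOnCompacts (μ.prod ν)]
    {A : Set X} {B : Set Y} (hA : IsCompact A) (hB : IsCompact B) {f : X × Y → ℝ}
    (hf : Continuous f) : Integrable f ((μ.restrict A).prod (ν.restrict B)) := by
  rw [Measure.prod_restrict]
  exact hf.continuousOn.integrableOn_compact (hA.prod hB)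

/-- A contraction towards a point of a convex set by a factor `t ≥ 1/2` increases the integral of a
nonnegative function at most by the factor `2 ^ d`. -/
lemma setIntegral_contraction_le (hK : IsCompact K) (hc : Convex ℝ K) {g : E d → ℝ}
    (hg : Continuous g) (hg0 : ∀ x, 0 ≤ g x) {y : E d} (hy : y ∈ K) {t : ℝ} (ht : 1 / 2 ≤ t)
    (ht1 : t ≤ 1) :
    ∫ x in K, g ((1 - t) • y + t • x) ≤ 2 ^ d * ∫ x in K, g x := by
  have ht0 : 0 < t := by linarith
  have h1 := setIntegral_comp_homothety g K hK.measurableSet ((1 - t) • y) ht0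
  have hsub : K ⊆ (fun x => (1 - t) • y + t • x) ⁻¹' K := fun x hx =>
    hc hy hx (by linarith) ht0.le (by ring)
  have hcomp : IsCompact ((fun x => (1 - t) • y + t • x) ⁻¹' K) := by
    have h2 : (fun x => (1 - t) • y + t • x) ⁻¹' K
        = (fun x => t⁻¹ • (x - (1 - t) • y)) '' K := by
      ext x
      constructor
      · intro hx
        refine ⟨_, hx, ?_⟩
        simp [smul_smul, inv_mul_cancel₀ ht0.ne']
      · rintro ⟨z, hz, rfl⟩
        simpa [smul_smul, mul_inv_cancel₀ ht0.ne'] using hz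
    rw [h2]
    exact hK.image (by fun_prop)
  have h3 : ∫ x in K, g ((1 - t) • y + t • x)
      ≤ ∫ x in (fun x => (1 - t) • y + t • x) ⁻¹' K, g ((1 - t) • y + t • x) :=
    setIntegral_mono_set ((by fun_prop : Continuous fun x => g ((1 - t) • y + t • x)).continuousOn
      |>.integrableOn_compact hcomp) (.of_forall fun x => hg0 _) (.of_forall hsub)
  set I := ∫ x in (fun x => (1 - t) • y + t • x) ⁻¹' K, g ((1 - t) • y + t • x) with hI
  have hI0 : 0 ≤ I := integral_nonneg fun x => hg0 _
  refine h3.trans ?_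
  rw [h1, ← mul_assoc, ← mul_pow]
  refine le_mul_of_one_le_left hI0 (one_le_pow₀ (by linarith))

/-- The mean value inequality along a segment, in integrated form. -/
lemma sq_sub_le_integral (hφ : ContDiff ℝ ∞ φ) (x y : E d) :
    (φ x - φ y) ^ 2 ≤ ‖x - y‖ ^ 2 *
      ∫ t in Set.Icc (0 : ℝ) 1, ∑ j, pd j φ ((1 - t) • y + t • x) ^ 2 := by
  have hc : ∀ j, Continuous (pd j φ) := continuous_pd hφ
  set f' : ℝ → ℝ := fun t => ∑ j, (x - y) j * pd j φ ((1 - t) • y + t • x) with hf'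
  have hf'c : Continuous f' := by fun_prop
  have h1 : ∀ t : ℝ, HasDerivAt (fun t : ℝ => φ ((1 - t) • y + t • x)) (f' t) t := by
    intro t
    have h2 : HasDerivAt (fun t : ℝ => (1 - t) • y + t • x) (x - y) t := by
      have h3 := (((hasDerivAt_id t).const_sub 1).smul_const y).add
        ((hasDerivAt_id t).smul_const x)
      refine h3.congr_deriv ?_
      module
    have h3 := (differentiable_of_smooth hφ ((1 - t) • y + t • x)).hasFDerivAt.comp_hasDerivAt t h2
    rw [fderiv_eq_sum_pd] at h3
    exact h3
  have h2 : φ x - φ y = ∫ t in Set.Icc (0 : ℝ) 1, f' t * 1 := by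
    have h3 := intervalIntegral.integral_eq_sub_of_hasDerivAt (fun t _ => h1 t)
      (hf'c.intervalIntegrable 0 1)
    rw [intervalIntegral.integral_of_le zero_le_one, ← integral_Icc_eq_integral_Ioc] at h3
    simp only [mul_one]
    rw [h3]
    simp
  have hm : ∀ f : ℝ → ℝ, Continuous f → MemLp f 2 (volume.restrict (Set.Icc (0 : ℝ) 1)) := by
    intro f hf
    obtain ⟨C, hC⟩ := isCompact_Icc.exists_bound_of_continuousOn hf.continuousOn (s := Set.Icc 0 1)
    exact MemLp.of_bound hf.aestronglyMeasurable C
      ((ae_restrict_iff' measurableSet_Icc).2 (.of_forall hC))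
  have h4 : (φ x - φ y) ^ 2 ≤ ∫ t in Set.Icc (0 : ℝ) 1, f' t ^ 2 := by
    have h5 := abs_integral_mul_le (hm f' hf'c) (hm _ continuous_const :
      MemLp (fun _ => (1 : ℝ)) 2 _)
    rw [← h2] at h5
    have h6 : nm (volume.restrict (Set.Icc (0 : ℝ) 1)) (fun _ => 1) = 1 := by simp [nm]
    rw [h6, mul_one] at h5
    rw [← sq_abs, ← nm_sq]
    exact pow_le_pow_left₀ (abs_nonneg _) h5 2
  refine h4.trans ?_
  rw [← integral_const_mul]
  refine integral_mono (integrable_sq_of_memLp (hm f' hf'c)) ?_ fun t => ?_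
  · exact ((by fun_prop : Continuous fun t : ℝ => ‖x - y‖ ^ 2 *
      ∑ j, pd j φ ((1 - t) • y + t • x) ^ 2).continuousOn).integrableOn_compact isCompact_Icc
  · have h7 := Finset.sum_mul_sq_le_sq_mul_sq Finset.univ (fun j => (x - y) j)
      fun j => pd j φ ((1 - t) • y + t • x)
    rwa [← EuclideanSpace.real_norm_sq_eq] at h7

/-- The Poincaré inequality on a convex set for smooth functions with mean value zero. -/
lemma sq_nm_le_of_integral_eq_zero (hK : IsCompact K) (hc : Convex ℝ K)
    (hK' : (interior K).Nonempty) {h : ℝ} (hh : ∀ x ∈ K, ∀ y ∈ K, ‖x - y‖ ≤ h)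
    (hφ : ContDiff ℝ ∞ φ) (h0 : ∫ x in K, φ x = 0) :
    nm (volume.restrict K) φ ^ 2
      ≤ 2 ^ d * h ^ 2 * ∑ j, nm (volume.restrict K) (pd j φ) ^ 2 := by
  have hcφ := hφ.continuous
  have hcp : ∀ j, Continuous (pd j φ) := continuous_pd hφ
  set g : E d → ℝ := fun x => ∑ j, pd j φ x ^ 2 with hg
  have hgc : Continuous g := by fun_prop
  have hg0 : ∀ x, 0 ≤ g x := fun x => Finset.sum_nonneg fun j _ => sq_nonneg _
  set V := volume.real K with hV
  have hV0 : 0 < V := by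
    refine ENNReal.toReal_pos ?_ hK.measure_lt_top.ne
    exact ((isOpen_interior.measure_pos volume hK').trans_le (measure_mono interior_subset)).ne'
  have hInt : ∀ f : E d × E d → ℝ, Continuous f →
      Integrable f ((volume.restrict K).prod (volume.restrict K)) := fun f hf =>
    integrable_prod_of_continuous hK hK hf
  set ν := (volume.restrict K).prod (volume.restrict K) with hν
  have hν1 : ∀ᵐ z ∂ν, z.1 ∈ K ∧ z.2 ∈ K := by
    rw [hν, Measure.prod_restrict]
    filter_upwards [ae_restrict_mem (hK.measurableSet.prod hK.measurableSet)] with z hz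
    exact hz
  have hone : ∫ _ in K, (1 : ℝ) = V := by simp [hV, Measure.real]
  -- the left side
  have e1 : ∫ z, (φ z.1 - φ z.2) ^ 2 ∂ν = 2 * V * ∫ x in K, φ x ^ 2 := by
    have e2 : (fun z : E d × E d => (φ z.1 - φ z.2) ^ 2) = fun z =>
        (φ z.1 ^ 2 * (fun _ => (1 : ℝ)) z.2 - 2 * (φ z.1 * φ z.2))
          + (fun _ => (1 : ℝ)) z.1 * (fun x => φ x ^ 2) z.2 := by
      ext z; ring
    rw [e2, integral_add (hInt _ (by fun_prop)) (hInt _ (by fun_prop)),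
      integral_sub (hInt _ (by fun_prop)) (hInt _ (by fun_prop)), integral_const_mul,
      integral_prod_mul (fun x => φ x ^ 2) (fun _ => (1 : ℝ)), integral_prod_mul φ φ,
      integral_prod_mul (fun _ => (1 : ℝ)) (fun x => φ x ^ 2), h0, hone]
    ring
  -- the right side, for a fixed point of the segment
  have e3 : ∀ t ∈ Set.Icc (0 : ℝ) 1, ∫ z, g ((1 - t) • z.2 + t • z.1) ∂ν
      ≤ V * (2 ^ d * ∫ x in K, g x) := by
    intro t ht
    have hV' : V * (2 ^ d * ∫ x in K, g x) = ∫ _ in K, 2 ^ d * ∫ x in K, g x := by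
      rw [← hone, ← integral_mul_const]; simp
    rw [hV']
    have hgi := hInt (fun z => g ((1 - t) • z.2 + t • z.1)) (by fun_prop)
    -- Contract in the variable whose weight is at least `1 / 2`.
    rcases le_total (1 / 2) t with h1 | h1
    · rw [hν, integral_prod_symm _ (hInt _ (by fun_prop))]
      refine integral_mono_ae hgi.integral_prod_right
        (integrable_const_iff.2 (Or.inr ⟨by simpa using hK.measure_lt_top⟩)) ?_
      filter_upwards [ae_restrict_mem hK.measurableSet] with y hy
      exact setIntegral_contraction_le hK hc hgc hg0 hy h1 ht.2
    · rw [hν, integral_prod _ (hInt _ (by fun_prop))]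
      refine integral_mono_ae hgi.integral_prod_left
        (integrable_const_iff.2 (Or.inr ⟨by simpa using hK.measure_lt_top⟩)) ?_
      filter_upwards [ae_restrict_mem hK.measurableSet] with y hy
      have := setIntegral_contraction_le hK hc hgc hg0 hy (t := 1 - t) (by linarith)
        (by linarith [ht.1])
      refine le_trans (le_of_eq ?_) this
      congr 1
      ext x
      rw [sub_sub_cancel, add_comm]
  have e4 : ∫ z, (φ z.1 - φ z.2) ^ 2 ∂ν
      ≤ h ^ 2 * ∫ z, (∫ t in Set.Icc (0 : ℝ) 1, g ((1 - t) • z.2 + t • z.1)) ∂ν := by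
    have hI3 : Integrable (Function.uncurry fun (z : E d × E d) (t : ℝ) =>
        g ((1 - t) • z.2 + t • z.1)) (ν.prod (volume.restrict (Set.Icc (0 : ℝ) 1))) := by
      rw [hν, Measure.prod_restrict]
      refine integrable_prod_of_continuous (hK.prod hK) isCompact_Icc ?_
      unfold Function.uncurry
      fun_prop
    rw [← integral_const_mul]
    refine integral_mono_ae (hInt _ (by fun_prop)) (hI3.integral_prod_left.const_mul _) ?_
    filter_upwards [hν1] with z hz
    refine (sq_sub_le_integral hφ z.1 z.2).trans ?_
    refine mul_le_mul_of_nonneg_right (pow_le_pow_left₀ (norm_nonneg _) (hh _ hz.1 _ hz.2) 2)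
      (integral_nonneg fun t => hg0 _)
  have e5 : ∫ z, (∫ t in Set.Icc (0 : ℝ) 1, g ((1 - t) • z.2 + t • z.1)) ∂ν
      ≤ V * (2 ^ d * ∫ x in K, g x) := by
    have hI3 : Integrable (Function.uncurry fun (z : E d × E d) (t : ℝ) =>
        g ((1 - t) • z.2 + t • z.1)) (ν.prod (volume.restrict (Set.Icc (0 : ℝ) 1))) := by
      rw [hν, Measure.prod_restrict]
      refine integrable_prod_of_continuous (hK.prod hK) isCompact_Icc ?_
      unfold Function.uncurry
      fun_prop
    rw [integral_integral_swap hI3]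
    refine (integral_mono_ae hI3.integral_prod_right
      (integrable_const_iff.2 (Or.inr ⟨by simp⟩) :
        Integrable (fun _ => V * (2 ^ d * ∫ x in K, g x)) _) ?_).trans (le_of_eq ?_)
    · filter_upwards [ae_restrict_mem measurableSet_Icc] with t ht
      exact e3 t ht
    · simp
  have e6 : ∑ j, nm (volume.restrict K) (pd j φ) ^ 2 = ∫ x in K, g x := by
    rw [hg, integral_finsetSum _ fun j _ => ?_]
    · exact Finset.sum_congr rfl fun j _ => nm_sq
    · exact ((hcp j).pow 2).continuousOn.integrableOn_compact hK
  have hI0 : 0 ≤ ∫ x in K, g x := integral_nonneg hg0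
  rw [e6, nm_sq]
  have e7 : V * (2 * ∫ x in K, φ x ^ 2) ≤ V * (2 ^ d * h ^ 2 * ∫ x in K, g x) := by
    calc V * (2 * ∫ x in K, φ x ^ 2) = ∫ z, (φ z.1 - φ z.2) ^ 2 ∂ν := by rw [e1]; ring
      _ ≤ h ^ 2 * (V * (2 ^ d * ∫ x in K, g x)) := e4.trans (by gcongr)
      _ = _ := by ring
  have e8 := le_of_mul_le_mul_left e7 hV0
  have e9 : 0 ≤ ∫ x in K, φ x ^ 2 := integral_nonneg fun x => sq_nonneg _
  linarith

end poincare

/-! ### Regularisation -/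

section mollify

/-- A nonnegative smooth function of integral one supported in the ball of radius `δ`. -/
structure IsMollifier (ρ : E d → ℝ) (δ : ℝ) : Prop where
  smooth : ContDiff ℝ ∞ ρ
  nonneg : ∀ x, 0 ≤ ρ x
  integral : ∫ x, ρ x = 1
  norm_lt : ∀ x, ρ x ≠ 0 → ‖x‖ < δ

lemma exists_isMollifier {δ : ℝ} (hδ : 0 < δ) : ∃ ρ : E d → ℝ, IsMollifier ρ δ := by
  let f : ContDiffBump (0 : E d) := ⟨δ / 2, δ, by linarith, by linarith⟩
  refine ⟨f.normed volume, f.contDiff_normed, f.nonneg_normed, f.integral_normed, fun x hx => ?_⟩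
  have h : x ∈ Function.support (f.normed volume) := hx
  rw [f.support_normed_eq] at h
  simpa using h

/-- The regularisation `W ⋆ ρ`. -/
def mollify (ρ W : E d → ℝ) (y : E d) : ℝ := ∫ t, W t * ρ (y - t)

variable {ρ W : E d → ℝ} {δ : ℝ}

lemma IsMollifier.hasCompactSupport (hρ : IsMollifier ρ δ) : HasCompactSupport ρ := by
  refine HasCompactSupport.of_support_subset_isCompact (isCompact_closedBall (0 : E d) δ)
    fun x hx => ?_
  simpa using (hρ.norm_lt x hx).le

lemma IsMollifier.integrable (hρ : IsMollifier ρ δ) : Integrable ρ :=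
  hρ.smooth.continuous.integrable_of_hasCompactSupport hρ.hasCompactSupport

lemma IsMollifier.integral_translate (hρ : IsMollifier ρ δ) (y : E d) :
    ∫ t, ρ (y - t) = 1 := by
  rw [integral_sub_left_eq_self ρ volume y, hρ.integral]

lemma mollify_eq : mollify ρ W = convolution W ρ (ContinuousLinearMap.mul ℝ ℝ) volume := rfl

lemma contDiff_mollify (hρ : IsMollifier ρ δ) (hW : LocallyIntegrable W) :
    ContDiff ℝ ∞ (mollify ρ W) :=
  hρ.hasCompactSupport.contDiff_convolution_right (ContinuousLinearMap.mul ℝ ℝ) hW hρ.smooth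

lemma pd_mollify (hρ : IsMollifier ρ δ) (hW : LocallyIntegrable W) (j : Fin d) (y : E d) :
    pd j (mollify ρ W) y = ∫ t, W t * pd j ρ (y - t) := by
  have h1 : ContDiff ℝ 1 ρ := hρ.smooth.of_le (by exact_mod_cast (le_top : (1 : ℕ∞) ≤ ⊤))
  have h := hρ.hasCompactSupport.hasFDerivAt_convolution_right (ContinuousLinearMap.mul ℝ ℝ) hW h1 y
  unfold pd
  rw [mollify_eq, h.fderiv, convolution_precompR_apply _ hW (hρ.hasCompactSupport.fderiv ℝ)
    (h1.continuous_fderiv one_ne_zero)]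
  rfl

/-- Jensen's inequality for the average defining the regularisation. -/
lemma sq_mollify_le (hρ : IsMollifier ρ δ) (hW : MemLp W 2) (y : E d) :
    mollify ρ W y ^ 2 ≤ mollify ρ (fun x => W x ^ 2) y := by
  have hc : Continuous fun t => ρ (y - t) := hρ.smooth.continuous.comp (by fun_prop)
  have hρi : Integrable fun t => ρ (y - t) := hρ.integrable.comp_sub_left y
  have hsq : ∀ t, √(ρ (y - t)) ^ 2 = ρ (y - t) := fun t => Real.sq_sqrt (hρ.nonneg _)
  have h1 : MemLp (fun t => √(ρ (y - t))) 2 := by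
    refine (memLp_two_iff_integrable_sq (Real.continuous_sqrt.comp hc).aestronglyMeasurable).2 ?_
    simpa only [Function.comp_def, hsq] using hρi
  obtain ⟨B, hB⟩ := hρ.hasCompactSupport.exists_bound_of_continuous hρ.smooth.continuous
  have h2i : Integrable fun t => W t ^ 2 * ρ (y - t) :=
    (integrable_sq_of_memLp hW).mul_bdd hc.aestronglyMeasurable (.of_forall fun t => hB _)
  -- Cauchy–Schwarz for the factors `W √ρ` and `√ρ`.
  have h2 : MemLp (fun t => W t * √(ρ (y - t))) 2 := by
    refine (memLp_two_iff_integrable_sq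
      (hW.1.mul (Real.continuous_sqrt.comp hc).aestronglyMeasurable)).2 ?_
    refine h2i.congr (.of_forall fun t => ?_)
    simp only [Pi.mul_apply, Function.comp_apply, mul_pow, hsq]
  have h3 := abs_integral_mul_le h2 h1
  have h4 : ∫ t, W t * √(ρ (y - t)) * √(ρ (y - t)) = mollify ρ W y := by
    unfold mollify
    congr 1
    ext t
    rw [mul_assoc, ← pow_two, hsq]
  have h5 : nm volume (fun t => √(ρ (y - t))) = 1 := by
    simp only [nm, hsq, hρ.integral_translate y, Real.sqrt_one]
  rw [h4, h5, mul_one] at h3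
  have h6 : nm volume (fun t => W t * √(ρ (y - t))) ^ 2 = mollify ρ (fun x => W x ^ 2) y := by
    rw [nm_sq]
    unfold mollify
    congr 1
    ext t
    rw [mul_pow, hsq]
  rw [← h6, ← sq_abs]
  exact pow_le_pow_left₀ (abs_nonneg _) h3 2

variable {s : ℝ}

/-- Regularisation after a dilation is bounded on `L²`. -/
lemma nm_mollify_le (hρ : IsMollifier ρ δ) (hW : MemLp W 2) (b : E d) (hs : 1 / 2 ≤ s)
    (K : Set (E d)) :
    nm (volume.restrict K) (fun x => mollify ρ W (b + s • x)) ^ 2 ≤ 2 ^ d * nm volume W ^ 2 := by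
  have hs0 : 0 < s := by linarith
  have hW2 : Integrable fun x => W x ^ 2 := integrable_sq_of_memLp hW
  have hI : Integrable (mollify ρ fun x => W x ^ 2) :=
    hW2.integrable_convolution (ContinuousLinearMap.mul ℝ ℝ) hρ.integrable
  have h0 : ∀ y, 0 ≤ mollify ρ (fun x => W x ^ 2) y := fun y =>
    integral_nonneg fun t => mul_nonneg (sq_nonneg _) (hρ.nonneg _)
  have hI' : Integrable fun x => mollify ρ (fun x => W x ^ 2) (b + s • x) :=
    (hI.comp_add_left b).comp_smul hs0.ne'
  have h1 := setIntegral_comp_homothety (mollify ρ fun x => W x ^ 2) Set.univ MeasurableSet.univ b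
    hs0
  rw [Set.preimage_univ] at h1
  simp only [setIntegral_univ] at h1
  have h2 : ∫ x, mollify ρ (fun x => W x ^ 2) x = nm volume W ^ 2 := by
    rw [nm_sq, mollify_eq, integral_convolution _ hW2 hρ.integrable, hρ.integral]
    simp
  rw [nm_sq]
  calc ∫ x in K, mollify ρ W (b + s • x) ^ 2
      ≤ ∫ x in K, mollify ρ (fun x => W x ^ 2) (b + s • x) := by
        refine integral_mono_of_nonneg (.of_forall fun x => sq_nonneg _) hI'.integrableOn
          (.of_forall fun x => sq_mollify_le hρ hW _)
    _ ≤ ∫ x, mollify ρ (fun x => W x ^ 2) (b + s • x) :=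
        setIntegral_le_integral hI' (.of_forall fun x => h0 _)
    _ ≤ 2 ^ d * (s ^ d * ∫ x, mollify ρ (fun x => W x ^ 2) (b + s • x)) := by
        rw [← mul_assoc, ← mul_pow]
        exact le_mul_of_one_le_left (integral_nonneg fun x => h0 _) (one_le_pow₀ (by linarith))
    _ = _ := by rw [← h1, h2]

/-- The regularisation of a uniformly continuous function is uniformly close to it. -/
lemma abs_mollify_sub_le (hρ : IsMollifier ρ δ) {g : E d → ℝ} (hg : Continuous g) {ε : ℝ}
    {x y : E d} (h : ∀ t, ‖y - t‖ < δ → |g t - g x| ≤ ε) : |mollify ρ g y - g x| ≤ ε := by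
  have hi : ∀ f : E d → ℝ, Continuous f → Integrable fun t => f t * ρ (y - t) := fun f hf => by
    refine (hf.mul (hρ.smooth.continuous.comp (by fun_prop))).integrable_of_hasCompactSupport ?_
    refine HasCompactSupport.of_support_subset_isCompact (isCompact_closedBall y δ) fun t ht => ?_
    have h1 : ρ (y - t) ≠ 0 := right_ne_zero_of_mul ht
    have := hρ.norm_lt _ h1
    rw [Metric.mem_closedBall, dist_comm, dist_eq_norm]
    exact this.le
  have h1 : mollify ρ g y - g x = ∫ t, (g t - g x) * ρ (y - t) := by
    have h2 : ∫ t, g x * ρ (y - t) = g x := by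
      rw [integral_const_mul, hρ.integral_translate, mul_one]
    simp only [sub_mul]
    rw [integral_sub (hi g hg) (hi _ continuous_const), h2]
    rfl
  rw [h1, ← Real.norm_eq_abs]
  have h3 : ∫ t, ε * ρ (y - t) = ε := by
    rw [integral_const_mul, hρ.integral_translate, mul_one]
  rw [← h3]
  refine norm_integral_le_of_norm_le (hi (fun _ => ε) continuous_const) (.of_forall fun t => ?_)
  rw [norm_mul, Real.norm_eq_abs, Real.norm_eq_abs, abs_of_nonneg (hρ.nonneg _)]
  by_cases h4 : ρ (y - t) = 0
  · simp [h4]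
  · exact mul_le_mul_of_nonneg_right (h t (hρ.norm_lt _ h4)) (hρ.nonneg _)

/-- Dilated regularisations of an `L²` function converge to it. -/
lemma tendsto_nm_mollify_sub {K : Set (E d)} (hK : IsCompact K) (hW : MemLp W 2) (c : E d)
    {ρ : ℕ → E d → ℝ}
    {δ s : ℕ → ℝ} (hρ : ∀ n, IsMollifier (ρ n) (δ n)) (hδ : Tendsto δ atTop (𝓝 0))
    (hs : ∀ n, 1 / 2 ≤ s n) (hs1 : Tendsto s atTop (𝓝 1)) :
    Tendsto (fun n => nm (volume.restrict K)
      fun x => mollify (ρ n) W ((1 - s n) • c + s n • x) - W x) atTop (𝓝 0) := by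
  have hfin : IsFiniteMeasure (volume.restrict K) := ⟨by simpa using hK.measure_lt_top⟩
  have hWl : LocallyIntegrable W := hW.locallyIntegrable (by norm_num)
  rw [Metric.tendsto_atTop]
  intro ε hε
  set M := nm (volume.restrict K) (fun _ => (1 : ℝ)) with hM
  have hM0 : 0 ≤ M := nm_nonneg
  set D := √(2 ^ d) with hD
  have hD0 : 0 ≤ D := Real.sqrt_nonneg _
  set η := ε / (2 * (D + 1 + M)) with hη
  have hη0 : 0 < η := by positivity
  -- For a continuous function `g` with compact support the convergence is uniform; `W` is close to
  -- such a function, and the operators are uniformly bounded.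
  obtain ⟨g, hgs, hgW, hgc, hgm⟩ := hW.exists_hasCompactSupport_eLpNorm_sub_le (by norm_num)
    (ε := ENNReal.ofReal η) (by simpa using hη0)
  have hWg : MemLp (fun x => W x - g x) 2 := hW.sub hgm
  have hWg' : nm volume (fun x => W x - g x) ≤ η := by
    rw [nm_eq hWg]
    exact ENNReal.toReal_le_of_le_ofReal hη0.le hgW
  -- uniform continuity
  have huc := hgs.uniformContinuous_of_continuous hgc
  rw [Metric.uniformContinuous_iff] at huc
  obtain ⟨τ, hτ, hgτ⟩ := huc η hη0
  obtain ⟨R, hR⟩ := hK.isBounded.exists_norm_le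
  have hlim : Tendsto (fun n => δ n + |1 - s n| * (‖c‖ + |R|)) atTop (𝓝 0) := by
    have h1 : Tendsto (fun n => |1 - s n|) atTop (𝓝 0) := by
      have := (tendsto_const_nhds (x := (1 : ℝ))).sub hs1
      simpa using this.abs
    simpa using hδ.add (h1.mul_const (‖c‖ + |R|))
  obtain ⟨N, hN⟩ := (hlim.eventually_lt_const hτ).exists_forall_of_atTop
  refine ⟨N, fun n hn => ?_⟩
  have hcl : ∀ x ∈ K, |mollify (ρ n) g ((1 - s n) • c + s n • x) - g x| ≤ η := by
    intro x hx
    refine abs_mollify_sub_le (hρ n) hgc fun t ht => ?_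
    have h1 : dist t x < τ := by
      refine lt_of_le_of_lt ?_ (hN n hn)
      rw [dist_eq_norm]
      have h2 : t - x = -(((1 - s n) • c + s n • x) - t) + (1 - s n) • (c - x) := by
        module
      rw [h2]
      refine (norm_add_le _ _).trans (add_le_add ?_ ?_)
      · rw [norm_neg]
        exact ht.le
      · rw [norm_smul, Real.norm_eq_abs]
        refine mul_le_mul_of_nonneg_left ((norm_sub_le _ _).trans ?_) (abs_nonneg _)
        exact add_le_add le_rfl ((hR x hx).trans (le_abs_self R))
    have := hgτ h1
    rw [Real.dist_eq] at this
    exact this.le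
  have hgl : LocallyIntegrable g := hgm.locallyIntegrable (by norm_num)
  have hcm : ∀ V : E d → ℝ, LocallyIntegrable V →
      MemLp (fun x => mollify (ρ n) V ((1 - s n) • c + s n • x)) 2 (volume.restrict K) :=
    fun V hV => memLp_volume hK ((contDiff_mollify (hρ n) hV).continuous.comp (by fun_prop))
  have hWK : ∀ {V : E d → ℝ}, MemLp V 2 → MemLp V 2 (volume.restrict K) := fun hV => hV.restrict K
  have e1 : nm (volume.restrict K) (fun x => mollify (ρ n) W ((1 - s n) • c + s n • x)
      - mollify (ρ n) g ((1 - s n) • c + s n • x)) ≤ D * η := by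
    have h1 : (fun x => mollify (ρ n) W ((1 - s n) • c + s n • x)
        - mollify (ρ n) g ((1 - s n) • c + s n • x))
        = fun x => mollify (ρ n) (fun x => W x - g x) ((1 - s n) • c + s n • x) := by
      ext x
      set y := (1 - s n) • c + s n • x
      have hi : ∀ V : E d → ℝ, LocallyIntegrable V → Integrable fun t => V t * ρ n (y - t) :=
        fun V hV => (hρ n).hasCompactSupport.convolutionExists_right
          (ContinuousLinearMap.mul ℝ ℝ) hV (hρ n).smooth.continuous y
      unfold mollify
      rw [← integral_sub (hi W hWl) (hi g hgl)]
      congr 1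
      ext t
      ring
    rw [h1]
    have h2 := nm_mollify_le (hρ n) hWg ((1 - s n) • c) (hs n) K
    refine abs_le_of_sq_le_sq' ?_ (by positivity) |>.2
    rw [mul_pow, hD, Real.sq_sqrt (by positivity)]
    exact h2.trans (by gcongr; exact nm_nonneg)
  have e2 : nm (volume.restrict K) (fun x => mollify (ρ n) g ((1 - s n) • c + s n • x) - g x)
      ≤ η * M := by
    refine nm_le_of_abs_le hη0.le (memLp_const 1) ?_
    filter_upwards [ae_restrict_mem hK.measurableSet] with x hx
    simpa using hcl x hx
  have e3 : nm (volume.restrict K) (fun x => g x - W x) ≤ η := by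
    rw [nm_sub_comm]
    refine le_trans ?_ hWg'
    have := nm_mono_set (μ := volume) (Set.subset_univ K) (f := fun x => W x - g x)
      (by rw [Measure.restrict_univ]; exact hWg)
    rwa [Measure.restrict_univ] at this
  have e4 := nm_sub_le_add (hcm W hWl) (hcm g hgl) (hWK hW)
  have e5 := nm_sub_le_add (hcm g hgl) (hWK hgm) (hWK hW)
  rw [Real.dist_eq, sub_zero, abs_of_nonneg nm_nonneg]
  calc _ ≤ D * η + (η * M + η) := by linarith
    _ = ε / 2 := by rw [hη]; field_simp; ring
    _ < ε := by linarith

end mollify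

section weak_derivative

lemma foldr_single {ι : Type*} [DecidableEq ι] {A : Type*} (F : ι → A → A) (l : List ι)
    (hl : l.Nodup) (j : ι) (ψ : A) :
    l.foldr (fun i ψ => (F i)^[(Pi.single j 1 : ι → ℕ) i] ψ) ψ = if j ∈ l then F j ψ else ψ := by
  induction l with
  | nil => simp
  | cons i l ih =>
    rw [List.nodup_cons] at hl
    rw [List.foldr_cons, ih hl.2]
    by_cases hij : i = j
    · subst hij
      simp [hl.1]
    · simp [hij, Ne.symm hij]

lemma pdMulti_single (j : Fin d) (φ : E d → ℝ) : pdMulti (Pi.single j 1) φ = pd j φ := by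
  unfold pdMulti
  rw [foldr_single pd _ (List.nodup_finRange d) j φ]
  simp

/-- A weak derivative in direction `j`, tested with a smooth function supported in a compact set
`K` of which only the interior has to lie in the domain. -/
lemma HasWeakDeriv.setIntegral_eq {Ω K : Set (E d)} (hKΩ : interior K ⊆ Ω)
    {j : Fin d} {w g φ : E d → ℝ} (hw : HasWeakDeriv Ω (Pi.single j 1) w g) (hφ : ContDiff ℝ ∞ φ)
    (hc : HasCompactSupport φ) (hs : tsupport φ ⊆ interior K) :
    ∫ x in K, w x * pd j φ x = -∫ x in K, g x * φ x := by
  have h := hw φ hφ hc (hs.trans hKΩ)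
  rw [pdMulti_single] at h
  have h0 : ∀ x, x ∉ interior K → φ x = 0 ∧ pd j φ x = 0 := by
    intro x hx
    have hx' : x ∉ tsupport φ := fun h => hx (hs h)
    refine ⟨image_eq_zero_of_notMem_tsupport hx', ?_⟩
    have h1 : x ∉ tsupport (fderiv ℝ φ) := fun h => hx' (tsupport_fderiv_subset ℝ h)
    unfold pd
    rw [image_eq_zero_of_notMem_tsupport h1]
    rfl
  have h1 : ∀ S : Set (E d), interior K ⊆ S → ∀ f ψ : E d → ℝ, (∀ x, x ∉ interior K → ψ x = 0) →
      ∫ x in S, f x * ψ x = ∫ x, f x * ψ x := by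
    intro S hS f ψ hψ
    refine setIntegral_eq_integral_of_forall_compl_eq_zero fun x hx => ?_
    rw [hψ x fun h => hx (hS h), mul_zero]
  rw [h1 Ω hKΩ _ _ fun x hx => (h0 x hx).2, h1 Ω hKΩ _ _ fun x hx => (h0 x hx).1] at h
  rw [h1 K interior_subset _ _ fun x hx => (h0 x hx).2,
    h1 K interior_subset _ _ fun x hx => (h0 x hx).1, h]
  simp

end weak_derivative

/-! ### Functions with weak derivatives as limits of smooth functions -/

section H1

/-- The smooth functions `φ n` converge to `w` in `L²(K)` and their gradients to `G`. -/
structure H1Approx (K : Set (E d)) (w : E d → ℝ) (G : Fin d → E d → ℝ) (φ : ℕ → E d → ℝ) :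
    Prop where
  smooth : ∀ n, ContDiff ℝ ∞ (φ n)
  mem : MemLp w 2 (volume.restrict K)
  memG : ∀ j, MemLp (G j) 2 (volume.restrict K)
  lim : Tendsto (fun n => nm (volume.restrict K) fun x => φ n x - w x) atTop (𝓝 0)
  limG : ∀ j, Tendsto (fun n => nm (volume.restrict K) fun x => pd j (φ n) x - G j x) atTop (𝓝 0)

/-- The boundary of a convex set is a null set. -/
lemma memLp_of_interior {Ω K : Set (E d)} (hc : Convex ℝ K) (hKΩ : interior K ⊆ Ω) {w : E d → ℝ}
    (hw : MemLp w 2 (volume.restrict Ω)) : MemLp w 2 (volume.restrict K) := by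
  have h : (interior K : Set (E d)) =ᵐ[volume] K :=
    interior_ae_eq_of_null_frontier (hc.addHaar_frontier volume)
  rw [← Measure.restrict_congr_set h]
  exact hw.mono_measure (Measure.restrict_mono hKΩ le_rfl)

lemma nm_const_mul_sub_le {α : Type*} {m : MeasurableSpace α} {μ : Measure α} {f g : α → ℝ}
    (hf : MemLp f 2 μ) (hg : MemLp g 2 μ) (s : ℝ) :
    nm μ (fun x => s * f x - g x) ≤ |s| * nm μ (fun x => f x - g x) + |s - 1| * nm μ g := by
  rw [← nm_const_mul, ← nm_const_mul]
  refine le_trans (le_of_eq ?_) (nm_add_le ((hf.sub hg).const_mul s) (hg.const_mul (s - 1)))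
  congr 1
  ext x
  ring

/-- Functions with weak derivatives in `L²` are limits of smooth functions on compact convex
subsets: contract the set towards an interior point and regularise. -/
lemma exists_h1Approx {Ω K : Set (E d)} (hK : IsCompact K) (hc : Convex ℝ K)
    (hK' : (interior K).Nonempty) (hKΩ : interior K ⊆ Ω) {w : E d → ℝ} {G : Fin d → E d → ℝ}
    (hw : MemLp w 2 (volume.restrict Ω)) (hG : ∀ j, MemLp (G j) 2 (volume.restrict Ω))
    (hwG : ∀ j, HasWeakDeriv Ω (Pi.single j 1) w (G j)) : ∃ φ, H1Approx K w G φ := by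
  obtain ⟨c, hcK⟩ := hK'
  obtain ⟨r, hr, hrK⟩ := Metric.isOpen_iff.1 isOpen_interior c hcK
  set s : ℕ → ℝ := fun n => 1 - 1 / ((n : ℝ) + 2) with hs
  have hpos : ∀ n : ℕ, 0 < 1 / ((n : ℝ) + 2) := fun n => by positivity
  have hs0 : ∀ n, 1 / 2 ≤ s n := fun n => by
    have : 1 / ((n : ℝ) + 2) ≤ 1 / 2 := one_div_le_one_div_of_le (by norm_num) (by
      have : (0 : ℝ) ≤ n := by positivity
      linarith)
    simp only [hs]
    linarith
  have hs' : ∀ n, 1 - s n = 1 / ((n : ℝ) + 2) := fun n => by simp [hs]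
  have hlim : Tendsto (fun n : ℕ => 1 / ((n : ℝ) + 2)) atTop (𝓝 0) := by
    have := (tendsto_add_atTop_iff_nat 2).2 (tendsto_one_div_atTop_nhds_zero_nat (𝕜 := ℝ))
    refine this.congr fun n => ?_
    push_cast
    rfl
  have hs1 : Tendsto s atTop (𝓝 1) := by
    have := (tendsto_const_nhds (x := (1 : ℝ))).sub hlim
    rwa [sub_zero] at this
  set δ : ℕ → ℝ := fun n => (1 - s n) * (r / 2) with hδ
  have hδ0 : ∀ n, 0 < δ n := fun n => by
    simp only [hδ, hs']
    exact mul_pos (hpos n) (by linarith)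
  have hδ1 : Tendsto δ atTop (𝓝 0) := by
    have h1 : δ = fun n : ℕ => 1 / ((n : ℝ) + 2) * (r / 2) := by
      ext n
      simp only [hδ, hs']
    rw [h1]
    simpa using hlim.mul_const (r / 2)
  choose ρ hρ using fun n => exists_isMollifier (d := d) (hδ0 n)
  have hKm := hK.measurableSet
  have hind : ∀ f : E d → ℝ, MemLp f 2 (volume.restrict K) → MemLp (K.indicator f) 2 :=
    fun f hf => (memLp_indicator_iff_restrict hKm).2 hf
  have hwK := memLp_of_interior hc hKΩ hw
  have hGK := fun j => memLp_of_interior hc hKΩ (hG j)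
  have hWl : LocallyIntegrable (K.indicator w) := (hind w hwK).locallyIntegrable (by norm_num)
  have hsm : ∀ n, ContDiff ℝ ∞ (mollify (ρ n) (K.indicator w)) := fun n =>
    contDiff_mollify (hρ n) hWl
  have hindK : ∀ f : E d → ℝ, ∀ a : E d → ℝ, nm (volume.restrict K) (fun x => a x - K.indicator f x)
      = nm (volume.restrict K) (fun x => a x - f x) := fun f a => nm_congr_ae (by
    filter_upwards [ae_restrict_mem hKm] with x hx
    rw [Set.indicator_of_mem hx])
  -- The contracted set stays away from the boundary of `K` by more than the support radius of the
  -- mollifier, so the weak derivative may be tested with the translated mollifiers.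
  have hball : ∀ n, ∀ x ∈ K, Metric.closedBall ((1 - s n) • c + s n • x) (δ n) ⊆ interior K := by
    intro n x hx
    have h1 : 0 < 1 - s n := by rw [hs']; exact hpos n
    have h2 : Metric.ball ((1 - s n) • c + s n • x) ((1 - s n) * r) ⊆ K := by
      intro z hz
      rw [Metric.mem_ball, dist_eq_norm] at hz
      set e := (1 - s n)⁻¹ • (z - ((1 - s n) • c + s n • x)) with he
      have h3 : c + e ∈ K := by
        refine interior_subset (hrK ?_)
        rw [Metric.mem_ball, dist_eq_norm, add_sub_cancel_left, he, norm_smul, norm_inv,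
          Real.norm_eq_abs, abs_of_pos h1, inv_mul_lt_iff₀ h1]
        exact hz
      have h4 : z = (1 - s n) • (c + e) + s n • x := by
        rw [he, smul_add, smul_smul, mul_inv_cancel₀ h1.ne']
        module
      rw [h4]
      exact hc h3 hx h1.le (by linarith [hs0 n]) (by ring)
    refine (Metric.closedBall_subset_ball ?_).trans (interior_maximal h2 Metric.isOpen_ball)
    simp only [hδ]
    nlinarith
  have hpd : ∀ n j, ∀ x ∈ K,
      pd j (fun x => mollify (ρ n) (K.indicator w) ((1 - s n) • c + s n • x)) x
      = s n * mollify (ρ n) (K.indicator (G j)) ((1 - s n) • c + s n • x) := by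
    intro n j x hx
    set y := (1 - s n) • c + s n • x with hy
    rw [pd_comp_homothety (hsm n), pd_mollify (hρ n) hWl]
    congr 1
    set η : E d → ℝ := fun t => ρ n (y - t) with hη
    have hηs : ContDiff ℝ ∞ η := (hρ n).smooth.comp (contDiff_const.sub contDiff_id)
    have hηp : ∀ t, pd j η t = -pd j (ρ n) (y - t) := by
      intro t
      have := pd_comp_homothety (hρ n).smooth y (-1) j t
      simp only [neg_smul, one_smul, ← sub_eq_add_neg, neg_mul, one_mul] at this
      exact this
    have hηt : tsupport η ⊆ Metric.closedBall y (δ n) := by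
      refine closure_minimal (fun t ht => ?_) Metric.isClosed_closedBall
      have := (hρ n).norm_lt _ ht
      rw [Metric.mem_closedBall, dist_comm, dist_eq_norm]
      exact this.le
    have hηc : HasCompactSupport η :=
      HasCompactSupport.of_support_subset_isCompact (isCompact_closedBall y (δ n))
        ((subset_tsupport η).trans hηt)
    have h1 := (hwG j).setIntegral_eq hKΩ hηs hηc (hηt.trans (hball n x hx))
    have h2 : ∀ f b : E d → ℝ, ∫ t, K.indicator f t * b t = ∫ t in K, f t * b t := by
      intro f b
      rw [← integral_indicator hKm]
      congr 1
      ext t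
      by_cases ht : t ∈ K <;> simp [ht]
    rw [h2 w fun t => pd j (ρ n) (y - t)]
    unfold mollify
    rw [h2 (G j) η, ← neg_neg (∫ t in K, G j t * η t), ← h1, ← integral_neg]
    congr 1
    ext t
    rw [hηp]
    ring
  refine ⟨fun n x => mollify (ρ n) (K.indicator w) ((1 - s n) • c + s n • x),
    fun n => (hsm n).comp (contDiff_const.add (contDiff_id.const_smul _)), hwK, hGK, ?_, ?_⟩
  · refine (tendsto_nm_mollify_sub hK (hind w hwK) c hρ hδ1 hs0 hs1).congr fun n => ?_
    exact hindK _ _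
  · intro j
    have hm : ∀ n, MemLp (fun x => mollify (ρ n) (K.indicator (G j)) ((1 - s n) • c + s n • x)) 2
        (volume.restrict K) := fun n => memLp_volume hK ((contDiff_mollify (hρ n)
          ((hind _ (hGK j)).locallyIntegrable (by norm_num))).continuous.comp (by fun_prop))
    have h1 := tendsto_nm_mollify_sub hK (hind _ (hGK j)) c hρ hδ1 hs0 hs1
    have h2 : Tendsto (fun n => |s n| * nm (volume.restrict K) (fun x =>
        mollify (ρ n) (K.indicator (G j)) ((1 - s n) • c + s n • x) - G j x)
          + |s n - 1| * nm (volume.restrict K) (G j)) atTop (𝓝 0) := by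
      have h3 := hs1.abs.mul (h1.congr fun n => hindK _ _)
      have h4 := ((hs1.sub_const 1).abs).mul_const (nm (volume.restrict K) (G j))
      simpa using h3.add h4
    refine squeeze_zero (fun _ => nm_nonneg) (fun n => ?_) h2
    refine le_trans (le_of_eq ?_) (nm_const_mul_sub_le (hm n) (hGK j) (s n))
    refine nm_congr_ae ?_
    filter_upwards [ae_restrict_mem hKm] with x hx
    rw [hpd n j x hx]

variable {K : Set (E d)} {w w' : E d → ℝ} {G G' : Fin d → E d → ℝ} {φ φ' : ℕ → E d → ℝ}

lemma tendsto_nm_sub {α : Type*} {m : MeasurableSpace α} {μ : Measure α} {F F' : ℕ → α → ℝ}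
    {f f' : α → ℝ} (hF : ∀ n, MemLp (F n) 2 μ) (hF' : ∀ n, MemLp (F' n) 2 μ) (hf : MemLp f 2 μ)
    (hf' : MemLp f' 2 μ) (h : Tendsto (fun n => nm μ fun x => F n x - f x) atTop (𝓝 0))
    (h' : Tendsto (fun n => nm μ fun x => F' n x - f' x) atTop (𝓝 0)) :
    Tendsto (fun n => nm μ fun x => (F n x - F' n x) - (f x - f' x)) atTop (𝓝 0) := by
  refine squeeze_zero (fun _ => nm_nonneg) (fun n => ?_) (by simpa using h.add h')
  refine le_trans (le_of_eq ?_) (nm_sub_le ((hF n).sub hf) ((hF' n).sub hf'))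
  congr 1
  ext x
  ring

lemma H1Approx.sub (hK : IsCompact K) (h : H1Approx K w G φ) (h' : H1Approx K w' G' φ') :
    H1Approx K (fun x => w x - w' x) (fun j x => G j x - G' j x) (fun n x => φ n x - φ' n x) where
  smooth n := (h.smooth n).sub (h'.smooth n)
  mem := h.mem.sub h'.mem
  memG j := (h.memG j).sub (h'.memG j)
  lim := tendsto_nm_sub (fun n => memLp_volume hK (h.smooth n).continuous)
    (fun n => memLp_volume hK (h'.smooth n).continuous) h.mem h'.mem h.lim h'.lim
  limG j := by
    have := tendsto_nm_sub (fun n => memLp_volume hK (continuous_pd (h.smooth n) j))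
      (fun n => memLp_volume hK (continuous_pd (h'.smooth n) j)) (h.memG j) (h'.memG j) (h.limG j)
      (h'.limG j)
    refine this.congr fun n => ?_
    congr 1
    ext x
    rw [pd_sub (h.smooth n) (h'.smooth n)]

lemma h1Approx_const (hK : IsCompact K) {g : E d → ℝ} (hg : ContDiff ℝ ∞ g) :
    H1Approx K g (fun j => pd j g) fun _ => g where
  smooth _ := hg
  mem := memLp_volume hK hg.continuous
  memG j := memLp_volume hK (continuous_pd hg j)
  lim := by simp [nm]
  limG j := by simp [nm]

/-- The Poincaré inequality for limits of smooth functions, obtained by subtracting the mean values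
of the approximating functions. -/
lemma H1Approx.nm_le (h : H1Approx K w G φ) (hK : IsCompact K) (hc : Convex ℝ K)
    (hK' : (interior K).Nonempty) {D : ℝ} (hD0 : 0 ≤ D) (hD : ∀ x ∈ K, ∀ y ∈ K, ‖x - y‖ ≤ D)
    (h0 : ∫ x in K, w x = 0) :
    nm (volume.restrict K) w ≤ √(2 ^ d) * (D * ∑ j, nm (volume.restrict K) (G j)) := by
  set V := volume.real K with hV
  have hfin : IsFiniteMeasure (volume.restrict K) := ⟨by simpa using hK.measure_lt_top⟩
  have hV0 : 0 < V := by
    refine ENNReal.toReal_pos ?_ hK.measure_lt_top.ne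
    exact ((isOpen_interior.measure_pos volume hK').trans_le (measure_mono interior_subset)).ne'
  have hmφ : ∀ n, MemLp (φ n) 2 (volume.restrict K) := fun n =>
    memLp_volume hK (h.smooth n).continuous
  set m : ℕ → ℝ := fun n => V⁻¹ * ∫ x in K, φ n x with hm
  have hm0 : Tendsto m atTop (𝓝 0) := by
    have h1 := tendsto_integral_mul hmφ h.mem (memLp_const (1 : ℝ)) h.lim
    simp only [mul_one, h0] at h1
    simpa using h1.const_mul V⁻¹
  have hone : ∫ _ in K, (1 : ℝ) = V := by simp [hV, Measure.real]
  have e1 : ∀ n, nm (volume.restrict K) (fun x => φ n x - m n)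
      ≤ √(2 ^ d) * (D * ∑ j, nm (volume.restrict K) (pd j (φ n))) := by
    intro n
    have h2 : ∫ x in K, (φ n x - m n) = 0 := by
      rw [integral_sub ((hmφ n).integrable (by norm_num)) (integrable_const _)]
      have : ∫ _ in K, m n = V * m n := by simp [hV, Measure.real]
      rw [this, hm]
      field_simp
      ring
    have h3 := sq_nm_le_of_integral_eq_zero hK hc hK' hD ((h.smooth n).sub contDiff_const) h2
    have h4 : ∀ j, pd j (fun x => φ n x - m n) = pd j (φ n) := by
      intro j
      ext x
      rw [pd_sub (h.smooth n) contDiff_const]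
      simp [pd]
    simp only [h4] at h3
    refine abs_le_of_sq_le_sq' ?_ (mul_nonneg (Real.sqrt_nonneg _) (mul_nonneg hD0
      (Finset.sum_nonneg fun _ _ => nm_nonneg))) |>.2
    rw [mul_pow, mul_pow, Real.sq_sqrt (by positivity), ← mul_assoc]
    refine h3.trans (mul_le_mul_of_nonneg_left ?_ (by positivity))
    exact Finset.sum_sq_le_sq_sum_of_nonneg fun j _ => nm_nonneg
  have e2 : Tendsto (fun n => nm (volume.restrict K) (fun x => φ n x - m n)) atTop
      (𝓝 (nm (volume.restrict K) w)) := by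
    refine tendsto_nm (fun n => (hmφ n).sub (memLp_const (m n))) h.mem ?_
    have h5 : Tendsto (fun n => nm (volume.restrict K) (fun x => φ n x - w x)
        + |m n| * nm (volume.restrict K) (fun _ => 1)) atTop (𝓝 0) := by
      simpa using h.lim.add (hm0.abs.mul_const (nm (volume.restrict K) (fun _ => 1)))
    refine squeeze_zero (fun _ => nm_nonneg) (fun n => ?_) h5
    rw [← nm_const_mul]
    simp only [mul_one]
    refine le_trans (le_of_eq ?_) (nm_sub_le ((hmφ n).sub h.mem) (memLp_const (m n)))
    congr 1
    ext x
    ring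
  refine le_of_tendsto_of_tendsto' e2 ?_ e1
  refine ((tendsto_finsetSum _ fun j _ => ?_).const_mul D).const_mul _
  exact tendsto_nm (fun n => memLp_volume hK (continuous_pd (h.smooth n) j)) (h.memG j) (h.limG j)

end H1

/-! ### Traces on the facets of a simplex -/

section facet_traces

variable {γ : ℝ} {T : Finset (E d)}

/-- The trace inequality in scaled form. -/
lemma sqrt_diam_mul_nm_facet_le (hγ : 0 < γ) (hd : 1 ≤ d) (hT : IsRegular γ T) {a : E d}
    (ha : a ∈ T) {g : E d → ℝ} (hg : ContDiff ℝ ∞ g) :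
    √(diam T) * nm ((surf d).restrict (hull (opp T a))) g ≤ √(γ * (2 * d + 1)) *
      (nm (volume.restrict (hull T)) g + diam T * ∑ j, nm (volume.restrict (hull T)) (pd j g)) := by
  have hh := diam_pos hT.simplex hd
  set N := nm (volume.restrict (hull T)) g with hN
  have hN0 : 0 ≤ N := nm_nonneg
  set S := ∑ j, nm (volume.restrict (hull T)) (pd j g) with hS
  have hS0 : 0 ≤ S := Finset.sum_nonneg fun _ _ => nm_nonneg
  have h1 := nm_facet_sq_le hγ hd hT ha hg
  have h2 : ∑ j, nm (volume.restrict (hull T)) (pd j g) ^ 2 ≤ S ^ 2 :=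
    Finset.sum_sq_le_sq_sum_of_nonneg fun j _ => nm_nonneg
  refine abs_le_of_sq_le_sq' ?_ (by positivity) |>.2
  rw [mul_pow, mul_pow, Real.sq_sqrt hh.le, Real.sq_sqrt (by positivity)]
  calc diam T * nm ((surf d).restrict (hull (opp T a))) g ^ 2
      ≤ diam T * (γ * (2 * d * (diam T)⁻¹ * N ^ 2 + diam T * S ^ 2)) :=
        mul_le_mul_of_nonneg_left (h1.trans (by gcongr)) hh.le
    _ = γ * (2 * d * N ^ 2 + (diam T * S) ^ 2) := by field_simp
    _ ≤ γ * ((2 * d + 1) * (N + diam T * S) ^ 2) := by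
        gcongr
        have h3 : N ^ 2 ≤ (N + diam T * S) ^ 2 := pow_le_pow_left₀ hN0 (by nlinarith) 2
        have h4 : (diam T * S) ^ 2 ≤ (N + diam T * S) ^ 2 :=
          pow_le_pow_left₀ (by positivity) (by linarith) 2
        have hd0 : (0 : ℝ) ≤ d := by positivity
        nlinarith
    _ = _ := by ring

/-- `w` has the gradient `G` on the simplex `T` and the trace `t a` on the facet opposite to `a`:
all of these are limits of smooth functions, their gradients and their restrictions. -/
structure HasFacetTraces (T : Finset (E d)) (w : E d → ℝ) (G : Fin d → E d → ℝ)
    (t : E d → E d → ℝ) : Prop where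
  memt : ∀ a ∈ T, MemLp (t a) 2 ((surf d).restrict (hull (opp T a)))
  approx : ∃ φ, H1Approx (hull T) w G φ ∧ ∀ a ∈ T,
    Tendsto (fun n => nm ((surf d).restrict (hull (opp T a))) fun x => φ n x - t a x) atTop (𝓝 0)

variable {w w' : E d → ℝ} {G G' : Fin d → E d → ℝ} {t t' : E d → E d → ℝ}

lemma HasFacetTraces.mem (h : HasFacetTraces T w G t) : MemLp w 2 (volume.restrict (hull T)) :=
  h.approx.choose_spec.1.mem

lemma HasFacetTraces.memG (h : HasFacetTraces T w G t) (j : Fin d) :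
    MemLp (G j) 2 (volume.restrict (hull T)) := h.approx.choose_spec.1.memG j

/-- By the trace inequality a sequence of smooth functions which converges together with its
gradients converges in `L²` of each facet. -/
lemma exists_hasFacetTraces (hγ : 0 < γ) (hd : 1 ≤ d) (hT : IsRegular γ T) {φ : ℕ → E d → ℝ}
    (h : H1Approx (hull T) w G φ) : ∃ t, HasFacetTraces T w G t ∧ ∀ a ∈ T,
      Tendsto (fun n => nm ((surf d).restrict (hull (opp T a))) fun x => φ n x - t a x)
        atTop (𝓝 0) := by
  have hh := diam_pos hT.simplex hd
  set C := √(γ * (2 * d + 1)) with hC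
  set b : ℕ → ℝ := fun n => (√(diam T))⁻¹
    * (C * (nm (volume.restrict (hull T)) (fun x => φ n x - w x)
    + diam T * ∑ j, nm (volume.restrict (hull T)) fun x => pd j (φ n) x - G j x)) with hb
  have hb0 : Tendsto b atTop (𝓝 0) := by
    have h1 := tendsto_finsetSum Finset.univ fun j _ => h.limG j
    simpa using (((h.lim.add (h1.const_mul (diam T))).const_mul C).const_mul (√(diam T))⁻¹)
  have hm : ∀ n, MemLp (φ n) 2 (volume.restrict (hull T)) := fun n =>
    memLp_hull T (h.smooth n).continuous
  have hmp : ∀ n j, MemLp (pd j (φ n)) 2 (volume.restrict (hull T)) := fun n j =>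
    memLp_hull T (continuous_pd (h.smooth n) j)
  have hcauchy : ∀ a ∈ T, ∀ n m, nm ((surf d).restrict (hull (opp T a)))
      (fun x => φ n x - φ m x) ≤ b n + b m := by
    intro a ha n m
    have h1 := sqrt_diam_mul_nm_facet_le hγ hd hT ha ((h.smooth n).sub (h.smooth m))
    have h2 : nm (volume.restrict (hull T)) (fun x => φ n x - φ m x)
        ≤ nm (volume.restrict (hull T)) (fun x => φ n x - w x)
          + nm (volume.restrict (hull T)) (fun x => φ m x - w x) := by
      rw [nm_sub_comm (f := φ m)]
      exact nm_sub_le_add (hm n) h.mem (hm m)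
    have h3 : ∀ j, nm (volume.restrict (hull T)) (pd j fun x => φ n x - φ m x)
        ≤ nm (volume.restrict (hull T)) (fun x => pd j (φ n) x - G j x)
          + nm (volume.restrict (hull T)) (fun x => pd j (φ m) x - G j x) := by
      intro j
      rw [nm_sub_comm (f := pd j (φ m)),
        show (pd j fun x => φ n x - φ m x) = fun x => pd j (φ n) x - pd j (φ m) x from
          funext (pd_sub (h.smooth n) (h.smooth m) j)]
      exact nm_sub_le_add (hmp n j) (h.memG j) (hmp m j)
    have hs : 0 < √(diam T) := Real.sqrt_pos.2 hh
    have h4 : nm ((surf d).restrict (hull (opp T a))) (fun x => φ n x - φ m x)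
        ≤ (√(diam T))⁻¹ * (C * (nm (volume.restrict (hull T)) (fun x => φ n x - φ m x)
          + diam T * ∑ j, nm (volume.restrict (hull T)) (pd j fun x => φ n x - φ m x))) := by
      rw [le_inv_mul_iff₀ hs]
      exact h1
    refine h4.trans ?_
    rw [hb]
    simp only
    rw [← mul_add, ← mul_add]
    refine mul_le_mul_of_nonneg_left (mul_le_mul_of_nonneg_left ?_ (Real.sqrt_nonneg _))
      (inv_nonneg.2 (Real.sqrt_nonneg _))
    have h5 := Finset.sum_le_sum fun j (_ : j ∈ Finset.univ) => h3 j
    rw [Finset.sum_add_distrib] at h5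
    nlinarith [mul_le_mul_of_nonneg_left h5 hh.le]
  have hex : ∀ a, ∃ g, a ∈ T → MemLp g 2 ((surf d).restrict (hull (opp T a))) ∧
      Tendsto (fun n => nm ((surf d).restrict (hull (opp T a))) fun x => φ n x - g x)
        atTop (𝓝 0) := by
    intro a
    by_cases ha : a ∈ T
    · obtain ⟨g, hg⟩ := exists_nm_limit (fun n => memLp_facet hT.simplex hd ha
        (h.smooth n).continuous) hb0 (hcauchy a ha)
      exact ⟨g, fun _ => hg⟩
    · exact ⟨0, fun h => (ha h).elim⟩
  choose t ht using hex
  exact ⟨t, ⟨fun a ha => (ht a ha).1, φ, h, fun a ha => (ht a ha).2⟩, fun a ha => (ht a ha).2⟩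

/-- The trace does not depend on the approximating sequence. -/
lemma HasFacetTraces.ae_eq (hγ : 0 < γ) (hd : 1 ≤ d) (hT : IsRegular γ T)
    (h : HasFacetTraces T w G t) {ψ : ℕ → E d → ℝ} (hψ : H1Approx (hull T) w G ψ) {a : E d}
    (ha : a ∈ T) {g : E d → ℝ} (hg : MemLp g 2 ((surf d).restrict (hull (opp T a))))
    (hψg : Tendsto (fun n => nm ((surf d).restrict (hull (opp T a))) fun x => ψ n x - g x)
      atTop (𝓝 0)) : t a =ᵐ[(surf d).restrict (hull (opp T a))] g := by
  have hh := diam_pos hT.simplex hd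
  obtain ⟨φ, hφ, hφt⟩ := h.approx
  have hs := hφ.sub (isCompact_hull T) hψ
  have hs0 : 0 < √(diam T) := Real.sqrt_pos.2 hh
  set C := √(γ * (2 * d + 1)) with hC
  have hz : nm (volume.restrict (hull T)) (fun _ => (0 : ℝ)) = 0 := by simp [nm]
  have h1 : Tendsto (fun n => (√(diam T))⁻¹ * (C * (nm (volume.restrict (hull T))
      (fun x => φ n x - ψ n x) + diam T * ∑ j, nm (volume.restrict (hull T))
        (pd j fun x => φ n x - ψ n x)))) atTop (𝓝 0) := by
    have h2 := hs.lim
    have h3 := hs.limG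
    simp only [sub_self, sub_zero] at h2 h3
    have h4 := tendsto_finsetSum Finset.univ fun j _ => h3 j
    simpa using (((h2.add (h4.const_mul (diam T))).const_mul C).const_mul (√(diam T))⁻¹)
  have hmφ := fun n => memLp_facet hT.simplex hd ha (hφ.smooth n).continuous
  have hmψ := fun n => memLp_facet hT.simplex hd ha (hψ.smooth n).continuous
  have h5 : Tendsto (fun n => nm ((surf d).restrict (hull (opp T a))) fun x => φ n x - ψ n x)
      atTop (𝓝 0) := by
    refine squeeze_zero (fun _ => nm_nonneg) (fun n => ?_) h1
    rw [le_inv_mul_iff₀ hs0]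
    exact sqrt_diam_mul_nm_facet_le hγ hd hT ha (hs.smooth n)
  have h6 : nm ((surf d).restrict (hull (opp T a))) (fun x => t a x - g x) ≤ 0 := by
    have h7 := ((hφt a ha).add (h5.add hψg))
    simp only [add_zero] at h7
    refine ge_of_tendsto' h7 fun n => ?_
    have h8 := nm_sub_le_add (h.memt a ha) (hmφ n) hg
    have h9 := nm_sub_le_add (hmφ n) (hmψ n) hg
    rw [nm_sub_comm (f := t a) (g := φ n)] at h8
    linarith
  have h10 := ae_eq_zero_of_nm_eq_zero ((h.memt a ha).sub hg) (le_antisymm h6 nm_nonneg)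
  filter_upwards [h10] with x hx
  exact sub_eq_zero.1 hx

lemma HasFacetTraces.sub (hd : 1 ≤ d) (hT : IsSimplex T) (h : HasFacetTraces T w G t)
    (h' : HasFacetTraces T w' G' t') :
    HasFacetTraces T (fun x => w x - w' x) (fun j x => G j x - G' j x)
      (fun a x => t a x - t' a x) := by
  obtain ⟨φ, hφ, hφt⟩ := h.approx
  obtain ⟨ψ, hψ, hψt⟩ := h'.approx
  exact ⟨fun a ha => (h.memt a ha).sub (h'.memt a ha), _, hφ.sub (isCompact_hull T) hψ,
    fun a ha => tendsto_nm_sub (fun n => memLp_facet hT hd ha (hφ.smooth n).continuous)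
      (fun n => memLp_facet hT hd ha (hψ.smooth n).continuous) (h.memt a ha) (h'.memt a ha)
      (hφt a ha) (hψt a ha)⟩

lemma hasFacetTraces_smooth (hd : 1 ≤ d) (hT : IsSimplex T) {g : E d → ℝ} (hg : ContDiff ℝ ∞ g) :
    HasFacetTraces T g (fun j => pd j g) fun _ => g :=
  ⟨fun _ ha => memLp_facet hT hd ha hg.continuous, _, h1Approx_const (isCompact_hull T) hg,
    fun _ _ => by simp [nm]⟩

lemma HasFacetTraces.sub_ev (hd : 1 ≤ d) (hT : IsSimplex T) (h : HasFacetTraces T w G t)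
    (p : Poly d) :
    HasFacetTraces T (fun x => w x - ev p x) (fun j x => G j x - ev (MvPolynomial.pderiv j p) x)
      (fun a x => t a x - ev p x) := by
  have := h.sub hd hT (hasFacetTraces_smooth hd hT (contDiff_ev p))
  simpa only [pd_ev] using this

/-- The trace inequality. -/
lemma HasFacetTraces.nm_le (hγ : 0 < γ) (hd : 1 ≤ d) (hT : IsRegular γ T)
    (h : HasFacetTraces T w G t) {a : E d} (ha : a ∈ T) :
    √(diam T) * nm ((surf d).restrict (hull (opp T a))) (t a) ≤ √(γ * (2 * d + 1)) *
      (nm (volume.restrict (hull T)) w + diam T * ∑ j, nm (volume.restrict (hull T)) (G j)) := by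
  obtain ⟨φ, hφ, hφt⟩ := h.approx
  refine le_of_tendsto_of_tendsto' ((tendsto_nm (fun n => memLp_facet hT.simplex hd ha
    (hφ.smooth n).continuous) (h.memt a ha) (hφt a ha)).const_mul _) (((tendsto_nm (fun n =>
      memLp_hull T (hφ.smooth n).continuous) hφ.mem hφ.lim).add ((tendsto_finsetSum _ fun j _ =>
        tendsto_nm (fun n => memLp_hull T (continuous_pd (hφ.smooth n) j)) (hφ.memG j)
          (hφ.limG j)).const_mul (diam T))).const_mul _) fun n => ?_
  exact sqrt_diam_mul_nm_facet_le hγ hd hT ha (hφ.smooth n)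

/-- Integration by parts against a smooth function. -/
lemma HasFacetTraces.integral_mul (hd : 1 ≤ d) (hT : IsSimplex T) (h : HasFacetTraces T w G t)
    {ψ : E d → ℝ} (hψ : ContDiff ℝ ∞ ψ) (j : Fin d) :
    ∫ x in hull T, G j x * ψ x = -(∫ x in hull T, w x * pd j ψ x)
      + ∑ a ∈ T, ∫ y in hull (opp T a), t a y * ψ y * normal T a j ∂(surf d) := by
  obtain ⟨φ, hφ, hφt⟩ := h.approx
  have h1 := tendsto_integral_mul (fun n => memLp_hull T (continuous_pd (hφ.smooth n) j))
    (hφ.memG j) (memLp_hull T hψ.continuous) (hφ.limG j)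
  have h2 := tendsto_integral_mul (fun n => memLp_hull T (hφ.smooth n).continuous)
    hφ.mem (memLp_hull T (continuous_pd hψ j)) hφ.lim
  have h3 : ∀ a ∈ T, Tendsto (fun n => ∫ y in hull (opp T a), φ n y * ψ y * normal T a j ∂(surf d))
      atTop (𝓝 (∫ y in hull (opp T a), t a y * ψ y * normal T a j ∂(surf d))) := by
    intro a ha
    simp only [mul_assoc]
    exact tendsto_integral_mul (fun n => memLp_facet hT hd ha (hφ.smooth n).continuous)
      (h.memt a ha) (memLp_facet hT hd ha (by fun_prop)) (hφt a ha)
  refine tendsto_nhds_unique h1 (((h2.neg).add (tendsto_finsetSum _ h3)).congr fun n => ?_)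
  exact (integral_pd_mul_add hT hd (hφ.smooth n) hψ j).symm

end facet_traces

/-! ### Sobolev functions and polynomial approximation -/

section multi_index

/-- Iterated application of the operators `F i`, with multiplicities `α i`. -/
def iterOp {ι A : Type*} (F : ι → A → A) (l : List ι) (α : ι → ℕ) (ψ : A) : A :=
  l.foldr (fun i ψ => (F i)^[α i] ψ) ψ

section iterOp

variable {ι A : Type*} {F : ι → A → A} {Q : A → Prop} (hQ : ∀ i ψ, Q ψ → Q (F i ψ))
  (hF : ∀ i j ψ, Q ψ → F i (F j ψ) = F j (F i ψ))
include hQ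

lemma iterate_mem (i : ι) (n : ℕ) {ψ : A} (hψ : Q ψ) : Q ((F i)^[n] ψ) := by
  induction n generalizing ψ with
  | zero => exact hψ
  | succ n ih => exact ih (hQ i ψ hψ)

lemma iterOp_mem (l : List ι) (α : ι → ℕ) {ψ : A} (hψ : Q ψ) : Q (iterOp F l α ψ) := by
  induction l with
  | nil => exact hψ
  | cons i l ih => exact iterate_mem hQ i _ ih

include hF

lemma iterate_comm (i j : ι) (n : ℕ) {ψ : A} (hψ : Q ψ) :
    (F i)^[n] (F j ψ) = F j ((F i)^[n] ψ) := by
  induction n generalizing ψ with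
  | zero => rfl
  | succ n ih => rw [Function.iterate_succ_apply, hF i j ψ hψ, ih (hQ i ψ hψ),
      Function.iterate_succ_apply]

lemma iterOp_comm (l : List ι) (α : ι → ℕ) (j : ι) {ψ : A} (hψ : Q ψ) :
    iterOp F l α (F j ψ) = F j (iterOp F l α ψ) := by
  induction l with
  | nil => rfl
  | cons i l ih =>
    change (F i)^[α i] (iterOp F l α (F j ψ)) = F j ((F i)^[α i] (iterOp F l α ψ))
    rw [ih, iterate_comm hQ hF i j _ (iterOp_mem hQ l α hψ)]

/-- For commuting operators, raising one multiplicity by one amounts to one more application. -/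
lemma iterOp_add_single [DecidableEq ι] (l : List ι) (hl : l.Nodup) (α : ι → ℕ) (j : ι) {ψ : A}
    (hψ : Q ψ) :
    iterOp F l (α + Pi.single j 1) ψ = if j ∈ l then F j (iterOp F l α ψ) else iterOp F l α ψ := by
  induction l with
  | nil => simp [iterOp]
  | cons i l ih =>
    rw [List.nodup_cons] at hl
    change (F i)^[(α + Pi.single j 1 : ι → ℕ) i] (iterOp F l (α + Pi.single j 1) ψ) = _
    rw [ih hl.2]
    by_cases hij : i = j
    · subst hij
      simp only [hl.1, if_false, Pi.add_apply, Pi.single_eq_same, List.mem_cons, true_or, if_true,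
        Function.iterate_succ_apply']
      rfl
    · have h1 : (α + Pi.single j 1 : ι → ℕ) i = α i := by simp [hij]
      rw [h1]
      by_cases hjl : j ∈ l
      · simp only [hjl, if_true, List.mem_cons, or_true]
        exact iterate_comm hQ hF i j _ (iterOp_mem hQ l α hψ)
      · simp only [hjl, if_false, List.mem_cons, Ne.symm hij, or_false]
        rfl

end iterOp

/-- The derivative `∂^α p` of a polynomial. -/
def pderivMulti (α : Fin d → ℕ) (p : Poly d) : Poly d :=
  iterOp (fun i p => MvPolynomial.pderiv i p) (List.finRange d) α p

lemma pderiv_comm (i j : Fin d) (p : Poly d) :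
    MvPolynomial.pderiv i (MvPolynomial.pderiv j p)
      = MvPolynomial.pderiv j (MvPolynomial.pderiv i p) := by
  have h : ∀ x : E d, ev (MvPolynomial.pderiv i (MvPolynomial.pderiv j p)) x
      = ev (MvPolynomial.pderiv j (MvPolynomial.pderiv i p)) x := by
    intro x
    rw [← pd_ev, ← pd_ev, ← pd_ev, ← pd_ev, pd_comm (contDiff_ev p)]
  rw [← sub_eq_zero]
  refine eq_zero_of_ev_eq_zero isOpen_univ Set.univ_nonempty fun x _ => ?_
  rw [ev_sub, h, sub_self]

lemma pderivMulti_add_single (α : Fin d → ℕ) (j : Fin d) (p : Poly d) :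
    pderivMulti (α + Pi.single j 1) p = MvPolynomial.pderiv j (pderivMulti α p) := by
  unfold pderivMulti
  rw [iterOp_add_single (Q := fun _ => True) (fun _ _ _ => trivial)
    (fun i j ψ _ => pderiv_comm i j ψ) _ (List.nodup_finRange d) α j trivial]
  simp

lemma pdMulti_add_single (α : Fin d → ℕ) (j : Fin d) {φ : E d → ℝ} (hφ : ContDiff ℝ ∞ φ) :
    pdMulti (α + Pi.single j 1) φ = pdMulti α (pd j φ) := by
  have hQ : ∀ (i : Fin d) (ψ : E d → ℝ), ContDiff ℝ ∞ ψ → ContDiff ℝ ∞ (pd i ψ) :=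
    fun i ψ hψ => contDiff_pd hψ i
  have hF : ∀ (i j : Fin d) (ψ : E d → ℝ), ContDiff ℝ ∞ ψ → pd i (pd j ψ) = pd j (pd i ψ) :=
    fun i j ψ hψ => pd_comm hψ i j
  change iterOp pd (List.finRange d) _ φ = iterOp pd (List.finRange d) α (pd j φ)
  rw [iterOp_comm (Q := fun ψ => ContDiff ℝ ∞ ψ) hQ hF _ _ _ hφ,
    iterOp_add_single (Q := fun ψ => ContDiff ℝ ∞ ψ) hQ hF _ (List.nodup_finRange d) α j hφ]
  simp

lemma iterOp_zero {ι A : Type*} (F : ι → A → A) (l : List ι) (ψ : A) : iterOp F l 0 ψ = ψ := by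
  induction l with
  | nil => rfl
  | cons i l ih => exact ih

lemma pdMulti_zero (φ : E d → ℝ) : pdMulti 0 φ = φ := iterOp_zero pd _ φ

lemma pderivMulti_zero (p : Poly d) : pderivMulti 0 p = p := iterOp_zero _ _ p

/-- A nonzero multi-index is the sum of a smaller one and a unit vector. -/
lemma exists_eq_add_single {α : Fin d → ℕ} {l : ℕ} (h : ∑ i, α i = l + 1) :
    ∃ (β : Fin d → ℕ) (j : Fin d), α = β + Pi.single j 1 ∧ ∑ i, β i = l := by
  obtain ⟨j, hj⟩ : ∃ j, α j ≠ 0 := by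
    by_contra! h0
    rw [Finset.sum_eq_zero fun i _ => h0 i] at h
    omega
  have h1 : α = (α - Pi.single j 1) + Pi.single j 1 := by
    refine (tsub_add_cancel_of_le fun i => ?_).symm
    by_cases hij : i = j
    · subst hij; simp; omega
    · simp [hij]
  refine ⟨α - Pi.single j 1, j, h1, ?_⟩
  rw [h1] at h
  simp only [Pi.add_apply, Finset.sum_add_distrib, Finset.sum_pi_single', Finset.mem_univ,
    if_true] at h
  omega

lemma sum_add_single (α : Fin d → ℕ) (j : Fin d) :
    ∑ i, (α + Pi.single j 1 : Fin d → ℕ) i = ∑ i, α i + 1 := by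
  simp [Finset.sum_add_distrib]

lemma pderivMulti_mem_P {k : ℕ} {p : Poly d} (hp : p ∈ P d k) {l : ℕ} {α : Fin d → ℕ}
    (hα : ∑ i, α i = l) : pderivMulti α p ∈ P d (k - l) := by
  induction l generalizing α with
  | zero =>
    have : α = 0 := by
      ext i
      exact (Finset.sum_eq_zero_iff.1 hα) i (Finset.mem_univ i)
    rw [this, pderivMulti_zero]
    exact hp
  | succ l ih =>
    obtain ⟨β, j, rfl, hβ⟩ := exists_eq_add_single hα
    rw [pderivMulti_add_single, ← Nat.sub_sub]
    exact pderiv_mem_P (ih hβ) j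

lemma pderivMulti_eq_zero {k : ℕ} {p : Poly d} (hp : p ∈ P d k) {α : Fin d → ℕ}
    (hα : ∑ i, α i = k + 1) : pderivMulti α p = 0 := by
  obtain ⟨β, j, rfl, hβ⟩ := exists_eq_add_single hα
  rw [pderivMulti_add_single]
  have := pderivMulti_mem_P hp hβ
  rw [Nat.sub_self] at this
  exact pderiv_eq_zero_of_mem_P_zero this j

lemma pderivMulti_add (α : Fin d → ℕ) (p q : Poly d) :
    pderivMulti α (p + q) = pderivMulti α p + pderivMulti α q := by
  unfold pderivMulti
  induction List.finRange d with
  | nil => rfl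
  | cons i l ih =>
    change (MvPolynomial.pderiv i)^[α i] (iterOp _ l α (p + q)) = _
    rw [ih, iterate_map_add]
    rfl

lemma pderivMulti_smul (α : Fin d → ℕ) (c : ℝ) (p : Poly d) :
    pderivMulti α (c • p) = c • pderivMulti α p := by
  unfold pderivMulti
  induction List.finRange d with
  | nil => rfl
  | cons i l ih =>
    change (MvPolynomial.pderiv i)^[α i] (iterOp _ l α (c • p)) = _
    rw [ih]
    have : ∀ (n : ℕ) (q : Poly d), (MvPolynomial.pderiv i)^[n] (c • q)
        = c • (MvPolynomial.pderiv i)^[n] q := by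
      intro n
      induction n with
      | zero => intro q; rfl
      | succ n ihn =>
        intro q
        rw [Function.iterate_succ_apply, (MvPolynomial.pderiv i).map_smul, ihn,
          Function.iterate_succ_apply]
    rw [this]
    rfl

end multi_index

section sobolev

variable {Ω : Set (E d)} {w g g' : E d → ℝ}

/-- Weak derivatives are unique. -/
lemma HasWeakDeriv.ae_eq (hΩ : IsOpen Ω) {α : Fin d → ℕ} (hg : MemLp g 2 (volume.restrict Ω))
    (hg' : MemLp g' 2 (volume.restrict Ω)) (h : HasWeakDeriv Ω α w g)
    (h' : HasWeakDeriv Ω α w g') : g =ᵐ[volume.restrict Ω] g' := by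
  have hl : LocallyIntegrableOn (fun x => g x - g' x) Ω := by
    refine (locallyIntegrableOn_iff hΩ.isLocallyClosed).2 fun K hKΩ hK => ?_
    have hm : MemLp (fun x => g x - g' x) 2 (volume.restrict K) :=
      (hg.sub hg').mono_measure (Measure.restrict_mono hKΩ le_rfl)
    have : IsFiniteMeasure (volume.restrict K) := ⟨by simpa using hK.measure_lt_top⟩
    exact hm.integrable (by norm_num)
  have h0 := hΩ.ae_eq_zero_of_integral_contDiff_smul_eq_zero hl (by
    intro φ hφ hc hs
    have h1 := (h φ hφ hc hs).symm.trans (h' φ hφ hc hs)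
    have h2 := mul_left_cancel₀ (pow_ne_zero _ (by norm_num)) h1
    have h3 : ∫ x, φ x • (g x - g' x) = ∫ x in Ω, φ x • (g x - g' x) := by
      refine (setIntegral_eq_integral_of_forall_compl_eq_zero fun x hx => ?_).symm
      rw [image_eq_zero_of_notMem_tsupport fun h => hx (hs h), zero_smul]
    have hφm : MemLp φ 2 (volume.restrict Ω) :=
      (hφ.continuous.memLp_of_hasCompactSupport hc).restrict Ω
    rw [h3, ← sub_eq_zero.2 h2, ← integral_sub (integrable_mul_of_memLp hg hφm)
      (integrable_mul_of_memLp hg' hφm)]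
    congr 1
    ext x
    rw [smul_eq_mul]
    ring)
  rw [Filter.EventuallyEq, ae_restrict_iff' hΩ.measurableSet]
  filter_upwards [h0] with x hx hxΩ
  exact sub_eq_zero.1 (hx hxΩ)

variable {m : ℕ}

lemma weakDeriv_spec (hw : MemSobolev Ω m w) {α : Fin d → ℕ} (hα : ∑ i, α i ≤ m) :
    MemLp (weakDeriv Ω α w) 2 (volume.restrict Ω) ∧ HasWeakDeriv Ω α w (weakDeriv Ω α w) := by
  have h := hw.2 α hα
  unfold weakDeriv
  rw [dif_pos h]
  exact h.choose_spec

lemma weakDeriv_zero (hΩ : IsOpen Ω) (hw : MemSobolev Ω m w) :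
    weakDeriv Ω 0 w =ᵐ[volume.restrict Ω] w := by
  obtain ⟨h1, h2⟩ := weakDeriv_spec hw (α := 0) (by simp)
  refine h2.ae_eq hΩ h1 hw.1 fun φ _ _ _ => ?_
  rw [pdMulti_zero]
  simp

/-- Weak derivatives of weak derivatives. -/
lemma hasWeakDeriv_weakDeriv (hw : MemSobolev Ω m w) {α : Fin d → ℕ} (hα : ∑ i, α i + 1 ≤ m)
    (j : Fin d) : HasWeakDeriv Ω (Pi.single j 1) (weakDeriv Ω α w)
      (weakDeriv Ω (α + Pi.single j 1) w) := by
  intro φ hφ hc hs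
  have hcd : HasCompactSupport (pd j φ) := (hc.fderiv ℝ).comp_left (g := fun L : E d →L[ℝ] ℝ =>
    L (EuclideanSpace.single j 1)) rfl
  have hts : tsupport (pd j φ) ⊆ Ω := by
    refine (closure_mono fun x hx => ?_).trans ((tsupport_fderiv_subset ℝ (f := φ)).trans hs)
    intro h0
    refine hx ?_
    unfold pd
    rw [h0]
    rfl
  have h1 := (weakDeriv_spec hw (α := α) (by omega)).2 (pd j φ) (contDiff_pd hφ j) hcd hts
  have h2 := (weakDeriv_spec hw (α := α + Pi.single j 1) (by rw [sum_add_single]; exact hα)).2 φ hφ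
    hc hs
  rw [pdMulti_add_single α j hφ, h1, sum_add_single, pow_succ, mul_assoc] at h2
  have h3 := mul_left_cancel₀ (pow_ne_zero _ (by norm_num)) h2
  rw [pdMulti_single, h3]
  simp

end sobolev

section approximation

variable {K : Set (E d)} {m : ℕ} {D D' : (Fin d → ℕ) → E d → ℝ}

/-- A family of functions on `K` consisting of the derivatives of order up to `m + 1` of a function:
those of order up to `m` are limits of smooth functions, with the gradients given by the family. -/
def IsJet (K : Set (E d)) (m : ℕ) (D : (Fin d → ℕ) → E d → ℝ) : Prop :=
  ∀ α : Fin d → ℕ, ∑ i, α i ≤ m → ∃ φ, H1Approx K (D α) (fun j => D (α + Pi.single j 1)) φ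

lemma IsJet.sub (hK : IsCompact K) (h : IsJet K m D) (h' : IsJet K m D') :
    IsJet K m fun α x => D α x - D' α x := fun α hα => by
  obtain ⟨φ, hφ⟩ := h α hα
  obtain ⟨ψ, hψ⟩ := h' α hα
  exact ⟨_, hφ.sub hK hψ⟩

lemma isJet_ev (hK : IsCompact K) (p : Poly d) : IsJet K m fun α => ev (pderivMulti α p) :=
  fun α _ => by
    refine ⟨fun _ => ev (pderivMulti α p), ?_⟩
    have := h1Approx_const hK (contDiff_ev (pderivMulti α p))
    simpa only [pd_ev, ← pderivMulti_add_single] using this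

lemma isJet_weakDeriv {Ω : Set (E d)} (hK : IsCompact K) (hc : Convex ℝ K)
    (hK' : (interior K).Nonempty) (hKΩ : interior K ⊆ Ω) {w : E d → ℝ}
    (hw : MemSobolev Ω (m + 1) w) : IsJet K m fun α => weakDeriv Ω α w := fun α hα =>
  exists_h1Approx hK hc hK' hKΩ (weakDeriv_spec hw (by omega)).1
    (fun j => (weakDeriv_spec hw (by rw [sum_add_single]; omega)).1)
    fun j => hasWeakDeriv_weakDeriv hw (by omega) j

/-- If all derivatives of order at most `m` have mean value zero, they are controlled by the
derivatives of order `m + 1`. -/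
lemma IsJet.nm_le (h : IsJet K m D) (hK : IsCompact K) (hc : Convex ℝ K)
    (hK' : (interior K).Nonempty) {δ : ℝ} (hδ0 : 0 ≤ δ) (hδ : ∀ x ∈ K, ∀ y ∈ K, ‖x - y‖ ≤ δ)
    (h0 : ∀ α : Fin d → ℕ, ∑ i, α i ≤ m → ∫ x in K, D α x = 0) (l : ℕ) {α : Fin d → ℕ}
    (hα : ∑ i, α i + l = m + 1) :
    nm (volume.restrict K) (D α) ≤ (√(2 ^ d) * d * δ) ^ l *
      ∑ β ∈ Finset.piAntidiag Finset.univ (m + 1), nm (volume.restrict K) (D β) := by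
  induction l generalizing α with
  | zero =>
    rw [pow_zero, one_mul]
    refine Finset.single_le_sum (f := fun β => nm (volume.restrict K) (D β))
      (fun _ _ => nm_nonneg) ?_
    rw [Finset.mem_piAntidiag]
    exact ⟨by omega, by simp⟩
  | succ l ih =>
    set S := ∑ β ∈ Finset.piAntidiag Finset.univ (m + 1), nm (volume.restrict K) (D β) with hS
    obtain ⟨φ, hφ⟩ := h α (by omega)
    refine (hφ.nm_le hK hc hK' hδ0 hδ (h0 α (by omega))).trans ?_
    have h1 : ∀ j : Fin d, nm (volume.restrict K) (D (α + Pi.single j 1))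
        ≤ (√(2 ^ d) * d * δ) ^ l * S := fun j => ih (by rw [sum_add_single]; omega)
    calc √(2 ^ d) * (δ * ∑ j, nm (volume.restrict K) (D (α + Pi.single j 1)))
        ≤ √(2 ^ d) * (δ * ∑ j : Fin d, (√(2 ^ d) * d * δ) ^ l * S) := by
          gcongr with j
          exact h1 j
      _ = _ := by
          rw [Finset.sum_const, Finset.card_univ, Fintype.card_fin, nsmul_eq_mul]
          ring

/-- The mean values of the derivatives of a polynomial can be prescribed. By the Poincaré inequality
they determine the polynomial, and their number is the dimension of the space. -/
lemma exists_integral_pderivMulti_eq (hK : IsCompact K) (hc : Convex ℝ K)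
    (hK' : (interior K).Nonempty) (b : (Fin d → ℕ) → ℝ) :
    ∃ p ∈ P d m, ∀ α : Fin d → ℕ, ∑ i, α i ≤ m → ∫ x in K, ev (pderivMulti α p) x = b α := by
  set S : Set (Fin d →₀ ℕ) := {n | (n.sum fun _ e => e) ≤ m} with hS
  let bas : Module.Basis S ℝ (P d m) := MvPolynomial.basisRestrictSupport ℝ S
  have hfin : Finite S := Module.Finite.finite_basis bas
  let _ : Fintype S := Fintype.ofFinite S
  have hi : ∀ p : Poly d, IntegrableOn (ev p) K := fun p =>
    (continuous_ev p).continuousOn.integrableOn_compact hK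
  let L : P d m →ₗ[ℝ] (S → ℝ) :=
    { toFun := fun p n => ∫ x in K, ev (pderivMulti n.1 p.1) x
      map_add' := fun p q => by
        ext n
        change ∫ x in K, ev (pderivMulti n.1 (p.1 + q.1)) x = _
        simp only [pderivMulti_add, ev_add]
        exact integral_add (hi _) (hi _)
      map_smul' := fun c p => by
        ext n
        change ∫ x in K, ev (pderivMulti n.1 (c • p.1)) x = _
        simp only [pderivMulti_smul, ev_smul]
        exact integral_const_mul _ _ }
  have hmem : ∀ α : Fin d → ℕ, ∑ i, α i ≤ m → Finsupp.equivFunOnFinite.symm α ∈ S := by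
    intro α hα
    rw [hS, Set.mem_ofPred_eq, Finsupp.sum_fintype _ _ fun _ => rfl]
    simpa using hα
  have hinj : Function.Injective L := by
    intro p q hpq
    have h1 : ∀ α : Fin d → ℕ, ∑ i, α i ≤ m →
        ∫ x in K, ev (pderivMulti α (p.1 - q.1)) x = 0 := by
      intro α hα
      have h2 : ∫ x in K, ev (pderivMulti α p.1) x = ∫ x in K, ev (pderivMulti α q.1) x :=
        congrFun hpq ⟨_, hmem α hα⟩
      have h3 : pderivMulti α (p.1 - q.1) = pderivMulti α p.1 + (-1 : ℝ) • pderivMulti α q.1 := by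
        rw [← pderivMulti_smul, ← pderivMulti_add, neg_one_smul, sub_eq_add_neg]
      simp only [h3, ev_add, ev_smul]
      rw [integral_add (hi _) ((hi _).const_mul _), integral_const_mul, h2]
      ring
    obtain ⟨R, hR⟩ := hK.isBounded.exists_norm_le
    have h4 := (isJet_ev (m := m) hK (p.1 - q.1)).nm_le hK hc hK' (δ := |R| + |R|) (by positivity)
      (fun x hx y hy => (norm_sub_le _ _).trans (add_le_add ((hR x hx).trans (le_abs_self R))
        ((hR y hy).trans (le_abs_self R)))) h1 (m + 1) (α := 0) (by simp)
    rw [Finset.sum_eq_zero, mul_zero, pderivMulti_zero] at h4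
    · have h5 := eq_zero_of_nm_eq_zero hK hK' (le_antisymm h4 nm_nonneg)
      exact Subtype.ext (sub_eq_zero.1 h5)
    · intro β hβ
      rw [Finset.mem_piAntidiag] at hβ
      rw [pderivMulti_eq_zero (sub_mem p.2 q.2) hβ.1]
      simp [nm]
  have hdim : Module.finrank ℝ (P d m) = Module.finrank ℝ (S → ℝ) := by
    rw [Module.finrank_eq_card_basis bas, Module.finrank_fintype_fun_eq_card]
  obtain ⟨p, hp⟩ := (LinearMap.injective_iff_surjective_of_finrank_eq_finrank hdim).1 hinj
    fun n => b n.1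
  refine ⟨p.1, p.2, fun α hα => ?_⟩
  exact congrFun hp ⟨_, hmem α hα⟩

/-- Polynomial approximation of a function and its derivatives, by the polynomial whose derivatives
have the same mean values. -/
lemma IsJet.exists_approx (h : IsJet K m D) (hK : IsCompact K) (hc : Convex ℝ K)
    (hK' : (interior K).Nonempty) {δ : ℝ} (hδ0 : 0 ≤ δ) (hδ : ∀ x ∈ K, ∀ y ∈ K, ‖x - y‖ ≤ δ) :
    ∃ p ∈ P d m, ∀ (l : ℕ) (α : Fin d → ℕ), ∑ i, α i + l = m + 1 →
      nm (volume.restrict K) (fun x => D α x - ev (pderivMulti α p) x)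
        ≤ (√(2 ^ d) * d * δ) ^ l *
          ∑ β ∈ Finset.piAntidiag Finset.univ (m + 1), nm (volume.restrict K) (D β) := by
  obtain ⟨p, hp, hpD⟩ := exists_integral_pderivMulti_eq (m := m) hK hc hK' fun α => ∫ x in K, D α x
  refine ⟨p, hp, fun l α hα => ?_⟩
  have hfin : IsFiniteMeasure (volume.restrict K) := ⟨by simpa using hK.measure_lt_top⟩
  have h1 := (h.sub hK (isJet_ev hK p)).nm_le hK hc hK' hδ0 hδ (fun α hα => by
    obtain ⟨φ, hφ⟩ := h α hα
    rw [integral_sub (hφ.mem.integrable (by norm_num))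
      ((continuous_ev _).continuousOn.integrableOn_compact hK), hpD α hα, sub_self]) l hα
  refine h1.trans (le_of_eq ?_)
  congr 1
  refine Finset.sum_congr rfl fun β hβ => ?_
  rw [Finset.mem_piAntidiag] at hβ
  rw [pderivMulti_eq_zero hp hβ.1]
  simp

end approximation

section mesh

/-! ### Geometry of the mesh -/

section simplex

variable {T : Finset (E d)} (hT : IsSimplex T)
include hT

lemma volume_bary_eq_zero {b : E d} (hb : b ∈ T) : volume {x | bary T b x = 0} = 0 := by
  have h : {x | bary T b x = 0}
      = ((AffineSubspace.comap (bary T b) (affineSpan ℝ {(0 : ℝ)}) : AffineSubspace ℝ (E d)) :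
        Set (E d)) := by
    ext x
    simp
  rw [h]
  refine Measure.addHaar_affineSubspace _ _ fun htop => ?_
  have h1 : b ∈ AffineSubspace.comap (bary T b) (affineSpan ℝ {(0 : ℝ)}) := by
    rw [htop]; trivial
  have h2 : b ∈ {x | bary T b x = 0} := by rw [h]; exact h1
  rw [Set.mem_ofPred_eq, bary_self hT hb] at h2
  exact one_ne_zero h2

/-- The intersection of the hyperplanes of two facets is a null set for the surface measure: it is
invariant under translations which are transversal to one of the hyperplanes. -/
lemma surf_ridge (hd : 2 ≤ d) {a b : E d} (ha : a ∈ T) (hb : b ∈ T) (hab : a ≠ b) :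
    surf d {x | bary T a x = 0 ∧ bary T b x = 0} = 0 := by
  classical
  have hd1 : 1 ≤ d := by omega
  obtain ⟨c, hc⟩ : ∃ c, c ∈ (T.erase a).erase b := by
    refine Finset.card_pos.1 ?_
    rw [Finset.card_erase_of_mem (Finset.mem_erase.2 ⟨hab.symm, hb⟩), Finset.card_erase_of_mem ha,
      hT.card]
    omega
  obtain ⟨hcb, hca, hcT⟩ : c ≠ b ∧ c ≠ a ∧ c ∈ T := by simpa using hc
  obtain ⟨κ, hκ⟩ := exists_hyper_eq hT hd1 ha
  -- `bary T b` is constant along the edge `c - a`, which is transversal to the hyperplane `bary T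
  -- a = 0`. Slicing the null set `{bary T b = 0}` along this edge gives translates of one and the
  -- same slice, so that this slice is null.
  set v := c - a with hv
  have hva : (bary T a).linear v = -1 := by
    rw [hv, ← affineMap_sub, bary_self hT ha, bary_ne hT ha hcT hca.symm]; ring
  have hvb : (bary T b).linear v = 0 := by
    rw [hv, ← affineMap_sub, bary_ne hT hb hcT hcb.symm, bary_ne hT hb ha hab.symm]; ring
  have hn := norm_normal hT hd1 ha
  have hnv : inner ℝ (normal T a) v ≠ 0 := by
    rw [inner_normal hT hd1 ha, hva]
    have := height_pos hT hd1 ha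
    simpa using this.ne'
  set t : Set (E d) := {x | bary T b x = 0} with ht
  have htm : MeasurableSet t :=
    (isClosed_eq (continuous_affineMap _) continuous_const).measurableSet
  have h1 := volume_slice hn κ hnv htm
  rw [volume_bary_eq_zero hT hb] at h1
  have h2 : ∀ s : ℝ, {y | y + s • v ∈ t} = t := by
    intro s
    ext y
    simp only [ht, Set.mem_ofPred_eq]
    have h3 : bary T b (y + s • v) = bary T b y := by
      have h4 := affineMap_sub (bary T b) (y + s • v) y
      rw [add_sub_cancel_left, map_smul, hvb, smul_zero] at h4
      linarith
    rw [h3]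
  simp only [h2, lintegral_const, Real.volume_univ] at h1
  have h3 := (mul_eq_zero.1 h1.symm).resolve_left (by simpa using hnv)
  have h4 := (mul_eq_zero.1 h3).resolve_right (by simp)
  rw [Measure.restrict_apply htm, hκ] at h4
  refine measure_mono_null (fun x hx => ?_) h4
  exact ⟨hx.2, hx.1⟩

end simplex

lemma mem_hull_opp_of_subset {T : Finset (E d)} {a : E d} {S : Set (E d)} (hS : S ⊆ T)
    (haS : a ∉ S) {x : E d} (hx : x ∈ convexHull ℝ S) : x ∈ hull (opp T a) :=
  convexHull_mono (fun _ hb => mem_opp.2 ⟨ne_of_mem_of_not_mem hb haS, hS hb⟩) hx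

/-- A domain with Lipschitz boundary lies locally on one side of it. -/
lemma interior_closure_subset {Ω : Set (E d)} (hΩ : IsLipschitzDomain Ω) :
    interior (closure Ω) ⊆ Ω := by
  intro x hx
  by_contra hxΩ
  have hfr : x ∈ frontier Ω := by
    rw [hΩ.isOpen.frontier_eq]
    exact ⟨interior_subset hx, hxΩ⟩
  obtain ⟨ν, r, K, g, hν, hr, hg, hgν, hloc⟩ := hΩ.lipschitz x hfr
  have hx0 : g x ≤ inner ℝ x ν := by
    have := (hloc x (Metric.mem_ball_self hr)).not.1 hxΩ
    exact not_lt.1 this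
  have hnhds : interior (closure Ω) ∩ Metric.ball x r ∈ 𝓝 x :=
    inter_mem (isOpen_interior.mem_nhds hx) (Metric.ball_mem_nhds x hr)
  have hlim : Tendsto (fun t : ℝ => x + t • ν) (𝓝[>] 0) (𝓝 x) := by
    have : Tendsto (fun t : ℝ => x + t • ν) (𝓝 0) (𝓝 (x + (0 : ℝ) • ν)) :=
      (by fun_prop : Continuous fun t : ℝ => x + t • ν).tendsto 0
    rw [zero_smul, add_zero] at this
    exact this.mono_left nhdsWithin_le_nhds
  -- Close to `x` the domain lies below the graph. Moving upwards from `x` stays in the closure of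
  -- the domain, but reaches a point with a neighbourhood above the graph.
  obtain ⟨t, ht, ht0⟩ := ((hlim.eventually hnhds).and self_mem_nhdsWithin).exists
  have hin : g (x + t • ν) < inner ℝ (x + t • ν) ν := by
    rw [hgν, inner_add_left, real_inner_smul_left, real_inner_self_eq_norm_sq, hν]
    have : (0 : ℝ) < t := ht0
    linarith
  have hU : {y | g y < inner ℝ y ν} ∩ Metric.ball x r ∈ 𝓝 (x + t • ν) := by
    refine inter_mem (IsOpen.mem_nhds (isOpen_lt hg.continuous (by fun_prop)) hin)
      (Metric.isOpen_ball.mem_nhds ht.2)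
  obtain ⟨z, hz, hzΩ⟩ := mem_closure_iff_nhds.1 (interior_subset ht.1) _ hU
  exact absurd ((hloc z hz.2).1 hzΩ) (not_lt.2 hz.1.le)

section triangulation

variable {Ω : Set (E d)} (𝒯 : Triangulation Ω) {T T' : Finset (E d)}

lemma mem_elems : T ∈ 𝒯.elems ↔ T ∈ 𝒯.complex.faces ∧ T.card = d + 1 := by
  simp [Triangulation.elems]

lemma isSimplex_of_mem_elems (h : T ∈ 𝒯.elems) : IsSimplex T :=
  ⟨𝒯.complex.indep ((mem_elems 𝒯).1 h).1, ((mem_elems 𝒯).1 h).2⟩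

lemma hull_subset_closure {s : Finset (E d)} (h : s ∈ 𝒯.complex.faces) : hull s ⊆ closure Ω := by
  rw [← 𝒯.space_eq]
  exact 𝒯.complex.convexHull_subset_space h

lemma opp_mem_faces (hd : 1 ≤ d) (h : T ∈ 𝒯.elems) {a : E d} (ha : a ∈ T) :
    opp T a ∈ 𝒯.complex.faces :=
  𝒯.complex.down_closed ((mem_elems 𝒯).1 h).1 (opp_subset T a)
    (opp_nonempty (isSimplex_of_mem_elems 𝒯 h) hd ha)

lemma card_opp {a : E d} (ha : a ∈ T) : (opp T a).card = T.card - 1 := by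
  classical
  rw [opp]
  convert Finset.card_erase_of_mem ha

lemma opp_mem_facets (hd : 1 ≤ d) (h : T ∈ 𝒯.elems) {a : E d} (ha : a ∈ T) :
    opp T a ∈ 𝒯.facets := by
  simp only [Triangulation.facets, Finset.mem_filter, Set.Finite.mem_toFinset]
  refine ⟨opp_mem_faces 𝒯 hd h ha, ?_⟩
  rw [card_opp ha, ((mem_elems 𝒯).1 h).2]
  rfl

variable (hΩ : IsLipschitzDomain Ω)

include hΩ in
lemma interior_hull_subset (h : T ∈ 𝒯.elems) : interior (hull T) ⊆ Ω :=
  (interior_mono (hull_subset_closure 𝒯 ((mem_elems 𝒯).1 h).1)).trans (interior_closure_subset hΩ)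

lemma interior_hull_ae_eq (T : Finset (E d)) : (interior (hull T) : Set (E d)) =ᵐ[volume] hull T :=
  interior_ae_eq_of_null_frontier ((convex_hull' T).addHaar_frontier volume)

/-- The elements of a complex meet in common faces: a face without the vertex `a` meets `T` in the
facet opposite to `a`. -/
lemma inter_hull_subset {s : Finset (E d)} (hs : s ∈ 𝒯.complex.faces) (h : T ∈ 𝒯.complex.faces)
    {a : E d} (has : a ∉ s) :
    hull T ∩ hull s ⊆ hull (opp T a) := fun _ hx =>
  mem_hull_opp_of_subset Set.inter_subset_left (fun h => has h.2)
    (𝒯.complex.inter_subset_convexHull h hs hx)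

lemma volume_inter_hull (h : T ∈ 𝒯.elems) (h' : T' ∈ 𝒯.elems) (hne : T ≠ T') :
    volume (hull T ∩ hull T') = 0 := by
  have hT := isSimplex_of_mem_elems 𝒯 h
  obtain ⟨a, ha, ha'⟩ : ∃ a ∈ T, a ∉ T' := by
    by_contra! hsub
    exact hne (Finset.eq_of_subset_of_card_le hsub
      (by rw [((mem_elems 𝒯).1 h).2, ((mem_elems 𝒯).1 h').2]))
  refine measure_mono_null (fun x hx => ?_) (volume_bary_eq_zero hT ha)
  exact ((mem_hull_opp hT ha).1 (inter_hull_subset 𝒯 ((mem_elems 𝒯).1 h').1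
    ((mem_elems 𝒯).1 h).1 ha' hx)).1

lemma card_le_of_mem_faces {s : Finset (E d)} (h : s ∈ 𝒯.complex.faces) : s.card ≤ d + 1 := by
  have := (𝒯.complex.indep h).card_le_finrank_succ
  rw [Fintype.card_coe] at this
  refine this.trans (Nat.succ_le_succ ((Submodule.finrank_le _).trans_eq ?_))
  exact finrank_euclideanSpace_fin

lemma volume_hull_of_card_le {s : Finset (E d)} (hs : s ∈ 𝒯.complex.faces) (hc : s.card ≤ d) :
    volume (hull s) = 0 := by
  refine measure_mono_null (convexHull_subset_affineSpan (𝕜 := ℝ) (s : Set (E d)))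
    (Measure.addHaar_affineSubspace _ _ fun htop => ?_)
  have hne := 𝒯.complex.nonempty_of_mem_faces hs
  -- Fewer than `d + 1` points do not span the space.
  have h1 := (𝒯.complex.indep hs).finrank_vectorSpan (n := s.card - 1)
    (by rw [Fintype.card_coe]; have := hne.card_pos; omega)
  have h2 : Set.range (fun x : s => (x : E d)) = (s : Set (E d)) := Subtype.range_coe
  rw [h2, ← direction_affineSpan, htop, AffineSubspace.direction_top, finrank_top,
    finrank_euclideanSpace_fin] at h1
  have := hne.card_pos
  omega

include hΩ in
/-- The elements cover the domain up to a null set. -/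
lemma iUnion_hull_ae_eq : (⋃ T : 𝒯.elems, hull T.1 : Set (E d)) =ᵐ[volume] Ω := by
  rw [ae_eq_set]
  refine ⟨?_, ?_⟩
  · rw [Set.iUnion_sdiff]
    refine measure_iUnion_null fun T => ?_
    refine measure_mono_null (Set.sdiff_subset_sdiff_right (interior_hull_subset 𝒯 hΩ T.2)) ?_
    exact (ae_eq_set.1 (interior_hull_ae_eq T.1)).2
  · have h1 : Ω \ ⋃ T : 𝒯.elems, hull T.1
        ⊆ ⋃ s ∈ {s | s ∈ 𝒯.complex.faces ∧ s.card ≤ d}, hull s := by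
      rintro x ⟨hx, hx'⟩
      have h2 : x ∈ 𝒯.complex.space := by
        rw [𝒯.space_eq]
        exact subset_closure hx
      obtain ⟨s, hs, hxs⟩ := 𝒯.complex.mem_space_iff.1 h2
      refine Set.mem_biUnion (x := s) ⟨hs, ?_⟩ hxs
      by_contra hc
      refine hx' (Set.mem_iUnion.2 ⟨⟨s, (mem_elems 𝒯).2 ⟨hs, ?_⟩⟩, hxs⟩)
      have := card_le_of_mem_faces 𝒯 hs
      omega
    refine measure_mono_null h1 ((measure_biUnion_null_iff
      (𝒯.finite.subset fun s hs => hs.1).countable).2 fun s hs => ?_)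
    exact volume_hull_of_card_le 𝒯 hs.1 hs.2

include hΩ in
/-- Integrals over the domain are sums of integrals over the elements. -/
lemma setIntegral_eq_sum_elems {f : E d → ℝ} (hf : IntegrableOn f Ω) :
    ∫ x in Ω, f x = ∑ T ∈ 𝒯.elems, ∫ x in hull T, f x := by
  have h1 := iUnion_hull_ae_eq 𝒯 hΩ
  have h2 : ∫ x in ⋃ T : 𝒯.elems, hull T.1, f x = ∑' T : 𝒯.elems, ∫ x in hull T.1, f x := by
    refine integral_iUnion_ae (fun T => (measurableSet_hull T.1).nullMeasurableSet)
      (fun T T' hne => ?_) (hf.congr_set_ae h1)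
    exact volume_inter_hull 𝒯 T.2 T'.2 fun h => hne (Subtype.ext h)
  rw [← setIntegral_congr_set h1, h2, tsum_fintype,
    ← Finset.sum_coe_sort 𝒯.elems fun T => ∫ x in hull T, f x]

include hΩ in
lemma ae_hull_of_ae (h : T ∈ 𝒯.elems) {p : E d → Prop} (hp : ∀ᵐ x ∂volume.restrict Ω, p x) :
    ∀ᵐ x ∂volume.restrict (hull T), p x := by
  rw [← Measure.restrict_congr_set (interior_hull_ae_eq T)]
  exact ae_restrict_of_ae_restrict_of_subset (interior_hull_subset 𝒯 hΩ h) hp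

/-- The relative interior of the facet of `T` opposite to `a`. -/
def facetInterior (T : Finset (E d)) (a : E d) : Set (E d) :=
  {x | bary T a x = 0 ∧ ∀ b ∈ T, b ≠ a → 0 < bary T b x}

lemma facetInterior_subset (hT : IsSimplex T) {a : E d} (ha : a ∈ T) :
    facetInterior T a ⊆ hull (opp T a) := fun x hx => (mem_hull_opp hT ha).2 ⟨hx.1, fun b hb => by
  by_cases h : b = a
  · rw [h, hx.1]
  · exact (hx.2 b hb h).le⟩

/-- The faces meeting the relative interior of a facet are the facet and the elements on it. -/
lemma opp_subset_of_mem_hull (h : T ∈ 𝒯.elems) {a : E d} (ha : a ∈ T) {x : E d}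
    (hx : x ∈ facetInterior T a) {s : Finset (E d)} (hs : s ∈ 𝒯.complex.faces) (hxs : x ∈ hull s) :
    opp T a ⊆ s := by
  have hT := isSimplex_of_mem_elems 𝒯 h
  intro b hb
  obtain ⟨hba, hbT⟩ := mem_opp.1 hb
  by_contra hbs
  have hxT : x ∈ hull T := convexHull_mono (by exact_mod_cast opp_subset T a)
    (facetInterior_subset hT ha hx)
  have h1 := inter_hull_subset 𝒯 hs ((mem_elems 𝒯).1 h).1 hbs ⟨hxT, hxs⟩
  exact (hx.2 b hbT hba).ne' ((mem_hull_opp hT hbT).1 h1).1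

/-- In an element, a function that vanishes on a facet is a multiple of the barycentric coordinate
of the opposite vertex. -/
lemma affineMap_eq_mul_bary (hT : IsSimplex T) {a : E d} (ha : a ∈ T) (f : E d →ᵃ[ℝ] ℝ)
    (hf : ∀ c ∈ opp T a, f c = 0) (y : E d) : f y = bary T a y * f a := by
  conv_lhs => rw [← sum_bary_smul hT y]
  rw [affineMap_sum _ _ _ _ (sum_bary hT y), Finset.sum_eq_single a]
  · intro c hc hca
    rw [hf c (mem_opp.2 ⟨hca, hc⟩), mul_zero]
  · exact fun h => (h ha).elim

/-- If two elements share a facet and lie on different sides of it, they cover a neighbourhood of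
every point in the relative interior of the facet. -/
lemma facetInterior_subset_of_neighbour (h : T ∈ 𝒯.elems) (h' : T' ∈ 𝒯.elems) {a a' : E d}
    (ha : a ∈ T) (ha' : a' ∈ T') (heq : opp T' a' = opp T a) (hneg : bary T a a' < 0) :
    facetInterior T a ⊆ interior (closure Ω) := by
  have hT := isSimplex_of_mem_elems 𝒯 h
  have hT' := isSimplex_of_mem_elems 𝒯 h'
  intro x hx
  -- The signs of `bary T a` and `bary T' a'` are opposite, and both vanish on the facet.
  have hid : ∀ y, bary T a y = bary T' a' y * bary T a a' := fun y =>
    affineMap_eq_mul_bary hT' ha' _ (fun c hc => by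
      rw [heq] at hc
      obtain ⟨hca, hcT⟩ := mem_opp.1 hc
      exact bary_ne hT ha hcT hca.symm) y
  -- On the facet, the remaining barycentric coordinates of the two elements agree.
  have hx' : ∀ b ∈ T', b ≠ a' → bary T' b x = bary T b x := by
    intro b hb hba
    have hbo : b ∈ opp T a := by rw [← heq]; exact mem_opp.2 ⟨hba, hb⟩
    obtain ⟨hba', hbT⟩ := mem_opp.1 hbo
    conv_lhs => rw [← sum_bary_smul hT x]
    rw [affineMap_sum _ _ _ _ (sum_bary hT x), Finset.sum_eq_single b]
    · rw [bary_self hT' hb, mul_one]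
    · intro c hc hcb
      by_cases hca : c = a
      · rw [hca, hx.1, zero_mul]
      · have hcT' : c ∈ opp T' a' := by rw [heq]; exact mem_opp.2 ⟨hca, hc⟩
        rw [bary_ne hT' hb (mem_opp.1 hcT').2 hcb.symm, mul_zero]
    · exact fun h => (h hbT).elim
  have hev : ∀ (S : Finset (E d)) (c b : E d), 0 < bary S b x →
      ∀ᶠ y in 𝓝 x, 0 < bary S b y := fun S _ b hb =>
    (continuous_affineMap (bary S b)).continuousAt.eventually_const_lt hb
  have h1 : ∀ᶠ y in 𝓝 x, ∀ b ∈ T, b ≠ a → 0 < bary T b y := by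
    rw [Filter.eventually_all_finset]
    intro b hb
    by_cases hba : b = a
    · exact .of_forall fun y hne => (hne hba).elim
    · exact (hev T a b (hx.2 b hb hba)).mono fun y hy _ => hy
  have h2 : ∀ᶠ y in 𝓝 x, ∀ b ∈ T', b ≠ a' → 0 < bary T' b y := by
    rw [Filter.eventually_all_finset]
    intro b hb
    by_cases hba : b = a'
    · exact .of_forall fun y hne => (hne hba).elim
    · refine (hev T' a b ?_).mono fun y hy _ => hy
      rw [hx' b hb hba]
      have hbo : b ∈ opp T a := by rw [← heq]; exact mem_opp.2 ⟨hba, hb⟩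
      exact hx.2 b (mem_opp.1 hbo).2 (mem_opp.1 hbo).1
  rw [mem_interior_iff_mem_nhds]
  filter_upwards [h1, h2] with y hy1 hy2
  rcases le_total 0 (bary T a y) with h3 | h3
  · refine hull_subset_closure 𝒯 ((mem_elems 𝒯).1 h).1 ((mem_hull hT).2 fun b hb => ?_)
    by_cases hba : b = a
    · rw [hba]; exact h3
    · exact (hy1 b hb hba).le
  · refine hull_subset_closure 𝒯 ((mem_elems 𝒯).1 h').1 ((mem_hull hT').2 fun b hb => ?_)
    by_cases hba : b = a'
    · rw [hba]
      rw [hid y] at h3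
      exact nonneg_of_mul_nonpos_left h3 hneg
    · exact (hy2 b hb hba).le

/-- A facet is contained in the closure of its relative interior: move towards the barycentre. -/
lemma hull_opp_subset_closure (hT : IsSimplex T) (hd : 1 ≤ d) {a : E d} (ha : a ∈ T) :
    hull (opp T a) ⊆ closure (facetInterior T a) := by
  obtain ⟨x₀, hx₀⟩ : ∃ x₀, x₀ ∈ facetInterior T a := by
    have hd0 : (0 : ℝ) < d := by exact_mod_cast hd
    have hsum : ∑ b ∈ opp T a, (d : ℝ)⁻¹ = 1 := by
      rw [Finset.sum_const, card_opp ha, hT.card, nsmul_eq_mul]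
      simp [hd0.ne']
    refine ⟨∑ b ∈ opp T a, (d : ℝ)⁻¹ • b, ?_, fun b hb hba => ?_⟩
    · rw [affineMap_sum (bary T a) (opp T a) (fun _ => (d : ℝ)⁻¹) (fun b => b) hsum]
      refine Finset.sum_eq_zero fun b hb => ?_
      rw [bary_ne hT ha (mem_opp.1 hb).2 (mem_opp.1 hb).1.symm, mul_zero]
    · rw [affineMap_sum (bary T b) (opp T a) (fun _ => (d : ℝ)⁻¹) (fun b => b) hsum,
        Finset.sum_eq_single b]
      · rw [bary_self hT hb, mul_one]
        exact inv_pos.2 hd0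
      · intro c hc hcb
        rw [bary_ne hT hb (mem_opp.1 hc).2 hcb.symm, mul_zero]
      · exact fun h => (h (mem_opp.2 ⟨hba, hb⟩)).elim
  intro y hy
  obtain ⟨hy0, hy1⟩ := (mem_hull_opp hT ha).1 hy
  have hlim : Tendsto (fun t : ℝ => y + t • (x₀ - y)) (𝓝[>] 0) (𝓝 y) := by
    have : Tendsto (fun t : ℝ => y + t • (x₀ - y)) (𝓝 0) (𝓝 (y + (0 : ℝ) • (x₀ - y))) :=
      (by fun_prop : Continuous fun t : ℝ => y + t • (x₀ - y)).tendsto 0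
    rw [zero_smul, add_zero] at this
    exact this.mono_left nhdsWithin_le_nhds
  refine mem_closure_of_tendsto hlim ?_
  filter_upwards [Ioo_mem_nhdsGT (zero_lt_one (α := ℝ))] with t ht
  have hb : ∀ b, bary T b (y + t • (x₀ - y)) = (1 - t) * bary T b y + t * bary T b x₀ := by
    intro b
    have h4 := affineMap_sub (bary T b) (y + t • (x₀ - y)) y
    rw [add_sub_cancel_left, map_smul, ← affineMap_sub, smul_eq_mul] at h4
    linarith
  refine ⟨?_, fun b hbT hba => ?_⟩
  · rw [hb, hy0, hx₀.1]; ring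
  · rw [hb]
    have := mul_nonneg (sub_nonneg.2 ht.2.le) (hy1 b hbT)
    have := mul_pos ht.1 (hx₀.2 b hbT hba)
    linarith

include hΩ in
/-- A facet lies on the boundary or its relative interior lies in the domain. -/
lemma facet_dichotomy (hd : 1 ≤ d) (h : T ∈ 𝒯.elems) {a : E d} (ha : a ∈ T) :
    hull (opp T a) ⊆ frontier Ω ∨ facetInterior T a ⊆ Ω := by
  have hT := isSimplex_of_mem_elems 𝒯 h
  -- Either the facet has an element on its other side, or its relative interior avoids the domain.
  by_cases hA : ∃ T' ∈ 𝒯.elems, ∃ a' ∈ T', opp T' a' = opp T a ∧ bary T a a' < 0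
  · obtain ⟨T', h', a', ha', heq, hneg⟩ := hA
    exact Or.inr ((facetInterior_subset_of_neighbour 𝒯 h h' ha ha' heq hneg).trans
      (interior_closure_subset hΩ))
  left
  have hempty : facetInterior T a ⊆ Ωᶜ := by
    intro x hx hxΩ
    -- leave `T` through the facet; nearby points do not belong to any face
    have hlim : Tendsto (fun t : ℝ => x + t • (x - a)) (𝓝[>] 0) (𝓝 x) := by
      have : Tendsto (fun t : ℝ => x + t • (x - a)) (𝓝 0) (𝓝 (x + (0 : ℝ) • (x - a))) :=
        (by fun_prop : Continuous fun t : ℝ => x + t • (x - a)).tendsto 0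
      rw [zero_smul, add_zero] at this
      exact this.mono_left nhdsWithin_le_nhds
    have hnear : ∀ᶠ y in 𝓝 x, y ∈ Ω ∧ ∀ s ∈ 𝒯.finite.toFinset, y ∈ hull s → x ∈ hull s := by
      have hΩx : ∀ᶠ y in 𝓝 x, y ∈ Ω := hΩ.isOpen.mem_nhds hxΩ
      refine hΩx.and ?_
      rw [Filter.eventually_all_finset]
      intro s _
      by_cases hxs : x ∈ hull s
      · exact .of_forall fun _ _ => hxs
      · filter_upwards [(isCompact_hull s).isClosed.isOpen_compl.mem_nhds hxs] with y hy hys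
        exact (hy hys).elim
    obtain ⟨t, ⟨hyΩ, hys⟩, ht0⟩ := ((hlim.eventually hnear).and self_mem_nhdsWithin).exists
    have ht : (0 : ℝ) < t := ht0
    set y := x + t • (x - a) with hy
    have hya : bary T a y < 0 := by
      have h4 := affineMap_sub (bary T a) y x
      rw [hy, add_sub_cancel_left, map_smul, ← affineMap_sub, hx.1, bary_self hT ha,
        smul_eq_mul] at h4
      rw [hy]
      linarith
    have hsp : y ∈ 𝒯.complex.space := by
      rw [𝒯.space_eq]
      exact subset_closure hyΩ
    obtain ⟨s, hs, hysm⟩ := 𝒯.complex.mem_space_iff.1 hsp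
    have hxs := hys s (by simpa using hs) hysm
    have hsub := opp_subset_of_mem_hull 𝒯 h ha hx hs hxs
    have hcard := card_le_of_mem_faces 𝒯 hs
    have hco : (opp T a).card = d := by rw [card_opp ha, hT.card]; rfl
    rcases (Finset.card_le_card hsub).eq_or_lt with hc | hc
    · have hse := Finset.eq_of_subset_of_card_le hsub hc.ge
      have : y ∈ hull (opp T a) := by rw [hse]; exact hysm
      exact hya.ne ((mem_hull_opp hT ha).1 this).1
    · have hsel : s ∈ 𝒯.elems := (mem_elems 𝒯).2 ⟨hs, by omega⟩
      obtain ⟨a', ha's, ha'o⟩ := Finset.exists_mem_notMem_of_card_lt_card hc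
      have hoe : opp T a = opp s a' := by
        refine Finset.eq_of_subset_of_card_le (fun b hb => mem_opp.2
          ⟨fun hba => ha'o (hba ▸ hb), hsub hb⟩) ?_
        rw [card_opp ha's]
        omega
      -- There is no element on the other side, so `s` lies on the same side as `T`, unlike `y`.
      have hnn : 0 ≤ bary T a a' := by
        by_contra hlt
        exact hA ⟨s, hsel, a', ha's, hoe.symm, not_le.1 hlt⟩
      have hsS := isSimplex_of_mem_elems 𝒯 hsel
      have hid := affineMap_eq_mul_bary hsS ha's (bary T a) (fun c hc => by
        rw [← hoe] at hc
        exact bary_ne hT ha (mem_opp.1 hc).2 (mem_opp.1 hc).1.symm) y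
      rw [hid] at hya
      exact hya.not_ge (mul_nonneg ((mem_hull hsS).1 hysm a' ha's) hnn)
  intro y hy
  rw [hΩ.isOpen.frontier_eq]
  refine ⟨hull_subset_closure 𝒯 (opp_mem_faces 𝒯 hd h ha) hy, ?_⟩
  have h1 := closure_mono hempty (hull_opp_subset_closure hT hd ha hy)
  rwa [hΩ.isOpen.isClosed_compl.closure_eq] at h1

open scoped Classical in
/-- The part of the domain off the facets other than `e`. -/
def facetNhd (e : Finset (E d)) : Set (E d) := Ω \ ⋃ e' ∈ 𝒯.facets.erase e, hull e'

include hΩ in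
lemma isOpen_facetNhd (e : Finset (E d)) : IsOpen (facetNhd 𝒯 e) :=
  hΩ.isOpen.sdiff (Set.Finite.isClosed_biUnion (Finset.finite_toSet _)
    fun e' _ => (isCompact_hull e').isClosed)

include hΩ in
/-- Up to a null set, a facet that is not on the boundary is contained in the domain and disjoint
from the other facets. -/
lemma ae_mem_facetNhd (hd : 2 ≤ d) (h : T ∈ 𝒯.elems) {a : E d} (ha : a ∈ T)
    (hfr : ¬ hull (opp T a) ⊆ frontier Ω) : surf d (hull (opp T a) \ facetNhd 𝒯 (opp T a)) = 0 := by
  have hT := isSimplex_of_mem_elems 𝒯 h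
  have hd1 : 1 ≤ d := by omega
  have hin := (facet_dichotomy 𝒯 hΩ hd1 h ha).resolve_left hfr
  -- The exceptional points lie on the hyperplanes of two facets of `T`.
  have hsub : hull (opp T a) \ facetNhd 𝒯 (opp T a)
      ⊆ ⋃ b ∈ (opp T a : Finset (E d)), {x | bary T a x = 0 ∧ bary T b x = 0} := by
    rintro x ⟨hx, hx'⟩
    obtain ⟨hx0, hx1⟩ := (mem_hull_opp hT ha).1 hx
    by_contra hcon
    have hxI : x ∈ facetInterior T a := by
      refine ⟨hx0, fun b hb hba => (hx1 b hb).lt_of_ne' fun h0 => hcon ?_⟩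
      exact Set.mem_biUnion (x := b) (Finset.mem_coe.2 (mem_opp.2 ⟨hba, hb⟩)) ⟨hx0, h0⟩
    refine hx' ⟨hin hxI, fun hmem => ?_⟩
    obtain ⟨e', he', hxe⟩ := Set.mem_iUnion₂.1 hmem
    obtain ⟨hne, he'⟩ := Finset.mem_erase.1 he'
    simp only [Triangulation.facets, Finset.mem_filter, Set.Finite.mem_toFinset] at he'
    refine hne (Finset.eq_of_subset_of_card_le
      (opp_subset_of_mem_hull 𝒯 h ha hxI he'.1 hxe) ?_).symm
    rw [card_opp ha, hT.card, he'.2]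
    rfl
  refine measure_mono_null hsub ((measure_biUnion_null_iff
    (Finset.countable_toSet _)).2 fun b hb => ?_)
  obtain ⟨hba, hbT⟩ := mem_opp.1 (Finset.mem_coe.1 hb)
  exact surf_ridge hT hd ha hbT hba.symm

lemma isRegular_of_mem_elems {γ : ℝ} (hreg : 𝒯.ShapeRegular γ) (h : T ∈ 𝒯.elems) :
    IsRegular γ T := ⟨isSimplex_of_mem_elems 𝒯 h, hreg T h⟩

end triangulation

end mesh

section cancellation

/-! ### Cancellation of single-valued traces on interior facets -/

variable {Ω : Set (E d)} (𝒯 : Triangulation Ω) {γ : ℝ} {w : E d → ℝ} {G : Fin d → E d → ℝ}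
  {t : Finset (E d) → E d → E d → ℝ}

open scoped Classical in
/-- The jump, across the facet `e`, of the traces `t` multiplied by the `j`-th component of the
outward normals of the adjacent elements. -/
def facetJump (t : Finset (E d) → E d → E d → ℝ) (e : Finset (E d)) (j : Fin d) (y : E d) : ℝ :=
  ∑ T ∈ 𝒯.elems, ∑ a ∈ T, if opp T a = e then t T a y * normal T a j else 0

lemma memLp_facetJump (ht : ∀ T ∈ 𝒯.elems, HasFacetTraces T w G (t T)) (e : Finset (E d))
    (j : Fin d) : MemLp (facetJump 𝒯 t e j) 2 ((surf d).restrict (hull e)) := by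
  refine memLp_finsetSum _ fun T hT => memLp_finsetSum _ fun a ha => ?_
  split_ifs with h
  · rw [← h]
    exact ((ht T hT).memt a ha).mul_const (normal T a j)
  · exact MemLp.zero

open scoped Classical in
/-- Testing the jump on `e` collects the boundary terms on `e` of the integration by parts over the
adjacent elements. -/
lemma integral_facetJump_mul (hd : 1 ≤ d) (ht : ∀ T ∈ 𝒯.elems, HasFacetTraces T w G (t T))
    (e : Finset (E d)) (j : Fin d) {φ : E d → ℝ} (hφ : Continuous φ) :
    ∫ y in hull e, facetJump 𝒯 t e j y * φ y ∂(surf d)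
      = ∑ T ∈ 𝒯.elems, ∑ a ∈ T, if opp T a = e then
          ∫ y in hull (opp T a), t T a y * φ y * normal T a j ∂(surf d) else 0 := by
  have hint : ∀ T ∈ 𝒯.elems, ∀ a ∈ T, Integrable (fun y =>
      (if opp T a = e then t T a y * normal T a j else 0) * φ y) ((surf d).restrict (hull e)) := by
    intro T hT a ha
    split_ifs with h
    · rw [← h]
      exact integrable_mul_of_memLp (((ht T hT).memt a ha).mul_const (normal T a j))
        (memLp_facet (isSimplex_of_mem_elems 𝒯 hT) hd ha hφ)
    · simp
  simp only [facetJump, Finset.sum_mul]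
  rw [integral_finsetSum _ fun T hT => integrable_finsetSum _ fun a ha => hint T hT a ha]
  refine Finset.sum_congr rfl fun T hT => ?_
  rw [integral_finsetSum _ fun a ha => hint T hT a ha]
  refine Finset.sum_congr rfl fun a ha => ?_
  split_ifs with h
  · rw [h]
    exact integral_congr_ae (.of_forall fun y => by ring)
  · simp

/-- The jumps of a function in `H¹(Ω)` across the facets inside the domain vanish. -/
lemma facetJump_ae_eq_zero (hΩ : IsLipschitzDomain Ω) (hd : 2 ≤ d)
    (hw : MemLp w 2 (volume.restrict Ω)) (hG : ∀ j, MemLp (G j) 2 (volume.restrict Ω))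
    (hwG : ∀ j, HasWeakDeriv Ω (Pi.single j 1) w (G j))
    (ht : ∀ T ∈ 𝒯.elems, HasFacetTraces T w G (t T)) {T : Finset (E d)} (hT : T ∈ 𝒯.elems)
    {a : E d} (ha : a ∈ T) (hfr : ¬ hull (opp T a) ⊆ frontier Ω) (j : Fin d) :
    facetJump 𝒯 t (opp T a) j =ᵐ[(surf d).restrict (hull (opp T a))] 0 := by
  classical
  have hd1 : 1 ≤ d := by omega
  set e := opp T a with he
  have hfin : IsFiniteMeasure ((surf d).restrict (hull e)) :=
    ⟨by simpa using surf_hull_opp_lt_top (isSimplex_of_mem_elems 𝒯 hT) hd1 ha⟩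
  have hmem := memLp_facetJump 𝒯 ht e j
  have hU : ∀ᵐ y ∂(surf d).restrict (hull e), y ∈ facetNhd 𝒯 e := by
    rw [ae_restrict_iff' (measurableSet_hull _)]
    refine measure_mono_null (fun y hy => ?_) (ae_mem_facetNhd 𝒯 hΩ hd hT ha hfr)
    exact Classical.not_imp.1 hy
  -- Test functions supported in `facetNhd 𝒯 e` meet no other facet. The sum over the elements of
  -- the integration by parts formula, compared with the definition of the weak derivative on `Ω`,
  -- leaves the integral of the jump on `e`.
  have hzero := (isOpen_facetNhd 𝒯 hΩ e).ae_eq_zero_of_integral_contDiff_smul_eq_zero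
    (μ := (surf d).restrict (hull e)) (f := facetJump 𝒯 t e j)
    ((hmem.integrable one_le_two).locallyIntegrable.locallyIntegrableOn _) (fun φ hφ hφc hφs => by
      have hφΩ : tsupport φ ⊆ Ω := hφs.trans Set.sdiff_subset
      have hpφ := contDiff_pd hφ j
      have hcφ : ∀ {ψ : E d → ℝ}, ContDiff ℝ ∞ ψ → HasCompactSupport ψ →
          MemLp ψ 2 (volume.restrict Ω) := fun hψ hψc =>
        (hψ.continuous.memLp_of_hasCompactSupport hψc).restrict _
      have hpc : HasCompactSupport (pd j φ) := by
        refine HasCompactSupport.of_support_subset_isCompact hφc fun x hx => ?_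
        by_contra hx'
        refine hx ?_
        have : φ =ᶠ[𝓝 x] 0 := notMem_tsupport_iff_eventuallyEq.1 hx'
        simp [pd, this.fderiv_eq]
      have h1 := setIntegral_eq_sum_elems 𝒯 hΩ
        (integrable_mul_of_memLp (hG j) (hcφ hφ hφc))
      have h2 := setIntegral_eq_sum_elems 𝒯 hΩ
        (integrable_mul_of_memLp hw (hcφ hpφ hpc))
      have h3 := hwG j φ hφ hφc hφΩ
      rw [pdMulti_single] at h3
      have h4 : ∑ i, (Pi.single j 1 : Fin d → ℕ) i = 1 := by simp
      rw [h4, pow_one, h1, h2] at h3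
      have h5 : ∑ T ∈ 𝒯.elems, ∫ x in hull T, G j x * φ x
          = -∑ T ∈ 𝒯.elems, (∫ x in hull T, w x * pd j φ x)
            + ∑ T ∈ 𝒯.elems, ∑ a ∈ T, ∫ y in hull (opp T a), t T a y * φ y * normal T a j
              ∂(surf d) := by
        rw [← Finset.sum_neg_distrib, ← Finset.sum_add_distrib]
        exact Finset.sum_congr rfl fun T hT =>
          (ht T hT).integral_mul hd1 (isSimplex_of_mem_elems 𝒯 hT) hφ j
      have h6 := integral_facetJump_mul 𝒯 hd1 ht e j hφ.continuous
      have h7 : ∑ T ∈ 𝒯.elems, ∑ a ∈ T, (if opp T a = e then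
            ∫ y in hull (opp T a), t T a y * φ y * normal T a j ∂(surf d) else 0)
          = ∑ T ∈ 𝒯.elems, ∑ a ∈ T, ∫ y in hull (opp T a), t T a y * φ y * normal T a j
              ∂(surf d) := by
        refine Finset.sum_congr rfl fun T hT => Finset.sum_congr rfl fun a ha => ?_
        split_ifs with h
        · rfl
        · symm
          refine setIntegral_eq_zero_of_forall_eq_zero fun y hy => ?_
          have : φ y = 0 := by
            by_contra hne
            refine (hφs (subset_tsupport φ hne)).2 (Set.mem_biUnion (x := opp T a) ?_ hy)
            exact Finset.mem_erase.2 ⟨h, opp_mem_facets 𝒯 hd1 hT ha⟩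
          rw [this, mul_zero, zero_mul]
      have h8 : ∫ y in hull e, φ y • facetJump 𝒯 t e j y ∂(surf d)
          = ∫ y in hull e, facetJump 𝒯 t e j y * φ y ∂(surf d) :=
        integral_congr_ae (.of_forall fun y => mul_comm _ _)
      rw [h8, h6, h7]
      linarith)
  filter_upwards [hzero, hU] with y hy hyU
  exact hy hyU

/-- If `q` is single-valued on the facets and vanishes on the boundary, the boundary terms
`⟨w, q n_j⟩` of the elements sum to zero. -/
lemma sum_facet_integral_eq_zero (hΩ : IsLipschitzDomain Ω) (hd : 2 ≤ d)
    (hw : MemLp w 2 (volume.restrict Ω)) (hG : ∀ j, MemLp (G j) 2 (volume.restrict Ω))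
    (hwG : ∀ j, HasWeakDeriv Ω (Pi.single j 1) w (G j))
    (ht : ∀ T ∈ 𝒯.elems, HasFacetTraces T w G (t T)) (q : Finset (E d) → Poly d)
    (hq : ∀ e ∈ 𝒯.facets, hull e ⊆ frontier Ω → ∀ x ∈ hull e, ev (q e) x = 0) (j : Fin d) :
    ∑ T ∈ 𝒯.elems, ∑ a ∈ T, ∫ y in hull (opp T a),
      t T a y * ev (q (opp T a)) y * normal T a j ∂(surf d) = 0 := by
  classical
  have hd1 : 1 ≤ d := by omega
  have h1 : ∑ T ∈ 𝒯.elems, ∑ a ∈ T, ∫ y in hull (opp T a),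
      t T a y * ev (q (opp T a)) y * normal T a j ∂(surf d)
      = ∑ e ∈ 𝒯.facets, ∑ T ∈ 𝒯.elems, ∑ a ∈ T, if opp T a = e then
          ∫ y in hull (opp T a), t T a y * ev (q e) y * normal T a j ∂(surf d) else 0 := by
    rw [Finset.sum_comm]
    refine Finset.sum_congr rfl fun T hT => ?_
    rw [Finset.sum_comm]
    refine Finset.sum_congr rfl fun a ha => ?_
    rw [Finset.sum_ite_eq, if_pos (opp_mem_facets 𝒯 hd1 hT ha)]
  rw [h1]
  refine Finset.sum_eq_zero fun e he => ?_
  rw [← integral_facetJump_mul 𝒯 hd1 ht e j (continuous_ev (q e))]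
  by_cases hfr : hull e ⊆ frontier Ω
  · exact setIntegral_eq_zero_of_forall_eq_zero fun y hy => by rw [hq e he hfr y hy, mul_zero]
  by_cases hex : ∃ T ∈ 𝒯.elems, ∃ a ∈ T, opp T a = e
  · obtain ⟨T, hT, a, ha, rfl⟩ := hex
    rw [integral_congr_ae (g := fun _ => 0), integral_zero]
    filter_upwards [facetJump_ae_eq_zero 𝒯 hΩ hd hw hG hwG ht hT ha hfr j] with y hy
    rw [hy, Pi.zero_apply, zero_mul]
  · push Not at hex
    have : ∀ y, facetJump 𝒯 t e j y = 0 := fun y =>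
      Finset.sum_eq_zero fun T hT => Finset.sum_eq_zero fun a ha => if_neg (hex T hT a ha)
    simp [this]

end cancellation

section traces

/-! ### Traces on facets and the projections `Q_h` -/

variable {Ω : Set (E d)} (𝒯 : Triangulation Ω) {γ : ℝ} {T : Finset (E d)} {w : E d → ℝ}
  {t : E d → E d → ℝ} {a : E d}

lemma restrict_hull_le (hΩ : IsLipschitzDomain Ω) (h : T ∈ 𝒯.elems) :
    volume.restrict (hull T) ≤ volume.restrict Ω := by
  rw [← Measure.restrict_congr_set (interior_hull_ae_eq T)]
  exact Measure.restrict_mono_set _ (interior_hull_subset 𝒯 hΩ h)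

/-- A sequence converging in `H¹(Ω)` converges in `H¹` of each element. -/
lemma h1Approx_of_tendsto (hΩ : IsLipschitzDomain Ω) (h : T ∈ 𝒯.elems) {G : Fin d → E d → ℝ}
    (hw : MemLp w 2 (volume.restrict Ω)) (hG : ∀ j, MemLp (G j) 2 (volume.restrict Ω))
    {φ : ℕ → E d → ℝ} (hφ : ∀ n, ContDiff ℝ ∞ (φ n))
    (h0 : Tendsto (fun n => eLpNorm (φ n - w) 2 (volume.restrict Ω)) atTop (𝓝 0))
    (h1 : ∀ i, Tendsto (fun n => eLpNorm (pd i (φ n) - G i) 2 (volume.restrict Ω)) atTop (𝓝 0)) :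
    H1Approx (hull T) w G φ := by
  have hle := restrict_hull_le 𝒯 hΩ h
  refine ⟨hφ, hw.mono_measure hle, fun j => (hG j).mono_measure hle, ?_, fun j => ?_⟩
  · exact tendsto_nm_of_eLpNorm (fun n => (memLp_hull T (hφ n).continuous).sub
      (hw.mono_measure hle)) (tendsto_of_tendsto_of_tendsto_of_le_of_le tendsto_const_nhds h0
        (fun _ => zero_le) fun n => eLpNorm_mono_measure _ hle)
  · exact tendsto_nm_of_eLpNorm (fun n => (memLp_hull T (continuous_pd (hφ n) j)).sub
      ((hG j).mono_measure hle)) (tendsto_of_tendsto_of_tendsto_of_le_of_le tendsto_const_nhds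
        (h1 j) (fun _ => zero_le) fun n => eLpNorm_mono_measure _ hle)

/-- A trace on a set containing a facet agrees on the facet with the trace from the element. -/
lemma HasTrace.ae_eq_facet (hΩ : IsLipschitzDomain Ω) (hγ : 0 < γ) (hd : 1 ≤ d)
    (hreg : 𝒯.ShapeRegular γ) (h : T ∈ 𝒯.elems) (ha : a ∈ T) (hw : MemLp w 2 (volume.restrict Ω))
    (hG : ∀ j, MemLp (weakDeriv Ω (Pi.single j 1) w) 2 (volume.restrict Ω))
    (ht : HasFacetTraces T w (fun j => weakDeriv Ω (Pi.single j 1) w) t) {S : Set (E d)}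
    {g : E d → ℝ} (hg : HasTrace Ω S w g) (hS : hull (opp T a) ⊆ S) :
    t a =ᵐ[(surf d).restrict (hull (opp T a))] g := by
  obtain ⟨hgm, φ, hφ, h0, h1, h2⟩ := hg
  have hT := isRegular_of_mem_elems 𝒯 hreg h
  have hle := Measure.restrict_mono_set (surf d) hS
  refine ht.ae_eq hγ hd hT (h1Approx_of_tendsto 𝒯 hΩ h hw hG hφ h0 h1) ha
    (hgm.mono_measure hle) (tendsto_nm_of_eLpNorm (fun n => (memLp_facet hT.simplex hd ha
      (hφ n).continuous).sub (hgm.mono_measure hle)) ?_)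
  exact tendsto_of_tendsto_of_tendsto_of_le_of_le tendsto_const_nhds h2
    (fun _ => zero_le) fun n => eLpNorm_mono_measure _ hle

/-- A function with a trace on the boundary has a trace on each facet, the one from the element. -/
lemma trace_ae_eq (hΩ : IsLipschitzDomain Ω) (hγ : 0 < γ) (hd : 1 ≤ d)
    (hreg : 𝒯.ShapeRegular γ) (h : T ∈ 𝒯.elems) (ha : a ∈ T) (hw : MemLp w 2 (volume.restrict Ω))
    (hG : ∀ j, MemLp (weakDeriv Ω (Pi.single j 1) w) 2 (volume.restrict Ω))
    (ht : HasFacetTraces T w (fun j => weakDeriv Ω (Pi.single j 1) w) t) {S : Set (E d)}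
    {g : E d → ℝ} (hg : HasTrace Ω S w g) :
    t a =ᵐ[(surf d).restrict (hull (opp T a))] trace Ω (hull (opp T a)) w := by
  have hT := isRegular_of_mem_elems 𝒯 hreg h
  obtain ⟨-, φ, hφ, h0, h1, -⟩ := hg
  obtain ⟨t', ht', hlim⟩ := exists_hasFacetTraces hγ hd hT
    (h1Approx_of_tendsto 𝒯 hΩ h hw hG hφ h0 h1)
  have hex : ∃ g, HasTrace Ω (hull (opp T a)) w g := ⟨t' a, ht'.memt a ha, φ, hφ, h0, h1,
    tendsto_eLpNorm_of_nm (fun n => (memLp_facet hT.simplex hd ha (hφ n).continuous).sub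
      (ht'.memt a ha)) (hlim a ha)⟩
  rw [trace, dif_pos hex]
  exact hex.choose_spec.ae_eq_facet 𝒯 hΩ hγ hd hreg h ha hw hG ht subset_rfl

lemma elemProj_spec (hd : 1 ≤ d) (hγ : 0 < γ) (hT : IsRegular γ T) (k : ℕ)
    (hw : MemLp w 2 (volume.restrict (hull T))) :
    elemProj k T w ∈ P d k ∧ ∀ φ ∈ P d k,
      ∫ x in hull T, ev (elemProj k T w) x * ev φ x = ∫ x in hull T, w x * ev φ x := by
  refine represent_hull_spec hd hγ hT (fun φ ψ => ?_) fun c φ => ?_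
  · simp only [ev_add, mul_add]
    exact integral_add (integrable_mul_of_memLp hw (memLp_hull T (continuous_ev φ)))
      (integrable_mul_of_memLp hw (memLp_hull T (continuous_ev ψ)))
  · simp only [ev_smul, mul_left_comm _ c]
    exact integral_const_mul _ _

lemma facetProj_spec (hd : 1 ≤ d) (hT : IsSimplex T) (ha : a ∈ T) (k : ℕ) {g : E d → ℝ}
    (hg : MemLp g 2 ((surf d).restrict (hull (opp T a)))) :
    facetProj k (opp T a) g ∈ P d k ∧ ∀ φ ∈ P d k,
      ∫ x in hull (opp T a), ev (facetProj k (opp T a) g) x * ev φ x ∂(surf d)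
        = ∫ x in hull (opp T a), g x * ev φ x ∂(surf d) := by
  refine represent_spec (isCompact_hull _) (surf_hull_opp_lt_top hT hd ha) (fun φ ψ => ?_)
    (fun c φ => ?_) fun φ hφ => ?_
  · simp only [ev_add, mul_add]
    exact integral_add (integrable_mul_of_memLp hg (memLp_facet hT hd ha (continuous_ev φ)))
      (integrable_mul_of_memLp hg (memLp_facet hT hd ha (continuous_ev ψ)))
  · simp only [ev_smul, mul_left_comm _ c]
    exact integral_const_mul _ _
  · rw [← integral_zero (E d) ℝ (μ := (surf d).restrict (hull (opp T a)))]
    refine integral_congr_ae ?_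
    filter_upwards [hφ] with x hx
    rw [hx, Pi.zero_apply, mul_zero]

lemma facetProj_congr {e : Finset (E d)} {g g' : E d → ℝ}
    (h : g =ᵐ[(surf d).restrict (hull e)] g') (k : ℕ) : facetProj k e g = facetProj k e g' := by
  rw [facetProj, facetProj]
  congr 1
  funext φ
  refine integral_congr_ae ?_
  filter_upwards [h] with x hx
  rw [hx]

/-- An `L²` projection onto polynomials does not increase the distance to polynomials. -/
lemma nm_proj_sub_le {μ : Measure (E d)} {f : E d → ℝ} {p q : Poly d} (hf : MemLp f 2 μ)
    (hp : MemLp (ev p) 2 μ) (hq : MemLp (ev q) 2 μ)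
    (h : ∫ x, ev p x * ev (p - q) x ∂μ = ∫ x, f x * ev (p - q) x ∂μ) :
    nm μ (fun x => ev p x - ev q x) ≤ nm μ fun x => f x - ev q x := by
  have hpq : MemLp (ev (p - q)) 2 μ := by
    have : ev (p - q) = fun x => ev p x - ev q x := funext fun x => ev_sub p q x
    rw [this]; exact hp.sub hq
  have h1 : nm μ (ev (p - q)) ^ 2 = ∫ x, (f x - ev q x) * ev (p - q) x ∂μ := by
    rw [nm_sq]
    simp only [sub_mul]
    rw [integral_sub (integrable_mul_of_memLp hf hpq) (integrable_mul_of_memLp hq hpq), ← h,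
      ← integral_sub (integrable_mul_of_memLp hp hpq) (integrable_mul_of_memLp hq hpq)]
    refine integral_congr_ae (.of_forall fun x => ?_)
    simp only [ev_sub]
    ring
  have h2 := (le_abs_self _).trans (abs_integral_mul_le (hf.sub hq) hpq)
  have h3 : nm μ (ev (p - q)) = nm μ fun x => ev p x - ev q x := by
    congr 1; funext x; exact ev_sub p q x
  rw [h3] at h1 h2
  have h4 : nm μ (f - ev q) = nm μ fun x => f x - ev q x := rfl
  simp only [Pi.sub_apply] at h2
  rw [← h1, h4, sq] at h2
  rcases (nm_nonneg (μ := μ) (f := fun x => ev p x - ev q x)).eq_or_lt with h5 | h5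
  · rw [← h5]; exact nm_nonneg
  · exact le_of_mul_le_mul_right h2 h5

variable {u : E d → E d} {k : ℕ} {i j : Fin d} {G : Fin d → E d → ℝ}

/-- The weak gradient of `Q_h u` is the projection of the gradient of `u`. -/
lemma integral_weakGrad_Qh_mul (hd : 1 ≤ d) (hγ : 0 < γ) (hT : IsRegular γ T)
    (ht : HasFacetTraces T (fun x => u x i) G t)
    (htr : ∀ a ∈ T, t a =ᵐ[(surf d).restrict (hull (opp T a))]
      trace Ω (hull (opp T a)) fun x => u x i) {φ : Poly d} (hφ : φ ∈ P d (k - 1)) :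
    ∫ x in hull T, ev (weakGrad k (Qh Ω k u) T i j) x * ev φ x = ∫ x in hull T, G j x * ev φ x := by
  rw [(weakGrad_spec hd hγ hT k _ i j).2 φ hφ,
    ht.integral_mul hd hT.simplex (contDiff_ev φ) j]
  have hφk : φ ∈ P d k := P_mono (Nat.sub_le k 1) hφ
  congr 1
  · rw [pd_ev]
    exact congrArg _ ((elemProj_spec hd hγ hT k ht.mem).2 _
      (P_mono (by omega) (pderiv_mem_P hφ j)))
  · refine Finset.sum_congr rfl fun a ha => ?_
    rw [integral_mul_const, integral_mul_const]
    congr 1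
    have h1 := (facetProj_spec hd hT.simplex ha k (ht.memt a ha)).2 φ hφk
    rwa [facetProj_congr (htr a ha)] at h1

/-- The weak divergence of `Q_h u` is the projection of the divergence of `u`. -/
lemma integral_weakDiv_Qh_mul {G : Fin d → Fin d → E d → ℝ} {t : Fin d → E d → E d → ℝ}
    (hd : 1 ≤ d) (hγ : 0 < γ) (hT : IsRegular γ T)
    (ht : ∀ i, HasFacetTraces T (fun x => u x i) (G i) (t i))
    (htr : ∀ i, ∀ a ∈ T, t i a =ᵐ[(surf d).restrict (hull (opp T a))]
      trace Ω (hull (opp T a)) fun x => u x i) {φ : Poly d} (hφ : φ ∈ P d k) :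
    ∫ x in hull T, ev (weakDiv k (Qh Ω k u) T) x * ev φ x
      = ∑ i, ∫ x in hull T, G i i x * ev φ x := by
  rw [(weakDiv_spec hd hγ hT k _).2 φ hφ]
  have h1 : ∀ i, ∫ x in hull T, G i i x * ev φ x
      = -(∫ x in hull T, ev ((Qh Ω k u).1 T i) x * ev (MvPolynomial.pderiv i φ) x)
        + ∑ a ∈ T, ∫ x in hull (opp T a), ev ((Qh Ω k u).2 (opp T a) i) x * normal T a i * ev φ x
          ∂(surf d) := by
    intro i
    rw [(ht i).integral_mul hd hT.simplex (contDiff_ev φ) i, pd_ev]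
    congr 1
    · exact congrArg _ ((elemProj_spec hd hγ hT k (ht i).mem).2 _
        (P_mono (by omega) (pderiv_mem_P hφ i))).symm
    · refine Finset.sum_congr rfl fun a ha => ?_
      simp only [mul_right_comm _ (normal T a i)]
      rw [integral_mul_const, integral_mul_const]
      congr 1
      have h1 := (facetProj_spec hd hT.simplex ha k ((ht i).memt a ha)).2 φ hφ
      rw [facetProj_congr (htr i a ha)] at h1
      exact h1.symm
  simp only [h1, Finset.sum_add_distrib, Finset.sum_neg_distrib, Finset.sum_mul]
  rw [integral_finsetSum _ fun i _ => integrable_hull T (by fun_prop), Finset.sum_comm]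
  congr 1
  refine Finset.sum_congr rfl fun a ha => ?_
  rw [integral_finsetSum _ fun i _ => integrable_facet hT.simplex hd ha (by fun_prop)]

end traces

section local_estimates

/-! ### Projection errors on an element -/

variable {γ : ℝ} {T : Finset (E d)}

/-- The trace of a function differs from its `L²(T)`-projection by an approximation error. -/
lemma exists_facet_sub_proj_le (hd : 1 ≤ d) (hγ : 0 < γ) (m : ℕ) :
    ∃ C : ℝ, 0 < C ∧ ∀ T : Finset (E d), IsRegular γ T →
      ∀ (w : E d → ℝ) (G : Fin d → E d → ℝ) (t : E d → E d → ℝ), HasFacetTraces T w G t →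
      ∀ p ∈ P d m, ∀ q ∈ P d m,
      (∀ φ ∈ P d m, ∫ x in hull T, ev q x * ev φ x = ∫ x in hull T, w x * ev φ x) → ∀ a ∈ T,
      √(diam T) * nm ((surf d).restrict (hull (opp T a))) (fun x => t a x - ev q x)
        ≤ C * (nm (volume.restrict (hull T)) (fun x => w x - ev p x)
          + diam T * ∑ j, nm (volume.restrict (hull T))
              fun x => G j x - ev (MvPolynomial.pderiv j p) x) := by
  obtain ⟨C, hC, hinv⟩ := exists_inverse (d := d) hd m hγ
  refine ⟨√(γ * (2 * d + 1)) + √C, by positivity, fun T hT w G t ht p hp q hq hproj a ha => ?_⟩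
  have hh := diam_pos hT.simplex hd
  have h1 := (ht.sub_ev hd hT.simplex p).nm_le hγ hd hT ha
  set A := nm (volume.restrict (hull T)) fun x => w x - ev p x with hA
  set S := ∑ j, nm (volume.restrict (hull T))
    fun x => G j x - ev (MvPolynomial.pderiv j p) x with hS
  have hA0 : 0 ≤ A := nm_nonneg
  have hS0 : 0 ≤ S := Finset.sum_nonneg fun _ _ => nm_nonneg
  have h2 := ((hinv T hT (q - p) (sub_mem hq hp)).2 a ha)
  have h3 := nm_proj_sub_le ht.mem (memLp_hull T (continuous_ev q))
    (memLp_hull T (continuous_ev p)) (hproj _ (sub_mem hq hp))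
  have h4 : ev (q - p) = fun x => ev q x - ev p x := funext fun x => ev_sub q p x
  rw [h4] at h2
  have h5 : √(diam T) * nm ((surf d).restrict (hull (opp T a))) (fun x => ev q x - ev p x)
      ≤ √C * A := by
    refine (abs_le_of_sq_le_sq' ?_ (by positivity)).2
    rw [mul_pow, mul_pow, Real.sq_sqrt hh.le, Real.sq_sqrt hC.le]
    calc _ ≤ diam T * (C * (diam T)⁻¹ * A ^ 2) := by
          refine mul_le_mul_of_nonneg_left (h2.trans ?_) hh.le
          exact mul_le_mul_of_nonneg_left (pow_le_pow_left₀ nm_nonneg h3 2) (by positivity)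
      _ = C * A ^ 2 := by field_simp
  have hmp := memLp_facet hT.simplex hd ha (continuous_ev p)
  have hmq := memLp_facet hT.simplex hd ha (continuous_ev q)
  have h6 := nm_sub_le_add (ht.memt a ha) hmp hmq
  rw [nm_sub_comm (f := ev p)] at h6
  have h7 := mul_le_mul_of_nonneg_left h6 (Real.sqrt_nonneg (diam T))
  have h8 : √C * A ≤ √C * (A + diam T * S) :=
    mul_le_mul_of_nonneg_left (by nlinarith) (Real.sqrt_nonneg _)
  rw [add_mul]
  linarith

/-- The sum of the `L²` norms of the derivatives of order `m`. -/
def topNm (K : Set (E d)) (m : ℕ) (D : (Fin d → ℕ) → E d → ℝ) : ℝ :=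
  ∑ β ∈ Finset.piAntidiag Finset.univ m, nm (volume.restrict K) (D β)

lemma topNm_nonneg (K : Set (E d)) (m : ℕ) (D : (Fin d → ℕ) → E d → ℝ) : 0 ≤ topNm K m D :=
  Finset.sum_nonneg fun _ _ => nm_nonneg

/-- Polynomial approximation of a function and of its derivatives up to order two. The estimate of
second order is multiplied by the diameter, which avoids the exponent `k - 1`. -/
lemma exists_approx_hull (hd : 1 ≤ d) {k : ℕ} (hk : 1 ≤ k) : ∃ C : ℝ, 0 < C ∧
    ∀ (γ : ℝ) (T : Finset (E d)), 0 < γ → IsRegular γ T → ∀ D, IsJet (hull T) k D →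
      ∃ p ∈ P d k,
        (nm (volume.restrict (hull T)) (fun x => D 0 x - ev p x)
          ≤ C * diam T ^ (k + 1) * topNm (hull T) (k + 1) D) ∧
        (∀ j, nm (volume.restrict (hull T))
            (fun x => D (Pi.single j 1) x - ev (MvPolynomial.pderiv j p) x)
          ≤ C * diam T ^ k * topNm (hull T) (k + 1) D) ∧
        ∀ j l, diam T * nm (volume.restrict (hull T)) (fun x => D (Pi.single j 1 + Pi.single l 1) x
            - ev (MvPolynomial.pderiv l (MvPolynomial.pderiv j p)) x)
          ≤ C * diam T ^ k * topNm (hull T) (k + 1) D := by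
  set c : ℝ := √(2 ^ d) * d with hc
  have hc1 : 1 ≤ c := by
    have h1 : (1 : ℝ) ≤ √(2 ^ d) := Real.one_le_sqrt.2 (one_le_pow₀ one_le_two)
    have h2 : (1 : ℝ) ≤ d := by exact_mod_cast hd
    exact one_le_mul_of_one_le_of_one_le h1 h2
  have hc0 : 0 < c := by linarith
  refine ⟨c ^ (k + 1), by positivity, fun γ T hγ hT D hD => ?_⟩
  have hh := diam_pos hT.simplex hd
  have hM := topNm_nonneg (hull T) (k + 1) D
  obtain ⟨p, hp, happ⟩ := hD.exists_approx (isCompact_hull T) (convex_hull' T)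
    (interior_hull_nonempty hγ hd hT) hh.le fun x hx y hy => by
      rw [← dist_eq_norm]
      exact Metric.dist_le_diam_of_mem (isCompact_hull T).isBounded hx hy
  -- A single constant for all exponents `l`.
  have hbd : ∀ l ≤ k + 1, (c * diam T) ^ l * topNm (hull T) (k + 1) D
      ≤ c ^ (k + 1) * diam T ^ l * topNm (hull T) (k + 1) D := fun l hl => by
    rw [mul_pow]
    gcongr
  have hs : ∀ j : Fin d, pderivMulti (Pi.single j 1) p = MvPolynomial.pderiv j p := fun j => by
    have := pderivMulti_add_single 0 j p
    rwa [zero_add, pderivMulti_zero] at this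
  refine ⟨p, hp, ?_, fun j => ?_, fun j l => ?_⟩
  · have := happ (k + 1) 0 (by simp)
    rw [pderivMulti_zero] at this
    exact this.trans (hbd _ le_rfl)
  · have := happ k (Pi.single j 1) (by simp [add_comm])
    rw [hs] at this
    exact this.trans (hbd _ (by omega))
  · have := happ (k - 1) (Pi.single j 1 + Pi.single l 1) (by
      rw [sum_add_single]
      have h1 : ∑ i, (Pi.single j 1 : Fin d → ℕ) i = 1 := by simp
      omega)
    rw [pderivMulti_add_single, hs] at this
    have h2 := mul_le_mul_of_nonneg_left (this.trans (hbd _ (by omega))) hh.le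
    refine h2.trans_eq ?_
    obtain ⟨k, rfl⟩ : ∃ m, k = m + 1 := ⟨k - 1, by omega⟩
    simp only [Nat.add_sub_cancel]
    ring

/-- The derivatives `D`, on an element, of a function `w` in `H^{k+1}`, with the traces `t` of `w`
and `tg` of its gradient. -/
structure HasJetTraces (T : Finset (E d)) (k : ℕ) (w : E d → ℝ) (D : (Fin d → ℕ) → E d → ℝ)
    (t : E d → E d → ℝ) (tg : Fin d → E d → E d → ℝ) : Prop where
  jet : IsJet (hull T) k D
  zero : D 0 =ᵐ[volume.restrict (hull T)] w
  trace : HasFacetTraces T w (fun j => D (Pi.single j 1)) t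
  traceGrad : ∀ j, HasFacetTraces T (D (Pi.single j 1))
    (fun l => D (Pi.single j 1 + Pi.single l 1)) (tg j)

/-- The three consistency errors on an element. -/
lemma exists_consistency_le (hd : 1 ≤ d) (hγ : 0 < γ) {k : ℕ} (hk : 1 ≤ k) : ∃ C : ℝ, 0 < C ∧
    ∀ T : Finset (E d), IsRegular γ T → ∀ w D t tg, HasJetTraces T k w D t tg →
      (∀ q ∈ P d k,
        (∀ φ ∈ P d k, ∫ x in hull T, ev q x * ev φ x = ∫ x in hull T, w x * ev φ x) →
        ∀ a ∈ T, √(diam T) * nm ((surf d).restrict (hull (opp T a))) (fun x => t a x - ev q x)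
          ≤ C * diam T ^ (k + 1) * topNm (hull T) (k + 1) D) ∧
      (∀ j, ∀ q ∈ P d (k - 1), (∀ φ ∈ P d (k - 1),
          ∫ x in hull T, ev q x * ev φ x = ∫ x in hull T, D (Pi.single j 1) x * ev φ x) →
        ∀ a ∈ T, √(diam T) * nm ((surf d).restrict (hull (opp T a))) (fun x => tg j a x - ev q x)
          ≤ C * diam T ^ k * topNm (hull T) (k + 1) D) ∧
      ∀ j, ∀ δ : E d → ℝ, MemLp δ 2 (volume.restrict (hull T)) →
        (∀ φ ∈ P d (k - 1), ∫ x in hull T, δ x * ev φ x = 0) →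
        diam T * |∫ x in hull T, D (Pi.single j 1 + Pi.single j 1) x * δ x|
          ≤ C * diam T ^ k * topNm (hull T) (k + 1) D * nm (volume.restrict (hull T)) δ := by
  obtain ⟨C₀, hC₀, happ⟩ := exists_approx_hull (d := d) hd hk
  obtain ⟨C₁, hC₁, h₁⟩ := exists_facet_sub_proj_le (d := d) hd hγ k
  obtain ⟨C₂, hC₂, h₂⟩ := exists_facet_sub_proj_le (d := d) hd hγ (k - 1)
  refine ⟨C₁ * (C₀ + d * C₀) + C₂ * (C₀ + d * C₀) + C₀, by positivity,
    fun T hT w D t tg hD => ?_⟩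
  have hh := diam_pos hT.simplex hd
  have hM := topNm_nonneg (hull T) (k + 1) D
  obtain ⟨p, hp, ha0, ha1, ha2⟩ := happ γ T hγ hT D hD.jet
  set M := topNm (hull T) (k + 1) D with hMdef
  refine ⟨fun q hq hproj a ha => ?_, fun j q hq hproj a ha => ?_, fun j δ hδ hort => ?_⟩
  · refine (h₁ T hT w _ t hD.trace p hp q hq hproj a ha).trans ?_
    have h3 : nm (volume.restrict (hull T)) (fun x => w x - ev p x)
        ≤ C₀ * diam T ^ (k + 1) * M := by
      refine le_of_eq_of_le (nm_congr_ae ?_) ha0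
      filter_upwards [hD.zero] with x hx
      rw [hx]
    have h4 := Finset.sum_le_sum fun j (_ : j ∈ Finset.univ) => ha1 j
    rw [Finset.sum_const, Finset.card_univ, Fintype.card_fin, nsmul_eq_mul] at h4
    calc _ ≤ C₁ * (C₀ * diam T ^ (k + 1) * M + diam T * (d * (C₀ * diam T ^ k * M))) := by
          gcongr
      _ = C₁ * (C₀ + d * C₀) * diam T ^ (k + 1) * M := by ring
      _ ≤ _ := by
          gcongr
          rw [add_assoc]
          exact le_add_of_nonneg_right (by positivity)
  · refine (h₂ T hT _ _ _ (hD.traceGrad j) (MvPolynomial.pderiv j p) (pderiv_mem_P hp j) q hq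
      hproj a ha).trans ?_
    have h4 := Finset.sum_le_sum fun l (_ : l ∈ Finset.univ) => ha2 j l
    rw [Finset.sum_const, Finset.card_univ, Fintype.card_fin, nsmul_eq_mul, ← Finset.mul_sum] at h4
    calc _ ≤ C₂ * (C₀ * diam T ^ k * M + d * (C₀ * diam T ^ k * M)) := by
          gcongr
          exact ha1 j
      _ = C₂ * (C₀ + d * C₀) * diam T ^ k * M := by ring
      _ ≤ _ := by
          gcongr
          have h5 : 0 < C₁ * (C₀ + d * C₀) := by positivity
          linarith
  · -- subtract the second derivative of the approximating polynomial, which is orthogonal to `δ`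
    have hp2 : MvPolynomial.pderiv j (MvPolynomial.pderiv j p) ∈ P d (k - 1) :=
      P_mono (Nat.sub_le _ 1) (pderiv_mem_P (pderiv_mem_P hp j) j)
    have hmp := memLp_hull T (continuous_ev (MvPolynomial.pderiv j (MvPolynomial.pderiv j p)))
    have hmD := (hD.traceGrad j).memG j
    have h3 : ∫ x in hull T, D (Pi.single j 1 + Pi.single j 1) x * δ x
        = ∫ x in hull T, (D (Pi.single j 1 + Pi.single j 1) x
          - ev (MvPolynomial.pderiv j (MvPolynomial.pderiv j p)) x) * δ x := by
      simp only [sub_mul]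
      rw [integral_sub (integrable_mul_of_memLp hmD hδ) (integrable_mul_of_memLp hmp hδ)]
      simp only [mul_comm _ (δ _)]
      rw [hort _ hp2, sub_zero]
    rw [h3]
    have h4 := abs_integral_mul_le (hmD.sub hmp) hδ
    have h5 := mul_le_mul_of_nonneg_left h4 hh.le
    refine h5.trans ?_
    rw [← mul_assoc]
    refine mul_le_mul_of_nonneg_right ((ha2 j j).trans ?_) nm_nonneg
    gcongr
    have h5 : 0 < C₁ * (C₀ + d * C₀) + C₂ * (C₀ + d * C₀) := by positivity
    linarith

end local_estimates

section element

/-! ### The error equation on an element -/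

variable {Ω : Set (E d)} (𝒯 : Triangulation Ω) {γ : ℝ} {T : Finset (E d)} {k : ℕ} {u : E d → E d}
  {v : WeakFun d} {D : Fin d → (Fin d → ℕ) → E d → ℝ} {t : Fin d → E d → E d → ℝ}
  {tg : Fin d → Fin d → E d → E d → ℝ}

/-- The function and its first derivatives are in `H¹`, hence have traces on the facets of the
element. -/
lemma exists_hasJetTraces (hΩ : IsLipschitzDomain Ω) (hγ : 0 < γ) (hd : 1 ≤ d) (hk : 1 ≤ k)
    (hreg : 𝒯.ShapeRegular γ) (h : T ∈ 𝒯.elems) {w : E d → ℝ} (hw : MemSobolev Ω (k + 1) w) :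
    ∃ t tg, HasJetTraces T k w (fun α => weakDeriv Ω α w) t tg := by
  have hT := isRegular_of_mem_elems 𝒯 hreg h
  have hne := interior_hull_nonempty hγ hd hT
  have hsub := interior_hull_subset 𝒯 hΩ h
  have hs1 : ∀ j : Fin d, ∑ i, (Pi.single j 1 : Fin d → ℕ) i = 1 := fun j => by simp
  have hs2 : ∀ j l : Fin d, ∑ i, (Pi.single j 1 + Pi.single l 1 : Fin d → ℕ) i = 2 := fun j l => by
    rw [sum_add_single, hs1]
  have hm1 := fun j : Fin d => weakDeriv_spec hw (α := Pi.single j 1) (by rw [hs1]; omega)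
  have hm2 := fun j l : Fin d =>
    weakDeriv_spec hw (α := Pi.single j 1 + Pi.single l 1) (by rw [hs2]; omega)
  obtain ⟨φ, hφ⟩ := exists_h1Approx (isCompact_hull T) (convex_hull' T) hne hsub hw.1
    (fun j => (hm1 j).1) fun j => (hm1 j).2
  obtain ⟨t, ht, -⟩ := exists_hasFacetTraces hγ hd hT hφ
  have h1 : ∀ j : Fin d, ∃ t, HasFacetTraces T (weakDeriv Ω (Pi.single j 1) w)
      (fun l => weakDeriv Ω (Pi.single j 1 + Pi.single l 1) w) t := by
    intro j
    obtain ⟨φ, hφ⟩ := exists_h1Approx (isCompact_hull T) (convex_hull' T) hne hsub (hm1 j).1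
      (fun l => (hm2 j l).1) fun l => hasWeakDeriv_weakDeriv hw (by rw [hs1]; omega) l
    obtain ⟨t, ht, -⟩ := exists_hasFacetTraces hγ hd hT hφ
    exact ⟨t, ht⟩
  choose tg htg using h1
  exact ⟨t, tg, isJet_weakDeriv (isCompact_hull T) (convex_hull' T) hne hsub hw,
    ae_hull_of_ae 𝒯 hΩ h (weakDeriv_zero hΩ.isOpen hw), ht, htg⟩

/-- The weak gradient form, with `W` the `L²`-projection of `∂ⱼuᵢ`: a volume term with `∂ⱼ∂ⱼuᵢ`, the
error of `W` tested with the jump `v₀ - v_b`, and the trace of `∂ⱼuᵢ` tested with `v_b`. -/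
lemma integral_weakGrad_mul_weakGrad (hd : 1 ≤ d) (hγ : 0 < γ) (hT : IsRegular γ T)
    (hD : ∀ i, HasJetTraces T k (fun x => u x i) (D i) (t i) (tg i)) (hv : ∀ i, v.1 T i ∈ P d k)
    (i j : Fin d) {W : Poly d} (hW : W ∈ P d (k - 1)) (hproj : ∀ φ ∈ P d (k - 1),
      ∫ x in hull T, ev W x * ev φ x = ∫ x in hull T, D i (Pi.single j 1) x * ev φ x) :
    ∫ x in hull T, ev W x * ev (weakGrad k v T i j) x
      = -(∫ x in hull T, D i (Pi.single j 1 + Pi.single j 1) x * ev (v.1 T i) x)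
        + ∑ a ∈ T, (∫ x in hull (opp T a), (tg i j a x - ev W x)
            * (ev (v.1 T i) x - ev (v.2 (opp T a) i) x) * normal T a j ∂(surf d))
        + ∑ a ∈ T, ∫ x in hull (opp T a), tg i j a x * ev (v.2 (opp T a) i) x * normal T a j
            ∂(surf d) := by
  have h1 := integral_weakGrad_mul hd hγ hT k v i j hW
  have h2 := hproj _ (pderiv_mem_P (hv i) j)
  have h3 := ((hD i).traceGrad j).integral_mul hd hT.simplex (contDiff_ev (v.1 T i)) j
  rw [pd_ev] at h3
  simp only [mul_comm (ev W _)] at h2 ⊢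
  rw [h1, h2]
  have h4 : ∀ a ∈ T, (∫ x in hull (opp T a), (tg i j a x - ev W x)
        * (ev (v.1 T i) x - ev (v.2 (opp T a) i) x) * normal T a j ∂(surf d))
      = (∫ x in hull (opp T a), tg i j a x * ev (v.1 T i) x * normal T a j ∂(surf d))
        - (∫ x in hull (opp T a), tg i j a x * ev (v.2 (opp T a) i) x * normal T a j ∂(surf d))
        - ∫ x in hull (opp T a), (ev (v.1 T i) x - ev (v.2 (opp T a) i) x) * ev W x
            * normal T a j ∂(surf d) := by
    intro a ha
    have ht := ((hD i).traceGrad j).memt a ha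
    have hi : ∀ q : Poly d, Integrable (fun x => tg i j a x * ev q x * normal T a j)
        ((surf d).restrict (hull (opp T a))) := fun q =>
      (integrable_mul_of_memLp ht (memLp_facet hT.simplex hd ha (continuous_ev q))).mul_const _
    have hc : Integrable (fun x => (ev (v.1 T i) x - ev (v.2 (opp T a) i) x) * ev W x
        * normal T a j) ((surf d).restrict (hull (opp T a))) :=
      integrable_facet hT.simplex hd ha (by fun_prop)
    have hs : Integrable (fun x => tg i j a x * ev (v.1 T i) x * normal T a j
        - tg i j a x * ev (v.2 (opp T a) i) x * normal T a j)
        ((surf d).restrict (hull (opp T a))) := (hi _).sub (hi _)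
    rw [← integral_sub (hi _) (hi _), ← integral_sub hs hc]
    refine integral_congr_ae (.of_forall fun x => ?_)
    simp only
    ring
  rw [Finset.sum_congr rfl h4, Finset.sum_sub_distrib, Finset.sum_sub_distrib]
  linarith

/-- The weak divergence form, with `W` the `L²`-projection of `∇ · u`: since `weakDiv` is the
divergence of the reconstruction, whose normal components on the facets are those of `v_b`,
integration by parts gives a volume term with `∇ (∇ · u)` tested with the reconstruction, and no
approximation error. -/
lemma integral_weakDiv_mul_weakDiv (hd : 1 ≤ d) (hγ : 0 < γ) (hT : IsRegular γ T) (hk : 1 ≤ k)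
    (hD : ∀ i, HasJetTraces T k (fun x => u x i) (D i) (t i) (tg i))
    (hv : ∀ a ∈ T, ∀ i, v.2 (opp T a) i ∈ P d k) {W : Poly d} (hproj : ∀ φ ∈ P d k,
      ∫ x in hull T, ev W x * ev φ x = ∑ i, ∫ x in hull T, D i (Pi.single i 1) x * ev φ x) :
    ∫ x in hull T, ev W x * ev (weakDiv k v T) x
      = -(∑ i, ∑ j, ∫ x in hull T, D j (Pi.single j 1 + Pi.single i 1) x
          * ev (reconstruct k v T i) x)
        + ∑ i, ∑ j, ∑ a ∈ T, ∫ x in hull (opp T a), tg j j a x * ev (v.2 (opp T a) i) x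
            * normal T a i ∂(surf d) := by
  set r := reconstruct k v T with hr
  rw [hproj _ (weakDiv_spec hd hγ hT k v).1, ← pdiv_reconstruct hd hγ hT hk v, ← hr]
  have h1 : ∀ i j, ∫ x in hull T, D j (Pi.single j 1) x * ev (MvPolynomial.pderiv i (r i)) x
      = -(∫ x in hull T, D j (Pi.single j 1 + Pi.single i 1) x * ev (r i) x)
        + ∑ a ∈ T, ∫ x in hull (opp T a), tg j j a x * ev (r i) x * normal T a i ∂(surf d) := by
    intro i j
    have := ((hD j).traceGrad j).integral_mul hd hT.simplex (contDiff_ev (r i)) i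
    rw [pd_ev] at this
    linarith
  have h2 : ∀ j, ∫ x in hull T, D j (Pi.single j 1) x * ev (pdiv r) x
      = ∑ i, ∫ x in hull T, D j (Pi.single j 1) x * ev (MvPolynomial.pderiv i (r i)) x := by
    intro j
    rw [← integral_finsetSum _ fun i _ => integrable_mul_of_memLp ((hD j).traceGrad j).mem
      (memLp_hull T (continuous_ev _))]
    simp only [pdiv, ev_sum, Finset.mul_sum]
  -- the normal components of `r` and of `v_b` agree on the facets
  have h3 : ∀ j, ∀ a ∈ T, ∑ i, ∫ x in hull (opp T a), tg j j a x * ev (r i) x * normal T a i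
        ∂(surf d)
      = ∑ i, ∫ x in hull (opp T a), tg j j a x * ev (v.2 (opp T a) i) x * normal T a i
        ∂(surf d) := by
    intro j a ha
    have hi : ∀ (q : Fin d → Poly d) (i : Fin d), i ∈ Finset.univ →
        Integrable (fun x => tg j j a x * ev (q i) x * normal T a i)
        ((surf d).restrict (hull (opp T a))) := fun q i _ =>
      (integrable_mul_of_memLp (((hD j).traceGrad j).memt a ha)
        (memLp_facet hT.simplex hd ha (continuous_ev (q i)))).mul_const _
    rw [← integral_finsetSum _ (hi r), ← integral_finsetSum _ (hi (v.2 (opp T a)))]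
    refine integral_congr_ae ?_
    filter_upwards [ncomp_reconstruct_ae hd hγ hT hk ha (hv a ha)] with x hx
    rw [ev_ncomp, ev_ncomp] at hx
    simp only [mul_assoc, ← Finset.mul_sum]
    rw [hx]
  have h4 : ∑ j, ∑ i, ∑ a ∈ T, ∫ x in hull (opp T a), tg j j a x * ev (r i) x * normal T a i
        ∂(surf d)
      = ∑ j, ∑ i, ∑ a ∈ T, ∫ x in hull (opp T a), tg j j a x * ev (v.2 (opp T a) i) x
        * normal T a i ∂(surf d) := by
    refine Finset.sum_congr rfl fun j _ => ?_
    rw [Finset.sum_comm, Finset.sum_comm (s := Finset.univ) (t := T)]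
    exact Finset.sum_congr rfl (h3 j)
  simp only [h2, h1, Finset.sum_add_distrib, Finset.sum_neg_distrib]
  rw [h4, Finset.sum_comm, Finset.sum_comm (s := Finset.univ) (t := Finset.univ)
    (f := fun j i => ∑ a ∈ T, ∫ x in hull (opp T a), tg j j a x * ev (v.2 (opp T a) i) x
        * normal T a i ∂(surf d))]

/-- The jump `v₀ - v_b` on the boundary of an element, in the scaling of the energy norm. -/
def jumpNm (T : Finset (E d)) (v : WeakFun d) : ℝ :=
  (√(diam T))⁻¹ * ∑ a ∈ T, ∑ i, nm ((surf d).restrict (hull (opp T a)))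
    fun x => ev (v.1 T i) x - ev (v.2 (opp T a) i) x

lemma jumpNm_nonneg (T : Finset (E d)) (v : WeakFun d) : 0 ≤ jumpNm T v :=
  mul_nonneg (inv_nonneg.2 (Real.sqrt_nonneg _))
    (Finset.sum_nonneg fun _ _ => Finset.sum_nonneg fun _ _ => nm_nonneg)

lemma inv_sqrt_mul_nm_le_jumpNm {a : E d} (ha : a ∈ T) (i : Fin d) :
    (√(diam T))⁻¹ * nm ((surf d).restrict (hull (opp T a)))
      (fun x => ev (v.1 T i) x - ev (v.2 (opp T a) i) x) ≤ jumpNm T v := by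
  refine mul_le_mul_of_nonneg_left ?_ (inv_nonneg.2 (Real.sqrt_nonneg _))
  refine le_trans ?_ (Finset.single_le_sum (f := fun a => ∑ i, nm ((surf d).restrict
    (hull (opp T a))) fun x => ev (v.1 T i) x - ev (v.2 (opp T a) i) x)
    (fun _ _ => Finset.sum_nonneg fun _ _ => nm_nonneg) ha)
  exact Finset.single_le_sum (f := fun i => nm ((surf d).restrict
    (hull (opp T a))) fun x => ev (v.1 T i) x - ev (v.2 (opp T a) i) x)
    (fun _ _ => nm_nonneg) (Finset.mem_univ i)

lemma abs_facet_integral_le (hd : 1 ≤ d) (hT : IsSimplex T) {a : E d} (ha : a ∈ T) (i : Fin d)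
    {f : E d → ℝ} (hf : MemLp f 2 ((surf d).restrict (hull (opp T a)))) {B : ℝ}
    (hB : √(diam T) * nm ((surf d).restrict (hull (opp T a))) f ≤ B) :
    |∫ x in hull (opp T a), f x * (ev (v.1 T i) x - ev (v.2 (opp T a) i) x) ∂(surf d)|
      ≤ B * jumpNm T v := by
  have hs : 0 < √(diam T) := Real.sqrt_pos.2 (diam_pos hT hd)
  have h1 := abs_integral_mul_le hf ((memLp_facet hT hd ha (continuous_ev (v.1 T i))).sub
    (memLp_facet hT hd ha (continuous_ev (v.2 (opp T a) i))))
  refine h1.trans ?_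
  have h2 := inv_sqrt_mul_nm_le_jumpNm (v := v) ha i
  calc _ = (√(diam T) * nm ((surf d).restrict (hull (opp T a))) f) * ((√(diam T))⁻¹ *
        nm ((surf d).restrict (hull (opp T a)))
          fun x => ev (v.1 T i) x - ev (v.2 (opp T a) i) x) := by
        rw [mul_mul_mul_comm, mul_inv_cancel₀ hs.ne', one_mul]
        rfl
    _ ≤ _ := mul_le_mul hB h2 (mul_nonneg (inv_nonneg.2 hs.le) nm_nonneg)
        ((mul_nonneg hs.le nm_nonneg).trans hB)

/-- The contribution of an element to the consistency error. -/
def elemError (μ : ℝ) (T : Finset (E d)) (k : ℕ) (v w : WeakFun d)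
    (D : Fin d → (Fin d → ℕ) → E d → ℝ) (tg : Fin d → Fin d → E d → E d → ℝ) : ℝ :=
  μ * (∑ i, ∑ j, ((∫ x in hull T, D i (Pi.single j 1 + Pi.single j 1) x
        * (ev (reconstruct k v T i) x - ev (v.1 T i) x))
      + ∑ a ∈ T, ∫ x in hull (opp T a), (tg i j a x - ev (weakGrad k w T i j) x)
          * (ev (v.1 T i) x - ev (v.2 (opp T a) i) x) * normal T a j ∂(surf d)))
    + (diam T)⁻¹ * ∑ a ∈ T, ∫ x in hull (opp T a),
      ∑ i, (ev (w.1 T i) x - ev (w.2 (opp T a) i) x) * (ev (v.1 T i) x - ev (v.2 (opp T a) i) x)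
        ∂(surf d)

/-- The consistency error of an element is of order `k`: each of its three parts is a product of an
approximation error of `u` or `∇u` and the jump `v₀ - v_b`. -/
lemma exists_abs_elemError_le (hd : 1 ≤ d) (hγ : 0 < γ) (hk : 1 ≤ k) (m : ℝ) :
    ∃ C : ℝ, 0 < C ∧ ∀ μ : ℝ, 0 ≤ μ → μ ≤ m → ∀ T : Finset (E d), IsRegular γ T →
      ∀ (Ω : Set (E d)) (u : E d → E d) (D : Fin d → (Fin d → ℕ) → E d → ℝ)
        (t : Fin d → E d → E d → ℝ) (tg : Fin d → Fin d → E d → E d → ℝ) (v : WeakFun d),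
      (∀ i, HasJetTraces T k (fun x => u x i) (D i) (t i) (tg i)) →
      (∀ i, ∀ a ∈ T, t i a =ᵐ[(surf d).restrict (hull (opp T a))]
        trace Ω (hull (opp T a)) fun x => u x i) →
      (∀ i, v.1 T i ∈ P d k) → (∀ a ∈ T, ∀ i, v.2 (opp T a) i ∈ P d k) →
      |elemError μ T k v (Qh Ω k u) D tg|
        ≤ C * diam T ^ k * (∑ i, topNm (hull T) (k + 1) (D i)) * jumpNm T v := by
  obtain ⟨C₁, hC₁, hcons⟩ := exists_consistency_le (d := d) hd hγ hk
  obtain ⟨C₂, hC₂, hrec⟩ := exists_nm_reconstruct_sub_le (d := d) hd hk hγ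
  have hd0 : (0 : ℝ) < d := by exact_mod_cast hd
  refine ⟨|m| * (d * (d * (C₁ * C₂ + (d + 1) * C₁))) + (d + 1) * (d * C₁), by positivity,
    fun μ hμ hμm T hT Ω u D t tg v hD htr hv1 hv2 => ?_⟩
  have hh := diam_pos hT.simplex hd
  have hs : 0 < √(diam T) := Real.sqrt_pos.2 hh
  have hss : √(diam T) * √(diam T) = diam T := Real.mul_self_sqrt hh.le
  have hJ := jumpNm_nonneg T v
  have hMi : ∀ i, topNm (hull T) (k + 1) (D i) ≤ ∑ i, topNm (hull T) (k + 1) (D i) := fun i =>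
    Finset.single_le_sum (f := fun i => topNm (hull T) (k + 1) (D i))
      (fun i _ => topNm_nonneg _ _ _) (Finset.mem_univ i)
  have hM : 0 ≤ ∑ i, topNm (hull T) (k + 1) (D i) :=
    Finset.sum_nonneg fun i _ => topNm_nonneg _ _ _
  set M := ∑ i, topNm (hull T) (k + 1) (D i) with hMdef
  have hcard : (T.card : ℝ) = d + 1 := by rw [hT.simplex.card]; push_cast; ring
  -- the reconstruction error
  have hA : ∀ i j, |∫ x in hull T, D i (Pi.single j 1 + Pi.single j 1) x
      * (ev (reconstruct k v T i) x - ev (v.1 T i) x)| ≤ C₁ * C₂ * diam T ^ k * M * jumpNm T v := by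
    intro i j
    -- The reconstruction has the same moments as `v₀` against polynomials of degree `k - 1`.
    have h1 := (hcons T hT _ _ _ _ (hD i)).2.2 j
      (fun x => ev (reconstruct k v T i) x - ev (v.1 T i) x)
      ((memLp_hull T (continuous_ev _)).sub (memLp_hull T (continuous_ev _))) (fun φ hφ => by
        simp only [sub_mul]
        rw [integral_sub (integrable_hull T (by fun_prop)) (integrable_hull T (by fun_prop)),
          integral_reconstruct_mul hd hγ hT hk v i hφ, sub_self])
    have h2 := hrec T hT v hv1 hv2 i
    have h3 : √(diam T) * ∑ a ∈ T, ∑ i, nm ((surf d).restrict (hull (opp T a)))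
        (fun x => ev (v.1 T i) x - ev (v.2 (opp T a) i) x) = diam T * jumpNm T v := by
      rw [jumpNm, ← mul_assoc]
      congr 1
      rw [eq_mul_inv_iff_mul_eq₀ hs.ne', hss]
    rw [h3] at h2
    refine le_of_mul_le_mul_left ?_ hh
    calc _ ≤ C₁ * diam T ^ k * topNm (hull T) (k + 1) (D i) * (C₂ * (diam T * jumpNm T v)) :=
          h1.trans (mul_le_mul_of_nonneg_left h2
            (mul_nonneg (by positivity) (topNm_nonneg _ _ _)))
      _ ≤ C₁ * diam T ^ k * M * (C₂ * (diam T * jumpNm T v)) := by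
          gcongr
          exact hMi i
      _ = _ := by ring
  -- the error of the weak gradient on the facets
  have hB : ∀ i j, ∀ a ∈ T, |∫ x in hull (opp T a),
      (tg i j a x - ev (weakGrad k (Qh Ω k u) T i j) x)
          * (ev (v.1 T i) x - ev (v.2 (opp T a) i) x) * normal T a j ∂(surf d)|
      ≤ C₁ * diam T ^ k * M * jumpNm T v := by
    intro i j a ha
    have h1 := (hcons T hT _ _ _ _ (hD i)).2.1 j _ (weakGrad_spec hd hγ hT k (Qh Ω k u) i j).1
      (fun φ hφ => integral_weakGrad_Qh_mul hd hγ hT (hD i).trace (htr i) hφ) a ha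
    rw [integral_mul_const, abs_mul]
    have h2 := abs_facet_integral_le (v := v) hd hT.simplex ha i
      ((((hD i).traceGrad j).memt a ha).sub (memLp_facet hT.simplex hd ha (continuous_ev _))) h1
    calc _ ≤ |_| * 1 := mul_le_mul_of_nonneg_left (abs_normal_le hT.simplex hd ha j) (abs_nonneg _)
      _ ≤ _ := by
          rw [mul_one]
          refine h2.trans (mul_le_mul_of_nonneg_right ?_ hJ)
          exact mul_le_mul_of_nonneg_left (hMi i) (by positivity)
  -- in the stabilizer, `Q_b u` may be replaced by the trace of `u`
  have hS : ∀ a ∈ T, ∀ i, |∫ x in hull (opp T a),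
      (ev ((Qh Ω k u).1 T i) x - ev ((Qh Ω k u).2 (opp T a) i) x)
        * (ev (v.1 T i) x - ev (v.2 (opp T a) i) x) ∂(surf d)|
      ≤ C₁ * diam T ^ (k + 1) * M * jumpNm T v := by
    intro a ha i
    have hq := elemProj_spec hd hγ hT k (hD i).trace.mem
    have h1 := (hcons T hT _ _ _ _ (hD i)).1 _ hq.1 hq.2 a ha
    have htm := (hD i).trace.memt a ha
    have hmq := memLp_facet hT.simplex hd ha (continuous_ev (elemProj k T fun x => u x i))
    have h2 := abs_facet_integral_le (v := v) hd hT.simplex ha i (htm.sub hmq) h1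
    have h3 := (facetProj_spec hd hT.simplex ha k htm).2 _ (sub_mem (hv1 i) (hv2 a ha i))
    rw [facetProj_congr (htr i a ha)] at h3
    have hmv := memLp_facet hT.simplex hd ha (continuous_ev (v.1 T i - v.2 (opp T a) i))
    have h4 : ∫ x in hull (opp T a), (ev ((Qh Ω k u).1 T i) x - ev ((Qh Ω k u).2 (opp T a) i) x)
          * (ev (v.1 T i) x - ev (v.2 (opp T a) i) x) ∂(surf d)
        = -∫ x in hull (opp T a), (t i a x - ev (elemProj k T fun x => u x i) x)
          * (ev (v.1 T i) x - ev (v.2 (opp T a) i) x) ∂(surf d) := by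
      simp only [← ev_sub _ (v.2 (opp T a) i), sub_mul]
      rw [integral_sub (integrable_facet hT.simplex hd ha (by fun_prop))
        (integrable_facet hT.simplex hd ha (by fun_prop)),
        integral_sub (integrable_mul_of_memLp htm hmv) (integrable_mul_of_memLp hmq hmv), ← h3]
      simp only [Qh]
      ring
    rw [h4, abs_neg]
    refine h2.trans (mul_le_mul_of_nonneg_right ?_ hJ)
    exact mul_le_mul_of_nonneg_left (hMi i) (by positivity)
  rw [elemError]
  set X := diam T ^ k * M * jumpNm T v with hX
  have hX0 : 0 ≤ X := by positivity
  have h1 : |∑ i, ∑ j, ((∫ x in hull T, D i (Pi.single j 1 + Pi.single j 1) x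
        * (ev (reconstruct k v T i) x - ev (v.1 T i) x))
      + ∑ a ∈ T, ∫ x in hull (opp T a), (tg i j a x - ev (weakGrad k (Qh Ω k u) T i j) x)
          * (ev (v.1 T i) x - ev (v.2 (opp T a) i) x) * normal T a j ∂(surf d))|
      ≤ d * (d * (C₁ * C₂ + (d + 1) * C₁)) * X := by
    have h2 : ∀ i j, |(∫ x in hull T, D i (Pi.single j 1 + Pi.single j 1) x
        * (ev (reconstruct k v T i) x - ev (v.1 T i) x))
      + ∑ a ∈ T, ∫ x in hull (opp T a), (tg i j a x - ev (weakGrad k (Qh Ω k u) T i j) x)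
          * (ev (v.1 T i) x - ev (v.2 (opp T a) i) x) * normal T a j ∂(surf d)|
        ≤ (C₁ * C₂ + (d + 1) * C₁) * X := by
      intro i j
      refine (abs_add_le _ _).trans ?_
      have h3 := (Finset.abs_sum_le_sum_abs _ _).trans
        (Finset.sum_le_sum fun a (ha : a ∈ T) => hB i j a ha)
      rw [Finset.sum_const, nsmul_eq_mul, hcard] at h3
      refine (add_le_add (hA i j) h3).trans_eq ?_
      rw [hX]; ring
    have h3 : ∀ i, |∑ j, ((∫ x in hull T, D i (Pi.single j 1 + Pi.single j 1) x
        * (ev (reconstruct k v T i) x - ev (v.1 T i) x))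
      + ∑ a ∈ T, ∫ x in hull (opp T a), (tg i j a x - ev (weakGrad k (Qh Ω k u) T i j) x)
          * (ev (v.1 T i) x - ev (v.2 (opp T a) i) x) * normal T a j ∂(surf d))|
        ≤ d * (C₁ * C₂ + (d + 1) * C₁) * X := by
      intro i
      refine (Finset.abs_sum_le_sum_abs _ _).trans
        ((Finset.sum_le_sum fun j _ => h2 i j).trans_eq ?_)
      rw [Finset.sum_const, Finset.card_univ, Fintype.card_fin, nsmul_eq_mul, mul_assoc]
    refine (Finset.abs_sum_le_sum_abs _ _).trans ((Finset.sum_le_sum fun i _ => h3 i).trans_eq ?_)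
    rw [Finset.sum_const, Finset.card_univ, Fintype.card_fin, nsmul_eq_mul, mul_assoc, mul_assoc,
      mul_assoc]
  have h2 : |(diam T)⁻¹ * ∑ a ∈ T, ∫ x in hull (opp T a),
      ∑ i, (ev ((Qh Ω k u).1 T i) x - ev ((Qh Ω k u).2 (opp T a) i) x)
        * (ev (v.1 T i) x - ev (v.2 (opp T a) i) x) ∂(surf d)| ≤ (d + 1) * (d * C₁) * X := by
    have h3 : ∀ a ∈ T, |∫ x in hull (opp T a),
        ∑ i, (ev ((Qh Ω k u).1 T i) x - ev ((Qh Ω k u).2 (opp T a) i) x)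
          * (ev (v.1 T i) x - ev (v.2 (opp T a) i) x) ∂(surf d)|
        ≤ d * (C₁ * diam T ^ (k + 1) * M * jumpNm T v) := by
      intro a ha
      rw [integral_finsetSum _ fun i _ => integrable_facet hT.simplex hd ha (by fun_prop)]
      refine (Finset.abs_sum_le_sum_abs _ _).trans
        ((Finset.sum_le_sum fun i _ => hS a ha i).trans_eq ?_)
      rw [Finset.sum_const, Finset.card_univ, Fintype.card_fin, nsmul_eq_mul]
    rw [abs_mul, abs_of_pos (inv_pos.2 hh), inv_mul_le_iff₀ hh]
    refine (Finset.abs_sum_le_sum_abs _ _).trans ((Finset.sum_le_sum h3).trans_eq ?_)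
    rw [Finset.sum_const, nsmul_eq_mul, hcard, hX]
    ring
  refine (abs_add_le _ _).trans ((add_le_add ((abs_mul _ _).le.trans (mul_le_mul
    ((abs_of_nonneg hμ).le.trans (hμm.trans (le_abs_self m))) h1 (abs_nonneg _) (abs_nonneg m)))
      h2).trans_eq ?_)
  rw [hX]; ring

end element

section error_equation

/-! ### The error equation and the energy estimate -/

variable {Ω : Set (E d)} (𝒯 : Triangulation Ω) {γ : ℝ} {k : ℕ} {u : E d → E d} {v : WeakFun d}
  {t : Finset (E d) → Fin d → E d → E d → ℝ} {tg : Finset (E d) → Fin d → Fin d → E d → E d → ℝ}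

/-- The consistency error of the scheme is a sum of contributions of the elements which do not
involve `lam`: the traces of `∇u` and `∇ · u` tested with `v_b` cancel, and the term with
`∇ (∇ · u)` cancels because the divergence of the reconstruction of `v` is its weak divergence. -/
lemma formAs_Qh_sub_eq (hΩ : IsLipschitzDomain Ω) (hd : 2 ≤ d) (hk : 1 ≤ k) (hγ : 0 < γ)
    (hreg : 𝒯.ShapeRegular γ) {μ lam : ℝ} {f g : E d → E d} (hsol : IsExactSolution Ω μ lam f g u)
    (hu : ∀ i, MemSobolev Ω (k + 1) fun x => u x i)
    (hD : ∀ T ∈ 𝒯.elems, ∀ i, HasJetTraces T k (fun x => u x i)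
      (fun α => weakDeriv Ω α fun x => u x i) (t T i) (tg T i))
    (htr : ∀ T ∈ 𝒯.elems, ∀ i, ∀ a ∈ T, t T i a =ᵐ[(surf d).restrict (hull (opp T a))]
      trace Ω (hull (opp T a)) fun x => u x i) (hv : InVh0 𝒯 k v) :
    formAs 𝒯 k μ lam (Qh Ω k u) v
        - ∑ T ∈ 𝒯.elems, ∫ x in hull T, ∑ i, f x i * ev (reconstruct k v T i) x
      = ∑ T ∈ 𝒯.elems, elemError μ T k v (Qh Ω k u) (fun i α => weakDeriv Ω α fun x => u x i)
          (tg T) := by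
  have hd1 : 1 ≤ d := by omega
  set D : Fin d → (Fin d → ℕ) → E d → ℝ := fun i α => weakDeriv Ω α fun x => u x i with hDdef
  have hs1 : ∀ j : Fin d, ∑ i, (Pi.single j 1 : Fin d → ℕ) i = 1 := fun j => by simp
  have hs2 : ∀ j l : Fin d, ∑ i, (Pi.single j 1 + Pi.single l 1 : Fin d → ℕ) i = 2 := fun j l => by
    rw [sum_add_single, hs1]
  -- the terms with the single-valued traces cancel
  have hcancel : ∀ i j i' l : Fin d, ∑ T ∈ 𝒯.elems, ∑ a ∈ T, ∫ y in hull (opp T a),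
      tg T i j a y * ev (v.2 (opp T a) i') y * normal T a l ∂(surf d) = 0 := fun i j i' l =>
    sum_facet_integral_eq_zero 𝒯 hΩ hd (t := fun T => tg T i j)
      (weakDeriv_spec (hu i) (by rw [hs1]; omega)).1
      (fun l => (weakDeriv_spec (hu i) (by rw [hs2]; omega)).1)
      (fun l => hasWeakDeriv_weakDeriv (hu i) (by rw [hs1]; omega) l)
      (fun T hT => (hD T hT i).traceGrad j) (fun e => v.2 e i')
      (fun e he hfr => hv.2 e he hfr i') l
  have hA1 : ∀ T ∈ 𝒯.elems, (∫ x in hull T, ∑ i, ∑ j, ev (weakGrad k (Qh Ω k u) T i j) x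
        * ev (weakGrad k v T i j) x)
      = ∑ i, ∑ j, (-(∫ x in hull T, D i (Pi.single j 1 + Pi.single j 1) x * ev (v.1 T i) x)
        + (∑ a ∈ T, ∫ x in hull (opp T a), (tg T i j a x - ev (weakGrad k (Qh Ω k u) T i j) x)
            * (ev (v.1 T i) x - ev (v.2 (opp T a) i) x) * normal T a j ∂(surf d))
        + ∑ a ∈ T, ∫ x in hull (opp T a), tg T i j a x * ev (v.2 (opp T a) i) x * normal T a j
            ∂(surf d)) := by
    intro T hT
    have hTr := isRegular_of_mem_elems 𝒯 hreg hT
    rw [integral_finsetSum _ fun i _ => integrable_hull T (by fun_prop)]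
    refine Finset.sum_congr rfl fun i _ => ?_
    rw [integral_finsetSum _ fun j _ => integrable_hull T (by fun_prop)]
    refine Finset.sum_congr rfl fun j _ => ?_
    exact integral_weakGrad_mul_weakGrad hd1 hγ hTr (hD T hT) (hv.1.1 T hT) i j
      (weakGrad_spec hd1 hγ hTr k _ i j).1 fun φ hφ =>
        integral_weakGrad_Qh_mul hd1 hγ hTr (hD T hT i).trace (htr T hT i) hφ
  have hA2 : ∀ T ∈ 𝒯.elems, (∫ x in hull T, ev (weakDiv k (Qh Ω k u) T) x * ev (weakDiv k v T) x)
      = -(∑ i, ∑ j, ∫ x in hull T, D j (Pi.single j 1 + Pi.single i 1) x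
          * ev (reconstruct k v T i) x)
        + ∑ i, ∑ j, ∑ a ∈ T, ∫ x in hull (opp T a), tg T j j a x * ev (v.2 (opp T a) i) x
            * normal T a i ∂(surf d) := by
    intro T hT
    have hTr := isRegular_of_mem_elems 𝒯 hreg hT
    exact integral_weakDiv_mul_weakDiv hd1 hγ hTr hk (hD T hT)
      (fun a ha => hv.1.2 _ (opp_mem_facets 𝒯 hd1 hT ha)) fun φ hφ =>
        integral_weakDiv_Qh_mul hd1 hγ hTr (fun i => (hD T hT i).trace) (htr T hT) hφ
  have hF : ∀ T ∈ 𝒯.elems, (∫ x in hull T, ∑ i, f x i * ev (reconstruct k v T i) x)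
      = -μ * (∑ i, ∑ j, ∫ x in hull T, D i (Pi.single j 1 + Pi.single j 1) x
          * ev (reconstruct k v T i) x)
        - (lam + μ) * ∑ i, ∑ j, ∫ x in hull T, D j (Pi.single j 1 + Pi.single i 1) x
          * ev (reconstruct k v T i) x := by
    intro T hT
    have hi : ∀ i j l m : Fin d, Integrable (fun x => D i (Pi.single j 1 + Pi.single l 1) x
        * ev (reconstruct k v T m) x) (volume.restrict (hull T)) := fun i j l m =>
      integrable_mul_of_memLp (((hD T hT i).traceGrad j).memG l) (memLp_hull T (continuous_ev _))
    have h1 : (∫ x in hull T, ∑ i, f x i * ev (reconstruct k v T i) x)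
        = ∫ x in hull T, (-μ * (∑ i, ∑ j, D i (Pi.single j 1 + Pi.single j 1) x
            * ev (reconstruct k v T i) x)
          - (lam + μ) * ∑ i, ∑ j, D j (Pi.single j 1 + Pi.single i 1) x
            * ev (reconstruct k v T i) x) := by
      refine integral_congr_ae ?_
      filter_upwards [ae_hull_of_ae 𝒯 hΩ hT hsol.pde] with x hx
      rw [Finset.mul_sum, Finset.mul_sum, ← Finset.sum_sub_distrib]
      refine Finset.sum_congr rfl fun i _ => ?_
      rw [← hx i, ← Finset.sum_mul, ← Finset.sum_mul, sub_mul, mul_assoc, mul_assoc]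
      simp only [hDdef, add_comm (Pi.single i 1 : Fin d → ℕ)]
    have hi1 : Integrable (fun x => ∑ i, ∑ j, D i (Pi.single j 1 + Pi.single j 1) x
        * ev (reconstruct k v T i) x) (volume.restrict (hull T)) :=
      integrable_finsetSum _ fun i _ => integrable_finsetSum _ fun j _ => hi i j j i
    have hi2 : Integrable (fun x => ∑ i, ∑ j, D j (Pi.single j 1 + Pi.single i 1) x
        * ev (reconstruct k v T i) x) (volume.restrict (hull T)) :=
      integrable_finsetSum _ fun i _ => integrable_finsetSum _ fun j _ => hi j j i i
    rw [h1, integral_sub (hi1.const_mul _) (hi2.const_mul _), integral_const_mul,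
      integral_const_mul, integral_finsetSum _ fun i _ =>
        integrable_finsetSum _ fun j _ => hi i j j i,
      integral_finsetSum _ fun i _ => integrable_finsetSum _ fun j _ => hi j j i i]
    congr 2
    · exact Finset.sum_congr rfl fun i _ => integral_finsetSum _ fun j _ => hi i j j i
    · exact congrArg _ (funext fun i => integral_finsetSum _ fun j _ => hi j j i i)
  have hE : ∀ T ∈ 𝒯.elems, elemError μ T k v (Qh Ω k u) D (tg T)
      = μ * (∑ i, ∑ j, ((∫ x in hull T, D i (Pi.single j 1 + Pi.single j 1) x
            * ev (reconstruct k v T i) x)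
          - (∫ x in hull T, D i (Pi.single j 1 + Pi.single j 1) x * ev (v.1 T i) x)
          + ∑ a ∈ T, ∫ x in hull (opp T a), (tg T i j a x - ev (weakGrad k (Qh Ω k u) T i j) x)
            * (ev (v.1 T i) x - ev (v.2 (opp T a) i) x) * normal T a j ∂(surf d)))
        + (diam T)⁻¹ * ∑ a ∈ T, ∫ x in hull (opp T a),
          ∑ i, (ev ((Qh Ω k u).1 T i) x - ev ((Qh Ω k u).2 (opp T a) i) x)
            * (ev (v.1 T i) x - ev (v.2 (opp T a) i) x) ∂(surf d) := by
    intro T hT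
    have h1 : ∀ i j, (∫ x in hull T, D i (Pi.single j 1 + Pi.single j 1) x
          * (ev (reconstruct k v T i) x - ev (v.1 T i) x))
        = (∫ x in hull T, D i (Pi.single j 1 + Pi.single j 1) x * ev (reconstruct k v T i) x)
          - ∫ x in hull T, D i (Pi.single j 1 + Pi.single j 1) x * ev (v.1 T i) x := by
      intro i j
      simp only [mul_sub]
      exact integral_sub (integrable_mul_of_memLp (((hD T hT i).traceGrad j).memG j)
        (memLp_hull T (continuous_ev _))) (integrable_mul_of_memLp
          (((hD T hT i).traceGrad j).memG j) (memLp_hull T (continuous_ev _)))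
    rw [elemError]
    simp only [h1]
  have hc1 : ∑ T ∈ 𝒯.elems, ∑ i, ∑ j, ∑ a ∈ T, ∫ x in hull (opp T a),
      tg T i j a x * ev (v.2 (opp T a) i) x * normal T a j ∂(surf d) = 0 := by
    rw [Finset.sum_comm]
    refine Finset.sum_eq_zero fun i _ => ?_
    rw [Finset.sum_comm]
    exact Finset.sum_eq_zero fun j _ => hcancel i j i j
  have hc2 : ∑ T ∈ 𝒯.elems, ∑ i, ∑ j, ∑ a ∈ T, ∫ x in hull (opp T a),
      tg T j j a x * ev (v.2 (opp T a) i) x * normal T a i ∂(surf d) = 0 := by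
    rw [Finset.sum_comm]
    refine Finset.sum_eq_zero fun i _ => ?_
    rw [Finset.sum_comm]
    exact Finset.sum_eq_zero fun j _ => hcancel j j i i
  rw [formAs, formA, stab, Finset.sum_congr rfl hA1, Finset.sum_congr rfl hA2,
    Finset.sum_congr rfl hF, Finset.sum_congr rfl hE]
  simp only [Finset.sum_add_distrib, Finset.sum_sub_distrib, Finset.sum_neg_distrib,
    ← Finset.mul_sum, hc1, hc2]
  ring

lemma weakGrad_congr {T : Finset (E d)} {w w' : WeakFun d} (h₁ : w.1 T = w'.1 T)
    (h₂ : ∀ a ∈ T, w.2 (opp T a) = w'.2 (opp T a)) (i j : Fin d) :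
    weakGrad k w T i j = weakGrad k w' T i j := by
  rw [weakGrad, weakGrad, h₁]
  congr 1
  funext φ
  rw [Finset.sum_congr rfl fun a ha => by rw [h₂ a ha]]

lemma weakDiv_congr {T : Finset (E d)} {w w' : WeakFun d} (h₁ : w.1 T = w'.1 T)
    (h₂ : ∀ a ∈ T, w.2 (opp T a) = w'.2 (opp T a)) : weakDiv k w T = weakDiv k w' T := by
  rw [weakDiv, weakDiv, h₁]
  congr 1
  funext φ
  rw [Finset.sum_congr rfl fun a ha => by rw [h₂ a ha]]

lemma energyNorm_congr {w w' : WeakFun d} (h₁ : ∀ T ∈ 𝒯.elems, w.1 T = w'.1 T)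
    (h₂ : ∀ T ∈ 𝒯.elems, ∀ a ∈ T, w.2 (opp T a) = w'.2 (opp T a)) :
    energyNorm 𝒯 k w = energyNorm 𝒯 k w' := by
  rw [energyNorm, energyNorm]
  congr 1
  refine Finset.sum_congr rfl fun T hT => ?_
  rw [h₁ T hT, Finset.sum_congr rfl fun a ha => by rw [h₂ T hT a ha]]
  simp only [weakGrad_congr (h₁ T hT) (h₂ T hT)]

lemma energyNorm_sq (w : WeakFun d) : energyNorm 𝒯 k w ^ 2 = ∑ T ∈ 𝒯.elems,
    ((∫ x in hull T, ∑ i, ∑ j, (ev (weakGrad k w T i j) x) ^ 2)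
      + (diam T)⁻¹ * ∑ a ∈ T, ∫ x in hull (opp T a),
          ∑ i, (ev (w.1 T i) x - ev (w.2 (opp T a) i) x) ^ 2 ∂(surf d)) := by
  refine Real.sq_sqrt (Finset.sum_nonneg fun T _ => add_nonneg ?_ ?_)
  · exact integral_nonneg fun x => Finset.sum_nonneg fun i _ => Finset.sum_nonneg fun j _ =>
      sq_nonneg _
  · refine mul_nonneg (inv_nonneg.2 Metric.diam_nonneg) (Finset.sum_nonneg fun a _ => ?_)
    exact integral_nonneg fun x => Finset.sum_nonneg fun i _ => sq_nonneg _

/-- Coercivity, for the difference of two weak functions. The test function has to agree with the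
difference only on the elements and on their facets. -/
lemma mul_energyNorm_sq_le (hd : 1 ≤ d) (hγ : 0 < γ) (hreg : 𝒯.ShapeRegular γ) {μ lam c : ℝ}
    (hcμ : c ≤ μ) (hc1 : c ≤ 1) (hlam : 0 ≤ lam + μ) {w w' : WeakFun d}
    (h₁ : ∀ T ∈ 𝒯.elems, v.1 T = (w - w').1 T)
    (h₂ : ∀ T ∈ 𝒯.elems, ∀ a ∈ T, v.2 (opp T a) = (w - w').2 (opp T a)) :
    c * energyNorm 𝒯 k v ^ 2 ≤ formAs 𝒯 k μ lam w v - formAs 𝒯 k μ lam w' v := by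
  have hG : ∀ T ∈ 𝒯.elems, (∫ x in hull T, ∑ i, ∑ j, ev (weakGrad k w T i j) x
        * ev (weakGrad k v T i j) x)
      - (∫ x in hull T, ∑ i, ∑ j, ev (weakGrad k w' T i j) x * ev (weakGrad k v T i j) x)
      = ∫ x in hull T, ∑ i, ∑ j, (ev (weakGrad k v T i j) x) ^ 2 := by
    intro T hT
    rw [← integral_sub (integrable_hull T (by fun_prop)) (integrable_hull T (by fun_prop))]
    refine integral_congr_ae (.of_forall fun x => ?_)
    simp only [← Finset.sum_sub_distrib]
    refine Finset.sum_congr rfl fun i _ => Finset.sum_congr rfl fun j _ => ?_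
    rw [weakGrad_congr (h₁ T hT) (h₂ T hT),
      weakGrad_sub hd hγ (isRegular_of_mem_elems 𝒯 hreg hT), ev_sub]
    ring
  -- The divergence terms do not enter the energy norm; nonnegativity suffices.
  have hV : ∀ T ∈ 𝒯.elems, 0 ≤ (∫ x in hull T, ev (weakDiv k w T) x * ev (weakDiv k v T) x)
      - ∫ x in hull T, ev (weakDiv k w' T) x * ev (weakDiv k v T) x := by
    intro T hT
    rw [← integral_sub (integrable_hull T (by fun_prop)) (integrable_hull T (by fun_prop))]
    refine integral_nonneg fun x => ?_
    simp only
    rw [weakDiv_congr (h₁ T hT) (h₂ T hT),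
      weakDiv_sub hd hγ (isRegular_of_mem_elems 𝒯 hreg hT), ev_sub, ← sub_mul]
    exact mul_self_nonneg _
  have hS : ∀ T ∈ 𝒯.elems, ∀ a ∈ T, (∫ x in hull (opp T a),
        ∑ i, (ev (w.1 T i) x - ev (w.2 (opp T a) i) x)
          * (ev (v.1 T i) x - ev (v.2 (opp T a) i) x) ∂(surf d))
      - (∫ x in hull (opp T a), ∑ i, (ev (w'.1 T i) x - ev (w'.2 (opp T a) i) x)
          * (ev (v.1 T i) x - ev (v.2 (opp T a) i) x) ∂(surf d))
      = ∫ x in hull (opp T a), ∑ i, (ev (v.1 T i) x - ev (v.2 (opp T a) i) x) ^ 2 ∂(surf d) := by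
    intro T hT a ha
    have hTs := isSimplex_of_mem_elems 𝒯 hT
    rw [← integral_sub (integrable_facet hTs hd ha (by fun_prop))
      (integrable_facet hTs hd ha (by fun_prop))]
    refine integral_congr_ae (.of_forall fun x => ?_)
    simp only [← Finset.sum_sub_distrib]
    refine Finset.sum_congr rfl fun i _ => ?_
    rw [h₁ T hT, h₂ T hT a ha]
    simp only [Prod.fst_sub, Prod.snd_sub, Pi.sub_apply, ev_sub]
    ring
  have hS' : ∀ T ∈ 𝒯.elems, (diam T)⁻¹ * (∑ a ∈ T, ∫ x in hull (opp T a),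
        ∑ i, (ev (w.1 T i) x - ev (w.2 (opp T a) i) x)
          * (ev (v.1 T i) x - ev (v.2 (opp T a) i) x) ∂(surf d))
      - (diam T)⁻¹ * (∑ a ∈ T, ∫ x in hull (opp T a),
        ∑ i, (ev (w'.1 T i) x - ev (w'.2 (opp T a) i) x)
          * (ev (v.1 T i) x - ev (v.2 (opp T a) i) x) ∂(surf d))
      = (diam T)⁻¹ * ∑ a ∈ T, ∫ x in hull (opp T a),
          ∑ i, (ev (v.1 T i) x - ev (v.2 (opp T a) i) x) ^ 2 ∂(surf d) := by
    intro T hT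
    rw [← mul_sub, ← Finset.sum_sub_distrib, Finset.sum_congr rfl (hS T hT)]
  have hA := Finset.sum_congr rfl hG
  have hB := Finset.sum_nonneg hV
  have hC := Finset.sum_congr rfl hS'
  rw [Finset.sum_sub_distrib] at hA hB hC
  rw [energyNorm_sq, Finset.sum_add_distrib]
  have hA0 : 0 ≤ ∑ T ∈ 𝒯.elems, ∫ x in hull T, ∑ i, ∑ j, (ev (weakGrad k v T i j) x) ^ 2 :=
    Finset.sum_nonneg fun T _ => integral_nonneg fun x => Finset.sum_nonneg fun i _ =>
      Finset.sum_nonneg fun j _ => sq_nonneg _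
  have hC0 : 0 ≤ ∑ T ∈ 𝒯.elems, (diam T)⁻¹ * ∑ a ∈ T, ∫ x in hull (opp T a),
          ∑ i, (ev (v.1 T i) x - ev (v.2 (opp T a) i) x) ^ 2 ∂(surf d) :=
    Finset.sum_nonneg fun T _ => mul_nonneg (inv_nonneg.2 Metric.diam_nonneg)
      (Finset.sum_nonneg fun a _ => integral_nonneg fun x => Finset.sum_nonneg fun i _ =>
        sq_nonneg _)
  have h1 := mul_le_mul_of_nonneg_right hcμ hA0
  have h2 := mul_le_mul_of_nonneg_right hc1 hC0
  have h3 := mul_nonneg hlam hB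
  rw [mul_add, formAs, formAs, formA, formA, stab, stab]
  refine (add_le_add h1 h2).trans ?_
  rw [← hA, ← hC]
  linarith

/-- The jumps are controlled by the energy norm. -/
lemma sum_jumpNm_sq_le (hd : 1 ≤ d) (v : WeakFun d) :
    ∑ T ∈ 𝒯.elems, jumpNm T v ^ 2 ≤ (d + 1) * d * energyNorm 𝒯 k v ^ 2 := by
  rw [energyNorm_sq, Finset.mul_sum]
  refine Finset.sum_le_sum fun T hT => ?_
  have hTs := isSimplex_of_mem_elems 𝒯 hT
  have hh := diam_pos hTs hd
  have h1 : ∀ a ∈ T, (∫ x in hull (opp T a), ∑ i, (ev (v.1 T i) x - ev (v.2 (opp T a) i) x) ^ 2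
      ∂(surf d)) = ∑ i, nm ((surf d).restrict (hull (opp T a)))
        (fun x => ev (v.1 T i) x - ev (v.2 (opp T a) i) x) ^ 2 := by
    intro a ha
    rw [integral_finsetSum _ fun i _ => integrable_facet hTs hd ha (by fun_prop)]
    exact Finset.sum_congr rfl fun i _ => nm_sq.symm
  have h2 : 0 ≤ ∫ x in hull T, ∑ i, ∑ j, (ev (weakGrad k v T i j) x) ^ 2 :=
    integral_nonneg fun x => Finset.sum_nonneg fun i _ => Finset.sum_nonneg fun j _ => sq_nonneg _
  have h3 : (∑ a ∈ T, ∑ i, nm ((surf d).restrict (hull (opp T a)))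
        fun x => ev (v.1 T i) x - ev (v.2 (opp T a) i) x) ^ 2
      ≤ (d + 1) * d * ∑ a ∈ T, ∑ i, nm ((surf d).restrict (hull (opp T a)))
        (fun x => ev (v.1 T i) x - ev (v.2 (opp T a) i) x) ^ 2 := by
    have hcard : (T.card : ℝ) = d + 1 := by rw [hTs.card]; push_cast; ring
    refine sq_sum_le_card_mul_sum_sq.trans ?_
    rw [hcard, mul_assoc, Finset.mul_sum (a := (d : ℝ))]
    refine mul_le_mul_of_nonneg_left (Finset.sum_le_sum fun a _ => ?_) (by positivity)
    have := sq_sum_le_card_mul_sum_sq (s := (Finset.univ : Finset (Fin d)))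
      (f := fun i => nm ((surf d).restrict (hull (opp T a)))
        fun x => ev (v.1 T i) x - ev (v.2 (opp T a) i) x)
    rwa [Finset.card_univ, Fintype.card_fin] at this
  rw [jumpNm, mul_pow, inv_pow, Real.sq_sqrt hh.le, Finset.sum_congr rfl h1, mul_add]
  calc _ ≤ (diam T)⁻¹ * ((d + 1) * d * ∑ a ∈ T, ∑ i, nm ((surf d).restrict (hull (opp T a)))
        (fun x => ev (v.1 T i) x - ev (v.2 (opp T a) i) x) ^ 2) :=
        mul_le_mul_of_nonneg_left h3 (inv_nonneg.2 hh.le)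
    _ = (d + 1) * d * ((diam T)⁻¹ * ∑ a ∈ T, ∑ i, nm ((surf d).restrict (hull (opp T a)))
        (fun x => ev (v.1 T i) x - ev (v.2 (opp T a) i) x) ^ 2) := by ring
    _ ≤ _ := le_add_of_nonneg_left (by positivity)

/-- The derivatives of order `k + 1` are controlled by the Sobolev norm. -/
lemma sum_topNm_sq_le (hΩ : IsLipschitzDomain Ω) (hd : 1 ≤ d)
    (hu : ∀ i, MemSobolev Ω (k + 1) fun x => u x i) :
    ∑ T ∈ 𝒯.elems, (∑ i, topNm (hull T) (k + 1) fun α => weakDeriv Ω α fun x => u x i) ^ 2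
      ≤ d * (Finset.piAntidiag (Finset.univ : Finset (Fin d)) (k + 1)).card
        * sobolevNorm Ω (k + 1) u ^ 2 := by
  set B := Finset.piAntidiag (Finset.univ : Finset (Fin d)) (k + 1) with hB
  have hm : ∀ i, ∀ β ∈ B, MemLp (weakDeriv Ω β fun x => u x i) 2 (volume.restrict Ω) :=
    fun i β hβ => (weakDeriv_spec (hu i) (Finset.mem_piAntidiag.1 hβ).1.le).1
  have hnn : 0 ≤ ∑ i : Fin d, ∑ l ∈ Finset.range (k + 1 + 1),
      ∑ α ∈ Finset.piAntidiag Finset.univ l, ∫ x in Ω, (weakDeriv Ω α (fun y => u y i) x) ^ 2 :=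
    Finset.sum_nonneg fun i _ => Finset.sum_nonneg fun l _ => Finset.sum_nonneg fun α _ =>
      integral_nonneg fun x => sq_nonneg _
  have h1 : ∑ i, ∑ β ∈ B, (∫ x in Ω, (weakDeriv Ω β (fun y => u y i) x) ^ 2)
      ≤ sobolevNorm Ω (k + 1) u ^ 2 := by
    rw [sobolevNorm, Real.sq_sqrt hnn]
    refine Finset.sum_le_sum fun i _ => ?_
    exact Finset.single_le_sum (f := fun l => ∑ α ∈ Finset.piAntidiag Finset.univ l,
      ∫ x in Ω, (weakDeriv Ω α (fun y => u y i) x) ^ 2) (fun l _ => Finset.sum_nonneg fun α _ =>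
        integral_nonneg fun x => sq_nonneg _) (Finset.mem_range.2 (Nat.lt_succ_self (k + 1)))
  have h2 : ∀ T ∈ 𝒯.elems,
      (∑ i, topNm (hull T) (k + 1) fun α => weakDeriv Ω α fun x => u x i) ^ 2
      ≤ d * B.card * ∑ i, ∑ β ∈ B, ∫ x in hull T, (weakDeriv Ω β (fun y => u y i) x) ^ 2 := by
    intro T _
    refine sq_sum_le_card_mul_sum_sq.trans ?_
    rw [Finset.card_univ, Fintype.card_fin, mul_assoc, Finset.mul_sum (a := (B.card : ℝ))]
    refine mul_le_mul_of_nonneg_left (Finset.sum_le_sum fun i _ => ?_) (by positivity)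
    rw [topNm]
    refine sq_sum_le_card_mul_sum_sq.trans_eq ?_
    simp only [nm_sq]
    rfl
  refine (Finset.sum_le_sum h2).trans ?_
  rw [← Finset.mul_sum]
  refine mul_le_mul_of_nonneg_left (le_of_eq_of_le ?_ h1) (by positivity)
  rw [Finset.sum_comm]
  refine Finset.sum_congr rfl fun i _ => ?_
  rw [Finset.sum_comm]
  refine Finset.sum_congr rfl fun β hβ => ?_
  exact (setIntegral_eq_sum_elems 𝒯 hΩ (integrable_sq_of_memLp (hm i β hβ))).symm

lemma diam_le_meshSize {T : Finset (E d)} (hT : T ∈ 𝒯.elems) : diam T ≤ 𝒯.meshSize :=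
  le_csSup (𝒯.elems.finite_toSet.image diam).bddAbove (Set.mem_image_of_mem _ hT)

lemma meshSize_nonneg : 0 ≤ 𝒯.meshSize :=
  Real.sSup_nonneg (by rintro _ ⟨T, -, rfl⟩; exact Metric.diam_nonneg)

/-- The error estimate in the energy norm. -/
lemma exists_energyNorm_le (hd : 2 ≤ d) (hk : 1 ≤ k) (hΩ : IsLipschitzDomain Ω) {μ₁ : ℝ}
    (hμ₁ : 0 < μ₁) (μ₂ : ℝ) (hγ : 0 < γ) : ∃ C : ℝ, 0 < C ∧
    ∀ μ lam : ℝ, μ₁ ≤ μ → μ ≤ μ₂ → 0 < lam → ∀ f g u : E d → E d,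
      (∀ i, MemSobolev Ω (k + 1) fun x => u x i) → IsExactSolution Ω μ lam f g u →
      ∀ 𝒯 : Triangulation Ω, 𝒯.ShapeRegular γ →
      ∀ uh : WeakFun d, IsWGSolution 𝒯 k μ lam f g uh →
        energyNorm 𝒯 k (Qh Ω k u - uh) ≤ C * 𝒯.meshSize ^ k * sobolevNorm Ω (k + 1) u := by
  classical
  have hd1 : 1 ≤ d := by omega
  obtain ⟨C, hC, hcons⟩ := exists_abs_elemError_le hd1 hγ hk μ₂
  -- The stabilizer has coefficient `1` and the gradient part coefficient `μ ≥ μ₁`.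
  set c := min μ₁ 1 with hc
  have hc0 : 0 < c := lt_min hμ₁ one_pos
  set N : ℝ := d * (Finset.piAntidiag (Finset.univ : Finset (Fin d)) (k + 1)).card with hN
  set J : ℝ := (d + 1) * d with hJ
  -- The summand `1` makes the constant positive without discussing `N` and `J`.
  refine ⟨C * √N * √J / c + 1, by positivity,
    fun μ lam hμ hμ' hlam f g u hu hsol 𝒯 hreg uh huh => ?_⟩
  have hμ0 : 0 < μ := hμ₁.trans_le hμ
  have hreg' : ∀ T ∈ 𝒯.elems, IsRegular γ T := fun T hT => isRegular_of_mem_elems 𝒯 hreg hT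
  have hex : ∀ (T : Finset (E d)) (i : Fin d), ∃ t tg, T ∈ 𝒯.elems → HasJetTraces T k
      (fun x => u x i) (fun α => weakDeriv Ω α fun x => u x i) t tg := by
    intro T i
    by_cases hT : T ∈ 𝒯.elems
    · obtain ⟨t, tg, h⟩ := exists_hasJetTraces 𝒯 hΩ hγ hd1 hk hreg hT (hu i)
      exact ⟨t, tg, fun _ => h⟩
    · exact ⟨0, 0, fun h => (hT h).elim⟩
  choose t tg hD' using hex
  have hD : ∀ T ∈ 𝒯.elems, ∀ i, HasJetTraces T k (fun x => u x i)
      (fun α => weakDeriv Ω α fun x => u x i) (t T i) (tg T i) := fun T hT i => hD' T i hT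
  have hG : ∀ i j : Fin d, MemLp (weakDeriv Ω (Pi.single j 1) fun x => u x i) 2
      (volume.restrict Ω) := fun i j => (weakDeriv_spec (hu i) (by simp)).1
  have htr : ∀ T ∈ 𝒯.elems, ∀ i, ∀ a ∈ T, t T i a =ᵐ[(surf d).restrict (hull (opp T a))]
      trace Ω (hull (opp T a)) fun x => u x i := fun T hT i a ha =>
    trace_ae_eq 𝒯 hΩ hγ hd1 hreg hT ha (hu i).1 (hG i) (hD T hT i).trace (hsol.bc i)
  -- The error, set to zero on the facets which belong to no element: there nothing is known about
  -- the trace of `u`, and the energy norm does not see these facets.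
  set v : WeakFun d := ((Qh Ω k u - uh).1, fun e =>
    if ∃ T ∈ 𝒯.elems, ∃ a ∈ T, opp T a = e then (Qh Ω k u - uh).2 e else 0) with hv
  have hv1 : ∀ T ∈ 𝒯.elems, v.1 T = (Qh Ω k u - uh).1 T := fun T _ => rfl
  have hv2 : ∀ T ∈ 𝒯.elems, ∀ a ∈ T, v.2 (opp T a) = (Qh Ω k u - uh).2 (opp T a) :=
    fun T hT a ha => if_pos ⟨T, hT, a, ha, rfl⟩
  have hvV : InVh0 𝒯 k v := by
    refine ⟨⟨fun T hT i => ?_, fun e he i => ?_⟩, fun e he hfr i x hx => ?_⟩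
    · exact sub_mem (elemProj_spec hd1 hγ (hreg' T hT) k (hD T hT i).trace.mem).1
        (huh.mem.1 T hT i)
    · by_cases hex : ∃ T ∈ 𝒯.elems, ∃ a ∈ T, opp T a = e
      · obtain ⟨T, hT, a, ha, rfl⟩ := hex
        rw [hv2 T hT a ha]
        refine sub_mem ?_ (huh.mem.2 _ he i)
        have := (facetProj_spec hd1 (hreg' T hT).simplex ha k ((hD T hT i).trace.memt a ha)).1
        rwa [facetProj_congr (htr T hT i a ha)] at this
      · simp only [hv, if_neg hex]
        exact zero_mem _
    · by_cases hex : ∃ T ∈ 𝒯.elems, ∃ a ∈ T, opp T a = e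
      · obtain ⟨T, hT, a, ha, rfl⟩ := hex
        have h1 : facetProj k (opp T a) (trace Ω (hull (opp T a)) fun x => u x i)
            = facetProj k (opp T a) fun y => g y i := by
          rw [← facetProj_congr (htr T hT i a ha)]
          exact facetProj_congr ((hsol.bc i).ae_eq_facet 𝒯 hΩ hγ hd1 hreg hT ha (hu i).1 (hG i)
            (hD T hT i).trace hfr) k
        rw [hv2 T hT a ha]
        simp only [Prod.snd_sub, Pi.sub_apply, ev_sub, Qh]
        rw [h1, huh.bc _ he hfr i x hx, sub_self]
      · simp only [hv, if_neg hex, Pi.zero_apply, ev_zero]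
  rw [energyNorm_congr 𝒯 (fun T hT => (hv1 T hT).symm) fun T hT a ha => (hv2 T hT a ha).symm]
  have hcoer := mul_energyNorm_sq_le 𝒯 (k := k) (lam := lam) hd1 hγ hreg
    ((min_le_left _ _).trans hμ : c ≤ μ) (min_le_right _ _) (by positivity) hv1 hv2
  -- By the scheme for `uh`, coercivity gives a bound by the consistency error of `Qh u`.
  rw [huh.eqn v hvV, formAs_Qh_sub_eq 𝒯 hΩ hd hk hγ hreg hsol hu hD htr hvV] at hcoer
  set H := 𝒯.meshSize with hH
  have hH0 : 0 ≤ H := meshSize_nonneg 𝒯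
  set S := sobolevNorm Ω (k + 1) u with hS
  have hS0 : 0 ≤ S := Real.sqrt_nonneg _
  set e := energyNorm 𝒯 k v with he
  have he0 : 0 ≤ e := Real.sqrt_nonneg _
  set M : Finset (E d) → ℝ := fun T =>
    ∑ i, topNm (hull T) (k + 1) fun α => weakDeriv Ω α fun x => u x i with hM
  have hM0 : ∀ T, 0 ≤ M T := fun T => Finset.sum_nonneg fun i _ => topNm_nonneg _ _ _
  have h1 : ∀ T ∈ 𝒯.elems, elemError μ T k v (Qh Ω k u)
      (fun i α => weakDeriv Ω α fun x => u x i) (tg T) ≤ C * H ^ k * (M T * jumpNm T v) := by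
    intro T hT
    refine (le_abs_self _).trans ((hcons μ hμ0.le hμ' T (hreg' T hT) Ω u _ (t T) (tg T) v (hD T hT)
      (htr T hT) (hvV.1.1 T hT) fun a ha =>
        hvV.1.2 _ (opp_mem_facets 𝒯 hd1 hT ha)).trans ?_)
    rw [mul_assoc]
    refine mul_le_mul_of_nonneg_right (mul_le_mul_of_nonneg_left (pow_le_pow_left₀
      Metric.diam_nonneg (diam_le_meshSize 𝒯 hT) k) hC.le) (mul_nonneg (hM0 T) (jumpNm_nonneg T v))
  have h2 : ∑ T ∈ 𝒯.elems, M T * jumpNm T v ≤ (√N * S) * (√J * e) := by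
    refine (Real.sum_mul_le_sqrt_mul_sqrt _ _ _).trans (mul_le_mul ?_ ?_ (Real.sqrt_nonneg _)
      (by positivity))
    · refine (Real.sqrt_le_sqrt (sum_topNm_sq_le 𝒯 hΩ hd1 hu)).trans_eq ?_
      rw [Real.sqrt_mul (by positivity), Real.sqrt_sq hS0]
    · refine (Real.sqrt_le_sqrt (sum_jumpNm_sq_le 𝒯 (k := k) hd1 v)).trans_eq ?_
      rw [Real.sqrt_mul (by positivity), Real.sqrt_sq he0]
  have h3 : c * e ^ 2 ≤ C * H ^ k * ((√N * S) * (√J * e)) := by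
    refine hcoer.trans ((Finset.sum_le_sum h1).trans ?_)
    rw [← Finset.mul_sum]
    exact mul_le_mul_of_nonneg_left h2 (by positivity)
  have h4 : e ≤ C * √N * √J / c * (H ^ k * S) := by
    rcases he0.eq_or_lt with h | h
    · rw [← h]; positivity
    · rw [div_mul_eq_mul_div, le_div_iff₀ hc0]
      refine le_of_mul_le_mul_right ?_ h
      calc e * c * e = c * e ^ 2 := by ring
        _ ≤ _ := h3
        _ = _ := by ring
  rw [mul_assoc]
  refine h4.trans (mul_le_mul_of_nonneg_right (by linarith) (by positivity))

end error_equation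

end WG

end

theorem theorem4p1 (d k : ℕ) (hd : d = 2 ∨ d = 3) (hk : 1 ≤ k)
    (Ω : Set (WG.E d)) (hΩ : WG.IsLipschitzDomain Ω)
    (μ₁ μ₂ : ℝ) (hμ₁ : 0 < μ₁) (γ : ℝ) (hγ : 0 < γ) :
    ∃ C : ℝ, 0 < C ∧
      ∀ (μ lam : ℝ), μ₁ ≤ μ → μ ≤ μ₂ → 0 < lam →
      ∀ (f g u : WG.E d → WG.E d),
        (∀ i, WG.MemSobolev Ω (k + 1) (fun x => u x i)) →
        WG.IsExactSolution Ω μ lam f g u →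
      ∀ 𝒯 : WG.Triangulation Ω, 𝒯.ShapeRegular γ →
      ∀ uh : WG.WeakFun d, WG.IsWGSolution 𝒯 k μ lam f g uh →
        WG.energyNorm 𝒯 k (WG.Qh Ω k u - uh)
          ≤ C * 𝒯.meshSize ^ k * WG.sobolevNorm Ω (k + 1) u :=
  WG.exists_energyNorm_le (by omega) hk hΩ hμ₁ μ₂ hγ
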